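/- Let $W$ be a (real) space-time white noise on $\mathbb R^2$ and $\widehat W$ its Fourier transform (normalized so that $\mathbb E|\int\varphi\, d\widehat W|^2=\|\varphi\|_{L^2(\mathbb R^2)}^2$). Let $(H_0,H_1)\in(0,1)^2$, $c_{H}=\frac12\big(\int_0^\infty\frac{1-\cos\xi}{\xi^{2H+1}}d\xi\big)^{-1/2}$, and for $\kappa>0$, $n\ge1$ let $$B^{\kappa,n}_t(x)=c_{H_0}c_{H_1}\int_{|\xi|\le 2^{2\kappa n}}\int_{|\eta|\le 2^{\kappa n}}\widehat W(d\xi,d\eta)\,\frac{e^{\imath\xi t}-1}{|\xi|^{H_0+1/2}}\frac{e^{\imath\eta x}-1}{|\eta|^{H_1+1/2}}.$$ For $k,\ell\in\mathbb Z$ let $\square^n_{k,\ell}$ be the rectangular increment of $B^{\kappa,n}$ over $[\frac{k}{2^n},\frac{k+1}{2^n}]\times[\frac{\ell}{2^n},\frac{\ell+1}{2^n}]$, and let $\mathring\square^n_{k,\ell}:=\square^n_{k,\ell}$ if $0\le k<2^n$ and $-2^{2n}\le\ell<2^{2n}$, $\mathring\square^n_{k,\ell}:=0$ otherwise. Let $\dot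 B^{n}$ be the function equal to $2^{2n}\mathring\square^n_{k,\ell}$ on $[\frac{k}{2^n},\frac{k+1}{2^n})\times[\frac{\ell}{2^n},\frac{\ell+1}{2^n})$, and $\widetilde\Psi^{\kappa,n}_t(x)=\int_0^t\int_{\mathbb R}G_{t-s}(x-y)\dot B^n_s(y)\,dy\,ds$, where $G$ is the heat kernel of $\partial_t-\Delta$ on $\mathbb R$. For $h>0$, let $\Phi^h_j$ ($j\in\mathbb Z$) be the piecewise linear hat function with nodes $(j-1)h,jh,(j+1)h$ and value $1$ at $jh$; let $\mathcal S^{(h,L)}$ be the span of those $\Phi^h_j$ with support in $[-L,L]$. For $u\in H^{1,2}_{loc}([0,1]\times\mathbb R)$ with $u_0=0$ and $t_i=i2^{-m}$, $\mathcal G^{(h,L)}_m(u)=(\bar u_{t_i})_{0\le i\le 2^m}$ is given by $\bar u_{0}=0$, $\bar u_{t_i}\in\mathcal S^{(h,L)}$ and, for all $\varphi\in\mathcal S^{(h,L)}$, $1\le i\le 2^m$, $$2^m\langle\bar u_{t_i}-\bar u_{t_{i-1}},\varphi\rangle+\langle\nabla\bar u_{t_i},\nabla\varphi\rangle=2^m\int_{t_{i-1}}^{t_i}\langle(\partial_tu)_s-\Delta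 u_s,\varphi\rangle\,ds .$$ Given an array $q=(q_{k,\ell})_{k,\ell\in\mathbb Z}$, let $\bar\Psi^n(q)$ be given on the mesh $t_i=i2^{-4n}$, $x_j=j2^{-2n}$ by $\bar\Psi^n(q)_{t_i}=\sum_{|j|<N}c_i^j\Phi^{2^{-2n}}_j$, $N=2^{3n+1}$, where $c_0=0$ and, with the convention $c_i^{\pm N}=0$, for $0\le i<2^{4n}$ and $|j|<N$, $$4c_{i+1}^j-\tfrac54\big(c_{i+1}^{j+1}+c_{i+1}^{j-1}\big)=c_i^j+\tfrac14\big(c_i^{j-1}+c_i^{j+1}\big)+\tfrac{3}{2^{2n+1}}\,\delta_{ij},$$ with $\tilde i=\lfloor 2^nt_i\rfloor$, $\tilde j=\lfloor2^nx_j\rfloor$, $\delta_{ij}=q_{\tilde i,\tilde j}$ if $x_j>\tilde j2^{-n}$ and $\delta_{ij}=\frac12(q_{\tilde i,\tilde j-1}+q_{\tilde i,\tilde j})$ if $x_j=\tilde j2^{-n}$. Let $\rho:\mathbb R\to[0,1]$ be smooth with compact support. Then: (1) For all $\beta>0$ and $\varepsilon\in(0,1)$ there is a finite random variable $C$, depending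 only on $W,H_0,H_1,\rho,\beta,\varepsilon$ (not on $\kappa,n,m,h,L$), such that for every $\kappa>0$, almost surely, for all $n,m\ge1$, $h>0$, $L>2^n$ with $L/h\in\mathbb N$, the approximation $\mathcal G^{(h,L)}_m(\widetilde\Psi^{\kappa,n})$ exists, is unique, and, with $t_i=i2^{-m}$, $$\sup_{0\le i\le2^m}\big\|\rho\{\widetilde\Psi^{\kappa,n}_{t_i}-\mathcal G^{(h,L)}_m(\widetilde\Psi^{\kappa,n})_{t_i}\}\big\|_{L^2(\mathbb R)}\le C\Big(2^{-m(1-\varepsilon)}2^{n(\frac72-H_0-H_1+\varepsilon)}+2^{m\varepsilon}h^22^{n(\frac72-H_0-H_1+\varepsilon)}+\tfrac{L^{1/2}}{|L-2^n|^\beta}2^{n(2-H_0-H_1+\varepsilon)}\Big).$$ (2) For all $\kappa>0$, $n\ge1$, the schemes $\bar\Psi^{\kappa,n}:=\bar\Psi^n(\mathring\square^n)$ and $\bar\Psi^n(\square^n)$ are well defined, and for $h=2^{-2n}$, $L=2^{n+1}$, $m=4n$ one has $\mathcal G^{(h,L)}_m(\widetilde\Psi^{\kappa,n})=\bar\Psi^{\kappa,n}$.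 (3) There is a finite random variable $C$, depending only on $W,H_0,H_1,\rho$ (not on $\kappa,n$), such that for every $\kappa>0$, almost surely, for all $n\ge1$, with $t_i=i2^{-4n}$, $$\sup_{0\le i\le2^{4n}}\big\|\rho\{\widetilde\Psi^{\kappa,n}_{t_i}-\bar\Psi^{\kappa,n}_{t_i}\}\big\|_{L^2(\mathbb R)}\le C\,2^{-n/2},$$ and the same bound holds with $\bar\Psi^n(\square^n)$ in place of $\bar\Psi^{\kappa,n}$. -/

import Mathlib

open MeasureTheory ProbabilityTheory Set
open scoped FourierTransform

noncomputable section

namespace FracHeat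

/-! ### Space-time white noise, its Fourier transform, and the smoothened fractional sheet -/

/-- The space-time plane: coordinate `0` is time, coordinate `1` is space (respectively their
dual frequencies `ξ` and `η`). -/
abbrev Plane : Type := EuclideanSpace ℝ (Fin 2)

/-- A (real) space-time white noise on the plane: a centered Gaussian family indexed by `L²` whose
covariance is the `L²` scalar product. -/
structure IsWhiteNoise {Ω : Type*} [MeasurableSpace Ω] (P : Measure Ω)
    (W : Lp ℝ 2 (volume : Measure Plane) → Ω → ℝ) : Prop where
  gaussian : IsGaussianProcess W P
  centered : ∀ f, ∫ ω, W f ω ∂P = 0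
  covariance : ∀ f g, ∫ ω, W f ω * W g ω ∂P = inner ℝ f g

/-- The Wiener integral `∫ φ dŴ` against the Fourier transform `Ŵ` of `W`, given by duality:
`∫ φ dŴ = ∫ 𝓕φ dW`, where `W` is extended to complex functions by linearity. The transform `𝓕` is
the unitary one, so that `E|∫ φ dŴ|² = ‖φ‖²`. (The value is `0` if `φ` is not in `L²`.) -/
def fourierIntegral {Ω : Type*} (W : Lp ℝ 2 (volume : Measure Plane) → Ω → ℝ)
    (φ : Plane → ℂ) (ω : Ω) : ℂ :=
  open Classical in
  if hφ : MemLp φ 2 volume then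
    (W (Complex.reCLM.compLp (𝓕 (hφ.toLp φ))) ω : ℂ)
      + Complex.I * (W (Complex.imCLM.compLp (𝓕 (hφ.toLp φ))) ω : ℂ)
  else 0

/-- The normalizing constant `c_H`. -/
def hurstConst (H : ℝ) : ℝ :=
  (1 / 2) * (∫ ξ in Ioi (0 : ℝ), (1 - Real.cos ξ) / |ξ| ^ (2 * H + 1)) ^ (-(1 / 2) : ℝ)

/-- The one-dimensional kernel `(e^{iξt} - 1) / |ξ|^{H + 1/2}`, cut off to `|ξ| ≤ r`. -/
def harmonizableKernel (H r t ξ : ℝ) : ℂ :=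
  if |ξ| ≤ r then
    (Complex.exp (Complex.I * (ξ * t : ℝ)) - 1) / ((|ξ| ^ (H + 1 / 2) : ℝ) : ℂ)
  else 0

theorem memLp_harmonizableKernel {H : ℝ} (hH : H ∈ Ioo (0 : ℝ) 1) (r t : ℝ) :
    MemLp (harmonizableKernel H r t) 2 volume := by
  have hm : Measurable (harmonizableKernel H r t) := by
    unfold harmonizableKernel
    refine Measurable.ite (measurableSet_le (by fun_prop) (by fun_prop)) ?_ (by fun_prop)
    fun_prop
  rw [memLp_two_iff_integrable_sq_norm hm.aestronglyMeasurable]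
  have hdom : Integrable ((Icc (-r) r).indicator
      (fun ξ : ℝ => t ^ 2 * |ξ| ^ (1 - 2 * H))) volume := by
    rw [integrable_indicator_iff measurableSet_Icc]
    apply Integrable.const_mul
    have : LocallyIntegrable (fun ξ : ℝ => |ξ| ^ (1 - 2 * H)) volume := by
      refine locallyIntegrable_of_norm_le_rpow (C := 1) (α := 2 * H - 1) (by simp) ?_ ?_
        (Measurable.aestronglyMeasurable (by fun_prop))
      · simp; linarith [hH.2]
      · refine Filter.Eventually.of_forall fun x => ?_
        rw [Real.norm_of_nonneg (by positivity), Real.norm_eq_abs, one_mul, neg_sub]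
    exact this.integrableOn_isCompact isCompact_Icc
  refine hdom.mono' (by fun_prop) (Filter.Eventually.of_forall fun ξ => ?_)
  unfold harmonizableKernel
  by_cases h : |ξ| ≤ r
  · have h' : ξ ∈ Icc (-r) r := abs_le.mp h
    rw [indicator_of_mem h', if_pos h, norm_div, Real.norm_of_nonneg (by positivity)]
    have h1 : ‖Complex.exp (Complex.I * (ξ * t : ℝ)) - 1‖ ≤ |ξ * t| := by
      simpa using Real.norm_exp_I_mul_ofReal_sub_one_le (x := ξ * t)
    rcases eq_or_ne ξ 0 with rfl | h0
    · simp; positivity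
    have hp : 0 < |ξ| := abs_pos.mpr h0
    rw [div_pow, Complex.norm_real, Real.norm_of_nonneg (by positivity), div_le_iff₀ (by positivity),
      ← Real.rpow_natCast (|ξ| ^ _), ← Real.rpow_mul hp.le, mul_assoc, ← Real.rpow_add hp]
    have : (1 - 2 * H + (H + 1 / 2) * ((2 : ℕ) : ℝ)) = ((2 : ℕ) : ℝ) := by push_cast; ring
    rw [this, Real.rpow_natCast, sq_abs, ← mul_pow, ← sq_abs (t * ξ), mul_comm t]
    gcongr
  · have h' : ξ ∉ Icc (-r) r := fun h2 => h (abs_le.mpr h2)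
    simp [h, h']

/-- The kernel of the sheet is square-integrable, so that its Wiener integral is a genuine one. -/
theorem memLp_sheetKernel {H₀ H₁ : ℝ} (h₀ : H₀ ∈ Ioo (0 : ℝ) 1) (h₁ : H₁ ∈ Ioo (0 : ℝ) 1)
    (r₀ r₁ t x : ℝ) :
    MemLp (fun z : Plane => harmonizableKernel H₀ r₀ t (z 0) * harmonizableKernel H₁ r₁ x (z 1))
      2 volume := by
  have h := (memLp_harmonizableKernel h₀ r₀ t)
  have h' := (memLp_harmonizableKernel h₁ r₁ x)
  have hp : MemLp (fun p : ℝ × ℝ => harmonizableKernel H₀ r₀ t p.1 * harmonizableKernel H₁ r₁ x p.2)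
      2 volume := by
    have hm := h.1.comp_fst (ν := (volume : Measure ℝ)) |>.mul
      (h'.1.comp_snd (μ := (volume : Measure ℝ)))
    refine (memLp_two_iff_integrable_sq_norm hm).2 ?_
    have := ((memLp_two_iff_integrable_sq_norm h.1).1 h).mul_prod
      ((memLp_two_iff_integrable_sq_norm h'.1).1 h')
    simpa [mul_pow] using this
  exact hp.comp_measurePreserving ((volume_preserving_finTwoArrow ℝ).comp
    (PiLp.volume_preserving_ofLp (Fin 2)))

/-- The smoothened fractional sheet `B^{κ,n}_t(x)`. The kernel takes conjugate values at opposite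
frequencies, hence its Fourier transform is real-valued and so is the integral; the real part only
adjusts the type. -/
def smoothSheet {Ω : Type*} (W : Lp ℝ 2 (volume : Measure Plane) → Ω → ℝ) (H₀ H₁ κ : ℝ) (n : ℕ)
    (ω : Ω) (t x : ℝ) : ℝ :=
  hurstConst H₀ * hurstConst H₁ *
    (fourierIntegral W (fun z => harmonizableKernel H₀ ((2 : ℝ) ^ (2 * κ * n)) t (z 0)
      * harmonizableKernel H₁ ((2 : ℝ) ^ (κ * n)) x (z 1)) ω).re

/-! ### Noise discretization -/

/-- The rectangular increment of `b` over `[k/2ⁿ, (k+1)/2ⁿ] × [l/2ⁿ, (l+1)/2ⁿ]`. -/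
def rectIncr (n : ℕ) (b : ℝ → ℝ → ℝ) (k l : ℤ) : ℝ :=
  b ((k + 1) / 2 ^ n) ((l + 1) / 2 ^ n) - b ((k + 1) / 2 ^ n) (l / 2 ^ n)
    - b (k / 2 ^ n) ((l + 1) / 2 ^ n) + b (k / 2 ^ n) (l / 2 ^ n)

/-- The rectangular increments along the finite grid `k/2ⁿ` (`0 ≤ k ≤ 2ⁿ`), `l/2ⁿ`
(`-2²ⁿ ≤ l ≤ 2²ⁿ`), set to `0` for the cells outside `[0,1] × [-2ⁿ, 2ⁿ]`. -/
def gridIncr (n : ℕ) (b : ℝ → ℝ → ℝ) (k l : ℤ) : ℝ :=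
  if k ∈ Ico (0 : ℤ) (2 ^ n) ∧ l ∈ Ico (-2 ^ (2 * n) : ℤ) (2 ^ (2 * n)) then rectIncr n b k l else 0

/-- The discretized noise `∂ₜ∂ₓ B̃` built from the increments of `b`. -/
def discreteNoise (n : ℕ) (b : ℝ → ℝ → ℝ) (s x : ℝ) : ℝ :=
  ∑ k ∈ Finset.Ico (0 : ℤ) (2 ^ n), ∑ l ∈ Finset.Ico (-2 ^ (2 * n) : ℤ) (2 ^ (2 * n)),
    2 ^ (2 * n) * rectIncr n b k l
      * (Ico ((k : ℝ) / 2 ^ n) ((k + 1) / 2 ^ n)).indicator 1 s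
      * (Ico ((l : ℝ) / 2 ^ n) ((l + 1) / 2 ^ n)).indicator 1 x

/-- The heat kernel on the line. -/
def heatKernel (t x : ℝ) : ℝ :=
  if 0 < t then 1 / √(4 * Real.pi * t) * Real.exp (-x ^ 2 / (4 * t)) else 0

/-- The space-time convolution `(G ∗ f)_t(x)`. -/
def heatConv (f : ℝ → ℝ → ℝ) (t x : ℝ) : ℝ :=
  ∫ s in (0 : ℝ)..t, ∫ y, heatKernel (t - s) (x - y) * f s y

/-- `Ψ̃^{κ,n}`, the solution of the heat equation driven by the discretized noise. -/
def psiTilde {Ω : Type*} (W : Lp ℝ 2 (volume : Measure Plane) → Ω → ℝ) (H₀ H₁ κ : ℝ) (n : ℕ)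
    (ω : Ω) : ℝ → ℝ → ℝ :=
  heatConv (discreteNoise n (smoothSheet W H₀ H₁ κ n ω))

/-! ### Weak derivatives on `[0,1] × ℝ` -/

/-- `u ∈ L²_loc([0,1] × ℝ)`. -/
def LocL2 (u : ℝ → ℝ → ℝ) : Prop :=
  ∀ R : ℝ, MemLp (fun p : ℝ × ℝ => u p.1 p.2) 2 (volume.restrict (Icc 0 1 ×ˢ Icc (-R) R))

/-- Smooth functions with compact support inside `(0,1) × ℝ`. -/
def IsTestFunction (ψ : ℝ × ℝ → ℝ) : Prop :=
  ContDiff ℝ (⊤ : ℕ∞) ψ ∧ HasCompactSupport ψ ∧ tsupport ψ ⊆ Ioo 0 1 ×ˢ univ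

/-- `v` is the weak time derivative of `u`. -/
def IsWeakTimeDeriv (u v : ℝ → ℝ → ℝ) : Prop :=
  ∀ ψ, IsTestFunction ψ →
    ∫ p : ℝ × ℝ, u p.1 p.2 * fderiv ℝ ψ p (1, 0) = -∫ p : ℝ × ℝ, v p.1 p.2 * ψ p

/-- `v` is the weak space derivative of `u`. -/
def IsWeakSpaceDeriv (u v : ℝ → ℝ → ℝ) : Prop :=
  ∀ ψ, IsTestFunction ψ →
    ∫ p : ℝ × ℝ, u p.1 p.2 * fderiv ℝ ψ p (0, 1) = -∫ p : ℝ × ℝ, v p.1 p.2 * ψ p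

/-- `u ∈ H^{1,2}_loc([0,1] × ℝ)`, with `∂ₜu = ut` and `Δu = uxx`. -/
def HasHeatDerivs (u ut uxx : ℝ → ℝ → ℝ) : Prop :=
  LocL2 u ∧ LocL2 ut ∧ LocL2 uxx ∧ IsWeakTimeDeriv u ut ∧
    ∃ ux, LocL2 ux ∧ IsWeakSpaceDeriv u ux ∧ IsWeakSpaceDeriv ux uxx

/-! ### Galerkin approximation combined with the implicit Euler scheme -/

/-- The hat function `Φ_j^h` around `x_j = j h`. -/
def hat (h : ℝ) (j : ℤ) (x : ℝ) : ℝ :=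
  if x ∈ Icc ((j - 1) * h) (j * h) then 1 / h * (x - (j - 1) * h)
  else if x ∈ Icc (j * h) ((j + 1) * h) then 1 / h * ((j + 1) * h - x)
  else 0

/-- The span of the hat functions supported in `[-L, L]`. -/
def galerkinSpace (h L : ℝ) : Submodule ℝ (ℝ → ℝ) :=
  Submodule.span ℝ (hat h '' {j : ℤ | tsupport (hat h j) ⊆ Icc (-L) L})

/-- `v = (v_{t_i})`, `t_i = i / 2^m`, is the approximation `𝒢^{(h,L)}_m(u)` of the function
`u ∈ H^{1,2}_loc([0,1] × ℝ)` with `u₀ = 0`. -/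
def IsGalerkinApprox (h L : ℝ) (m : ℕ) (u : ℝ → ℝ → ℝ) (v : Fin (2 ^ m + 1) → ℝ → ℝ) : Prop :=
  (∀ x, u 0 x = 0) ∧ ∃ ut uxx, HasHeatDerivs u ut uxx ∧
    v 0 = 0 ∧
    (∀ i, v i ∈ galerkinSpace h L) ∧
    ∀ i : Fin (2 ^ m), ∀ φ ∈ galerkinSpace h L,
      2 ^ m * (∫ x, (v i.succ x - v i.castSucc x) * φ x) + ∫ x, deriv (v i.succ) x * deriv φ x
        = 2 ^ m * ∫ s in ((i : ℕ) / 2 ^ m : ℝ)..(((i : ℕ) + 1) / 2 ^ m : ℝ),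
            ∫ x, (ut s x - uxx s x) * φ x

/-! ### The fully discrete scheme -/

/-- The noise term `δB_{ij}` on the mesh `t_i = i / 2^{4n}`, `x_j = j / 2^{2n}`, made from the
increments `q k l` over the coarse cells of side `2^{-n}`. The first case is `x_j > j̃ / 2ⁿ`, the
second one is `x_j = j̃ / 2ⁿ`. -/
def schemeNoise (n : ℕ) (q : ℤ → ℤ → ℝ) (i : ℕ) (j : ℤ) : ℝ :=
  let i' : ℤ := ⌊(2 : ℝ) ^ n * ((i : ℝ) / 2 ^ (4 * n))⌋
  let j' : ℤ := ⌊(2 : ℝ) ^ n * ((j : ℝ) / 2 ^ (2 * n))⌋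
  if (j' : ℝ) / 2 ^ n < (j : ℝ) / 2 ^ (2 * n) then q i' j'
  else 1 / 2 * q i' (j' - 1) + 1 / 2 * q i' j'

/-- `v = (v_{t_i})`, `t_i = i / 2^{4n}`, is produced by the iterative scheme with increments `q`:
here `N = 2^{3n+1}`, and `c i j` is the coefficient of the `j`-th hat function at time `t_i`. -/
def IsScheme (n : ℕ) (q : ℤ → ℤ → ℝ) (v : Fin (2 ^ (4 * n) + 1) → ℝ → ℝ) : Prop :=
  let N : ℤ := 2 ^ (3 * n + 1)
  ∃ c : Fin (2 ^ (4 * n) + 1) → ℤ → ℝ,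
    (∀ j, c 0 j = 0) ∧
    (∀ i : Fin (2 ^ (4 * n)),
      (4 * c i.succ (-N + 1) - 5 / 4 * c i.succ (-N + 2)
        = c i.castSucc (-N + 1) + 1 / 4 * c i.castSucc (-N + 2)
          + 3 / 2 ^ (2 * n + 1) * schemeNoise n q i (-N + 1)) ∧
      (∀ j ∈ Icc (-N + 2) (N - 2),
        4 * c i.succ j - 5 / 4 * (c i.succ (j + 1) + c i.succ (j - 1))
          = c i.castSucc j + 1 / 4 * (c i.castSucc (j - 1) + c i.castSucc (j + 1))
            + 3 / 2 ^ (2 * n + 1) * schemeNoise n q i j) ∧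
      (4 * c i.succ (N - 1) - 5 / 4 * c i.succ (N - 2)
        = 1 / 4 * c i.castSucc (N - 2) + c i.castSucc (N - 1)
          + 3 / 2 ^ (2 * n + 1) * schemeNoise n q i (N - 1))) ∧
    ∀ i x, v i x = ∑ j ∈ Finset.Icc (-N + 1) (N - 1), c i j * hat (1 / 2 ^ (2 * n)) j x

end FracHeat

end

/-! The statement separates into an almost sure bound on the increments of the sheet and a
deterministic error analysis for noise that is constant on cells.

Probability. A rectangular increment over a cell of side 2^{-n} is the white noise evaluated at the
real part of the Fourier transform of a kernel, cut off to a frequency box. The boxes grow with κ,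
so for fixed n the squared norms of differences along κ are increments of a bounded monotone
function. For Gaussian variables this controls all L^q norms, and a bisection argument
(`lintegral_finset_sup_increment_le`) then bounds the supremum over κ at the cost of a constant.
Scaling of the kernels gives the size 2^{-n(H₀+H₁)}. Summing q-th powers over all cells and all
levels, for q large, produces one random constant that serves every κ, outside a null set that may
depend on κ (`IsWhiteNoise.exists_rectIncr_bound`). The cells considered fill [0,1] × [-2^{n+1},
2^{n+1}], because the scheme driven by untruncated increments sees all of them.

Exact solution. The heat equation forced by sign/2 has the closed solution `heatStep`, and the
solution driven by cellwise constant noise is a finite sum of rectangular differences of it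
(`heatConv_noiseField`). Its weak derivatives are therefore explicit, and by uniqueness of weak
derivatives the Galerkin problem is an implicit Euler scheme driven by the noise itself
(`isGalerkinApprox_iff`). Positive definiteness of the form of one step gives existence and
uniqueness (`exists_unique_evolution`). Written in the hat basis at the calibrated mesh, a step is
the tridiagonal recursion of the scheme (`isScheme_iff_isEvolution`, `noiseRhs_hat`).

Error. The approximation is compared with the Ritz projection of the solution u, which in one
dimension is nodal interpolation after subtraction of the affine function with the boundary values
of u. In the energy estimate the defects of the single steps simply add up (`galerkin_step`). Each
is governed by the time increments of the second derivative of u in L² and of u at ±L. Two facts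
keep their sums free of powers of 2^m. The L¹ distance of heat kernels at times r < r' is at most
2(r'-r)/r', so the first increments form a harmonic sum of size m+1 (`sum_incrFactor_le`). At a
fixed distance the heat kernel is unimodal in time, so the second ones are bounded by a total
variation, which decays like any negative power of the distance L-2^n (`sum_abs_sol_sub_le`). Noise
bounded by F contributes F 2^{3n/2}: there are 2^n time slabs, and the L² norm is that of a bounded
function spread over length 2^{n+1}.

Truncation. The schemes with and without truncated increments differ only through noise outside
(-2^n, 2^n). A discrete minimum principle with the barrier (1+4h²)^i cosh x shows that near the
support of ρ this is an effect of order 2^{2n}/cosh(2^n), far below 2^{-n/2}. -/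

open MeasureTheory ProbabilityTheory Set
open scoped FourierTransform ENNReal NNReal

noncomputable section

namespace FracHeat

/-! ### A maximal inequality by bisection -/

section Maximal

variable {Ω : Type*} [MeasurableSpace Ω] {P : Measure Ω} {ι : Type*} [LinearOrder ι]

/-- Constant in the maximal inequality below: `2 ^ (-1/4) ≤ 6/7`. -/
theorem two_rpow_le_six_sevenths {q : ℝ} (hq : 4 ≤ q) :
    (2 : ℝ) ^ (1 / q - 1 / 2) ≤ 6 / 7 := by
  have h1 : (2 : ℝ) ^ (1 / q - 1 / 2) ≤ (2 : ℝ) ^ (-(1 / 4) : ℝ) := by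
    apply Real.rpow_le_rpow_of_exponent_le (by norm_num)
    have : 1 / q ≤ 1 / 4 := one_div_le_one_div_of_le (by norm_num) hq
    linarith
  refine h1.trans ?_
  rw [Real.rpow_neg (by norm_num), inv_le_comm₀ (by positivity) (by norm_num)]
  have : ((6 / 7 : ℝ)⁻¹) = ((7 / 6 : ℝ) ^ (4 : ℝ)) ^ (1 / 4 : ℝ) := by
    rw [← Real.rpow_mul (by norm_num)]; norm_num
  rw [this]
  apply Real.rpow_le_rpow (by positivity) _ (by norm_num)
  norm_num

/-- Bounding a maximum of two by the sum of q-th powers costs 2^{1/q}, while halving the variance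
gains 2^{-1/2}. For q ≥ 4 the product is at most 2^{-1/4} < 6/7, and this strict contraction is what
lets the bisection close. -/
theorem lintegral_sup_rpow_le {q : ℝ} (hq : 4 ≤ q) {f g : Ω → ℝ≥0∞}
    (hf : AEMeasurable f P) {K : ℝ≥0∞} {V : ℝ} (hV : 0 ≤ V)
    (h1 : (∫⁻ ω, f ω ^ q ∂P) ^ (1 / q) ≤ K * ENNReal.ofReal √(V / 2))
    (h2 : (∫⁻ ω, g ω ^ q ∂P) ^ (1 / q) ≤ K * ENNReal.ofReal √(V / 2)) :
    (∫⁻ ω, (f ω ⊔ g ω) ^ q ∂P) ^ (1 / q) ≤ K * ENNReal.ofReal (6 / 7 * √V) := by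
  have hq0 : 0 < q := by linarith
  have e : ∀ a b : ℝ≥0∞, a ^ (1 / q) ≤ b ↔ a ≤ b ^ q := by
    intro a b
    rw [one_div, ENNReal.rpow_inv_le_iff hq0]
  rw [e] at h1 h2
  have h3 : ∫⁻ ω, (f ω ⊔ g ω) ^ q ∂P ≤ 2 * (K * ENNReal.ofReal √(V / 2)) ^ q := by
    calc ∫⁻ ω, (f ω ⊔ g ω) ^ q ∂P ≤ ∫⁻ ω, (f ω ^ q + g ω ^ q) ∂P := by
          apply lintegral_mono
          intro ω
          rcases le_total (f ω) (g ω) with h | h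
          · simp [sup_eq_right.2 h]
          · simp [sup_eq_left.2 h]
      _ = ∫⁻ ω, f ω ^ q ∂P + ∫⁻ ω, g ω ^ q ∂P := lintegral_add_left' (hf.pow_const q) _
      _ ≤ _ := by rw [two_mul]; gcongr
  calc _ ≤ (2 * (K * ENNReal.ofReal √(V / 2)) ^ q) ^ (1 / q) := by gcongr
    _ = (2 : ℝ≥0∞) ^ (1 / q) * (K * ENNReal.ofReal √(V / 2)) := by
        rw [ENNReal.mul_rpow_of_nonneg _ _ (by positivity), ← ENNReal.rpow_mul,
          mul_one_div_cancel hq0.ne', ENNReal.rpow_one]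
    _ = K * ENNReal.ofReal ((2 : ℝ) ^ (1 / q) * √(V / 2)) := by
        rw [ENNReal.ofReal_mul (by positivity),
          ← ENNReal.ofReal_rpow_of_pos (by norm_num), ENNReal.ofReal_ofNat]
        ring
    _ ≤ _ := by
        refine mul_le_mul_right (ENNReal.ofReal_le_ofReal ?_) _
        have : √(V / 2) = (2 : ℝ) ^ (-(1 / 2) : ℝ) * √V := by
          rw [Real.rpow_neg (by norm_num), ← Real.sqrt_eq_rpow, Real.sqrt_div hV]; field_simp
        rw [this, ← mul_assoc, ← Real.rpow_add (by norm_num), ← sub_eq_add_neg]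
        exact mul_le_mul_of_nonneg_right (two_rpow_le_six_sevenths hq) (Real.sqrt_nonneg V)

theorem aemeasurable_finset_sup {f : ι → Ω → ℝ≥0∞} (hf : ∀ l, AEMeasurable (f l) P)
    (s : Finset ι) : AEMeasurable (fun ω => s.sup fun l => f l ω) P := by
  induction s using Finset.induction_on with
  | empty => simp
  | insert a s _ ih => simp only [Finset.sup_insert]; exact (hf a).sup ih

/-- If the `L^q` norms (`q ≥ 4`) of the increments of a process are controlled by the square roots
of the increments of a function, so is its maximum over finite sets. -/
theorem lintegral_finset_sup_increment_le {q : ℝ} (hq : 4 ≤ q) {S : ι → Ω → ℝ}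
    (hS : ∀ l, AEMeasurable (S l) P) {u : ι → ℝ} {K : ℝ≥0∞}
    (hinc : ∀ i j, i ≤ j →
      (∫⁻ ω, ‖S j ω - S i ω‖ₑ ^ q ∂P) ^ (1 / q) ≤ K * ENNReal.ofReal √(u j - u i))
    (s : Finset ι) : ∀ (i : ι) (V : ℝ), 0 ≤ V → (∀ l ∈ s, i ≤ l ∧ u l - u i ≤ V) →
      (∫⁻ ω, (s.sup fun l => ‖S l ω - S i ω‖ₑ) ^ q ∂P) ^ (1 / q)
        ≤ 7 * K * ENNReal.ofReal √V := by
  have hq0 : 0 < q := by linarith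
  induction s using Finset.strongInduction with
  | H s ih =>
  intro i V hV hs
  rcases s.eq_empty_or_nonempty with rfl | hne
  · simp [hq0]
  -- The indices at which at least half of the available variance V has been used.
  set t := s.filter fun l => V / 2 ≤ u l - u i with ht
  have hme : ∀ i l, AEMeasurable (fun ω => ‖S l ω - S i ω‖ₑ) P :=
    fun i l => ((hS l).sub (hS i)).enorm
  rcases t.eq_empty_or_nonempty with h0 | htne
  · -- all increments are at most `V / 2`: remove the maximum
    set m := s.max' hne
    have hms : m ∈ s := s.max'_mem hne
    have hsm : ∀ l ∈ s, u l - u i ≤ V / 2 := by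
      intro l hl
      by_contra hcon
      have : l ∈ t := by simp [ht, hl]; linarith
      simp [h0] at this
    have hlt : s.erase m ⊂ s := Finset.erase_ssubset hms
    have hA := ih _ hlt i (V / 2) (by linarith) (fun l hl =>
      ⟨(hs l (Finset.mem_of_mem_erase hl)).1, hsm l (Finset.mem_of_mem_erase hl)⟩)
    have hB : (∫⁻ ω, ‖S m ω - S i ω‖ₑ ^ q ∂P) ^ (1 / q) ≤ 7 * K * ENNReal.ofReal √(V / 2) := by
      refine (hinc i m (hs m hms).1).trans ?_
      gcongr
      · calc K = 1 * K := (one_mul K).symm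
          _ ≤ 7 * K := by gcongr; norm_num
      · exact hsm m hms
    have := lintegral_sup_rpow_le hq (hme i m) hV hB hA
    have he : ∀ ω, (s.sup fun l => ‖S l ω - S i ω‖ₑ)
        = ‖S m ω - S i ω‖ₑ ⊔ (s.erase m).sup fun l => ‖S l ω - S i ω‖ₑ := by
      intro ω
      rw [← Finset.sup_insert (f := fun l => ‖S l ω - S i ω‖ₑ), Finset.insert_erase hms]
    simp_rw [he]
    refine this.trans ?_
    gcongr
    have := Real.sqrt_nonneg V
    linarith
  -- Bisection at the first index past V/2. Indices before h have used less than V/2 by minimality,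
  -- and those after h have at most V/2 left when measured from h. As h belongs to neither `A` nor
  -- `B`, both are strictly smaller than `s`.
  set h := t.min' htne
  have hht : h ∈ t := t.min'_mem htne
  have hhs : h ∈ s := (Finset.mem_filter.1 hht).1
  have hhV : V / 2 ≤ u h - u i := (Finset.mem_filter.1 hht).2
  set A := s.filter fun l => l < h
  set B := s.filter fun l => h < l
  have hAs : A ⊂ s := by
    refine (Finset.ssubset_iff_of_subset (Finset.filter_subset _ _)).2 ⟨h, hhs, ?_⟩
    simp
  have hBs : B ⊂ s := by
    refine (Finset.ssubset_iff_of_subset (Finset.filter_subset _ _)).2 ⟨h, hhs, ?_⟩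
    simp
  have hA := ih A hAs i (V / 2) (by linarith) (fun l hl => by
    obtain ⟨hl1, hl2⟩ := Finset.mem_filter.1 hl
    refine ⟨(hs l hl1).1, ?_⟩
    by_contra hcon
    have : l ∈ t := Finset.mem_filter.2 ⟨hl1, by linarith⟩
    exact absurd (t.min'_le l this) (not_le.2 hl2))
  have hB := ih B hBs h (V / 2) (by linarith) (fun l hl => by
    obtain ⟨hl1, hl2⟩ := Finset.mem_filter.1 hl
    refine ⟨hl2.le, ?_⟩
    have := (hs l hl1).2
    linarith)
  have hAB := lintegral_sup_rpow_le hq (aemeasurable_finset_sup (hme i) A) hV hA hB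
  have hle : ∀ ω, (s.sup fun l => ‖S l ω - S i ω‖ₑ) ≤ ‖S h ω - S i ω‖ₑ
      + ((A.sup fun l => ‖S l ω - S i ω‖ₑ) ⊔ B.sup fun l => ‖S l ω - S h ω‖ₑ) := by
    intro ω
    apply Finset.sup_le
    intro l hl
    rcases lt_trichotomy l h with hlt | rfl | hgt
    · refine le_add_left (le_sup_of_le_left ?_)
      exact Finset.le_sup (f := fun l => ‖S l ω - S i ω‖ₑ) (Finset.mem_filter.2 ⟨hl, hlt⟩)
    · exact le_self_add
    · calc ‖S l ω - S i ω‖ₑ = ‖(S h ω - S i ω) + (S l ω - S h ω)‖ₑ := by congr 1; ring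
        _ ≤ ‖S h ω - S i ω‖ₑ + ‖S l ω - S h ω‖ₑ := enorm_add_le _ _
        _ ≤ _ := by
          gcongr
          refine le_sup_of_le_right ?_
          exact Finset.le_sup (f := fun l => ‖S l ω - S h ω‖ₑ) (Finset.mem_filter.2 ⟨hl, hgt⟩)
  calc _ ≤ (∫⁻ ω, (‖S h ω - S i ω‖ₑ
      + ((A.sup fun l => ‖S l ω - S i ω‖ₑ) ⊔ B.sup fun l => ‖S l ω - S h ω‖ₑ)) ^ q ∂P)
        ^ (1 / q) := by
        gcongr with ω; exact hle ω
    _ ≤ (∫⁻ ω, ‖S h ω - S i ω‖ₑ ^ q ∂P) ^ (1 / q) + (∫⁻ ω,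
      ((A.sup fun l => ‖S l ω - S i ω‖ₑ) ⊔ B.sup fun l => ‖S l ω - S h ω‖ₑ) ^ q ∂P)
        ^ (1 / q) :=
        ENNReal.lintegral_Lp_add_le (hme i h)
          ((aemeasurable_finset_sup (hme i) A).sup (aemeasurable_finset_sup (hme h) B))
          (by linarith)
    -- The constant 7 is the fixed point of the recursion: 1 + 7 · (6/7) = 7.
    _ ≤ K * ENNReal.ofReal √V + 7 * K * ENNReal.ofReal (6 / 7 * √V) := by
        gcongr
        refine (hinc i h (hs h hhs).1).trans ?_
        gcongr
        exact (hs h hhs).2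
    _ = _ := by
        rw [ENNReal.ofReal_mul (by norm_num), mul_assoc 7 K, mul_left_comm K, ← mul_assoc 7]
        have : (7 : ℝ≥0∞) * ENNReal.ofReal (6 / 7) = 6 := by
          rw [← ENNReal.ofReal_ofNat 7, ← ENNReal.ofReal_mul (by norm_num)]
          norm_num
        rw [this]; ring

/-- The maximal inequality over countable sets of indices. -/
theorem lintegral_iSup_rpow_le {q : ℝ} (hq : 4 ≤ q) {S : ι → Ω → ℝ}
    (hS : ∀ l, AEMeasurable (S l) P) {u : ι → ℝ} {K : ℝ≥0∞} {V : ℝ}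
    (hu0 : ∀ l, 0 ≤ u l) (huV : ∀ l, u l ≤ V)
    (hone : ∀ i, (∫⁻ ω, ‖S i ω‖ₑ ^ q ∂P) ^ (1 / q) ≤ K * ENNReal.ofReal √(u i))
    (hinc : ∀ i j, i ≤ j →
      (∫⁻ ω, ‖S j ω - S i ω‖ₑ ^ q ∂P) ^ (1 / q) ≤ K * ENNReal.ofReal √(u j - u i))
    (d : ℕ → ι) :
    ∫⁻ ω, (⨆ j, ‖S (d j) ω‖ₑ) ^ q ∂P ≤ (8 * K * ENNReal.ofReal √V) ^ q := by
  classical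
  have hq0 : 0 < q := by linarith
  have hfin : ∀ s : Finset ι,
      ∫⁻ ω, (s.sup fun l => ‖S l ω‖ₑ) ^ q ∂P ≤ (8 * K * ENNReal.ofReal √V) ^ q := by
    intro s
    rcases s.eq_empty_or_nonempty with rfl | hne
    · simp [hq0]
    -- The process is split into its value at the smallest index, controlled by `hone`, and its
    -- increments from there. Hence 8 = 1 + 7.
    set i := s.min' hne
    have hV : 0 ≤ V := (hu0 i).trans (huV i)
    have h := lintegral_finset_sup_increment_le hq hS hinc s i V hV
      (fun l hl => ⟨s.min'_le l hl, by linarith [hu0 i, huV l]⟩)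
    rw [← ENNReal.rpow_inv_le_iff hq0, ← one_div]
    have hle : ∀ ω, (s.sup fun l => ‖S l ω‖ₑ)
        ≤ ‖S i ω‖ₑ + s.sup fun l => ‖S l ω - S i ω‖ₑ := by
      intro ω
      apply Finset.sup_le
      intro l hl
      calc ‖S l ω‖ₑ = ‖S i ω + (S l ω - S i ω)‖ₑ := by congr 1; ring
        _ ≤ ‖S i ω‖ₑ + ‖S l ω - S i ω‖ₑ := enorm_add_le _ _
        _ ≤ _ := by
          gcongr
          exact Finset.le_sup (f := fun l => ‖S l ω - S i ω‖ₑ) hl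
    calc _ ≤ (∫⁻ ω, (‖S i ω‖ₑ + s.sup fun l => ‖S l ω - S i ω‖ₑ) ^ q ∂P) ^ (1 / q) := by
          gcongr with ω; exact hle ω
      _ ≤ (∫⁻ ω, ‖S i ω‖ₑ ^ q ∂P) ^ (1 / q)
          + (∫⁻ ω, (s.sup fun l => ‖S l ω - S i ω‖ₑ) ^ q ∂P) ^ (1 / q) :=
          ENNReal.lintegral_Lp_add_le (hS i).enorm
            (aemeasurable_finset_sup (fun l => ((hS l).sub (hS i)).enorm) s) (by linarith)
      _ ≤ K * ENNReal.ofReal √V + 7 * K * ENNReal.ofReal √V := by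
          gcongr
          refine (hone i).trans ?_
          gcongr
          exact huV i
      _ = _ := by ring
  -- The countable supremum is an increasing limit of finite maxima, so that monotone convergence
  -- applies to the finite bound, which does not depend on the set.
  have hsup : ∀ ω, (⨆ j, ‖S (d j) ω‖ₑ) ^ q
      = ⨆ n : ℕ, (((Finset.range n).image d).sup fun l => ‖S l ω‖ₑ) ^ q := by
    intro ω
    have : (⨆ j, ‖S (d j) ω‖ₑ) = ⨆ n : ℕ, ((Finset.range n).image d).sup fun l => ‖S l ω‖ₑ := by
      apply le_antisymm
      · apply iSup_le
        intro j
        refine le_iSup_of_le (j + 1) ?_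
        exact Finset.le_sup (f := fun l => ‖S l ω‖ₑ)
          (Finset.mem_image_of_mem d (Finset.self_mem_range_succ j))
      · refine iSup_le fun n => Finset.sup_le fun l hl => ?_
        obtain ⟨j, -, rfl⟩ := Finset.mem_image.1 hl
        exact le_iSup (fun j => ‖S (d j) ω‖ₑ) j
    rw [this]
    exact (ENNReal.orderIsoRpow q hq0).map_iSup _
  simp_rw [hsup]
  rw [lintegral_iSup']
  · exact iSup_le fun n => hfin _
  · intro n
    exact (aemeasurable_finset_sup (fun l => (hS l).enorm) _).pow_const q
  · refine Filter.Eventually.of_forall fun ω => ?_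
    intro a b hab
    dsimp only
    gcongr

end Maximal

/-! ### White noise along one-parameter families of functions -/

section WhiteNoise

variable {Ω : Type*} [MeasurableSpace Ω] {P : Measure Ω}
  {W : Lp ℝ 2 (volume : Measure Plane) → Ω → ℝ}

/-- The `L^q` norm of a standard Gaussian variable. -/
def gaussianLqNorm (q : ℝ) : ℝ≥0∞ := (∫⁻ x : ℝ, ‖x‖ₑ ^ q ∂gaussianReal 0 1) ^ (1 / q)

theorem gaussianLqNorm_ne_top {q : ℝ} (hq : 0 < q) : gaussianLqNorm q ≠ ∞ := by
  have h := (memLp_id_gaussianReal (μ := 0) (v := 1) q.toNNReal).eLpNorm_lt_top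
  rw [eLpNorm_eq_lintegral_rpow_enorm_toReal (by simpa using hq) (by simp)] at h
  simpa [gaussianLqNorm, hq.le] using h.ne

theorem IsWhiteNoise.memLp (hW : IsWhiteNoise P W) (f) : MemLp (W f) 2 P :=
  (hW.gaussian.hasGaussianLaw_eval f).memLp_two

/-- No linearity is assumed of a white noise; it follows almost surely from the covariance, because
the second moment of the defect expands to ‖f - g - (f - g)‖² = 0. -/
theorem IsWhiteNoise.sub_ae (hW : IsWhiteNoise P W) (f g) :
    ∀ᵐ ω ∂P, W f ω - W g ω = W (f - g) ω := by
  have hInt : ∀ a b, Integrable (fun ω => W a ω * W b ω) P :=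
    fun a b => (hW.memLp a).integrable_mul (hW.memLp b)
  have hexp : ∀ ω, (W f ω - W g ω - W (f - g) ω) ^ 2 = W f ω * W f ω + W g ω * W g ω
      + W (f - g) ω * W (f - g) ω - 2 * (W f ω * W g ω) - 2 * (W f ω * W (f - g) ω)
      + 2 * (W g ω * W (f - g) ω) := fun ω => by ring
  have h0 : ∫ ω, (W f ω - W g ω - W (f - g) ω) ^ 2 ∂P = 0 := by
    simp_rw [hexp]
    have i1 := hInt f f
    have i2 := hInt g g
    have i3 := hInt (f - g) (f - g)
    have i4 := (hInt f g).const_mul 2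
    have i5 := (hInt f (f - g)).const_mul 2
    have i6 := (hInt g (f - g)).const_mul 2
    rw [integral_add (by fun_prop) i6, integral_sub (by fun_prop) i5,
      integral_sub (by fun_prop) i4, integral_add (by fun_prop) i3, integral_add i1 i2]
    simp_rw [integral_const_mul, hW.covariance, inner_sub_left, inner_sub_right]
    rw [real_inner_comm g f]
    ring
  have hi : Integrable (fun ω => (W f ω - W g ω - W (f - g) ω) ^ 2) P :=
    (((hW.memLp f).sub (hW.memLp g)).sub (hW.memLp (f - g))).integrable_sq
  rw [integral_eq_zero_iff_of_nonneg (fun ω => sq_nonneg _) hi] at h0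
  filter_upwards [h0] with ω hω
  have : W f ω - W g ω - W (f - g) ω = 0 := by simpa using hω
  linarith

/-- The variable is centered Gaussian of variance ‖f‖², hence distributed as ‖f‖ times a standard
Gaussian. -/
theorem IsWhiteNoise.lintegral_rpow (hW : IsWhiteNoise P W) {q : ℝ} (hq : 0 < q) (f) :
    (∫⁻ ω, ‖W f ω‖ₑ ^ q ∂P) ^ (1 / q) = gaussianLqNorm q * ENNReal.ofReal ‖f‖ := by
  have hg := hW.gaussian.hasGaussianLaw_eval f
  have := hg.isProbabilityMeasure
  have hvar : Var[W f; P] = ‖f‖ ^ 2 := by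
    rw [variance_of_integral_eq_zero hg.aemeasurable (hW.centered f)]
    have := hW.covariance f f
    rw [real_inner_self_eq_norm_sq] at this
    simpa [sq] using this
  have hmap : P.map (W f) = (gaussianReal 0 1).map (fun x => ‖f‖ * x) := by
    rw [hg.map_eq_gaussianReal, hvar, gaussianReal_map_const_mul, hW.centered f]
    congr 1
    · simp
    · ext; simp
  have h1 : ∫⁻ ω, ‖W f ω‖ₑ ^ q ∂P = ∫⁻ x, ‖x‖ₑ ^ q ∂(P.map (W f)) := by
    rw [lintegral_map' (by fun_prop) hg.aemeasurable]
  rw [h1, hmap, lintegral_map (by fun_prop) (by fun_prop), gaussianLqNorm]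
  simp_rw [enorm_mul, ENNReal.mul_rpow_of_nonneg _ _ hq.le]
  rw [lintegral_const_mul _ (by fun_prop), ENNReal.mul_rpow_of_nonneg _ _ (by positivity),
    ← ENNReal.rpow_mul, mul_one_div_cancel hq.ne', ENNReal.rpow_one, mul_comm]
  congr 1
  rw [enorm_norm, ofReal_norm]

theorem IsWhiteNoise.lintegral_sub_rpow (hW : IsWhiteNoise P W) {q : ℝ} (hq : 0 < q) (f g) :
    (∫⁻ ω, ‖W f ω - W g ω‖ₑ ^ q ∂P) ^ (1 / q) = gaussianLqNorm q * ENNReal.ofReal ‖f - g‖ := by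
  rw [← hW.lintegral_rpow hq]
  congr 1
  apply lintegral_congr_ae
  filter_upwards [hW.sub_ae f g] with ω hω
  rw [hω]

/-- The values of a white noise along a one-parameter family of functions whose squared increments
are controlled by those of a bounded function are simultaneously dominated. -/
theorem IsWhiteNoise.exists_dominating (hW : IsWhiteNoise P W) {q : ℝ} (hq : 4 ≤ q)
    (f : ℝ → Lp ℝ 2 (volume : Measure Plane)) (u : ℝ → ℝ) (V : ℝ)
    (huV : ∀ κ, u κ ≤ V) (h1 : ∀ κ, ‖f κ‖ ^ 2 ≤ u κ)
    (h2 : ∀ κ κ', κ ≤ κ' → ‖f κ' - f κ‖ ^ 2 ≤ u κ' - u κ) :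
    ∃ Y : Ω → ℝ≥0∞, Measurable Y ∧ (∀ κ, ∀ᵐ ω ∂P, ‖W (f κ) ω‖ₑ ≤ Y ω) ∧
      ∫⁻ ω, Y ω ^ q ∂P ≤ (8 * gaussianLqNorm q * ENNReal.ofReal √V) ^ q := by
  have hq0 : 0 < q := by linarith
  have hm : ∀ κ, AEMeasurable (W (f κ)) P := fun κ => hW.gaussian.aemeasurable (f κ)
  have : Fact ((2 : ℝ≥0∞) ≠ ∞) := ⟨by simp⟩
  have : Nonempty (range f) := ⟨⟨f 0, mem_range_self 0⟩⟩
  -- The maximal inequality handles countably many parameters, so parameters are picked whose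
  -- functions are dense in the range of `f`. Density is asked of the functions and not of the
  -- parameters, as no continuity in κ is available.
  choose d hd using fun j => (TopologicalSpace.denseSeq (range f) j).2
  refine ⟨fun ω => ⨆ j, ‖(hm (d j)).mk _ ω‖ₑ, ?_, ?_, ?_⟩
  · exact Measurable.iSup fun j => (hm (d j)).measurable_mk.enorm
  · intro κ
    have hcl := (TopologicalSpace.denseRange_denseSeq (range f)) ⟨f κ, mem_range_self κ⟩
    obtain ⟨x, hx, hlim⟩ := mem_closure_iff_seq_limit.1 hcl
    choose k hk using hx
    have hlim' : Filter.Tendsto (fun j => f (d (k j))) Filter.atTop (nhds (f κ)) := by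
      have := (continuous_subtype_val.tendsto _).comp hlim
      refine this.congr fun j => ?_
      simp only [Function.comp_apply]
      rw [← hk j, hd]
    -- Convergence of the functions gives convergence in L^q of the noise, hence almost surely along
    -- a subsequence. The bound thus passes to the limit, with an exceptional null set that depends
    -- on κ.
    have hp : Filter.Tendsto (fun j => eLpNorm (W (f (d (k j))) - W (f κ)) (ENNReal.ofReal q) P)
        Filter.atTop (nhds 0) := by
      have he : ∀ j, eLpNorm (W (f (d (k j))) - W (f κ)) (ENNReal.ofReal q) P
          = gaussianLqNorm q * ENNReal.ofReal ‖f (d (k j)) - f κ‖ := by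
        intro j
        rw [eLpNorm_eq_lintegral_rpow_enorm_toReal (by simpa using hq0) (by simp),
          ENNReal.toReal_ofReal hq0.le, ← hW.lintegral_sub_rpow hq0]
        rfl
      simp_rw [he]
      have h3 : Filter.Tendsto (fun j => ENNReal.ofReal ‖f (d (k j)) - f κ‖) Filter.atTop
          (nhds (ENNReal.ofReal 0)) :=
        ENNReal.tendsto_ofReal (tendsto_iff_norm_sub_tendsto_zero.1 hlim')
      simpa using ENNReal.Tendsto.const_mul h3 (Or.inr (gaussianLqNorm_ne_top hq0))
    have htm := tendstoInMeasure_of_tendsto_eLpNorm (p := ENNReal.ofReal q)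
      (by simpa using hq0) (fun j => (hm (d (k j))).aestronglyMeasurable)
      (hm κ).aestronglyMeasurable hp
    obtain ⟨ns, -, hns⟩ := htm.exists_seq_tendsto_ae
    have hmk : ∀ᵐ ω ∂P, ∀ j, W (f (d j)) ω = (hm (d j)).mk _ ω :=
      ae_all_iff.2 fun j => (hm (d j)).ae_eq_mk
    filter_upwards [hns, hmk] with ω hω hω2
    refine le_of_tendsto (hω.enorm) (Filter.Eventually.of_forall fun j => ?_)
    rw [hω2]
    exact le_iSup (fun j => ‖(hm (d j)).mk _ ω‖ₑ) _
  · have := lintegral_iSup_rpow_le (P := P) hq (S := fun κ => W (f κ)) (u := u)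
      (K := gaussianLqNorm q) (V := V) hm (fun l => (sq_nonneg _).trans (h1 l)) huV
      (fun i => by
        rw [hW.lintegral_rpow hq0]
        gcongr
        exact Real.le_sqrt_of_sq_le (h1 i))
      (fun i j hij => by
        rw [hW.lintegral_sub_rpow hq0]
        gcongr
        exact Real.le_sqrt_of_sq_le (h2 i j hij)) d
    refine le_trans (le_of_eq (lintegral_congr_ae ?_)) this
    have hmk : ∀ᵐ ω ∂P, ∀ j, W (f (d j)) ω = (hm (d j)).mk _ ω :=
      ae_all_iff.2 fun j => (hm (d j)).ae_eq_mk
    filter_upwards [hmk] with ω hω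
    simp_rw [hω]

end WhiteNoise

/-! ### Increments of the smoothened sheet -/

/-- The kernel of an increment of a fractional Brownian motion over `[a, b]`. -/
def incrKernel (H a b ξ : ℝ) : ℂ :=
  (Complex.exp (Complex.I * (ξ * b : ℝ)) - Complex.exp (Complex.I * (ξ * a : ℝ)))
    / ((|ξ| ^ (H + 1 / 2) : ℝ) : ℂ)

/-- The squared norm of the kernel of a unit increment. -/
def incrConst (H : ℝ) : ℝ := ∫ ξ : ℝ, ‖incrKernel H 0 1 ξ‖ ^ 2

theorem measurable_incrKernel (H a b : ℝ) : Measurable (incrKernel H a b) := by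
  unfold incrKernel; fun_prop

theorem norm_exp_sub_exp (ξ a b : ℝ) :
    ‖Complex.exp (Complex.I * (ξ * b : ℝ)) - Complex.exp (Complex.I * (ξ * a : ℝ))‖
      = ‖Complex.exp (Complex.I * (ξ * (b - a) : ℝ)) - 1‖ := by
  have : Complex.exp (Complex.I * (ξ * b : ℝ)) - Complex.exp (Complex.I * (ξ * a : ℝ))
      = Complex.exp (Complex.I * (ξ * a : ℝ))
        * (Complex.exp (Complex.I * (ξ * (b - a) : ℝ)) - 1) := by
    rw [mul_sub, ← Complex.exp_add, mul_one]
    congr 2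
    push_cast; ring
  rw [this, norm_mul, mul_comm Complex.I, Complex.norm_exp_ofReal_mul_I, one_mul]

theorem norm_sq_incrKernel (H a b ξ : ℝ) :
    ‖incrKernel H a b ξ‖ ^ 2
      = ‖Complex.exp (Complex.I * (ξ * (b - a) : ℝ)) - 1‖ ^ 2 / |ξ| ^ (2 * H + 1) := by
  unfold incrKernel
  rw [norm_div, norm_exp_sub_exp, div_pow, Complex.norm_real, Real.norm_of_nonneg (by positivity),
    ← Real.rpow_natCast (|ξ| ^ _), ← Real.rpow_mul (abs_nonneg ξ)]
  congr 2
  push_cast; ring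

/-- For |ξ| ≤ 1 the kernel is the cut-off harmonizable kernel, already known to be
square-integrable. Beyond, the numerator is at most 2 and |ξ|^{-2H-1} is integrable because H > 0.
-/
theorem integrable_norm_sq_unit_incrKernel {H : ℝ} (hH : H ∈ Ioo (0 : ℝ) 1) :
    Integrable (fun ξ : ℝ => ‖incrKernel H 0 1 ξ‖ ^ 2) := by
  have h1 := (memLp_two_iff_integrable_sq_norm (memLp_harmonizableKernel hH 1 1).1).1
    (memLp_harmonizableKernel hH 1 1)
  have h2 : Integrable (fun ξ : ℝ => 4 * (2 : ℝ) ^ (2 * H + 1) * (1 + ‖ξ‖) ^ (-(2 * H + 1))) :=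
    (integrable_one_add_norm (by simp; linarith [hH.1])).const_mul _
  refine (h1.add h2).mono' ((measurable_incrKernel H 0 1).norm.pow_const 2).aestronglyMeasurable
    (Filter.Eventually.of_forall fun ξ => ?_)
  rw [Real.norm_of_nonneg (by positivity), Pi.add_apply]
  by_cases h : |ξ| ≤ 1
  · have : incrKernel H 0 1 ξ = harmonizableKernel H 1 1 ξ := by
      simp [incrKernel, harmonizableKernel, h]
    rw [this]
    have : 0 ≤ 4 * (2 : ℝ) ^ (2 * H + 1) * (1 + ‖ξ‖) ^ (-(2 * H + 1)) := by positivity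
    linarith
  · push Not at h
    refine le_add_of_nonneg_of_le (by positivity) ?_
    rw [norm_sq_incrKernel]
    have hp : 0 < 2 * H + 1 := by linarith [hH.1]
    have h3 : ‖Complex.exp (Complex.I * (ξ * (1 - 0) : ℝ)) - 1‖ ^ 2 ≤ 4 := by
      have : ‖Complex.exp (Complex.I * (ξ * (1 - 0) : ℝ)) - 1‖ ≤ 2 := by
        refine (norm_sub_le _ _).trans ?_
        rw [mul_comm Complex.I, Complex.norm_exp_ofReal_mul_I]; norm_num
      nlinarith [norm_nonneg (Complex.exp (Complex.I * (ξ * (1 - 0) : ℝ)) - 1)]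
    rw [mul_assoc, div_eq_mul_inv, ← Real.rpow_neg (abs_nonneg ξ)]
    refine mul_le_mul h3 ?_ (by positivity) (by norm_num)
    rw [Real.rpow_neg (abs_nonneg ξ), Real.rpow_neg (by positivity), ← div_eq_mul_inv,
      ← Real.inv_rpow (by positivity), ← Real.div_rpow (by norm_num) (by positivity)]
    apply Real.rpow_le_rpow (by positivity) _ hp.le
    rw [inv_eq_one_div, div_le_div_iff₀ (by linarith) (by positivity), Real.norm_eq_abs]
    linarith

/-- Stationarity and self-similarity of the increments, read on the frequency side: a translation
only changes a phase, and a dilation is a substitution. -/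
theorem norm_sq_incrKernel_scaling (H a : ℝ) {δ : ℝ} (hδ : 0 < δ) (ξ : ℝ) :
    ‖incrKernel H a (a + δ) ξ‖ ^ 2 = δ ^ (2 * H + 1) * ‖incrKernel H 0 1 (δ * ξ)‖ ^ 2 := by
  rw [norm_sq_incrKernel, norm_sq_incrKernel, abs_mul, abs_of_pos hδ,
    Real.mul_rpow hδ.le (abs_nonneg ξ)]
  have : δ ^ (2 * H + 1) ≠ 0 := (Real.rpow_pos_of_pos hδ _).ne'
  rw [show ξ * (a + δ - a) = δ * ξ * (1 - 0) by ring]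
  by_cases h : |ξ| ^ (2 * H + 1) = 0
  · simp [h]
  field_simp

theorem integrable_norm_sq_incrKernel {H : ℝ} (hH : H ∈ Ioo (0 : ℝ) 1) (a : ℝ) {δ : ℝ}
    (hδ : 0 < δ) : Integrable (fun ξ : ℝ => ‖incrKernel H a (a + δ) ξ‖ ^ 2) := by
  simp_rw [norm_sq_incrKernel_scaling H a hδ]
  exact ((integrable_norm_sq_unit_incrKernel hH).comp_mul_left' hδ.ne').const_mul _

theorem integral_norm_sq_incrKernel (H a : ℝ) {δ : ℝ} (hδ : 0 < δ) :
    ∫ ξ : ℝ, ‖incrKernel H a (a + δ) ξ‖ ^ 2 = δ ^ (2 * H) * incrConst H := by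
  simp_rw [norm_sq_incrKernel_scaling H a hδ]
  rw [integral_const_mul, Measure.integral_comp_mul_left (fun ξ => ‖incrKernel H 0 1 ξ‖ ^ 2) δ,
    smul_eq_mul, ← mul_assoc, incrConst, Real.rpow_add hδ, Real.rpow_one,
    abs_of_pos (inv_pos.2 hδ), mul_assoc (δ ^ (2 * H)), mul_inv_cancel₀ hδ.ne', mul_one]

/-- The kernel of a rectangular increment of the sheet. -/
def rectKernel (H₀ H₁ a b δ : ℝ) (z : Plane) : ℂ :=
  incrKernel H₀ a (a + δ) (z 0) * incrKernel H₁ b (b + δ) (z 1)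

theorem measurePreserving_plane :
    MeasurePreserving (fun z : Plane => (z 0, z 1)) volume (volume : Measure (ℝ × ℝ)) :=
  (volume_preserving_finTwoArrow ℝ).comp (PiLp.volume_preserving_ofLp (Fin 2))

theorem measurable_rectKernel (H₀ H₁ a b δ : ℝ) : Measurable (rectKernel H₀ H₁ a b δ) := by
  have h₀ := measurable_incrKernel H₀ a (a + δ)
  have h₁ := measurable_incrKernel H₁ b (b + δ)
  unfold rectKernel
  fun_prop

theorem integrable_norm_sq_rectKernel {H₀ H₁ : ℝ} (h₀ : H₀ ∈ Ioo (0 : ℝ) 1)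
    (h₁ : H₁ ∈ Ioo (0 : ℝ) 1) (a b : ℝ) {δ : ℝ} (hδ : 0 < δ) :
    Integrable (fun z => ‖rectKernel H₀ H₁ a b δ z‖ ^ 2) := by
  have := (integrable_norm_sq_incrKernel h₀ a hδ).mul_prod (integrable_norm_sq_incrKernel h₁ b hδ)
  have h2 := measurePreserving_plane.integrable_comp_of_integrable this
  simpa [rectKernel, mul_pow, Function.comp_def] using h2

theorem integral_norm_sq_rectKernel (H₀ H₁ a b : ℝ) {δ : ℝ} (hδ : 0 < δ) :
    ∫ z, ‖rectKernel H₀ H₁ a b δ z‖ ^ 2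
      = δ ^ (2 * (H₀ + H₁)) * (incrConst H₀ * incrConst H₁) := by
  have h1 : ∫ z, ‖rectKernel H₀ H₁ a b δ z‖ ^ 2 = ∫ p : ℝ × ℝ,
      ‖incrKernel H₀ a (a + δ) p.1‖ ^ 2 * ‖incrKernel H₁ b (b + δ) p.2‖ ^ 2 := by
    have hemb : MeasurableEmbedding (fun z : Plane => (z 0, z 1)) := by
      exact (MeasurableEquiv.finTwoArrow (α := ℝ)).measurableEmbedding.comp
        (MeasurableEquiv.toLp 2 (Fin 2 → ℝ)).symm.measurableEmbedding
    rw [← measurePreserving_plane.integral_comp hemb]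
    simp [rectKernel, mul_pow]
  rw [h1]
  have := integral_prod_mul (μ := volume) (ν := volume)
    (fun ξ => ‖incrKernel H₀ a (a + δ) ξ‖ ^ 2) (fun ξ => ‖incrKernel H₁ b (b + δ) ξ‖ ^ 2)
  rw [Measure.volume_eq_prod, this, integral_norm_sq_incrKernel H₀ a hδ,
    integral_norm_sq_incrKernel H₁ b hδ,
    mul_add, Real.rpow_add hδ]
  ring

theorem memLp_rectKernel {H₀ H₁ : ℝ} (h₀ : H₀ ∈ Ioo (0 : ℝ) 1)
    (h₁ : H₁ ∈ Ioo (0 : ℝ) 1) (a b : ℝ) {δ : ℝ} (hδ : 0 < δ) :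
    MemLp (rectKernel H₀ H₁ a b δ) 2 volume :=
  (memLp_two_iff_integrable_sq_norm (measurable_rectKernel H₀ H₁ a b δ).aestronglyMeasurable).2
    (integrable_norm_sq_rectKernel h₀ h₁ a b hδ)

/-- A box of frequencies. -/
def freqBox (r₀ r₁ : ℝ) : Set Plane := {z | |z 0| ≤ r₀ ∧ |z 1| ≤ r₁}

theorem measurableSet_freqBox (r₀ r₁ : ℝ) : MeasurableSet (freqBox r₀ r₁) := by
  have h₀ : Measurable fun z : Plane => |z 0| := by fun_prop
  have h₁ : Measurable fun z : Plane => |z 1| := by fun_prop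
  exact (measurableSet_le h₀ measurable_const).inter (measurableSet_le h₁ measurable_const)

theorem freqBox_mono {r₀ r₁ s₀ s₁ : ℝ} (h₀ : r₀ ≤ s₀) (h₁ : r₁ ≤ s₁) :
    freqBox r₀ r₁ ⊆ freqBox s₀ s₁ := fun _ hz => ⟨hz.1.trans h₀, hz.2.trans h₁⟩

/-- Real part of the `L²` Fourier transform. -/
def reFourier (g : Lp ℂ 2 (volume : Measure Plane)) : Lp ℝ 2 (volume : Measure Plane) :=
  Complex.reCLM.compLp (𝓕 g)

theorem reFourier_sub (g g' : Lp ℂ 2 (volume : Measure Plane)) :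
    reFourier (g - g') = reFourier g - reFourier g' := by
  have h : 𝓕 (g - g') = 𝓕 g - 𝓕 g' := (Lp.fourierTransformₗᵢ Plane ℂ).map_sub g g'
  unfold reFourier
  rw [h]
  exact (Complex.reCLM.compLpL 2 (volume : Measure Plane)).map_sub _ _

theorem norm_reFourier_le (g : Lp ℂ 2 (volume : Measure Plane)) : ‖reFourier g‖ ≤ ‖g‖ := by
  have h := Complex.reCLM.norm_compLp_le (𝓕 g)
  rwa [Complex.reCLM_norm, one_mul, Lp.norm_fourier_eq] at h

theorem norm_toLp_sq {D : Plane → ℂ} (hD : MemLp D 2 volume) :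
    ‖hD.toLp D‖ ^ 2 = ∫ z, ‖D z‖ ^ 2 := by
  rw [Lp.norm_toLp, toReal_eLpNorm hD.1,
    lpNorm_eq_integral_norm_rpow_toReal (by norm_num) (by norm_num) hD.1, ← Real.rpow_natCast,
    ← Real.rpow_mul (integral_nonneg fun _ => by positivity)]
  norm_num

theorem norm_toLp_indicator_sq {D : Plane → ℂ} (hD : MemLp D 2 volume) {A : Set Plane}
    (hA : MeasurableSet A) :
    ‖(hD.indicator hA).toLp (A.indicator D)‖ ^ 2 = ∫ z in A, ‖D z‖ ^ 2 := by
  rw [norm_toLp_sq, ← integral_indicator hA]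
  congr 1 with z
  by_cases hz : z ∈ A <;> simp [hz]

/-- For nested sets the squared norm of the difference is exactly an increment of the mass. This is
the structure that `IsWhiteNoise.exists_dominating` exploits. -/
theorem norm_toLp_indicator_sub_sq {D : Plane → ℂ} (hD : MemLp D 2 volume) {A B : Set Plane}
    (hA : MeasurableSet A) (hB : MeasurableSet B) (hAB : A ⊆ B) :
    ‖(hD.indicator hB).toLp (B.indicator D) - (hD.indicator hA).toLp (A.indicator D)‖ ^ 2
      = (∫ z in B, ‖D z‖ ^ 2) - ∫ z in A, ‖D z‖ ^ 2 := by
  rw [← MemLp.toLp_sub, norm_toLp_sq, ← integral_indicator hA, ← integral_indicator hB,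
    ← integral_sub]
  · congr 1 with z
    by_cases hz : z ∈ A
    · simp [hz, hAB hz]
    · by_cases hz' : z ∈ B <;> simp [hz, hz']
  all_goals
    refine Integrable.indicator ?_ (by assumption)
    exact (memLp_two_iff_integrable_sq_norm hD.1).1 hD

theorem re_fourierIntegral {Ω : Type*} {W : Lp ℝ 2 (volume : Measure Plane) → Ω → ℝ} {φ : Plane → ℂ} (hφ : MemLp φ 2 volume) (ω : Ω) :
    (fourierIntegral W φ ω).re = W (reFourier (hφ.toLp φ)) ω := by
  simp [fourierIntegral, hφ, reFourier]

/-- The constants -1 that make the kernel of the sheet integrable at the origin cancel in a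
rectangular increment. The grouping as a difference of differences matches three uses of
`IsWhiteNoise.sub_ae`. -/
theorem rect_harmonizableKernel (H₀ H₁ r₀ r₁ a b δ : ℝ) (z : Plane) :
    harmonizableKernel H₀ r₀ (a + δ) (z 0) * harmonizableKernel H₁ r₁ (b + δ) (z 1)
      - harmonizableKernel H₀ r₀ (a + δ) (z 0) * harmonizableKernel H₁ r₁ b (z 1)
      - (harmonizableKernel H₀ r₀ a (z 0) * harmonizableKernel H₁ r₁ (b + δ) (z 1)
      - harmonizableKernel H₀ r₀ a (z 0) * harmonizableKernel H₁ r₁ b (z 1))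
      = (freqBox r₀ r₁).indicator (rectKernel H₀ H₁ a b δ) z := by
  by_cases h0 : |z 0| ≤ r₀
  · by_cases h1 : |z 1| ≤ r₁
    · rw [indicator_of_mem (show z ∈ freqBox r₀ r₁ from ⟨h0, h1⟩)]
      simp only [harmonizableKernel, h0, h1, if_true, rectKernel, incrKernel]
      ring
    · rw [indicator_of_notMem (show z ∉ freqBox r₀ r₁ from fun h => h1 h.2)]
      simp [harmonizableKernel, h1]
  · rw [indicator_of_notMem (show z ∉ freqBox r₀ r₁ from fun h => h0 h.1)]
    simp [harmonizableKernel, h0]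

/-! ### Almost sure bounds on the increments, uniform in the cut-off -/

section Sheet

variable {Ω : Type*} [MeasurableSpace Ω] {P : Measure Ω}
  {W : Lp ℝ 2 (volume : Measure Plane) → Ω → ℝ}

/-- A rectangular increment of the sheet is a Wiener integral. -/
theorem IsWhiteNoise.rectIncr_smoothSheet_ae (hW : IsWhiteNoise P W) {H₀ H₁ : ℝ}
    (h₀ : H₀ ∈ Ioo (0 : ℝ) 1) (h₁ : H₁ ∈ Ioo (0 : ℝ) 1) (κ : ℝ) (n : ℕ) (k l : ℤ) :
    ∀ᵐ ω ∂P, rectIncr n (smoothSheet W H₀ H₁ κ n ω) k l = hurstConst H₀ * hurstConst H₁ *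
      W (reFourier (((memLp_rectKernel h₀ h₁ (k / 2 ^ n) (l / 2 ^ n)
        (show (0 : ℝ) < 1 / 2 ^ n by positivity)).indicator
        (measurableSet_freqBox ((2 : ℝ) ^ (2 * κ * n)) ((2 : ℝ) ^ (κ * n)))).toLp _)) ω := by
  set δ : ℝ := 1 / 2 ^ n with hδ
  set a : ℝ := k / 2 ^ n
  set b : ℝ := l / 2 ^ n
  have ha : ((k : ℝ) + 1) / 2 ^ n = a + δ := by rw [hδ, add_div]
  have hb : ((l : ℝ) + 1) / 2 ^ n = b + δ := by rw [hδ, add_div]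
  set r₀ : ℝ := (2 : ℝ) ^ (2 * κ * n)
  set r₁ : ℝ := (2 : ℝ) ^ (κ * n)
  have hm : ∀ t x, MemLp (fun z : Plane => harmonizableKernel H₀ r₀ t (z 0)
      * harmonizableKernel H₁ r₁ x (z 1)) 2 volume := memLp_sheetKernel h₀ h₁ r₀ r₁
  have e : ∀ hD : MemLp ((freqBox r₀ r₁).indicator (rectKernel H₀ H₁ a b δ)) 2 volume,
      reFourier (hD.toLp _)
      = reFourier ((hm (a + δ) (b + δ)).toLp _) - reFourier ((hm (a + δ) b).toLp _)
        - (reFourier ((hm a (b + δ)).toLp _) - reFourier ((hm a b).toLp _)) := by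
    intro hD
    rw [← reFourier_sub, ← reFourier_sub, ← reFourier_sub, ← MemLp.toLp_sub, ← MemLp.toLp_sub,
      ← MemLp.toLp_sub]
    congr 1
    apply MemLp.toLp_congr
    refine Filter.Eventually.of_forall fun z => ?_
    rw [← rect_harmonizableKernel]
    rfl
  rw [e]
  filter_upwards [hW.sub_ae (reFourier ((hm (a + δ) (b + δ)).toLp _))
      (reFourier ((hm (a + δ) b).toLp _)),
    hW.sub_ae (reFourier ((hm a (b + δ)).toLp _)) (reFourier ((hm a b).toLp _)),
    hW.sub_ae (reFourier ((hm (a + δ) (b + δ)).toLp _) - reFourier ((hm (a + δ) b).toLp _))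
      (reFourier ((hm a (b + δ)).toLp _) - reFourier ((hm a b).toLp _))] with ω e1 e2 e3
  rw [← e3, ← e1, ← e2]
  unfold rectIncr smoothSheet
  rw [ha, hb, re_fourierIntegral (hm _ _), re_fourierIntegral (hm _ _),
    re_fourierIntegral (hm _ _), re_fourierIntegral (hm _ _)]
  ring

/-- The constant in the moment bound of the increments. -/
def momentConst (H₀ H₁ q : ℝ) : ℝ≥0∞ :=
  ‖hurstConst H₀ * hurstConst H₁‖ₑ * (8 * gaussianLqNorm q
    * ENNReal.ofReal √(incrConst H₀ * incrConst H₁))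

theorem momentConst_ne_top (H₀ H₁ : ℝ) {q : ℝ} (hq : 0 < q) : momentConst H₀ H₁ q ≠ ∞ :=
  ENNReal.mul_ne_top enorm_ne_top (ENNReal.mul_ne_top
    (ENNReal.mul_ne_top (by simp) (gaussianLqNorm_ne_top hq)) ENNReal.ofReal_ne_top)

/-- Domination of a rectangular increment, uniformly in the cut-off. -/
theorem IsWhiteNoise.exists_dominating_rectIncr (hW : IsWhiteNoise P W) {H₀ H₁ : ℝ}
    (h₀ : H₀ ∈ Ioo (0 : ℝ) 1) (h₁ : H₁ ∈ Ioo (0 : ℝ) 1) {q : ℝ} (hq : 4 ≤ q) (n : ℕ) (k l : ℤ) :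
    ∃ Y : Ω → ℝ≥0∞, Measurable Y ∧
      (∀ κ, ∀ᵐ ω ∂P, ‖rectIncr n (smoothSheet W H₀ H₁ κ n ω) k l‖ₑ ≤ Y ω) ∧
      ∫⁻ ω, Y ω ^ q ∂P
        ≤ (momentConst H₀ H₁ q * ENNReal.ofReal ((2 : ℝ) ^ (-(n * (H₀ + H₁))))) ^ q := by
  have hδ : (0 : ℝ) < 1 / 2 ^ n := by positivity
  have hD := memLp_rectKernel h₀ h₁ (k / 2 ^ n) (l / 2 ^ n) hδ
  have hDi := (memLp_two_iff_integrable_sq_norm hD.1).1 hD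
  set D := rectKernel H₀ H₁ (k / 2 ^ n) (l / 2 ^ n) (1 / 2 ^ n)
  set A : ℝ → Set Plane := fun κ => freqBox ((2 : ℝ) ^ (2 * κ * n)) ((2 : ℝ) ^ (κ * n))
  have hA : ∀ κ, MeasurableSet (A κ) := fun κ => measurableSet_freqBox _ _
  -- Both cut-offs increase with κ, so the truncated kernels are nested and the maximal inequality
  -- applies in the single parameter κ.
  have hmono : ∀ κ κ', κ ≤ κ' → A κ ⊆ A κ' := by
    intro κ κ' h
    apply freqBox_mono <;>
    · apply Real.rpow_le_rpow_of_exponent_le (by norm_num)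
      gcongr
  obtain ⟨Y, hY, hdom, hmom⟩ := hW.exists_dominating hq
    (fun κ => reFourier ((hD.indicator (hA κ)).toLp _)) (fun κ => ∫ z in A κ, ‖D z‖ ^ 2)
    (∫ z, ‖D z‖ ^ 2)
    (fun κ => setIntegral_le_integral hDi (Filter.Eventually.of_forall fun _ => by positivity))
    (fun κ => by
      rw [← norm_toLp_indicator_sq hD (hA κ)]
      gcongr
      exact norm_reFourier_le _)
    (fun κ κ' h => by
      rw [← norm_toLp_indicator_sub_sq hD (hA κ) (hA κ') (hmono κ κ' h), ← reFourier_sub]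
      gcongr
      exact norm_reFourier_le _)
  refine ⟨fun ω => ‖hurstConst H₀ * hurstConst H₁‖ₑ * Y ω, hY.const_mul _, ?_, ?_⟩
  · intro κ
    filter_upwards [hdom κ, hW.rectIncr_smoothSheet_ae h₀ h₁ κ n k l] with ω h1 h2
    rw [h2, enorm_mul]
    gcongr
  · have hq0 : 0 < q := by linarith
    simp_rw [ENNReal.mul_rpow_of_nonneg _ _ hq0.le]
    rw [lintegral_const_mul _ (hY.pow_const q), momentConst,
      ENNReal.mul_rpow_of_nonneg _ _ hq0.le, mul_assoc, ← ENNReal.mul_rpow_of_nonneg _ _ hq0.le]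
    gcongr
    refine hmom.trans (le_of_eq ?_)
    congr 1
    have hs : √((1 / 2 ^ n : ℝ) ^ (2 * (H₀ + H₁))) = (2 : ℝ) ^ (-(n * (H₀ + H₁))) := by
      rw [Real.sqrt_eq_rpow, ← Real.rpow_mul hδ.le, one_div, Real.inv_rpow (by positivity),
        ← Real.rpow_natCast, ← Real.rpow_mul (by norm_num), Real.rpow_neg (by norm_num)]
      congr 2
      ring
    rw [integral_norm_sq_rectKernel _ _ _ _ hδ, Real.sqrt_mul (by positivity), hs,
      ENNReal.ofReal_mul (by positivity), mul_assoc (8 * gaussianLqNorm q), mul_comm (ENNReal.ofReal _)]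

/-- All increments over the cells of `[0, 1] × [-2ⁿ⁺¹, 2ⁿ⁺¹]` are simultaneously bounded by a
random multiple of `2^{-n(H₀ + H₁ - ε)}`, uniformly in the cut-off. -/
theorem IsWhiteNoise.exists_rectIncr_bound (hW : IsWhiteNoise P W) {H₀ H₁ : ℝ}
    (h₀ : H₀ ∈ Ioo (0 : ℝ) 1) (h₁ : H₁ ∈ Ioo (0 : ℝ) 1) {ε : ℝ} (hε : 0 < ε) :
    ∃ C : Ω → ℝ, Measurable C ∧ (∀ ω, 0 ≤ C ω) ∧ ∀ κ, ∀ᵐ ω ∂P, ∀ n : ℕ,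
      ∀ k ∈ Finset.Ico (0 : ℤ) (2 ^ n),
      ∀ l ∈ Finset.Ico (-2 ^ (2 * n + 1) : ℤ) (2 ^ (2 * n + 1)),
        |rectIncr n (smoothSheet W H₀ H₁ κ n ω) k l|
          ≤ C ω * (2 : ℝ) ^ (-(n * (H₀ + H₁ - ε))) := by
  -- The maximal inequality requires q ≥ 4. In addition qε ≥ 4 yields a decay 16^{-n}, which is
  -- summable against the 4 · 8^n cells of level n.
  set q : ℝ := 4 + 4 / ε with hqdef
  have hq : 4 ≤ q := by have : 0 < 4 / ε := by positivity
                        linarith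
  have hq0 : 0 < q := by linarith
  have hqε : 4 ≤ q * ε := by
    rw [hqdef, add_mul, div_mul_cancel₀ _ hε.ne']; nlinarith
  choose Y hY hdom hmom using hW.exists_dominating_rectIncr (H₀ := H₀) (H₁ := H₁) h₀ h₁ hq
  set w : ℕ → ℝ≥0∞ := fun n => ENNReal.ofReal ((2 : ℝ) ^ (n * (H₀ + H₁ - ε))) with hw
  set T : Ω → ℝ≥0∞ := fun ω => ∑' n : ℕ, ∑ k ∈ Finset.Ico (0 : ℤ) (2 ^ n),
    ∑ l ∈ Finset.Ico (-2 ^ (2 * n + 1) : ℤ) (2 ^ (2 * n + 1)), (w n * Y n k l ω) ^ q with hT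
  have hTm : Measurable T := by
    refine Measurable.tsum fun n => ?_
    refine Finset.measurable_fun_sum _ fun k _ => Finset.measurable_fun_sum _ fun l _ => ?_
    exact ((hY n k l).const_mul _).pow_const q
  have hTint : ∫⁻ ω, T ω ∂P ≠ ∞ := by
    rw [hT, lintegral_tsum]
    swap
    · intro n
      refine (Finset.measurable_fun_sum _ fun k _ => Finset.measurable_fun_sum _ fun l _ =>
        ?_).aemeasurable
      exact ((hY n k l).const_mul _).pow_const q
    have hterm : ∀ n : ℕ, ∫⁻ ω, ∑ k ∈ Finset.Ico (0 : ℤ) (2 ^ n),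
        ∑ l ∈ Finset.Ico (-2 ^ (2 * n + 1) : ℤ) (2 ^ (2 * n + 1)), (w n * Y n k l ω) ^ q ∂P
        ≤ (4 * momentConst H₀ H₁ q ^ q) * (2⁻¹ : ℝ≥0∞) ^ n := by
      intro n
      rw [lintegral_finsetSum _ fun k _ => Finset.measurable_fun_sum _ fun l _ =>
        ((hY n k l).const_mul _).pow_const q]
      have h3 : ∀ k l, ∫⁻ ω, (w n * Y n k l ω) ^ q ∂P
          ≤ momentConst H₀ H₁ q ^ q * ENNReal.ofReal ((2 : ℝ) ^ (-(4 * n : ℝ))) := by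
        intro k l
        simp_rw [ENNReal.mul_rpow_of_nonneg _ _ hq0.le]
        rw [lintegral_const_mul _ ((hY n k l).pow_const q)]
        calc _ ≤ w n ^ q * (momentConst H₀ H₁ q
              * ENNReal.ofReal ((2 : ℝ) ^ (-(n * (H₀ + H₁))))) ^ q := by
              gcongr; exact hmom n k l
          _ = momentConst H₀ H₁ q ^ q * ENNReal.ofReal ((2 : ℝ) ^ (-(n * (ε * q)))) := by
              rw [ENNReal.mul_rpow_of_nonneg _ _ hq0.le, mul_left_comm,
                ← ENNReal.mul_rpow_of_nonneg _ _ hq0.le, hw,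
                ← ENNReal.ofReal_mul (by positivity), ← Real.rpow_add (by norm_num),
                ENNReal.ofReal_rpow_of_pos (by positivity), ← Real.rpow_mul (by norm_num)]
              congr 3
              ring
          _ ≤ _ := by
              refine mul_le_mul_right (ENNReal.ofReal_le_ofReal
                (Real.rpow_le_rpow_of_exponent_le (by norm_num) ?_)) _
              nlinarith [(Nat.cast_nonneg n : (0 : ℝ) ≤ n)]
      calc _ ≤ ∑ k ∈ Finset.Ico (0 : ℤ) (2 ^ n),
          ∑ l ∈ Finset.Ico (-2 ^ (2 * n + 1) : ℤ) (2 ^ (2 * n + 1)),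
            momentConst H₀ H₁ q ^ q * ENNReal.ofReal ((2 : ℝ) ^ (-(4 * n : ℝ))) := by
            gcongr with k _
            rw [lintegral_finsetSum _ fun l _ => ((hY n k l).const_mul _).pow_const q]
            gcongr with l _
            exact h3 k l
        _ = _ := by
            simp only [Finset.sum_const, Int.card_Ico, nsmul_eq_mul]
            have c1 : ((2 : ℤ) ^ n - 0).toNat = 2 ^ n := by
              rw [sub_zero]; exact_mod_cast Int.toNat_natCast (2 ^ n)
            have c2 : ((2 : ℤ) ^ (2 * n + 1) - -2 ^ (2 * n + 1)).toNat = 4 * 4 ^ n := by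
              have : (2 : ℤ) ^ (2 * n + 1) - -2 ^ (2 * n + 1) = ((4 * 4 ^ n : ℕ) : ℤ) := by
                push_cast; rw [pow_succ, pow_mul]; norm_num; ring
              rw [this, Int.toNat_natCast]
            rw [c1, c2]
            have c3 : ENNReal.ofReal ((2 : ℝ) ^ (-(4 * n : ℝ))) = (16⁻¹ : ℝ≥0∞) ^ n := by
              rw [Real.rpow_neg (by norm_num), Real.rpow_mul (by norm_num), Real.rpow_natCast,
                ← inv_pow, ENNReal.ofReal_pow (by positivity), ENNReal.ofReal_inv_of_pos (by positivity)]
              norm_num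
            have c4 : (2⁻¹ : ℝ≥0∞) ^ n = 8 ^ n * (16⁻¹) ^ n := by
              rw [← mul_pow]
              congr 1
              rw [show (16 : ℝ≥0∞) = 8 * 2 by norm_num, ENNReal.mul_inv (by simp) (by simp),
                ← mul_assoc, ENNReal.mul_inv_cancel (by simp) (by simp), one_mul]
            rw [c3, c4, show (8 : ℝ≥0∞) = 2 * 4 by norm_num, mul_pow]
            push_cast
            ring
    refine ne_top_of_le_ne_top ?_ (ENNReal.tsum_le_tsum hterm)
    rw [ENNReal.tsum_mul_left]
    refine ENNReal.mul_ne_top (ENNReal.mul_ne_top (by simp)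
      (ENNReal.rpow_ne_top_of_nonneg hq0.le (momentConst_ne_top _ _ hq0))) ?_
    rw [ENNReal.tsum_geometric]
    simp
  -- `T` is built from the dominating variables only, so the random constant does not depend on κ;
  -- only the null set on which domination fails does.
  refine ⟨fun ω => (T ω ^ (1 / q)).toReal, (hTm.pow_const _).ennreal_toReal,
    fun ω => ENNReal.toReal_nonneg, fun κ => ?_⟩
  have hall : ∀ᵐ ω ∂P, ∀ n k l, ‖rectIncr n (smoothSheet W H₀ H₁ κ n ω) k l‖ₑ ≤ Y n k l ω := by
    simp only [ae_all_iff]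
    exact fun n k l => hdom n k l κ
  filter_upwards [hall, ae_lt_top hTm hTint] with ω h1 h2 n k hk l hl
  have h3 : w n * Y n k l ω ≤ T ω ^ (1 / q) := by
    rw [one_div, ENNReal.le_rpow_inv_iff hq0]
    calc (w n * Y n k l ω) ^ q ≤ ∑ l ∈ Finset.Ico (-2 ^ (2 * n + 1) : ℤ) (2 ^ (2 * n + 1)),
          (w n * Y n k l ω) ^ q :=
          Finset.single_le_sum_of_canonicallyOrdered (f := fun l => (w n * Y n k l ω) ^ q) hl
      _ ≤ ∑ k ∈ Finset.Ico (0 : ℤ) (2 ^ n),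
          ∑ l ∈ Finset.Ico (-2 ^ (2 * n + 1) : ℤ) (2 ^ (2 * n + 1)), (w n * Y n k l ω) ^ q :=
          Finset.single_le_sum_of_canonicallyOrdered
            (f := fun k => ∑ l ∈ Finset.Ico (-2 ^ (2 * n + 1) : ℤ) (2 ^ (2 * n + 1)),
              (w n * Y n k l ω) ^ q) hk
      _ ≤ T ω := ENNReal.le_tsum n
  have h4 : ENNReal.ofReal ((2 : ℝ) ^ (n * (H₀ + H₁ - ε))
      * |rectIncr n (smoothSheet W H₀ H₁ κ n ω) k l|) ≤ T ω ^ (1 / q) := by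
    rw [ENNReal.ofReal_mul (by positivity)]
    refine le_trans ?_ h3
    gcongr
    rw [← Real.norm_eq_abs, ofReal_norm]
    exact h1 n k l
  have h5 := (ENNReal.ofReal_le_iff_le_toReal
    (ENNReal.rpow_ne_top_of_nonneg (by positivity) h2.ne)).1 h4
  rw [Real.rpow_neg (by norm_num), ← div_eq_mul_inv, le_div_iff₀ (by positivity), mul_comm]
  exact h5

end Sheet

open Filter Topology

/-! ### Explicit solutions of the heat equation with piecewise constant data -/

theorem heatKernel_of_pos {r : ℝ} (hr : 0 < r) (z : ℝ) :
    heatKernel r z = 1 / √(4 * Real.pi * r) * Real.exp (-z ^ 2 / (4 * r)) := if_pos hr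

theorem heatKernel_of_nonpos {r : ℝ} (hr : r ≤ 0) (z : ℝ) : heatKernel r z = 0 :=
  if_neg (not_lt.2 hr)

theorem heatKernel_nonneg (r z : ℝ) : 0 ≤ heatKernel r z := by
  unfold heatKernel; split_ifs <;> positivity

theorem heatKernel_neg (r z : ℝ) : heatKernel r (-z) = heatKernel r z := by simp [heatKernel]

theorem continuous_heatKernel (r : ℝ) : Continuous (heatKernel r) := by
  unfold heatKernel; split_ifs <;> fun_prop

theorem measurable_heatKernel : Measurable (fun p : ℝ × ℝ => heatKernel p.1 p.2) := by
  unfold heatKernel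
  exact Measurable.ite (measurableSet_lt measurable_const measurable_fst) (by fun_prop)
    measurable_const

theorem heatKernel_eq_gaussianPDFReal {r : ℝ} (hr : 0 < r) (z : ℝ) :
    heatKernel r z = gaussianPDFReal 0 (2 * r).toNNReal z := by
  rw [heatKernel_of_pos hr, gaussianPDFReal, Real.coe_toNNReal _ (by positivity), sub_zero, one_div]
  ring_nf

theorem integrable_heatKernel (r : ℝ) : Integrable (heatKernel r) := by
  by_cases hr : 0 < r
  · rw [funext (heatKernel_eq_gaussianPDFReal hr)]
    exact integrable_gaussianPDFReal _ _
  · rw [funext (heatKernel_of_nonpos (not_lt.1 hr))]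
    exact integrable_zero _ _ _

theorem integral_heatKernel {r : ℝ} (hr : 0 < r) : ∫ z, heatKernel r z = 1 := by
  simp_rw [heatKernel_eq_gaussianPDFReal hr]
  exact integral_gaussianPDFReal_eq_one _ (by simpa using hr)

theorem heatKernel_scaling {r : ℝ} (hr : 0 < r) (z : ℝ) :
    heatKernel r z = heatKernel 1 (z / √r) / √r := by
  rw [heatKernel_of_pos hr, heatKernel_of_pos one_pos, div_pow, Real.sq_sqrt hr.le,
    Real.sqrt_mul (by positivity), mul_one]
  field_simp

theorem mul_heatKernel_le {r : ℝ} (hr : 0 < r) (z : ℝ) : r * heatKernel r z ≤ √r := by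
  rw [heatKernel_of_pos hr]
  have h1 : Real.exp (-z ^ 2 / (4 * r)) ≤ 1 := by
    rw [Real.exp_le_one_iff, neg_div]
    have : 0 ≤ z ^ 2 / (4 * r) := by positivity
    linarith
  have h2 : √r ≤ √(4 * Real.pi * r) := by
    apply Real.sqrt_le_sqrt
    nlinarith [Real.pi_gt_three]
  have h3 : 0 < √r := Real.sqrt_pos.2 hr
  calc r * (1 / √(4 * Real.pi * r) * Real.exp (-z ^ 2 / (4 * r)))
      ≤ r * (1 / √r * 1) := by gcongr
    _ = √r := by
      rw [mul_one, mul_one_div, Real.div_sqrt]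

/-- The primitive of the heat kernel at time `1`. -/
def gaussPrim (a : ℝ) : ℝ := ∫ y in (0 : ℝ)..a, heatKernel 1 y

theorem hasDerivAt_gaussPrim (a : ℝ) : HasDerivAt gaussPrim (heatKernel 1 a) a :=
  (continuous_heatKernel 1).integral_hasStrictDerivAt 0 a |>.hasDerivAt

theorem continuous_gaussPrim : Continuous gaussPrim :=
  continuous_iff_continuousAt.2 fun a => (hasDerivAt_gaussPrim a).continuousAt

theorem gaussPrim_neg (a : ℝ) : gaussPrim (-a) = -gaussPrim a := by
  unfold gaussPrim
  have := intervalIntegral.integral_comp_neg (a := 0) (b := a) (heatKernel 1)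
  simp only [heatKernel_neg, neg_zero] at this
  rw [this, intervalIntegral.integral_symm]

theorem gaussPrim_mono : Monotone gaussPrim :=
  monotone_of_deriv_nonneg (fun a => (hasDerivAt_gaussPrim a).differentiableAt)
    fun a => by rw [(hasDerivAt_gaussPrim a).deriv]; exact heatKernel_nonneg _ _

theorem tendsto_gaussPrim_atTop : Tendsto gaussPrim atTop (𝓝 (1 / 2)) := by
  have h1 : Tendsto gaussPrim atTop (𝓝 (∫ y in Ioi (0 : ℝ), heatKernel 1 y)) :=
    intervalIntegral_tendsto_integral_Ioi 0 (integrable_heatKernel 1).integrableOn tendsto_id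
  have h2 : ∫ y in Ioi (0 : ℝ), heatKernel 1 y = 1 / 2 := by
    have h3 := integral_comp_abs (f := heatKernel 1)
    have h4 : ∀ x, heatKernel 1 |x| = heatKernel 1 x := by intro x; simp [heatKernel]
    simp_rw [h4] at h3
    rw [integral_heatKernel one_pos] at h3
    linarith
  rwa [h2] at h1

theorem tendsto_gaussPrim_atBot : Tendsto gaussPrim atBot (𝓝 (-(1 / 2))) := by
  have := (tendsto_gaussPrim_atTop.comp tendsto_neg_atBot_atTop).neg
  refine this.congr fun a => ?_
  simp [gaussPrim_neg]

theorem abs_gaussPrim_le (a : ℝ) : |gaussPrim a| ≤ 1 / 2 :=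
  abs_le.2 ⟨gaussPrim_mono.le_of_tendsto tendsto_gaussPrim_atBot a,
    gaussPrim_mono.ge_of_tendsto tendsto_gaussPrim_atTop a⟩

/-- The solution of the heat equation started from `sign / 2`. -/
def heatSign (r z : ℝ) : ℝ := if 0 < r then gaussPrim (z / √r) else 0

theorem heatSign_of_pos {r : ℝ} (hr : 0 < r) (z : ℝ) : heatSign r z = gaussPrim (z / √r) :=
  if_pos hr

theorem heatSign_of_nonpos {r : ℝ} (hr : r ≤ 0) (z : ℝ) : heatSign r z = 0 := if_neg (not_lt.2 hr)

theorem abs_heatSign_le (r z : ℝ) : |heatSign r z| ≤ 1 / 2 := by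
  unfold heatSign; split_ifs
  · exact abs_gaussPrim_le _
  · simp

theorem measurable_heatSign : Measurable (fun p : ℝ × ℝ => heatSign p.1 p.2) := by
  unfold heatSign
  have := continuous_gaussPrim.measurable
  exact Measurable.ite (measurableSet_lt measurable_const measurable_fst) (by fun_prop)
    measurable_const

theorem hasDerivAt_heatSign_space {r : ℝ} (hr : 0 < r) (z : ℝ) :
    HasDerivAt (heatSign r) (heatKernel r z) z := by
  rw [funext (heatSign_of_pos hr), heatKernel_scaling hr]
  have h := (hasDerivAt_gaussPrim (z / √r)).comp z ((hasDerivAt_id z).div_const (√r))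
  exact h.congr_deriv (by simp [div_eq_mul_inv])

theorem hasDerivAt_heatKernel_space {r : ℝ} (hr : 0 < r) (z : ℝ) :
    HasDerivAt (heatKernel r) (-z / (2 * r) * heatKernel r z) z := by
  rw [funext (heatKernel_of_pos hr)]
  have h := (((hasDerivAt_pow 2 z).neg.div_const (4 * r)).exp).const_mul (1 / √(4 * Real.pi * r))
  refine h.congr_deriv ?_
  simp only [Nat.cast_ofNat, Pi.neg_apply]
  field_simp
  norm_num

theorem hasDerivAt_inv_sqrt {r : ℝ} (hr : 0 < r) :
    HasDerivAt (fun r : ℝ => (√r)⁻¹) (-(√r)⁻¹ / (2 * r)) r := by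
  have h := (Real.hasDerivAt_sqrt hr.ne').inv (Real.sqrt_pos.2 hr).ne'
  refine h.congr_deriv ?_
  have := Real.sqrt_pos.2 hr
  rw [Real.sq_sqrt hr.le]
  field_simp

/-- The value is the space derivative of the heat kernel, which is itself the space derivative of
`heatSign`: this is the heat equation for `heatSign`. -/
theorem hasDerivAt_heatSign_time {r : ℝ} (hr : 0 < r) (z : ℝ) :
    HasDerivAt (fun r => heatSign r z) (-z / (2 * r) * heatKernel r z) r := by
  have h := (hasDerivAt_gaussPrim (z / √r)).comp r
    ((hasDerivAt_inv_sqrt hr).const_mul z |>.congr_of_eventuallyEq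
      (Eventually.of_forall fun r => div_eq_mul_inv z (√r)))
  rw [heatKernel_scaling hr]
  refine (h.congr_deriv ?_).congr_of_eventuallyEq ?_
  · ring
  · filter_upwards [lt_mem_nhds hr] with s hs
    exact heatSign_of_pos hs z

theorem hasDerivAt_heatKernel_time {r : ℝ} (hr : 0 < r) (z : ℝ) :
    HasDerivAt (fun r => heatKernel r z)
      ((z ^ 2 / (4 * r ^ 2) - 1 / (2 * r)) * heatKernel r z) r := by
  have h1 : HasDerivAt (fun r : ℝ => 1 / √(4 * Real.pi) * (√r)⁻¹)
      (1 / √(4 * Real.pi) * (-(√r)⁻¹ / (2 * r))) r := (hasDerivAt_inv_sqrt hr).const_mul _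
  have h2 : HasDerivAt (fun r : ℝ => Real.exp (-z ^ 2 / 4 * r⁻¹))
      (Real.exp (-z ^ 2 / 4 * r⁻¹) * (-z ^ 2 / 4 * (-(r ^ 2)⁻¹))) r :=
    ((hasDerivAt_inv hr.ne').const_mul (-z ^ 2 / 4)).exp
  have e : ∀ s : ℝ, 0 < s → heatKernel s z
      = 1 / √(4 * Real.pi) * (√s)⁻¹ * Real.exp (-z ^ 2 / 4 * s⁻¹) := by
    intro s hs
    rw [heatKernel_of_pos hs, Real.sqrt_mul (by positivity)]
    congr 1
    · field_simp
    · congr 1; field_simp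
  refine ((h1.mul h2).congr_deriv ?_).congr_of_eventuallyEq ?_
  · rw [e r hr]
    field_simp
    ring
  · filter_upwards [lt_mem_nhds hr] with s hs
    exact e s hs

/-- The solution of the heat equation forced by `sign / 2`, started from `0`. -/
def heatStep (r z : ℝ) : ℝ :=
  if 0 < r then (r + z ^ 2 / 2) * heatSign r z + z * r * heatKernel r z - z * |z| / 4 else 0

/-- The space derivative of `heatStep`. -/
def heatStepX (r z : ℝ) : ℝ :=
  if 0 < r then z * heatSign r z + 2 * r * heatKernel r z - |z| / 2 else 0

/-- The second space derivative of `heatStep`. -/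
def heatStepXX (r z : ℝ) : ℝ :=
  if 0 < r then heatSign r z - (SignType.sign z : ℝ) / 2 else 0

/-- The correction z|z|/4 in `heatStep` is continuously differentiable across the origin, so only
the second space derivative of the solution jumps there. -/
theorem hasDerivAt_mul_abs (z : ℝ) : HasDerivAt (fun z : ℝ => z * |z|) (2 * |z|) z := by
  rcases eq_or_ne z 0 with rfl | hz
  · rw [hasDerivAt_iff_tendsto_slope_zero]
    have h : Tendsto (fun t : ℝ => |t|) (𝓝[≠] 0) (𝓝 (2 * |0|)) := by
      simpa using (continuous_abs.tendsto (0 : ℝ)).mono_left nhdsWithin_le_nhds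
    refine h.congr' ?_
    filter_upwards [self_mem_nhdsWithin] with t ht
    have : t ≠ 0 := ht
    simp [this]
  · refine ((hasDerivAt_id z).mul (hasDerivAt_abs hz)).congr_deriv ?_
    simp only [id]
    rw [mul_comm z, sign_mul_self]; ring

theorem hasDerivAt_heatStep_space (r z : ℝ) : HasDerivAt (heatStep r) (heatStepX r z) z := by
  by_cases hr : 0 < r
  · have h := (((((hasDerivAt_pow 2 z).div_const 2).const_add r).mul
      (hasDerivAt_heatSign_space hr z)).add (((hasDerivAt_id z).mul_const r).mul
      (hasDerivAt_heatKernel_space hr z))).sub ((hasDerivAt_mul_abs z).div_const 4)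
    refine (h.congr_deriv ?_).congr_of_eventuallyEq (Eventually.of_forall fun x => ?_)
    · simp only [heatStepX, if_pos hr, id]
      field_simp
      push_cast
      ring
    · simp [heatStep, hr]
  · have : heatStep r = fun _ => 0 := by ext; simp [heatStep, hr]
    rw [this]
    simpa [heatStepX, hr] using hasDerivAt_const z (0 : ℝ)

theorem hasDerivAt_heatStepX_space (r : ℝ) {z : ℝ} (hz : z ≠ 0) :
    HasDerivAt (heatStepX r) (heatStepXX r z) z := by
  by_cases hr : 0 < r
  · have h := (((hasDerivAt_id z).mul (hasDerivAt_heatSign_space hr z)).add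
      ((hasDerivAt_heatKernel_space hr z).const_mul (2 * r))).sub ((hasDerivAt_abs hz).div_const 2)
    refine (h.congr_deriv ?_).congr_of_eventuallyEq (Eventually.of_forall fun x => ?_)
    · simp only [heatStepXX, if_pos hr, id]
      field_simp
      ring
    · simp [heatStepX, hr]
  · have : heatStepX r = fun _ => 0 := by ext; simp [heatStepX, hr]
    rw [this]
    simpa [heatStepXX, hr] using hasDerivAt_const z (0 : ℝ)

theorem continuous_heatSign {r : ℝ} (hr : 0 < r) : Continuous (heatSign r) :=
  continuous_iff_continuousAt.2 fun z => (hasDerivAt_heatSign_space hr z).continuousAt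

theorem continuous_heatStepX (r : ℝ) : Continuous (heatStepX r) := by
  by_cases hr : 0 < r
  · have h1 := continuous_heatSign hr
    have h2 := continuous_heatKernel r
    have : heatStepX r = fun z => z * heatSign r z + 2 * r * heatKernel r z - |z| / 2 := by
      ext; simp [heatStepX, hr]
    rw [this]; fun_prop
  · have : heatStepX r = fun _ => 0 := by ext; simp [heatStepX, hr]
    rw [this]; fun_prop

/-- The terms of the product rule cancel down to `heatSign`. Time 0 is excluded: the forcing is
switched on there, and the one-sided derivatives differ unless z = 0. -/
theorem hasDerivAt_heatStep_time {r : ℝ} (hr : r ≠ 0) (z : ℝ) :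
    HasDerivAt (fun r => heatStep r z) (heatSign r z) r := by
  rcases lt_or_gt_of_ne hr with hr | hr
  · rw [heatSign_of_nonpos hr.le]
    refine (hasDerivAt_const r (0 : ℝ)).congr_of_eventuallyEq ?_
    filter_upwards [gt_mem_nhds hr] with s hs
    simp [heatStep, hs.le]
  · have h := ((((hasDerivAt_id r).add_const (z ^ 2 / 2)).mul
      (hasDerivAt_heatSign_time hr z)).add (((hasDerivAt_id r).const_mul z).mul
      (hasDerivAt_heatKernel_time hr z))).sub_const (z * |z| / 4)
    refine (h.congr_deriv ?_).congr_of_eventuallyEq ?_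
    · simp only [id]
      field_simp
      ring
    · filter_upwards [lt_mem_nhds hr] with s hs
      simp [heatStep, hs]

theorem tendsto_heatSign_zero {z : ℝ} (hz : z ≠ 0) :
    Tendsto (fun r => heatSign r z) (𝓝[>] 0) (𝓝 ((SignType.sign z : ℝ) / 2)) := by
  have h0 : Tendsto (fun r : ℝ => (√r)⁻¹) (𝓝[>] 0) atTop := by
    apply Tendsto.comp tendsto_inv_nhdsGT_zero
    refine tendsto_nhdsWithin_iff.2 ⟨?_, ?_⟩
    · have := (Real.continuous_sqrt.tendsto 0).mono_left (nhdsWithin_le_nhds (s := Ioi 0))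
      simpa using this
    · filter_upwards [self_mem_nhdsWithin] with r hr
      exact Real.sqrt_pos.2 hr
  have key : Tendsto (fun r : ℝ => gaussPrim (z * (√r)⁻¹)) (𝓝[>] 0)
      (𝓝 ((SignType.sign z : ℝ) / 2)) := by
    rcases lt_or_gt_of_ne hz with h | h
    · rw [sign_neg h]
      have := tendsto_gaussPrim_atBot.comp (h0.const_mul_atTop_of_neg h)
      simpa [neg_div, Function.comp_def] using this
    · rw [sign_pos h]
      have := tendsto_gaussPrim_atTop.comp (h0.const_mul_atTop h)
      simpa [Function.comp_def] using this
  refine key.congr' ?_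
  filter_upwards [self_mem_nhdsWithin] with r hr
  rw [heatSign_of_pos hr, div_eq_mul_inv]

/-- Only time 0 needs an argument. As r decreases to 0 the term (z²/2) · sign(z)/2 survives and is
cancelled exactly by z|z|/4; this is the purpose of that correction. -/
theorem continuous_heatStep_time (z : ℝ) : Continuous (fun r => heatStep r z) := by
  refine continuous_iff_continuousAt.2 fun r => ?_
  rcases eq_or_ne r 0 with rfl | hr
  swap
  · exact (hasDerivAt_heatStep_time hr z).continuousAt
  have h0 : heatStep 0 z = 0 := by simp [heatStep]
  rw [continuousAt_iff_continuous_left'_right']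
  constructor
  · rw [ContinuousWithinAt, h0]
    refine (tendsto_const_nhds (x := (0 : ℝ))).congr' ?_
    filter_upwards [self_mem_nhdsWithin] with s hs
    have : ¬ 0 < s := not_lt.2 (le_of_lt hs)
    simp [heatStep, this]
  · rw [ContinuousWithinAt, h0]
    rcases eq_or_ne z 0 with rfl | hz
    · refine (tendsto_const_nhds (x := (0 : ℝ))).congr' ?_
      filter_upwards [self_mem_nhdsWithin] with s hs
      have hs' : (0 : ℝ) < s := hs
      have : gaussPrim 0 = 0 := by simp [gaussPrim]
      simp [heatStep, heatSign, hs', this]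
    · have hid : Tendsto (fun r : ℝ => r) (𝓝[>] 0) (𝓝 0) := nhdsWithin_le_nhds
      have hG : Tendsto (fun r => r * heatKernel r z) (𝓝[>] 0) (𝓝 0) := by
        refine squeeze_zero' (g := fun r => √r) ?_ ?_ ?_
        · filter_upwards [self_mem_nhdsWithin] with r hr
          exact mul_nonneg (le_of_lt hr) (heatKernel_nonneg _ _)
        · filter_upwards [self_mem_nhdsWithin] with r hr
          exact mul_heatKernel_le hr z
        · simpa using (Real.continuous_sqrt.tendsto 0).mono_left (nhdsWithin_le_nhds (s := Ioi 0))
      have := (((hid.add_const (z ^ 2 / 2)).mul (tendsto_heatSign_zero hz)).add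
        (hG.const_mul z)).sub_const (z * |z| / 4)
      have e : (0 + z ^ 2 / 2) * ((SignType.sign z : ℝ) / 2) + z * 0 - z * |z| / 4 = 0 := by
        have : z * (SignType.sign z : ℝ) = |z| := by rw [mul_comm]; exact sign_mul_self z
        rw [← this]; ring
      rw [e] at this
      refine this.congr' ?_
      filter_upwards [self_mem_nhdsWithin] with r hr
      have hr' : (0 : ℝ) < r := hr
      simp only [heatStep, if_pos hr']
      ring

theorem abs_heatStep_le {r z : ℝ} (hr : r ≤ 1) : |heatStep r z| ≤ 1 + z ^ 2 + |z| := by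
  unfold heatStep
  split_ifs with h
  · have h1 := abs_heatSign_le r z
    have h2 := mul_heatKernel_le h z
    have h3 : √r ≤ 1 := Real.sqrt_le_one.2 hr
    have h4 := heatKernel_nonneg r z
    have e1 : |(r + z ^ 2 / 2) * heatSign r z| ≤ (1 + z ^ 2 / 2) * (1 / 2) := by
      rw [abs_mul, abs_of_nonneg (by positivity : 0 ≤ r + z ^ 2 / 2)]
      gcongr
    have e2 : |z * r * heatKernel r z| ≤ |z| := by
      rw [mul_assoc, abs_mul, abs_of_nonneg (by positivity : 0 ≤ r * heatKernel r z)]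
      nlinarith [abs_nonneg z]
    have e3 : |z * |z| / 4| = z ^ 2 / 4 := by
      rw [abs_div, abs_mul, abs_abs, ← sq, sq_abs]; norm_num
    calc _ ≤ |(r + z ^ 2 / 2) * heatSign r z| + |z * r * heatKernel r z| + |z * |z| / 4| := by
          refine (abs_sub _ _).trans ?_
          gcongr
          exact abs_add_le _ _
      _ ≤ _ := by rw [e3]; nlinarith
  · simp; positivity

theorem abs_heatStepX_le {r z : ℝ} (hr : r ≤ 1) : |heatStepX r z| ≤ 2 + |z| := by
  unfold heatStepX
  split_ifs with h
  · have h1 := abs_heatSign_le r z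
    have h2 := mul_heatKernel_le h z
    have h3 : √r ≤ 1 := Real.sqrt_le_one.2 hr
    have h4 := heatKernel_nonneg r z
    have e1 : |z * heatSign r z| ≤ |z| * (1 / 2) := by
      rw [abs_mul]; gcongr
    have e2 : |2 * r * heatKernel r z| ≤ 2 := by
      rw [abs_of_nonneg (by positivity)]; nlinarith
    have e3 : |(|z| / 2)| = |z| / 2 := abs_of_nonneg (by positivity)
    calc _ ≤ |z * heatSign r z| + |2 * r * heatKernel r z| + |(|z| / 2)| := by
          refine (abs_sub _ _).trans ?_
          gcongr
          exact abs_add_le _ _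
      _ ≤ _ := by rw [e3]; nlinarith
  · simp; positivity

theorem abs_heatStepXX_le (r z : ℝ) : |heatStepXX r z| ≤ 1 := by
  unfold heatStepXX
  split_ifs with h
  · have h1 := abs_heatSign_le r z
    have h2 : |(SignType.sign z : ℝ) / 2| ≤ 1 / 2 := by
      rcases lt_trichotomy z 0 with h | rfl | h
      · simp [sign_neg h, abs_div]
      · simp
      · simp [sign_pos h]
    refine (abs_sub _ _).trans ?_
    linarith
  · simp

theorem measurable_heatStep : Measurable (fun p : ℝ × ℝ => heatStep p.1 p.2) := by
  have h1 := measurable_heatSign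
  have h2 := measurable_heatKernel
  unfold heatStep
  exact Measurable.ite (measurableSet_lt measurable_const measurable_fst) (by fun_prop)
    measurable_const

theorem measurable_heatStepX : Measurable (fun p : ℝ × ℝ => heatStepX p.1 p.2) := by
  have h1 := measurable_heatSign
  have h2 := measurable_heatKernel
  unfold heatStepX
  exact Measurable.ite (measurableSet_lt measurable_const measurable_fst) (by fun_prop)
    measurable_const

theorem measurable_sign_real : Measurable (fun z : ℝ => (SignType.sign z : ℝ)) := by
  have : (fun z : ℝ => (SignType.sign z : ℝ))
      = fun z => if 0 < z then 1 else if z < 0 then -1 else 0 := by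
    ext z
    rcases lt_trichotomy z 0 with h | rfl | h
    · simp [h, not_lt.2 h.le]
    · simp
    · simp [h]
  rw [this]
  exact Measurable.ite measurableSet_Ioi measurable_const
    (Measurable.ite measurableSet_Iio measurable_const measurable_const)

theorem measurable_heatStepXX : Measurable (fun p : ℝ × ℝ => heatStepXX p.1 p.2) := by
  have h1 := measurable_heatSign
  have h2 := measurable_sign_real
  unfold heatStepXX
  exact Measurable.ite (measurableSet_lt measurable_const measurable_fst)
    (h1.sub ((h2.comp measurable_snd).div_const 2)) measurable_const

/-- The heat kernel integrated over an interval. -/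
theorem integral_heatKernel_sub (r x c d : ℝ) :
    ∫ y in c..d, heatKernel r (x - y) = heatSign r (x - c) - heatSign r (x - d) := by
  by_cases hr : 0 < r
  · rw [intervalIntegral.integral_comp_sub_left (heatKernel r),
      intervalIntegral.integral_eq_sub_of_hasDerivAt
        (fun z _ => hasDerivAt_heatSign_space hr z)
        ((continuous_heatKernel r).intervalIntegrable _ _)]
  · simp [heatKernel_of_nonpos (not_lt.1 hr), heatSign_of_nonpos (not_lt.1 hr)]

/-- Duhamel's integral of `heatSign`. -/
theorem integral_heatSign_sub (t z τ τ' : ℝ) :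
    ∫ s in τ..τ', heatSign (t - s) z = heatStep (t - τ) z - heatStep (t - τ') z := by
  have hm : Measurable fun s => heatSign (t - s) z :=
    measurable_heatSign.comp ((measurable_const.sub measurable_id).prodMk measurable_const)
  have h := integral_eq_of_hasDerivAt_off_countable (a := τ) (b := τ')
    (fun s => -heatStep (t - s) z) (fun s => heatSign (t - s) z) (countable_singleton t)
    (((continuous_heatStep_time z).comp (continuous_const.sub continuous_id)).neg.continuousOn)
    (fun s hs => by
      have hs' : t - s ≠ 0 := fun h => hs.2 (by simp; linarith)
      have := ((hasDerivAt_heatStep_time hs' z).comp s ((hasDerivAt_id s).const_sub t)).fun_neg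
      simpa [Function.comp_def] using this)
    (by
      refine (intervalIntegrable_const (c := (1 / 2 : ℝ))).mono_fun
        hm.aestronglyMeasurable.restrict (Eventually.of_forall fun s => ?_)
      simpa using abs_heatSign_le (t - s) z)
  rw [h]; ring

/-- The function equal to `a k l` on the cell `(k, l)` of the grid of `[0, 1] × [-2ⁿ, 2ⁿ]`. -/
def noiseField (n : ℕ) (a : ℤ → ℤ → ℝ) (s x : ℝ) : ℝ :=
  ∑ k ∈ Finset.Ico (0 : ℤ) (2 ^ n), ∑ l ∈ Finset.Ico (-2 ^ (2 * n) : ℤ) (2 ^ (2 * n)),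
    a k l * (Ico ((k : ℝ) / 2 ^ n) ((k + 1) / 2 ^ n)).indicator 1 s
      * (Ico ((l : ℝ) / 2 ^ n) ((l + 1) / 2 ^ n)).indicator 1 x

/-- The sum over all cells of the rectangular increments of a kernel, with coefficients `a`. -/
def cellSum (n : ℕ) (a : ℤ → ℤ → ℝ) (K : ℝ → ℝ → ℝ) (t x : ℝ) : ℝ :=
  ∑ k ∈ Finset.Ico (0 : ℤ) (2 ^ n), ∑ l ∈ Finset.Ico (-2 ^ (2 * n) : ℤ) (2 ^ (2 * n)),
    a k l * (K (t - k / 2 ^ n) (x - l / 2 ^ n) - K (t - (k + 1) / 2 ^ n) (x - l / 2 ^ n)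
      - (K (t - k / 2 ^ n) (x - (l + 1) / 2 ^ n) - K (t - (k + 1) / 2 ^ n) (x - (l + 1) / 2 ^ n)))

/-- Causality lets the Duhamel integral over [0, t] be replaced by one over a full time cell,
whatever the position of t relative to the cell. One formula then covers all times. -/
theorem integral_indicator_mul_causal {q : ℝ → ℝ} {t τ τ' : ℝ} (hτ : 0 ≤ τ) (hττ : τ ≤ τ')
    (hq : ∀ s, t ≤ s → q s = 0) :
    ∫ s in (0 : ℝ)..t, (Ico τ τ').indicator 1 s * q s = ∫ s in τ..τ', q s := by
  rw [intervalIntegral.integral_of_le hττ, ← integral_indicator measurableSet_Ioc]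
  rcases le_or_gt 0 t with ht | ht
  · rw [intervalIntegral.integral_of_le ht, ← integral_indicator measurableSet_Ioc]
    apply integral_congr_ae
    have h1 : ∀ᵐ s : ℝ, s ≠ τ := by simp [ae_iff]
    have h2 : ∀ᵐ s : ℝ, s ≠ τ' := by simp [ae_iff]
    filter_upwards [h1, h2] with s hs hs'
    by_cases hst : t ≤ s
    · simp [indicator, hq s hst]
    · push Not at hst
      simp only [indicator, mem_Ioc, mem_Ico, Pi.one_apply]
      have e : (τ ≤ s ∧ s < τ') ↔ (τ < s ∧ s ≤ τ') :=
        ⟨fun h => ⟨lt_of_le_of_ne h.1 hs.symm, h.2.le⟩, fun h => ⟨h.1.le, lt_of_le_of_ne h.2 hs'⟩⟩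
      simp only [e]
      by_cases h : τ < s ∧ s ≤ τ'
      · have h0 : 0 < s ∧ s ≤ t := ⟨by linarith [h.1], hst.le⟩
        simp [h, h0]
      · simp [h]
  · have e1 : ∀ s ∈ uIcc 0 t, (Ico τ τ').indicator 1 s * q s = 0 := by
      intro s hs
      rw [uIcc_of_ge ht.le] at hs
      rw [hq s hs.1, mul_zero]
    rw [intervalIntegral.integral_congr (g := fun _ => 0) e1]
    have e2 : (Ioc τ τ').indicator q = fun _ => 0 := by
      ext s
      by_cases h : s ∈ Ioc τ τ'
      · simp [h, hq s (by linarith [h.1])]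
      · simp [h]
    rw [e2]; simp

theorem integral_heatKernel_mul_indicator (r x : ℝ) {c d : ℝ} (hcd : c ≤ d) :
    ∫ y, heatKernel r (x - y) * (Ico c d).indicator 1 y
      = heatSign r (x - c) - heatSign r (x - d) := by
  rw [← integral_heatKernel_sub, intervalIntegral.integral_of_le hcd,
    ← integral_Ico_eq_integral_Ioc, ← integral_indicator measurableSet_Ico]
  congr 1 with y
  by_cases h : y ∈ Ico c d <;> simp [h]

theorem integrable_heatKernel_sub (r x : ℝ) : Integrable (fun y => heatKernel r (x - y)) :=
  (integrable_heatKernel r).comp_sub_left x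

theorem integral_heatKernel_mul_noiseField (n : ℕ) (a : ℤ → ℤ → ℝ) (r s x : ℝ) :
    ∫ y, heatKernel r (x - y) * noiseField n a s y
      = ∑ k ∈ Finset.Ico (0 : ℤ) (2 ^ n), ∑ l ∈ Finset.Ico (-2 ^ (2 * n) : ℤ) (2 ^ (2 * n)),
        a k l * ((Ico ((k : ℝ) / 2 ^ n) ((k + 1) / 2 ^ n)).indicator 1 s
          * (heatSign r (x - l / 2 ^ n) - heatSign r (x - (l + 1) / 2 ^ n))) := by
  have hInt : ∀ c d : ℝ, Integrable (fun y => heatKernel r (x - y) * (Ico c d).indicator 1 y) := by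
    intro c d
    have := (integrable_heatKernel_sub r x).indicator (measurableSet_Ico (a := c) (b := d))
    refine this.congr (Eventually.of_forall fun y => ?_)
    by_cases h : y ∈ Ico c d <;> simp [h]
  simp_rw [noiseField, Finset.mul_sum]
  have e : ∀ (y : ℝ) (k l : ℤ), heatKernel r (x - y) *
      (a k l * (Ico ((k : ℝ) / 2 ^ n) ((k + 1) / 2 ^ n)).indicator 1 s
      * (Ico ((l : ℝ) / 2 ^ n) ((l + 1) / 2 ^ n)).indicator 1 y)
      = a k l * (Ico ((k : ℝ) / 2 ^ n) ((k + 1) / 2 ^ n)).indicator 1 s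
        * (heatKernel r (x - y) * (Ico ((l : ℝ) / 2 ^ n) ((l + 1) / 2 ^ n)).indicator 1 y) :=
    fun y k l => by ring
  simp_rw [e]
  rw [integral_finsetSum _ fun k _ => integrable_finsetSum _ fun l _ => (hInt _ _).const_mul _]
  refine Finset.sum_congr rfl fun k _ => ?_
  rw [integral_finsetSum _ fun l _ => (hInt _ _).const_mul _]
  refine Finset.sum_congr rfl fun l _ => ?_
  rw [integral_const_mul, integral_heatKernel_mul_indicator r x (by gcongr; linarith), mul_assoc]

/-- On each cell, integrating the kernel in space gives a difference of `heatSign`, and integrating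
that in time a difference of `heatStep`. All regularity of the solution is read off this closed
form. -/
theorem heatConv_noiseField (n : ℕ) (a : ℤ → ℤ → ℝ) (t x : ℝ) :
    heatConv (noiseField n a) t x = cellSum n a heatStep t x := by
  have hm : ∀ z, Measurable fun s => heatSign (t - s) z := fun z =>
    measurable_heatSign.comp ((measurable_const.sub measurable_id).prodMk measurable_const)
  have hii : ∀ z α β, IntervalIntegrable (fun s => heatSign (t - s) z) volume α β := by
    intro z α β
    refine (intervalIntegrable_const (c := (1 / 2 : ℝ))).mono_fun
        (hm z).aestronglyMeasurable.restrict (Eventually.of_forall fun s => ?_)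
    simpa using abs_heatSign_le (t - s) z
  unfold heatConv cellSum
  simp_rw [integral_heatKernel_mul_noiseField]
  have hInt : ∀ k l : ℤ, IntervalIntegrable (fun s => a k l *
      ((Ico ((k : ℝ) / 2 ^ n) ((k + 1) / 2 ^ n)).indicator 1 s
        * (heatSign (t - s) (x - l / 2 ^ n) - heatSign (t - s) (x - (l + 1) / 2 ^ n))))
      volume 0 t := by
    intro k l
    apply IntervalIntegrable.const_mul
    refine ((hii (x - l / 2 ^ n) 0 t).sub (hii (x - (l + 1) / 2 ^ n) 0 t)).mono_fun ?_ ?_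
    · refine (Measurable.aestronglyMeasurable ?_).restrict
      exact ((measurable_one.indicator measurableSet_Ico).mul ((hm _).sub (hm _)))
    · refine Eventually.of_forall fun s => ?_
      by_cases h : s ∈ Ico ((k : ℝ) / 2 ^ n) ((k + 1) / 2 ^ n) <;> simp [h]
  rw [intervalIntegral.integral_finsetSum fun k _ => ?_]
  swap
  · have := IntervalIntegrable.sum (Finset.Ico (-2 ^ (2 * n) : ℤ) (2 ^ (2 * n)))
      (f := fun l s => a k l *
      ((Ico ((k : ℝ) / 2 ^ n) ((k + 1) / 2 ^ n)).indicator 1 s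
        * (heatSign (t - s) (x - l / 2 ^ n) - heatSign (t - s) (x - (l + 1) / 2 ^ n))))
      (μ := volume) (a := 0) (b := t) (fun l _ => hInt k l)
    simpa only [Finset.sum_fn] using this
  refine Finset.sum_congr rfl fun k hk => ?_
  rw [intervalIntegral.integral_finsetSum fun l _ => hInt k l]
  refine Finset.sum_congr rfl fun l _ => ?_
  have hk0 : (0 : ℝ) ≤ k := by exact_mod_cast (Finset.mem_Ico.1 hk).1
  rw [intervalIntegral.integral_const_mul, integral_indicator_mul_causal (by positivity)
    (by gcongr; linarith), intervalIntegral.integral_sub (hii _ _ _) (hii _ _ _),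
    integral_heatSign_sub, integral_heatSign_sub]
  intro s hs
  rw [heatSign_of_nonpos (by linarith), heatSign_of_nonpos (by linarith), sub_zero]

/-! ### Weak derivatives -/

/-- Integration by parts without boundary terms: the product gφ is continuous, differentiable off a
countable set, and vanishes at both ends of the interval. -/
theorem integral_mul_deriv_add_eq_zero {g g' φ φ' : ℝ → ℝ} {α β : ℝ} {s : Set ℝ}
    (hs : s.Countable) (hαβ : α ≤ β) (hg : Continuous g)
    (hg' : ∀ t ∈ Ioo α β \ s, HasDerivAt g (g' t) t)
    (hφ : ∀ t, HasDerivAt φ (φ' t) t) (hsupp : ∀ t ∉ Ioo α β, φ t = 0 ∧ φ' t = 0)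
    (hi : Integrable (fun t => g t * φ' t + g' t * φ t)) :
    ∫ t, (g t * φ' t + g' t * φ t) = 0 := by
  have h1 : ∫ t, (g t * φ' t + g' t * φ t) = ∫ t in α..β, (g t * φ' t + g' t * φ t) := by
    rw [intervalIntegral.integral_of_le hαβ, setIntegral_eq_integral_of_forall_compl_eq_zero]
    intro t ht
    have := hsupp t (fun h => ht ⟨h.1, h.2.le⟩)
    simp [this.1, this.2]
  have hφc : Continuous φ := continuous_iff_continuousAt.2 fun t => (hφ t).continuousAt
  rw [h1, integral_eq_of_hasDerivAt_off_countable (fun t => g t * φ t) _ hs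
    (hg.mul hφc).continuousOn ?_ hi.intervalIntegrable]
  · simp [(hsupp α (by simp)).1, (hsupp β (by simp)).1]
  · intro t ht
    rw [min_eq_left hαβ, max_eq_right hαβ] at ht
    exact ((hg' t ht).mul (hφ t)).congr_deriv (by ring)

/-- Bounded on bounded sets of `[0, 1] × ℝ`. -/
def LocBdd (u : ℝ → ℝ → ℝ) : Prop :=
  ∀ R : ℝ, ∃ C : ℝ, ∀ t ∈ Icc (0 : ℝ) 1, ∀ x ∈ Icc (-R) R, |u t x| ≤ C

theorem LocBdd.locL2 {u : ℝ → ℝ → ℝ} (hu : LocBdd u)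
    (hm : Measurable fun p : ℝ × ℝ => u p.1 p.2) : LocL2 u := by
  intro R
  obtain ⟨C, hC⟩ := hu R
  have hms : MeasurableSet (Icc (0 : ℝ) 1 ×ˢ Icc (-R) R) := measurableSet_Icc.prod measurableSet_Icc
  have : IsFiniteMeasure ((volume : Measure (ℝ × ℝ)).restrict (Icc (0 : ℝ) 1 ×ˢ Icc (-R) R)) := by
    refine ⟨?_⟩
    rw [Measure.restrict_apply_univ]
    exact (isCompact_Icc.prod isCompact_Icc).measure_lt_top
  refine MemLp.of_bound hm.aestronglyMeasurable C ?_
  refine (ae_restrict_iff' hms).2 (Eventually.of_forall fun p hp => ?_)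
  exact hC p.1 hp.1 p.2 hp.2

theorem IsTestFunction.exists_bound {ψ : ℝ × ℝ → ℝ} (hψ : IsTestFunction ψ) :
    ∃ R > 0, ∀ p, p ∈ tsupport ψ → p ∈ Icc (0 : ℝ) 1 ×ˢ Ioo (-R) R := by
  obtain ⟨R, hR⟩ := hψ.2.1.isBounded.exists_norm_le
  refine ⟨|R| + 1, by positivity, fun p hp => ⟨?_, ?_⟩⟩
  · have := (hψ.2.2 hp).1
    exact ⟨this.1.le, this.2.le⟩
  · have h1 := (norm_snd_le p).trans (hR p hp)
    have h2 := abs_le.1 ((Real.norm_eq_abs p.2 ▸ h1).trans (le_abs_self R))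
    exact ⟨by linarith [h2.1], by linarith [h2.2]⟩

theorem LocBdd.integrable_mul {u : ℝ → ℝ → ℝ} (hu : LocBdd u)
    (hm : Measurable fun p : ℝ × ℝ => u p.1 p.2) {R : ℝ} {χ : ℝ × ℝ → ℝ} (hχ : Continuous χ)
    (hχs : ∀ p ∉ Icc (0 : ℝ) 1 ×ˢ Icc (-R) R, χ p = 0) :
    Integrable (fun p : ℝ × ℝ => u p.1 p.2 * χ p) := by
  obtain ⟨C, hC⟩ := hu R
  have hcs : HasCompactSupport χ :=
    HasCompactSupport.intro (isCompact_Icc.prod isCompact_Icc) hχs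
  have h1 : Integrable χ := hχ.integrable_of_hasCompactSupport hcs
  refine (h1.norm.const_mul C).mono' (hm.mul hχ.measurable).aestronglyMeasurable
    (Eventually.of_forall fun p => ?_)
  by_cases hp : p ∈ Icc (0 : ℝ) 1 ×ˢ Icc (-R) R
  · rw [norm_mul]
    gcongr
    exact hC p.1 hp.1 p.2 hp.2
  · simp [hχs p hp]

theorem IsTestFunction.continuous_fderiv {ψ : ℝ × ℝ → ℝ} (hψ : IsTestFunction ψ) (v : ℝ × ℝ) :
    Continuous fun p => fderiv ℝ ψ p v :=
  (hψ.1.continuous_fderiv (by simp)).clm_apply continuous_const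

theorem IsTestFunction.fderiv_eq_zero {ψ : ℝ × ℝ → ℝ} {p : ℝ × ℝ} (hp : p ∉ tsupport ψ)
    (v : ℝ × ℝ) : fderiv ℝ ψ p v = 0 := by
  have : p ∉ Function.support (fderiv ℝ ψ) := fun h => hp (support_fderiv_subset ℝ h)
  rw [Function.notMem_support.1 this]; rfl

/-- Fubini reduces the claim to integration by parts on almost every line. A countable set of
exceptional times is harmless as long as the function stays continuous across it. -/
theorem isWeakTimeDeriv_of_hasDerivAt {u v : ℝ → ℝ → ℝ} {s : Set ℝ} (hs : s.Countable)
    (hum : Measurable fun p : ℝ × ℝ => u p.1 p.2) (hvm : Measurable fun p : ℝ × ℝ => v p.1 p.2)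
    (hub : LocBdd u) (hvb : LocBdd v) (hc : ∀ x, Continuous fun t => u t x)
    (hd : ∀ x, ∀ t ∉ s, HasDerivAt (fun t => u t x) (v t x) t) : IsWeakTimeDeriv u v := by
  intro ψ hψ
  obtain ⟨R, hR0, hR⟩ := hψ.exists_bound
  have hz : ∀ p ∉ Icc (0 : ℝ) 1 ×ˢ Icc (-R) R, p ∉ tsupport ψ := fun p hp h =>
    hp ⟨(hR p h).1, ⟨(hR p h).2.1.le, (hR p h).2.2.le⟩⟩
  have i1 := hub.integrable_mul hum (hψ.continuous_fderiv (1, 0))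
    (fun p hp => IsTestFunction.fderiv_eq_zero (hz p hp) _)
  have i2 := hvb.integrable_mul hvm hψ.1.continuous
    (fun p hp => image_eq_zero_of_notMem_tsupport (hz p hp))
  rw [eq_neg_iff_add_eq_zero, ← integral_add i1 i2, Measure.volume_eq_prod]
  have i12 : Integrable (fun p : ℝ × ℝ => u p.1 p.2 * fderiv ℝ ψ p (1, 0) + v p.1 p.2 * ψ p)
      (volume.prod volume) := i1.add i2
  rw [integral_prod_symm _ i12]
  have hz2 : ∀ᵐ x : ℝ, ∫ t, (u t x * fderiv ℝ ψ (t, x) (1, 0) + v t x * ψ (t, x)) = 0 := by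
    filter_upwards [i12.prod_left_ae] with x hx
    refine integral_mul_deriv_add_eq_zero hs zero_le_one (hc x) (fun t ht => hd x t ht.2)
      (φ := fun t => ψ (t, x)) (fun t => ?_) (fun t ht => ?_) hx
    · have h1 : HasFDerivAt ψ (fderiv ℝ ψ (t, x)) (t, x) :=
        (hψ.1.differentiable (by simp) (t, x)).hasFDerivAt
      exact h1.comp_hasDerivAt t ((hasDerivAt_id t).prodMk (hasDerivAt_const t x))
    · have : (t, x) ∉ tsupport ψ := fun h => ht (hψ.2.2 h).1
      exact ⟨image_eq_zero_of_notMem_tsupport this, IsTestFunction.fderiv_eq_zero this _⟩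
  rw [integral_congr_ae hz2, integral_zero]

theorem isWeakSpaceDeriv_of_hasDerivAt {u v : ℝ → ℝ → ℝ} {s : Set ℝ} (hs : s.Countable)
    (hum : Measurable fun p : ℝ × ℝ => u p.1 p.2) (hvm : Measurable fun p : ℝ × ℝ => v p.1 p.2)
    (hub : LocBdd u) (hvb : LocBdd v) (hc : ∀ t, Continuous (u t))
    (hd : ∀ t, ∀ x ∉ s, HasDerivAt (u t) (v t x) x) : IsWeakSpaceDeriv u v := by
  intro ψ hψ
  obtain ⟨R, hR0, hR⟩ := hψ.exists_bound
  have hz : ∀ p ∉ Icc (0 : ℝ) 1 ×ˢ Icc (-R) R, p ∉ tsupport ψ := fun p hp h =>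
    hp ⟨(hR p h).1, ⟨(hR p h).2.1.le, (hR p h).2.2.le⟩⟩
  have i1 := hub.integrable_mul hum (hψ.continuous_fderiv (0, 1))
    (fun p hp => IsTestFunction.fderiv_eq_zero (hz p hp) _)
  have i2 := hvb.integrable_mul hvm hψ.1.continuous
    (fun p hp => image_eq_zero_of_notMem_tsupport (hz p hp))
  rw [eq_neg_iff_add_eq_zero, ← integral_add i1 i2, Measure.volume_eq_prod]
  have i12 : Integrable (fun p : ℝ × ℝ => u p.1 p.2 * fderiv ℝ ψ p (0, 1) + v p.1 p.2 * ψ p)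
      (volume.prod volume) := i1.add i2
  rw [integral_prod _ i12]
  have hz2 : ∀ᵐ t : ℝ, ∫ x, (u t x * fderiv ℝ ψ (t, x) (0, 1) + v t x * ψ (t, x)) = 0 := by
    filter_upwards [i12.prod_right_ae] with t ht
    refine integral_mul_deriv_add_eq_zero (α := -R) (β := R) hs (by linarith) (hc t)
      (fun x hx => hd t x hx.2) (φ := fun x => ψ (t, x)) (fun x => ?_) (fun x hx => ?_) ht
    · have h1 : HasFDerivAt ψ (fderiv ℝ ψ (t, x)) (t, x) :=
        (hψ.1.differentiable (by simp) (t, x)).hasFDerivAt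
      exact h1.comp_hasDerivAt x ((hasDerivAt_const x t).prodMk (hasDerivAt_id x))
    · have : (t, x) ∉ tsupport ψ := fun h => hx (hR _ h).2
      exact ⟨image_eq_zero_of_notMem_tsupport this, IsTestFunction.fderiv_eq_zero this _⟩
  rw [integral_congr_ae hz2, integral_zero]

/-! ### Regularity of the explicit solution -/

theorem LocBdd.sum {ι : Type*} {s : Finset ι} {u : ι → ℝ → ℝ → ℝ} (hu : ∀ i ∈ s, LocBdd (u i)) :
    LocBdd (fun t x => ∑ i ∈ s, u i t x) := by
  intro R
  choose! C hC using fun i (hi : i ∈ s) => hu i hi R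
  refine ⟨∑ i ∈ s, C i, fun t ht x hx => (Finset.abs_sum_le_sum_abs _ _).trans ?_⟩
  exact Finset.sum_le_sum fun i hi => hC i hi t ht x hx

theorem LocBdd.const_mul {u : ℝ → ℝ → ℝ} (hu : LocBdd u) (a : ℝ) :
    LocBdd (fun t x => a * u t x) := by
  intro R
  obtain ⟨C, hC⟩ := hu R
  refine ⟨|a| * C, fun t ht x hx => ?_⟩
  rw [abs_mul]
  gcongr
  exact hC t ht x hx

theorem LocBdd.sub {u v : ℝ → ℝ → ℝ} (hu : LocBdd u) (hv : LocBdd v) :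
    LocBdd (fun t x => u t x - v t x) := by
  intro R
  obtain ⟨C, hC⟩ := hu R
  obtain ⟨D, hD⟩ := hv R
  exact ⟨C + D, fun t ht x hx => (abs_sub _ _).trans (add_le_add (hC t ht x hx) (hD t ht x hx))⟩

/-- Boundedness of a kernel on bounded sets, for times at most `1`. -/
def KernelBdd (K : ℝ → ℝ → ℝ) : Prop :=
  ∀ R : ℝ, ∃ C : ℝ, ∀ r ≤ 1, ∀ z ∈ Icc (-R) R, |K r z| ≤ C

theorem KernelBdd.locBdd {K : ℝ → ℝ → ℝ} (hK : KernelBdd K) {τ : ℝ} (hτ : 0 ≤ τ) (c : ℝ) :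
    LocBdd (fun t x => K (t - τ) (x - c)) := by
  intro R
  obtain ⟨C, hC⟩ := hK (R + |c|)
  refine ⟨C, fun t ht x hx => hC _ (by linarith [ht.2]) _ ?_⟩
  constructor <;> linarith [hx.1, hx.2, le_abs_self c, neg_abs_le c]

theorem kernelBdd_heatStep : KernelBdd heatStep := by
  refine fun R => ⟨1 + R ^ 2 + R, fun r hr z hz => (abs_heatStep_le hr).trans ?_⟩
  have : |z| ≤ R := abs_le.2 hz
  rw [← sq_abs z]
  gcongr

theorem kernelBdd_heatStepX : KernelBdd heatStepX := by
  refine fun R => ⟨2 + R, fun r hr z hz => (abs_heatStepX_le hr).trans ?_⟩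
  have : |z| ≤ R := abs_le.2 hz
  gcongr

theorem kernelBdd_heatStepXX : KernelBdd heatStepXX :=
  fun _ => ⟨1, fun r _ z _ => abs_heatStepXX_le r z⟩

theorem kernelBdd_heatSign : KernelBdd heatSign :=
  fun _ => ⟨1 / 2, fun r _ z _ => abs_heatSign_le r z⟩

theorem KernelBdd.locBdd_cellSum {K : ℝ → ℝ → ℝ} (hK : KernelBdd K) (n : ℕ) (a : ℤ → ℤ → ℝ) :
    LocBdd (cellSum n a K) := by
  unfold cellSum
  refine LocBdd.sum fun k hk => LocBdd.sum fun l _ => LocBdd.const_mul ?_ _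
  have hk0 : (0 : ℝ) ≤ k := by exact_mod_cast (Finset.mem_Ico.1 hk).1
  exact ((hK.locBdd (by positivity) _).sub (hK.locBdd (by positivity) _)).sub
    ((hK.locBdd (by positivity) _).sub (hK.locBdd (by positivity) _))

theorem measurable_cellSum {K : ℝ → ℝ → ℝ} (hK : Measurable fun p : ℝ × ℝ => K p.1 p.2) (n : ℕ)
    (a : ℤ → ℤ → ℝ) : Measurable fun p : ℝ × ℝ => cellSum n a K p.1 p.2 := by
  have h : ∀ τ c : ℝ, Measurable fun p : ℝ × ℝ => K (p.1 - τ) (p.2 - c) := fun τ c =>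
    hK.comp ((measurable_fst.sub_const τ).prodMk (measurable_snd.sub_const c))
  unfold cellSum
  exact Finset.measurable_fun_sum _ fun k _ => Finset.measurable_fun_sum _ fun l _ =>
    (((h _ _).sub (h _ _)).sub ((h _ _).sub (h _ _))).const_mul _

/-- The grid points. -/
def gridPoints (n : ℕ) : Set ℝ := range fun k : ℤ => (k : ℝ) / 2 ^ n

theorem countable_gridPoints (n : ℕ) : (gridPoints n).Countable := countable_range _

theorem sub_ne_zero_of_notMem_gridPoints {n : ℕ} {x : ℝ} (hx : x ∉ gridPoints n) (k : ℤ) :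
    x - k / 2 ^ n ≠ 0 ∧ x - (k + 1) / 2 ^ n ≠ 0 := by
  constructor
  · intro h
    exact hx ⟨k, by simp only; linarith⟩
  · intro h
    exact hx ⟨k + 1, by push_cast; linarith⟩

theorem hasDerivAt_cellSum_time {K K' : ℝ → ℝ → ℝ} (n : ℕ) (a : ℤ → ℤ → ℝ) {t : ℝ} (x : ℝ)
    (h : ∀ k : ℤ, ∀ z, HasDerivAt (fun r => K r z) (K' (t - k / 2 ^ n) z) (t - k / 2 ^ n) ∧
      HasDerivAt (fun r => K r z) (K' (t - (k + 1) / 2 ^ n) z) (t - (k + 1) / 2 ^ n)) :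
    HasDerivAt (fun t => cellSum n a K t x) (cellSum n a K' t x) t := by
  unfold cellSum
  refine HasDerivAt.fun_sum fun k _ => HasDerivAt.fun_sum fun l _ => HasDerivAt.const_mul _ ?_
  have h1 := fun z => (h k z).1.comp_sub_const t _
  have h2 := fun z => (h k z).2.comp_sub_const t _
  exact ((h1 _).sub (h2 _)).sub ((h1 _).sub (h2 _))

theorem hasDerivAt_cellSum_space {K K' : ℝ → ℝ → ℝ} (n : ℕ) (a : ℤ → ℤ → ℝ) (t : ℝ) {x : ℝ}
    (h : ∀ l : ℤ, ∀ r, HasDerivAt (K r) (K' r (x - l / 2 ^ n)) (x - l / 2 ^ n) ∧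
      HasDerivAt (K r) (K' r (x - (l + 1) / 2 ^ n)) (x - (l + 1) / 2 ^ n)) :
    HasDerivAt (cellSum n a K t) (cellSum n a K' t x) x := by
  unfold cellSum
  refine HasDerivAt.fun_sum fun k _ => HasDerivAt.fun_sum fun l _ => HasDerivAt.const_mul _ ?_
  have h1 := fun r => (h l r).1.comp_sub_const x _
  have h2 := fun r => (h l r).2.comp_sub_const x _
  exact ((h1 _).sub (h1 _)).sub ((h2 _).sub (h2 _))

theorem hasDerivAt_sol_time (n : ℕ) (a : ℤ → ℤ → ℝ) {t : ℝ} (ht : t ∉ gridPoints n) (x : ℝ) :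
    HasDerivAt (fun t => cellSum n a heatStep t x) (cellSum n a heatSign t x) t :=
  hasDerivAt_cellSum_time n a x fun k z =>
    ⟨hasDerivAt_heatStep_time (sub_ne_zero_of_notMem_gridPoints ht k).1 z,
      hasDerivAt_heatStep_time (sub_ne_zero_of_notMem_gridPoints ht k).2 z⟩

theorem continuous_sol_time (n : ℕ) (a : ℤ → ℤ → ℝ) (x : ℝ) :
    Continuous fun t => cellSum n a heatStep t x := by
  unfold cellSum
  have h := continuous_heatStep_time
  have h' : ∀ τ z : ℝ, Continuous fun t => heatStep (t - τ) z := fun τ z =>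
    (h z).comp (continuous_id.sub continuous_const)
  exact continuous_finsetSum _ fun k _ => continuous_finsetSum _ fun l _ => continuous_const.mul
    (((h' _ _).sub (h' _ _)).sub ((h' _ _).sub (h' _ _)))

theorem hasDerivAt_sol_space (n : ℕ) (a : ℤ → ℤ → ℝ) (t x : ℝ) :
    HasDerivAt (cellSum n a heatStep t) (cellSum n a heatStepX t x) x :=
  hasDerivAt_cellSum_space n a t fun _ r =>
    ⟨hasDerivAt_heatStep_space r _, hasDerivAt_heatStep_space r _⟩

theorem hasDerivAt_solX_space (n : ℕ) (a : ℤ → ℤ → ℝ) (t : ℝ) {x : ℝ} (hx : x ∉ gridPoints n) :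
    HasDerivAt (cellSum n a heatStepX t) (cellSum n a heatStepXX t x) x :=
  hasDerivAt_cellSum_space n a t fun l r =>
    ⟨hasDerivAt_heatStepX_space r (sub_ne_zero_of_notMem_gridPoints hx l).1,
      hasDerivAt_heatStepX_space r (sub_ne_zero_of_notMem_gridPoints hx l).2⟩

theorem continuous_solX (n : ℕ) (a : ℤ → ℤ → ℝ) (t : ℝ) :
    Continuous (cellSum n a heatStepX t) := by
  unfold cellSum
  have h' : ∀ r c : ℝ, Continuous fun x => heatStepX r (x - c) := fun r c =>
    (continuous_heatStepX r).comp (continuous_id.sub continuous_const)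
  exact continuous_finsetSum _ fun k _ => continuous_finsetSum _ fun l _ => continuous_const.mul
    (((h' _ _).sub (h' _ _)).sub ((h' _ _).sub (h' _ _)))

/-- The solution and its first space derivative are continuous in the variable that is
differentiated, so the jumps of the next derivatives at grid points leave no singular part. -/
theorem hasHeatDerivs_sol (n : ℕ) (a : ℤ → ℤ → ℝ) :
    HasHeatDerivs (cellSum n a heatStep) (cellSum n a heatSign) (cellSum n a heatStepXX) := by
  have m0 := measurable_cellSum measurable_heatStep n a
  have m1 := measurable_cellSum measurable_heatStepX n a
  have m2 := measurable_cellSum measurable_heatStepXX n a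
  have mt := measurable_cellSum measurable_heatSign n a
  have b0 := kernelBdd_heatStep.locBdd_cellSum n a
  have b1 := kernelBdd_heatStepX.locBdd_cellSum n a
  have b2 := kernelBdd_heatStepXX.locBdd_cellSum n a
  have bt := kernelBdd_heatSign.locBdd_cellSum n a
  refine ⟨b0.locL2 m0, bt.locL2 mt, b2.locL2 m2, ?_, cellSum n a heatStepX, b1.locL2 m1, ?_, ?_⟩
  · exact isWeakTimeDeriv_of_hasDerivAt (countable_gridPoints n) m0 mt b0 bt
      (continuous_sol_time n a) fun x t ht => hasDerivAt_sol_time n a ht x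
  · exact isWeakSpaceDeriv_of_hasDerivAt countable_empty m0 m1 b0 b1
      (fun t => continuous_iff_continuousAt.2 fun x => (hasDerivAt_sol_space n a t x).continuousAt)
      fun t x _ => hasDerivAt_sol_space n a t x
  · exact isWeakSpaceDeriv_of_hasDerivAt (countable_gridPoints n) m1 m2 b1 b2
      (continuous_solX n a) fun t x hx => hasDerivAt_solX_space n a t hx

theorem step_sub_step {τ τ' t : ℝ} (h : τ ≤ τ') (h1 : t - τ ≠ 0) (h2 : t - τ' ≠ 0) (q : ℝ) :
    (if 0 < t - τ then q else 0) - (if 0 < t - τ' then q else 0)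
      = (Ico τ τ').indicator 1 t * q := by
  by_cases a1 : 0 < t - τ
  · by_cases a2 : 0 < t - τ'
    · have : t ∉ Ico τ τ' := fun hh => by linarith [hh.2]
      simp [a1, a2, this]
    · have : t ∈ Ico τ τ' := ⟨by linarith, by
        rcases lt_or_gt_of_ne h2 with h | h <;> linarith⟩
      simp [a1, a2, this]
  · have a2 : ¬ 0 < t - τ' := by linarith
    have : t ∉ Ico τ τ' := fun hh => a1 (lt_of_le_of_ne (by linarith [hh.1]) h1.symm)
    simp [a1, a2, this]

theorem sign_sub_sign {c d x : ℝ} (h : c ≤ d) (h1 : x - c ≠ 0) (h2 : x - d ≠ 0) :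
    (SignType.sign (x - c) : ℝ) / 2 - (SignType.sign (x - d) : ℝ) / 2
      = (Ico c d).indicator 1 x := by
  rcases lt_or_gt_of_ne h1 with a1 | a1 <;> rcases lt_or_gt_of_ne h2 with a2 | a2
  · have : x ∉ Ico c d := fun hh => by linarith [hh.1]
    simp [sign_neg a1, sign_neg a2, this]
  · linarith
  · have : x ∈ Ico c d := ⟨by linarith, by linarith⟩
    simp [sign_pos a1, sign_neg a2, this]; norm_num
  · have : x ∉ Ico c d := fun hh => by linarith [hh.2]
    simp [sign_pos a1, sign_pos a2, this]

/-- At positive times `heatSign` and `heatStepXX` differ by sign/2. The rectangular difference of a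
unit step in time times sign/2 in space is the indicator of the cell. -/
theorem sol_time_sub_solXX (n : ℕ) (a : ℤ → ℤ → ℝ) {t x : ℝ} (ht : t ∉ gridPoints n)
    (hx : x ∉ gridPoints n) :
    cellSum n a heatSign t x - cellSum n a heatStepXX t x = noiseField n a t x := by
  unfold cellSum noiseField
  rw [← Finset.sum_sub_distrib]
  refine Finset.sum_congr rfl fun k _ => ?_
  rw [← Finset.sum_sub_distrib]
  refine Finset.sum_congr rfl fun l _ => ?_
  have e : ∀ r z, heatSign r z = heatStepXX r z
      + if 0 < r then (SignType.sign z : ℝ) / 2 else 0 := by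
    intro r z
    unfold heatStepXX
    split_ifs with h
    · ring
    · simp [heatSign, h]
  have h1 := step_sub_step (show (k : ℝ) / 2 ^ n ≤ (k + 1) / 2 ^ n by gcongr; linarith)
    (sub_ne_zero_of_notMem_gridPoints ht k).1 (sub_ne_zero_of_notMem_gridPoints ht k).2
  have h2 := sign_sub_sign (show (l : ℝ) / 2 ^ n ≤ (l + 1) / 2 ^ n by gcongr; linarith)
    (sub_ne_zero_of_notMem_gridPoints hx l).1 (sub_ne_zero_of_notMem_gridPoints hx l).2
  have h3 := h1 ((SignType.sign (x - l / 2 ^ n) : ℝ) / 2)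
  have h4 := h1 ((SignType.sign (x - (l + 1) / 2 ^ n) : ℝ) / 2)
  rw [← mul_sub, mul_assoc]
  congr 1
  rw [← h2, mul_sub, ← h3, ← h4]
  simp only [e]
  ring

/-! ### Uniqueness of weak derivatives -/

theorem LocL2.locallyIntegrableOn {u : ℝ → ℝ → ℝ} (hu : LocL2 u) :
    LocallyIntegrableOn (fun p : ℝ × ℝ => u p.1 p.2) (Ioo 0 1 ×ˢ univ) := by
  refine (locallyIntegrableOn_iff (isOpen_Ioo.prod isOpen_univ).isLocallyClosed).2 fun K hK hKc => ?_
  obtain ⟨R, hR⟩ := hKc.isBounded.exists_norm_le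
  have h1 : K ⊆ Icc 0 1 ×ˢ Icc (-R) R := by
    intro p hp
    refine ⟨⟨(hK hp).1.1.le, (hK hp).1.2.le⟩, ?_⟩
    exact abs_le.1 ((norm_snd_le p).trans (hR p hp))
  have : IsFiniteMeasure ((volume : Measure (ℝ × ℝ)).restrict (Icc (0 : ℝ) 1 ×ˢ Icc (-R) R)) := by
    refine ⟨?_⟩
    rw [Measure.restrict_apply_univ]
    exact (isCompact_Icc.prod isCompact_Icc).measure_lt_top
  exact IntegrableOn.mono_set ((hu R).integrable (by norm_num)) h1

theorem LocL2.integrable_mul {u : ℝ → ℝ → ℝ} (hu : LocL2 u) {ψ : ℝ × ℝ → ℝ}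
    (hψ : IsTestFunction ψ) : Integrable fun p : ℝ × ℝ => u p.1 p.2 * ψ p := by
  have h1 := hu.locallyIntegrableOn.integrableOn_compact_subset hψ.2.2 hψ.2.1
  have h2 := h1.mul_continuousOn hψ.1.continuous.continuousOn hψ.2.1
  rw [← integrable_indicator_iff (isClosed_tsupport ψ).measurableSet] at h2
  refine h2.congr (Eventually.of_forall fun p => ?_)
  by_cases hp : p ∈ tsupport ψ
  · simp [hp]
  · simp [hp, image_eq_zero_of_notMem_tsupport hp]

theorem ae_eq_of_forall_integral_eq {v w : ℝ → ℝ → ℝ} (hv : LocL2 v) (hw : LocL2 w)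
    (h : ∀ ψ, IsTestFunction ψ →
      ∫ p : ℝ × ℝ, v p.1 p.2 * ψ p = ∫ p : ℝ × ℝ, w p.1 p.2 * ψ p) :
    ∀ᵐ p : ℝ × ℝ, p ∈ Ioo (0 : ℝ) 1 ×ˢ (univ : Set ℝ) → v p.1 p.2 = w p.1 p.2 := by
  have hU : IsOpen (Ioo (0 : ℝ) 1 ×ˢ (univ : Set ℝ)) := isOpen_Ioo.prod isOpen_univ
  have := hU.ae_eq_zero_of_integral_contDiff_smul_eq_zero
    (hv.locallyIntegrableOn.sub hw.locallyIntegrableOn) (fun g hg hgc hgs => by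
      have hψ : IsTestFunction g := ⟨hg, hgc, hgs⟩
      have e : ∀ p : ℝ × ℝ, g p • ((fun p : ℝ × ℝ => v p.1 p.2) - fun p : ℝ × ℝ => w p.1 p.2) p
          = v p.1 p.2 * g p - w p.1 p.2 * g p := by
        intro p; simp only [smul_eq_mul, Pi.sub_apply]; ring
      simp_rw [e]
      rw [integral_sub (hv.integrable_mul hψ) (hw.integrable_mul hψ), h g hψ, sub_self])
  filter_upwards [this] with p hp hpU
  have := hp hpU
  simp only [Pi.sub_apply] at this
  linarith

theorem integral_congr_of_ae_strip {v w : ℝ → ℝ → ℝ} {χ : ℝ × ℝ → ℝ}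
    (h : ∀ᵐ p : ℝ × ℝ, p ∈ Ioo (0 : ℝ) 1 ×ˢ (univ : Set ℝ) → v p.1 p.2 = w p.1 p.2)
    (hχ : ∀ p ∉ Ioo (0 : ℝ) 1 ×ˢ (univ : Set ℝ), χ p = 0) :
    ∫ p : ℝ × ℝ, v p.1 p.2 * χ p = ∫ p : ℝ × ℝ, w p.1 p.2 * χ p := by
  apply integral_congr_ae
  filter_upwards [h] with p hp
  by_cases hpU : p ∈ Ioo (0 : ℝ) 1 ×ˢ (univ : Set ℝ)
  · simp only [hp hpU]
  · simp only [hχ p hpU, mul_zero]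

/-- `IsGalerkinApprox` asks for some choice of weak derivatives, and this makes the right-hand side
independent of that choice. The first space derivatives are identified first, since the second ones
are defined by testing them. Test functions live in the open strip, hence so does the conclusion. -/
theorem HasHeatDerivs.ae_unique {u ut uxx ut' uxx' : ℝ → ℝ → ℝ} (h : HasHeatDerivs u ut uxx)
    (h' : HasHeatDerivs u ut' uxx') :
    ∀ᵐ p : ℝ × ℝ, p ∈ Ioo (0 : ℝ) 1 ×ˢ (univ : Set ℝ) →
      ut p.1 p.2 - uxx p.1 p.2 = ut' p.1 p.2 - uxx' p.1 p.2 := by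
  obtain ⟨-, lt, lxx, wt, ux, lx, wx, wxx⟩ := h
  obtain ⟨-, lt', lxx', wt', ux', lx', wx', wxx'⟩ := h'
  have h1 := ae_eq_of_forall_integral_eq lt lt' fun ψ hψ => by
    have := (wt ψ hψ).symm.trans (wt' ψ hψ)
    linarith
  have h2 := ae_eq_of_forall_integral_eq lx lx' fun ψ hψ => by
    have := (wx ψ hψ).symm.trans (wx' ψ hψ)
    linarith
  have h3 := ae_eq_of_forall_integral_eq lxx lxx' fun ψ hψ => by
    have e := integral_congr_of_ae_strip h2 (χ := fun p => fderiv ℝ ψ p (0, 1)) (fun p hp =>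
      IsTestFunction.fderiv_eq_zero (fun hh => hp (hψ.2.2 hh)) _)
    have e1 := wxx ψ hψ
    have e2 := wxx' ψ hψ
    linarith
  filter_upwards [h1, h3] with p e1 e3 hp
  rw [e1 hp, e3 hp]

/-- The Galerkin approximation in terms of the noise itself. -/
theorem isGalerkinApprox_iff (h L : ℝ) (m n : ℕ) (a : ℤ → ℤ → ℝ)
    (v : Fin (2 ^ m + 1) → ℝ → ℝ) :
    IsGalerkinApprox h L m (heatConv (noiseField n a)) v ↔
      v 0 = 0 ∧ (∀ i, v i ∈ galerkinSpace h L) ∧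
      ∀ i : Fin (2 ^ m), ∀ φ ∈ galerkinSpace h L,
        2 ^ m * (∫ x, (v i.succ x - v i.castSucc x) * φ x) + ∫ x, deriv (v i.succ) x * deriv φ x
          = 2 ^ m * ∫ s in ((i : ℕ) / 2 ^ m : ℝ)..(((i : ℕ) + 1) / 2 ^ m : ℝ),
              ∫ x, noiseField n a s x * φ x := by
  have hsol : heatConv (noiseField n a) = cellSum n a heatStep := by
    ext t x; exact heatConv_noiseField n a t x
  have hH := hasHeatDerivs_sol n a
  have hgrid : ∀ᵐ x : ℝ, x ∉ gridPoints n :=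
    measure_mono_null (fun _ hx => not_not.1 hx) ((countable_gridPoints n).measure_zero _)
  -- Equality of the integrands for almost every s and almost every x is enough; the discarded times
  -- are the grid points, the time 1 and a null set. For this reason `φ` can be arbitrary.
  have key : ∀ ut uxx, HasHeatDerivs (heatConv (noiseField n a)) ut uxx →
      ∀ (i : Fin (2 ^ m)) (φ : ℝ → ℝ),
        ∫ s in ((i : ℕ) / 2 ^ m : ℝ)..(((i : ℕ) + 1) / 2 ^ m : ℝ),
            ∫ x, (ut s x - uxx s x) * φ x
          = ∫ s in ((i : ℕ) / 2 ^ m : ℝ)..(((i : ℕ) + 1) / 2 ^ m : ℝ),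
              ∫ x, noiseField n a s x * φ x := by
    intro ut uxx hu i φ
    rw [hsol] at hu
    have h1 := hu.ae_unique hH
    rw [Measure.volume_eq_prod] at h1
    have h2 := Measure.ae_ae_of_ae_prod h1
    apply intervalIntegral.integral_congr_ae
    have hne : ∀ᵐ s : ℝ, s ≠ 1 := by simp [ae_iff]
    filter_upwards [h2, hgrid, hne] with s hs hsg hs1 hsi
    rw [uIoc_of_le (by gcongr; linarith)] at hsi
    have hi1 : ((i : ℕ) : ℝ) + 1 ≤ 2 ^ m := by exact_mod_cast i.2
    have s0 : 0 < s := lt_of_le_of_lt (by positivity) hsi.1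
    have s1 : s ≤ 1 := hsi.2.trans (by rw [div_le_one (by positivity)]; exact hi1)
    apply integral_congr_ae
    filter_upwards [hs, hgrid] with x hx hxg
    rw [hx ⟨⟨s0, lt_of_le_of_ne s1 hs1⟩, mem_univ _⟩, sol_time_sub_solXX n a hsg hxg]
  constructor
  · rintro ⟨-, ut, uxx, hu, h0, hS, heq⟩
    refine ⟨h0, hS, fun i φ hφ => ?_⟩
    rw [heq i φ hφ, key ut uxx hu i φ]
  · rintro ⟨h0, hS, heq⟩
    refine ⟨fun x => by simp [heatConv], cellSum n a heatSign, cellSum n a heatStepXX,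
      by rw [hsol]; exact hH, h0, hS, fun i φ hφ => ?_⟩
    rw [heq i φ hφ, key _ _ (by rw [hsol]; exact hH) i φ]

/-! ### Piecewise linear functions -/

theorem hat_eq_max {h : ℝ} (hh : 0 < h) (j : ℤ) (x : ℝ) :
    hat h j x = max 0 (1 - |x - j * h| / h) := by
  unfold hat
  have e : ∀ y : ℝ, 1 / h * y = y / h := fun y => by ring
  split_ifs with h1 h2
  · obtain ⟨a, b⟩ := h1
    rw [abs_of_nonpos (by linarith), max_eq_right]
    · field_simp; ring
    · rw [sub_nonneg, div_le_one hh]; linarith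
  · obtain ⟨a, b⟩ := h2
    rw [abs_of_nonneg (by linarith), max_eq_right]
    · field_simp; ring
    · rw [sub_nonneg, div_le_one hh]; linarith
  · rw [max_eq_left]
    rw [sub_nonpos, one_le_div hh]
    by_contra hcon
    push Not at hcon
    obtain ⟨a, b⟩ := abs_lt.1 hcon
    rcases le_total x (j * h) with hx | hx
    · exact h1 ⟨by linarith, hx⟩
    · exact h2 ⟨hx, by linarith⟩

theorem hat_left {h : ℝ} {j : ℤ} {x : ℝ} (hx : x ∈ Icc ((j - 1) * h) (j * h)) :
    hat h j x = (x - (j - 1) * h) / h := by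
  simp only [hat, if_pos hx]; ring

theorem hat_right {h : ℝ} (hh : 0 < h) {j : ℤ} {x : ℝ} (hx : x ∈ Icc (j * h) ((j + 1) * h)) :
    hat h j x = ((j + 1) * h - x) / h := by
  rw [hat_eq_max hh, abs_of_nonneg (by linarith [hx.1]), max_eq_right]
  · field_simp; ring
  · rw [sub_nonneg, div_le_one hh]; linarith [hx.2]

theorem hat_eq_zero {h : ℝ} (hh : 0 < h) {j : ℤ} {x : ℝ} (hx : x ≤ (j - 1) * h ∨ (j + 1) * h ≤ x) :
    hat h j x = 0 := by
  rw [hat_eq_max hh, max_eq_left]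
  rw [sub_nonpos, one_le_div hh]
  rcases hx with hx | hx
  · rw [abs_of_nonpos (by linarith)]; linarith
  · rw [abs_of_nonneg (by linarith)]; linarith

theorem hat_node {h : ℝ} (hh : 0 < h) (j k : ℤ) : hat h j (k * h) = if k = j then 1 else 0 := by
  split_ifs with hk
  · subst hk
    rw [hat_eq_max hh]; simp
  · apply hat_eq_zero hh
    rcases lt_or_gt_of_ne hk with hlt | hlt
    · left
      have : (k : ℝ) ≤ j - 1 := by exact_mod_cast Int.le_sub_one_of_lt hlt
      gcongr
    · right
      have : (j : ℝ) + 1 ≤ k := by exact_mod_cast hlt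
      gcongr

/-- The slope of a hat function. -/
def hatDeriv (h : ℝ) (j : ℤ) (x : ℝ) : ℝ :=
  (1 / h) * (Ioc ((j - 1) * h) (j * h)).indicator 1 x
    - (1 / h) * (Ioc (j * h) ((j + 1) * h)).indicator 1 x

/-- The nodes of the mesh. -/
def nodes (h : ℝ) : Set ℝ := range fun k : ℤ => (k : ℝ) * h

theorem countable_nodes (h : ℝ) : (nodes h).Countable := countable_range _

theorem ae_notMem_nodes (h : ℝ) : ∀ᵐ x : ℝ, x ∉ nodes h :=
  measure_mono_null (fun _ hx => not_not.1 hx) ((countable_nodes h).measure_zero _)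

/-- Every point lies in an element of the mesh. -/
theorem exists_mem_element {h : ℝ} (hh : 0 < h) (x : ℝ) :
    ∃ k : ℤ, x ∈ Ico (k * h) ((k + 1) * h) := by
  refine ⟨⌊x / h⌋, ?_, ?_⟩
  · rw [← le_div_iff₀ hh]; exact Int.floor_le _
  · rw [← div_lt_iff₀ hh]; exact Int.lt_floor_add_one _

/-- Piecewise linear functions on the mesh of size `h`, vanishing outside `(-L, L)`. -/
structure IsPL (h L : ℝ) (v : ℝ → ℝ) : Prop where
  lipschitz : ∃ C, LipschitzWith C v
  affine : ∀ (k : ℤ), ∀ x ∈ Icc (k * h) ((k + 1) * h),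
    v x = v (k * h) + (v ((k + 1) * h) - v (k * h)) * ((x - k * h) / h)
  zero : ∀ x, L ≤ |x| → v x = 0

theorem lipschitzWith_hat {h : ℝ} (hh : 0 < h) (j : ℤ) :
    LipschitzWith (1 / h).toNNReal (hat h j) := by
  refine LipschitzWith.of_dist_le_mul fun x y => ?_
  rw [Real.dist_eq, Real.dist_eq, hat_eq_max hh, hat_eq_max hh, Real.coe_toNNReal _ (by positivity)]
  calc |max 0 (1 - |x - j * h| / h) - max 0 (1 - |y - j * h| / h)|
      ≤ |(1 - |x - j * h| / h) - (1 - |y - j * h| / h)| := by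
        have := abs_max_sub_max_le_max (0 : ℝ) (1 - |x - j * h| / h) 0 (1 - |y - j * h| / h)
        simpa using this
    _ = 1 / h * |(|y - j * h| - |x - j * h|)| := by
        have h0 : |1 / h| = 1 / h := abs_of_pos (by positivity)
        nth_rewrite 1 [← h0]
        rw [← abs_mul]
        congr 1; ring
    _ ≤ 1 / h * |x - y| := by
        refine mul_le_mul_of_nonneg_left ?_ (by positivity)
        refine (abs_abs_sub_abs_le_abs_sub _ _).trans ?_
        rw [abs_sub_comm x y]
        apply le_of_eq; congr 1; ring

theorem isPL_hat {h L : ℝ} (hh : 0 < h) {j : ℤ} (h1 : -L ≤ (j - 1) * h) (h2 : (j + 1) * h ≤ L) :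
    IsPL h L (hat h j) where
  lipschitz := ⟨_, lipschitzWith_hat hh j⟩
  affine := by
    intro k x hx
    have e : ((k : ℝ) + 1) * h = ((k + 1 : ℤ) : ℝ) * h := by push_cast; ring
    rw [hat_node hh, e, hat_node hh]
    rcases lt_trichotomy k (j - 1) with hk | hk | hk
    · have hk' : (k : ℝ) + 1 ≤ j - 1 := by exact_mod_cast hk
      rw [hat_eq_zero hh (Or.inl (hx.2.trans (by gcongr))), if_neg (by lia), if_neg (by lia)]
      ring
    · have hk' : (k : ℝ) = j - 1 := by exact_mod_cast hk
      rw [hat_left (by rw [hk'] at hx; simpa using hx), if_neg (by lia), if_pos (by lia), hk']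
      ring
    · rcases eq_or_lt_of_le (Int.add_one_le_of_lt hk) with hk | hk
      · have hk' : k = j := by lia
        subst hk'
        rw [hat_right hh hx, if_pos rfl, if_neg (by lia)]
        field_simp; ring
      · have hk' : (j : ℝ) + 1 ≤ k := by exact_mod_cast (show j + 1 ≤ k by lia)
        rw [hat_eq_zero hh (Or.inr (le_trans (by gcongr) hx.1)), if_neg (by lia), if_neg (by lia)]
        ring
  zero := by
    intro x hx
    apply hat_eq_zero hh
    rcases le_abs.1 hx with h | h
    · right; linarith
    · left; linarith

namespace IsPL

variable {h L : ℝ} {v w : ℝ → ℝ}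

theorem zero_fun : IsPL h L 0 := ⟨⟨0, LipschitzWith.const 0⟩, by simp, by simp⟩

theorem add (hv : IsPL h L v) (hw : IsPL h L w) : IsPL h L (v + w) where
  lipschitz := by
    obtain ⟨C, hC⟩ := hv.lipschitz
    obtain ⟨D, hD⟩ := hw.lipschitz
    exact ⟨_, hC.add hD⟩
  affine := by
    intro k x hx
    simp only [Pi.add_apply]
    rw [hv.affine k x hx, hw.affine k x hx]; ring
  zero := by
    intro x hx
    simp [hv.zero x hx, hw.zero x hx]

theorem smul (hv : IsPL h L v) (c : ℝ) : IsPL h L (c • v) where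
  lipschitz := by
    obtain ⟨C, hC⟩ := hv.lipschitz
    exact ⟨_, (lipschitzWith_smul c).comp hC⟩
  affine := by
    intro k x hx
    simp only [Pi.smul_apply, smul_eq_mul]
    rw [hv.affine k x hx]; ring
  zero := by
    intro x hx
    simp [hv.zero x hx]

theorem continuous (hv : IsPL h L v) : Continuous v := by
  obtain ⟨C, hC⟩ := hv.lipschitz
  exact hC.continuous

theorem hasCompactSupport (hv : IsPL h L v) : HasCompactSupport v := by
  refine HasCompactSupport.intro (isCompact_Icc (a := -L) (b := L)) fun x hx => hv.zero x ?_
  by_contra hcon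
  push Not at hcon
  exact hx (abs_le.1 hcon.le)

theorem integrable (hv : IsPL h L v) : Integrable v :=
  hv.continuous.integrable_of_hasCompactSupport hv.hasCompactSupport

theorem integrable_mul (hv : IsPL h L v) (hw : IsPL h L w) : Integrable fun x => v x * w x :=
  (hv.continuous.mul hw.continuous).integrable_of_hasCompactSupport hv.hasCompactSupport.mul_right

theorem hasDerivAt (hv : IsPL h L v) {k : ℤ} {x : ℝ}
    (hx : x ∈ Ioo (k * h) ((k + 1) * h)) :
    HasDerivAt v ((v ((k + 1) * h) - v (k * h)) / h) x := by
  have h1 : HasDerivAt (fun x => v (k * h) + (v ((k + 1) * h) - v (k * h)) * ((x - k * h) / h))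
      ((v ((k + 1) * h) - v (k * h)) / h) x := by
    have := ((((hasDerivAt_id x).sub_const (k * h)).div_const h).const_mul
      (v ((k + 1) * h) - v (k * h))).const_add (v (k * h))
    exact this.congr_deriv (by ring)
  refine h1.congr_of_eventuallyEq ?_
  filter_upwards [isOpen_Ioo.mem_nhds hx] with y hy
  exact hv.affine k y ⟨hy.1.le, hy.2.le⟩

theorem differentiableAt (hh : 0 < h) (hv : IsPL h L v) {x : ℝ} (hx : x ∉ nodes h) :
    DifferentiableAt ℝ v x := by
  obtain ⟨k, hk⟩ := exists_mem_element hh x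
  refine (hv.hasDerivAt (k := k) ⟨lt_of_le_of_ne hk.1 fun h => hx ⟨k, h⟩, hk.2⟩).differentiableAt

theorem deriv_eq_zero (hv : IsPL h L v) {x : ℝ} (hx : L < |x|) : deriv v x = 0 := by
  have : v =ᶠ[𝓝 x] fun _ => 0 := by
    filter_upwards [(isOpen_lt continuous_const continuous_abs).mem_nhds hx] with y hy
    exact hv.zero y (le_of_lt hy)
  rw [this.deriv_eq]; simp

theorem integrable_deriv_mul_deriv (hv : IsPL h L v) (hw : IsPL h L w) :
    Integrable fun x => deriv v x * deriv w x := by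
  obtain ⟨C, hC⟩ := hv.lipschitz
  obtain ⟨D, hD⟩ := hw.lipschitz
  have h1 : IntegrableOn (fun x => deriv v x * deriv w x) (Icc (-L) L) := by
    refine Measure.integrableOn_of_bounded (M := C * D) (by simp)
      ((measurable_deriv v).mul (measurable_deriv w)).aestronglyMeasurable
      (Eventually.of_forall fun x => ?_)
    rw [norm_mul]
    exact mul_le_mul (norm_deriv_le_of_lipschitz hC) (norm_deriv_le_of_lipschitz hD)
      (norm_nonneg _) C.2
  rw [← integrable_indicator_iff measurableSet_Icc] at h1
  refine h1.congr (Eventually.of_forall fun x => ?_)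
  by_cases hx : x ∈ Icc (-L) L
  · simp [hx]
  · have : L < |x| := not_le.1 fun hle => hx (abs_le.1 hle)
    simp [hx, hv.deriv_eq_zero this]

theorem integral_deriv (hh : 0 < h) (hv : IsPL h L v) (α β : ℝ) :
    ∫ x in α..β, deriv v x = v β - v α := by
  obtain ⟨C, hC⟩ := hv.lipschitz
  refine integral_eq_of_hasDerivAt_off_countable v (deriv v) (countable_nodes h)
    hv.continuous.continuousOn (fun x hx => (hv.differentiableAt hh hx.2).hasDerivAt) ?_
  refine (intervalIntegrable_const (c := (C : ℝ))).mono_fun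
    (measurable_deriv v).aestronglyMeasurable.restrict (Eventually.of_forall fun x => ?_)
  simpa using norm_deriv_le_of_lipschitz hC

theorem deriv_add_ae (hh : 0 < h) (hv : IsPL h L v) (hw : IsPL h L w) :
    ∀ᵐ x : ℝ, deriv (v + w) x = deriv v x + deriv w x := by
  filter_upwards [ae_notMem_nodes h] with x hx
  exact deriv_add (hv.differentiableAt hh hx) (hw.differentiableAt hh hx)

theorem integral_deriv_add (hh : 0 < h) (hv : IsPL h L v) (hw : IsPL h L w) {u : ℝ → ℝ}
    (hu : IsPL h L u) : ∫ x, deriv (v + w) x * deriv u x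
      = (∫ x, deriv v x * deriv u x) + ∫ x, deriv w x * deriv u x := by
  rw [← integral_add (hv.integrable_deriv_mul_deriv hu) (hw.integrable_deriv_mul_deriv hu)]
  apply integral_congr_ae
  filter_upwards [hv.deriv_add_ae hh hw] with x hx
  rw [hx, add_mul]

theorem integral_deriv_smul (v u : ℝ → ℝ) (c : ℝ) : ∫ x, deriv (c • v) x * deriv u x
      = c * ∫ x, deriv v x * deriv u x := by
  rw [← integral_const_mul]
  congr 1 with x
  rw [deriv_const_smul_field]
  simp [mul_assoc]

theorem ext_nodes (hh : 0 < h) (hv : IsPL h L v) (hw : IsPL h L w)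
    (he : ∀ k : ℤ, |(k : ℝ) * h| < L → v (k * h) = w (k * h)) : v = w := by
  have he' : ∀ k : ℤ, v (k * h) = w (k * h) := by
    intro k
    rcases lt_or_ge |(k : ℝ) * h| L with hk | hk
    · exact he k hk
    · rw [hv.zero _ hk, hw.zero _ hk]
  ext x
  obtain ⟨k, hk⟩ := exists_mem_element hh x
  have e := he' (k + 1)
  push_cast at e
  rw [hv.affine k x ⟨hk.1, hk.2.le⟩, hw.affine k x ⟨hk.1, hk.2.le⟩, he' k, e]

end IsPL

/-- Integrals against a hat function. -/
theorem integral_mul_hat {h : ℝ} (hh : 0 < h) (j : ℤ) {g : ℝ → ℝ}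
    (hg : ∀ α β, IntervalIntegrable g volume α β) :
    ∫ x, g x * hat h j x = (∫ x in ((j - 1) * h)..(j * h), g x * ((x - (j - 1) * h) / h))
      + ∫ x in (j * h)..((j + 1) * h), g x * (((j + 1) * h - x) / h) := by
  have h1 : ∫ x, g x * hat h j x = ∫ x in ((j - 1) * h)..((j + 1) * h), g x * hat h j x := by
    rw [intervalIntegral.integral_of_le (by nlinarith), setIntegral_eq_integral_of_forall_compl_eq_zero]
    intro x hx
    rw [hat_eq_zero hh, mul_zero]
    by_contra hcon
    push Not at hcon
    exact hx ⟨hcon.1, hcon.2.le⟩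
  have hi : ∀ α β, IntervalIntegrable (fun x => g x * hat h j x) volume α β := fun α β =>
    (hg α β).mul_continuousOn (lipschitzWith_hat hh j).continuous.continuousOn
  rw [h1, ← intervalIntegral.integral_add_adjacent_intervals (hi _ (j * h)) (hi _ _)]
  congr 1
  · apply intervalIntegral.integral_congr
    intro x hx
    rw [uIcc_of_le (by nlinarith)] at hx
    simp only [hat_left hx]
  · apply intervalIntegral.integral_congr
    intro x hx
    rw [uIcc_of_le (by nlinarith)] at hx
    simp only [hat_right hh hx]

theorem integral_affine_mul (A B a h : ℝ) (hh : 0 < h) :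
    ∫ x in a..(a + h), (A + B * ((x - a) / h)) * ((x - a) / h) = h * (A / 2 + B / 3) := by
  have hd : ∀ x, HasDerivAt (fun x : ℝ => h * (A * ((x - a) / h) ^ 2 / 2 + B * ((x - a) / h) ^ 3 / 3))
      ((A + B * ((x - a) / h)) * ((x - a) / h)) x := by
    intro x
    have h0 : HasDerivAt (fun x : ℝ => (x - a) / h) (1 / h) x :=
      ((hasDerivAt_id x).sub_const a).div_const h
    have := ((((h0.pow 2).const_mul A).div_const 2).add
      (((h0.pow 3).const_mul B).div_const 3)).const_mul h
    refine this.congr_deriv ?_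
    push_cast
    field_simp
  rw [intervalIntegral.integral_eq_sub_of_hasDerivAt (fun x _ => hd x)
    (Continuous.intervalIntegrable (by fun_prop) _ _)]
  have : (a + h - a) / h = 1 := by rw [add_sub_cancel_left, div_self hh.ne']
  rw [this]; simp

/-- A row of the mass matrix, with weights 1, 4, 1 times h/6. Both elements adjacent to the node
reduce to the same integral of an affine function. -/
theorem IsPL.integral_mul_hat {h L : ℝ} (hh : 0 < h) {v : ℝ → ℝ} (hv : IsPL h L v) (j : ℤ) :
    ∫ x, v x * hat h j x = h / 6 * (v ((j - 1) * h) + 4 * v (j * h) + v ((j + 1) * h)) := by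
  rw [FracHeat.integral_mul_hat hh j fun α β => hv.continuous.intervalIntegrable α β]
  have e1 : ∫ x in ((j - 1) * h)..(j * h), v x * ((x - (j - 1) * h) / h)
      = h * (v ((j - 1) * h) / 2 + (v (j * h) - v ((j - 1) * h)) / 3) := by
    rw [← integral_affine_mul _ _ ((j - 1) * h) h hh, show ((j : ℝ) - 1) * h + h = j * h by ring]
    apply intervalIntegral.integral_congr
    intro x hx
    rw [uIcc_of_le (by nlinarith)] at hx
    have := hv.affine (j - 1) x (by push_cast; simpa using hx)
    push_cast at this
    rw [sub_add_cancel] at this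
    simp only [this]
  have e2 : ∫ x in (j * h)..((j + 1) * h), v x * (((j + 1) * h - x) / h)
      = h * (v ((j + 1) * h) / 2 + (v (j * h) - v ((j + 1) * h)) / 3) := by
    -- Reflection of the right element onto the left one.
    have e3 := intervalIntegral.integral_comp_sub_left (a := j * h) (b := (j + 1) * h)
      (fun y => (v ((j + 1) * h) + (v (j * h) - v ((j + 1) * h)) * ((y - 0) / h)) * ((y - 0) / h))
      ((j + 1) * h)
    rw [sub_self, show ((j : ℝ) + 1) * h - j * h = 0 + h by ring, integral_affine_mul _ _ _ _ hh]
      at e3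
    rw [← e3]
    apply intervalIntegral.integral_congr
    intro x hx
    rw [uIcc_of_le (by nlinarith)] at hx
    simp only [sub_zero]
    rw [hv.affine j x hx]
    congr 1
    field_simp
    ring
  rw [e1, e2]; ring

theorem hat_hasDerivAt {h : ℝ} (hh : 0 < h) (j : ℤ) {x : ℝ} (hx : x ∉ nodes h) :
    HasDerivAt (hat h j) (hatDeriv h j x) x := by
  obtain ⟨k, hk⟩ := exists_mem_element hh x
  have hk' : x ∈ Ioo (k * h) ((k + 1) * h) := ⟨lt_of_le_of_ne hk.1 fun h => hx ⟨k, h⟩, hk.2⟩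
  have hpl : IsPL h (|(j - 1) * h| + |(j + 1) * h|) (hat h j) := isPL_hat hh
    (by linarith [neg_abs_le (((j : ℝ) - 1) * h), abs_nonneg (((j : ℝ) + 1) * h)])
    (by linarith [le_abs_self (((j : ℝ) + 1) * h), abs_nonneg (((j : ℝ) - 1) * h)])
  refine (hpl.hasDerivAt hk').congr_deriv ?_
  have e : ((k : ℝ) + 1) * h = ((k + 1 : ℤ) : ℝ) * h := by push_cast; ring
  rw [hat_node hh, e, hat_node hh]
  unfold hatDeriv
  have m1 : x ∈ Ioc (((j : ℝ) - 1) * h) (j * h) ↔ k + 1 = j := by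
    constructor
    · rintro ⟨a, b⟩
      have a1 : ((j : ℝ) - 1) < k + 1 := lt_of_mul_lt_mul_right (a.trans hk'.2) hh.le
      have a2 : (k : ℝ) < j := lt_of_mul_lt_mul_right (hk'.1.trans_le b) hh.le
      have a1' : j - 1 < k + 1 := by exact_mod_cast a1
      have a2' : k < j := by exact_mod_cast a2
      lia
    · rintro rfl
      push_cast
      exact ⟨by simpa using hk'.1, hk'.2.le⟩
  have m2 : x ∈ Ioc ((j : ℝ) * h) ((j + 1) * h) ↔ k = j := by
    constructor
    · rintro ⟨a, b⟩
      have a1 : (j : ℝ) < k + 1 := lt_of_mul_lt_mul_right (a.trans hk'.2) hh.le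
      have a2 : (k : ℝ) < j + 1 := lt_of_mul_lt_mul_right (hk'.1.trans_le b) hh.le
      have a1' : j < k + 1 := by exact_mod_cast a1
      have a2' : k < j + 1 := by exact_mod_cast a2
      lia
    · rintro rfl
      exact ⟨hk'.1, hk'.2.le⟩
  simp only [indicator, m1, m2, Pi.one_apply]
  split_ifs <;> simp [neg_div]

/-- A row of the stiffness matrix. The slope of the hat function is constant on each element, so
only increments of v between neighbouring nodes remain. -/
theorem IsPL.integral_deriv_mul_deriv_hat {h L : ℝ} (hh : 0 < h) {v : ℝ → ℝ} (hv : IsPL h L v)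
    (j : ℤ) : ∫ x, deriv v x * deriv (hat h j) x
      = (2 * v (j * h) - v ((j - 1) * h) - v ((j + 1) * h)) / h := by
  obtain ⟨C, hC⟩ := hv.lipschitz
  have hi : ∀ α β : ℝ, IntegrableOn (deriv v) (Ioc α β) := fun α β =>
    Measure.integrableOn_of_bounded (M := C) (by simp)
      (measurable_deriv v).aestronglyMeasurable
      (Eventually.of_forall fun x => norm_deriv_le_of_lipschitz hC)
  have e : ∀ᵐ x : ℝ, deriv v x * deriv (hat h j) x
      = (1 / h) * (Ioc ((j - 1) * h) (j * h)).indicator (deriv v) x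
        - (1 / h) * (Ioc (j * h) ((j + 1) * h)).indicator (deriv v) x := by
    filter_upwards [ae_notMem_nodes h] with x hx
    rw [(hat_hasDerivAt hh j hx).deriv, hatDeriv, mul_sub]
    simp only [indicator, Pi.one_apply]
    split_ifs <;> ring
  rw [integral_congr_ae e, integral_sub, integral_const_mul, integral_const_mul,
    integral_indicator measurableSet_Ioc, integral_indicator measurableSet_Ioc,
    ← intervalIntegral.integral_of_le (by nlinarith),
    ← intervalIntegral.integral_of_le (by nlinarith), hv.integral_deriv hh, hv.integral_deriv hh]
  · ring
  · exact ((integrable_indicator_iff measurableSet_Ioc).2 (hi _ _)).const_mul _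
  · exact ((integrable_indicator_iff measurableSet_Ioc).2 (hi _ _)).const_mul _

/-! ### The finite element space and the discrete evolution -/

/-- When L is a multiple of h, the support condition selects exactly the interior nodes of the mesh.
-/
theorem tsupport_hat_subset_iff {h : ℝ} (hh : 0 < h) (N : ℕ) (j : ℤ) :
    tsupport (hat h j) ⊆ Icc (-(N * h)) (N * h) ↔ j ∈ Finset.Icc (-(N : ℤ) + 1) (N - 1) := by
  have hsupp : Ioo ((j - 1) * h) ((j + 1) * h) ⊆ Function.support (hat h j) := by
    intro x hx
    rw [Function.mem_support, hat_eq_max hh]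
    have : |x - j * h| / h < 1 := by
      rw [div_lt_one hh, abs_lt]; constructor <;> linarith [hx.1, hx.2]
    exact (lt_max_of_lt_right (by linarith)).ne'
  have hsupp' : Function.support (hat h j) ⊆ Icc ((j - 1) * h) ((j + 1) * h) := by
    intro x hx
    by_contra hcon
    apply hx
    apply hat_eq_zero hh
    by_contra h2
    push Not at h2
    exact hcon ⟨h2.1.le, h2.2.le⟩
  rw [Finset.mem_Icc]
  constructor
  · intro hs
    have h1 : Icc ((j - 1) * h) ((j + 1) * h) ⊆ Icc (-(N * h)) (N * h) := by
      rw [← closure_Ioo (by nlinarith : ((j : ℝ) - 1) * h ≠ (j + 1) * h)]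
      exact (closure_mono hsupp).trans hs
    have h2 := h1 (left_mem_Icc.2 (by nlinarith))
    have h3 := h1 (right_mem_Icc.2 (by nlinarith))
    have h4 : (-(N : ℝ)) * h ≤ (j - 1) * h := by linarith [h2.1]
    have h5 : -(N : ℝ) ≤ j - 1 := le_of_mul_le_mul_right h4 hh
    have h6 : (j : ℝ) + 1 ≤ N := le_of_mul_le_mul_right h3.2 hh
    have h5' : -(N : ℤ) ≤ j - 1 := by exact_mod_cast h5
    have h6' : j + 1 ≤ N := by exact_mod_cast h6
    lia
  · rintro ⟨h1, h2⟩
    refine (closure_minimal hsupp' isClosed_Icc).trans (Icc_subset_Icc ?_ ?_)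
    · have : -(N : ℝ) ≤ j - 1 := by exact_mod_cast (by lia : -(N : ℤ) ≤ j - 1)
      nlinarith
    · have : (j : ℝ) + 1 ≤ N := by exact_mod_cast (by lia : j + 1 ≤ (N : ℤ))
      nlinarith

theorem galerkinSpace_eq {h : ℝ} (hh : 0 < h) (N : ℕ) :
    galerkinSpace h (N * h)
      = Submodule.span ℝ (hat h '' (Finset.Icc (-(N : ℤ) + 1) (N - 1) : Finset ℤ)) := by
  unfold galerkinSpace
  congr 2
  ext j
  exact tsupport_hat_subset_iff hh N j

theorem isPL_hat_of_mem {h : ℝ} (hh : 0 < h) {N : ℕ} {j : ℤ}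
    (hj : j ∈ Finset.Icc (-(N : ℤ) + 1) (N - 1)) : IsPL h (N * h) (hat h j) := by
  obtain ⟨h1, h2⟩ := Finset.mem_Icc.1 hj
  apply isPL_hat hh
  · have : -(N : ℝ) ≤ j - 1 := by exact_mod_cast (by lia : -(N : ℤ) ≤ j - 1)
    nlinarith
  · have : (j : ℝ) + 1 ≤ N := by exact_mod_cast (by lia : j + 1 ≤ (N : ℤ))
    nlinarith

theorem abs_node_lt_iff {h : ℝ} (hh : 0 < h) (N : ℕ) (k : ℤ) :
    |(k : ℝ) * h| < N * h ↔ k ∈ Finset.Icc (-(N : ℤ) + 1) (N - 1) := by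
  rw [abs_mul, abs_of_pos hh, mul_lt_mul_iff_left₀ hh, Finset.mem_Icc, abs_lt]
  constructor
  · rintro ⟨a, b⟩
    have a' : -(N : ℤ) < k := by exact_mod_cast a
    have b' : k < N := by exact_mod_cast b
    lia
  · rintro ⟨a, b⟩
    exact ⟨by exact_mod_cast (by lia : -(N : ℤ) < k), by exact_mod_cast (by lia : k < (N : ℤ))⟩

/-- The function with given nodal values. -/
def nodalSum (h : ℝ) (N : ℕ) (c : ℤ → ℝ) : ℝ → ℝ :=
  ∑ j ∈ Finset.Icc (-(N : ℤ) + 1) (N - 1), c j • hat h j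

theorem isPL_nodalSum {h : ℝ} (hh : 0 < h) (N : ℕ) (c : ℤ → ℝ) :
    IsPL h (N * h) (nodalSum h N c) := by
  unfold nodalSum
  exact Finset.sum_induction _ _ (fun _ _ => IsPL.add) IsPL.zero_fun
    fun j hj => (isPL_hat_of_mem hh hj).smul _

theorem nodalSum_node {h : ℝ} (hh : 0 < h) {N : ℕ} (c : ℤ → ℝ) {k : ℤ}
    (hk : k ∈ Finset.Icc (-(N : ℤ) + 1) (N - 1)) : nodalSum h N c (k * h) = c k := by
  simp only [nodalSum, Finset.sum_apply, Pi.smul_apply, smul_eq_mul, hat_node hh]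
  rw [Finset.sum_eq_single k]
  · simp
  · intro b _ hb; simp [hb.symm]
  · exact fun h => absurd hk h

theorem IsPL.eq_nodalSum {h : ℝ} (hh : 0 < h) {N : ℕ} {v : ℝ → ℝ} (hv : IsPL h (N * h) v) :
    v = nodalSum h N (fun j => v (j * h)) :=
  hv.ext_nodes hh (isPL_nodalSum hh N _) fun k hk => by
    rw [nodalSum_node hh _ ((abs_node_lt_iff hh N k).1 hk)]

theorem nodalSum_mem {h : ℝ} (hh : 0 < h) (N : ℕ) (c : ℤ → ℝ) :
    nodalSum h N c ∈ galerkinSpace h (N * h) := by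
  rw [galerkinSpace_eq hh]
  exact Submodule.sum_mem _ fun j hj =>
    Submodule.smul_mem _ _ (Submodule.subset_span (mem_image_of_mem _ (Finset.mem_coe.2 hj)))

/-- A piecewise linear function is recovered from its interior nodal values, so the span can be
handled through `IsPL` without choosing coordinates. -/
theorem mem_galerkinSpace_iff {h : ℝ} (hh : 0 < h) {N : ℕ} {v : ℝ → ℝ} :
    v ∈ galerkinSpace h (N * h) ↔ IsPL h (N * h) v := by
  constructor
  · intro hv
    rw [galerkinSpace_eq hh] at hv
    induction hv using Submodule.span_induction with
    | mem x hx =>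
      obtain ⟨j, hj, rfl⟩ := hx
      exact isPL_hat_of_mem hh (Finset.mem_coe.1 hj)
    | zero => exact IsPL.zero_fun
    | add x y _ _ hx hy => exact hx.add hy
    | smul a x _ hx => exact hx.smul a
  · intro hv
    rw [hv.eq_nodalSum hh]
    exact nodalSum_mem hh N _

theorem finiteDimensional_galerkinSpace {h : ℝ} (hh : 0 < h) (N : ℕ) :
    FiniteDimensional ℝ (galerkinSpace h (N * h)) := by
  rw [galerkinSpace_eq hh]
  exact FiniteDimensional.span_of_finite ℝ ((Finset.finite_toSet _).image _)

theorem hat_mem_galerkinSpace {h : ℝ} (hh : 0 < h) {N : ℕ} {j : ℤ}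
    (hj : j ∈ Finset.Icc (-(N : ℤ) + 1) (N - 1)) : hat h j ∈ galerkinSpace h (N * h) :=
  (mem_galerkinSpace_iff hh).2 (isPL_hat_of_mem hh hj)

/-- The bilinear form of an implicit Euler step. -/
def eulerForm {h : ℝ} (hh : 0 < h) (N : ℕ) (α : ℝ) :
    galerkinSpace h (N * h) →ₗ[ℝ] Module.Dual ℝ (galerkinSpace h (N * h)) :=
  LinearMap.mk₂ ℝ (fun v φ => α * (∫ x, (v : ℝ → ℝ) x * (φ : ℝ → ℝ) x)
      + ∫ x, deriv (v : ℝ → ℝ) x * deriv (φ : ℝ → ℝ) x)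
    (fun v w φ => by
      have hv := (mem_galerkinSpace_iff hh).1 v.2
      have hw := (mem_galerkinSpace_iff hh).1 w.2
      have hφ := (mem_galerkinSpace_iff hh).1 φ.2
      simp only [Submodule.coe_add, Pi.add_apply, add_mul]
      rw [integral_add (hv.integrable_mul hφ) (hw.integrable_mul hφ),
        hv.integral_deriv_add hh hw hφ]
      ring)
    (fun c v φ => by
      simp only [Submodule.coe_smul, Pi.smul_apply, smul_eq_mul, mul_assoc]
      rw [integral_const_mul, IsPL.integral_deriv_smul]
      ring)
    (fun v φ ψ => by
      have hv := (mem_galerkinSpace_iff hh).1 v.2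
      have hφ := (mem_galerkinSpace_iff hh).1 φ.2
      have hψ := (mem_galerkinSpace_iff hh).1 ψ.2
      simp only [Submodule.coe_add, Pi.add_apply, mul_add]
      rw [integral_add (hv.integrable_mul hφ) (hv.integrable_mul hψ)]
      simp only [mul_comm (deriv (v : ℝ → ℝ) _)]
      rw [hφ.integral_deriv_add hh hψ hv]
      ring)
    (fun c v φ => by
      simp only [Submodule.coe_smul, Pi.smul_apply, smul_eq_mul, mul_left_comm _ c]
      rw [integral_const_mul]
      simp only [mul_comm (deriv (v : ℝ → ℝ) _)]
      rw [IsPL.integral_deriv_smul]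
      ring)

theorem eulerForm_apply {h : ℝ} (hh : 0 < h) (N : ℕ) (α : ℝ) (v φ : galerkinSpace h (N * h)) :
    eulerForm hh N α v φ = α * (∫ x, (v : ℝ → ℝ) x * (φ : ℝ → ℝ) x)
      + ∫ x, deriv (v : ℝ → ℝ) x * deriv (φ : ℝ → ℝ) x := rfl

/-- Testing with v itself shows that the form is positive definite, since the mass term alone
controls v; finite dimension turns injectivity into bijectivity. -/
theorem eulerForm_bijective {h : ℝ} (hh : 0 < h) (N : ℕ) {α : ℝ} (hα : 0 < α) :
    Function.Bijective (eulerForm hh N α) := by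
  have := finiteDimensional_galerkinSpace hh N
  have hinj : Function.Injective (eulerForm hh N α) := by
    rw [injective_iff_map_eq_zero]
    intro v hv
    have hpl := (mem_galerkinSpace_iff hh).1 v.2
    have h0 : eulerForm hh N α v v = 0 := by rw [hv]; rfl
    rw [eulerForm_apply] at h0
    have h1 : 0 ≤ ∫ x, deriv (v : ℝ → ℝ) x * deriv (v : ℝ → ℝ) x :=
      integral_nonneg fun x => mul_self_nonneg _
    have h2 : 0 ≤ ∫ x, (v : ℝ → ℝ) x * (v : ℝ → ℝ) x := integral_nonneg fun x => mul_self_nonneg _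
    have h3 : ∫ x, (v : ℝ → ℝ) x * (v : ℝ → ℝ) x = 0 := by nlinarith
    rw [integral_eq_zero_iff_of_nonneg (fun x => mul_self_nonneg _) (hpl.integrable_mul hpl)] at h3
    have h4 := (hpl.continuous.mul hpl.continuous).ae_eq_iff_eq volume continuous_const |>.1 h3
    ext x
    exact mul_self_eq_zero.1 (congrFun h4 x)
  exact ⟨hinj, (LinearMap.injective_iff_surjective_of_finrank_eq_finrank
    Subspace.dual_finrank_eq.symm).1 hinj⟩

/-- `v` is the implicit Euler evolution in the finite element space, with right-hand sides `b`. -/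
def IsEvolution (h : ℝ) (N M : ℕ) (α : ℝ) (b : ℕ → (ℝ → ℝ) → ℝ) (v : Fin (M + 1) → ℝ → ℝ) : Prop :=
  v 0 = 0 ∧ (∀ i, v i ∈ galerkinSpace h (N * h)) ∧
    ∀ i : Fin M, ∀ φ ∈ galerkinSpace h (N * h),
      α * (∫ x, (v i.succ x - v i.castSucc x) * φ x) + ∫ x, deriv (v i.succ) x * deriv φ x = b i φ

/-- Linearity of a functional on the finite element space. -/
def LinearOnSpace (h : ℝ) (N : ℕ) (b : (ℝ → ℝ) → ℝ) : Prop :=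
  ∃ B : Module.Dual ℝ (galerkinSpace h (N * h)), ∀ φ : galerkinSpace h (N * h), b φ = B φ

theorem euler_step_iff {h : ℝ} (hh : 0 < h) (N : ℕ) (α : ℝ) (v w φ : galerkinSpace h (N * h))
    (β : ℝ) :
    α * (∫ x, ((v : ℝ → ℝ) x - (w : ℝ → ℝ) x) * (φ : ℝ → ℝ) x)
      + ∫ x, deriv (v : ℝ → ℝ) x * deriv (φ : ℝ → ℝ) x = β ↔
    eulerForm hh N α v φ = β + α * ∫ x, (w : ℝ → ℝ) x * (φ : ℝ → ℝ) x := by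
  have hv := (mem_galerkinSpace_iff hh).1 v.2
  have hw := (mem_galerkinSpace_iff hh).1 w.2
  have hφ := (mem_galerkinSpace_iff hh).1 φ.2
  simp only [sub_mul, eulerForm_apply]
  rw [integral_sub (hv.integrable_mul hφ) (hw.integrable_mul hφ)]
  constructor <;> intro h <;> linarith

/-- Each step is one uniquely solvable linear system, so the recursion both constructs the evolution
and forces it. -/
theorem exists_unique_evolution {h : ℝ} (hh : 0 < h) (N M : ℕ) {α : ℝ} (hα : 0 < α)
    {b : ℕ → (ℝ → ℝ) → ℝ} (hb : ∀ i, LinearOnSpace h N (b i)) :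
    ∃ G : Fin (M + 1) → ℝ → ℝ, ∀ v, IsEvolution h N M α b v ↔ v = G := by
  choose B hB using hb
  have hstep : ∀ (i : ℕ) (w : galerkinSpace h (N * h)), ∃ v : galerkinSpace h (N * h),
      ∀ φ : galerkinSpace h (N * h), eulerForm hh N α v φ
        = b i φ + α * ∫ x, (w : ℝ → ℝ) x * (φ : ℝ → ℝ) x := by
    intro i w
    -- The difference of the forms with parameters α and 0 isolates the mass term α⟨w, ·⟩ as a
    -- linear functional.
    obtain ⟨v, hv⟩ := (eulerForm_bijective hh N hα).2 (B i + (eulerForm hh N α w - eulerForm hh N 0 w))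
    refine ⟨v, fun φ => ?_⟩
    rw [hv, LinearMap.add_apply, LinearMap.sub_apply, ← hB, eulerForm_apply, eulerForm_apply]
    ring
  choose S hS using hstep
  set g : ℕ → galerkinSpace h (N * h) := fun i => Nat.rec 0 (fun i w => S i w) i with hg
  refine ⟨fun i => (g i : ℝ → ℝ), fun v => ⟨?_, ?_⟩⟩
  · rintro ⟨h0, hmem, heq⟩
    have : ∀ i : ℕ, ∀ hi : i < M + 1, v ⟨i, hi⟩ = g i := by
      intro i
      induction i with
      | zero => intro hi; rw [show (⟨0, hi⟩ : Fin (M + 1)) = 0 from rfl, h0]; rfl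
      | succ i ih =>
        intro hi
        have ih' := ih (by lia)
        have hiM : i < M := by lia
        have e : (⟨v ⟨i + 1, hi⟩, hmem _⟩ : galerkinSpace h (N * h)) = g (i + 1) := by
          apply (eulerForm_bijective hh N hα).1
          ext φ
          rw [show g (i + 1) = S i (g i) from rfl, hS]
          refine (euler_step_iff hh N α ⟨v ⟨i + 1, hi⟩, hmem _⟩ (g i) φ _).1 ?_
          have := heq ⟨i, hiM⟩ φ φ.2
          rw [show (⟨i, hiM⟩ : Fin M).castSucc = ⟨i, by lia⟩ from rfl, ih'] at this
          exact this
        exact congrArg Subtype.val e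
    ext i : 1
    exact this i i.2
  · rintro rfl
    refine ⟨rfl, fun i => (g i).2, fun i φ hφ => ?_⟩
    refine (euler_step_iff hh N α (g (i + 1)) (g i) ⟨φ, hφ⟩ _).2 ?_
    exact hS i (g i) ⟨φ, hφ⟩

theorem IsEvolution.congr {h : ℝ} {N M : ℕ} {α : ℝ} {b b' : ℕ → (ℝ → ℝ) → ℝ}
    (hb : ∀ i < M, ∀ φ ∈ galerkinSpace h (N * h), b i φ = b' i φ) (v : Fin (M + 1) → ℝ → ℝ) :
    IsEvolution h N M α b v ↔ IsEvolution h N M α b' v := by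
  unfold IsEvolution
  refine and_congr_right fun _ => and_congr_right fun _ => forall_congr' fun i =>
    forall_congr' fun φ => forall_congr' fun hφ => ?_
  rw [hb i i.2 φ hφ]

/-- Passage between the weak formulation, tested against the whole space, and one equation per
interior node. -/
theorem eq_on_galerkinSpace {h : ℝ} (hh : 0 < h) {N : ℕ} {b b' : (ℝ → ℝ) → ℝ}
    (hb : LinearOnSpace h N b) (hb' : LinearOnSpace h N b')
    (he : ∀ j ∈ Finset.Icc (-(N : ℤ) + 1) (N - 1), b (hat h j) = b' (hat h j)) :
    ∀ φ ∈ galerkinSpace h (N * h), b φ = b' φ := by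
  obtain ⟨B, hB⟩ := hb
  obtain ⟨B', hB'⟩ := hb'
  intro φ hφ
  have e : (⟨φ, hφ⟩ : galerkinSpace h (N * h)) = ∑ j ∈ (Finset.Icc (-(N : ℤ) + 1) (N - 1)).attach,
      φ (j * h) • ⟨hat h j, hat_mem_galerkinSpace hh j.2⟩ := by
    apply Subtype.ext
    have h1 := ((mem_galerkinSpace_iff hh).1 hφ).eq_nodalSum hh
    simp only [AddSubmonoidClass.coe_finsetSum, SetLike.mk_smul_mk]
    rw [Finset.sum_attach (Finset.Icc (-(N : ℤ) + 1) (N - 1)) (fun j => φ (j * h) • hat h j)]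
    exact h1
  have h2 : B ⟨φ, hφ⟩ = B' ⟨φ, hφ⟩ := by
    rw [e, map_sum, map_sum]
    refine Finset.sum_congr rfl fun j _ => ?_
    rw [map_smul, map_smul, ← hB, ← hB']
    simp only [he j j.2]
  exact (hB ⟨φ, hφ⟩).trans (h2.trans (hB' ⟨φ, hφ⟩).symm)

theorem linearOnSpace_nodal {h : ℝ} {N : ℕ} (s : Finset ℤ) (δ : ℤ → ℝ) :
    LinearOnSpace h N (fun φ => ∑ j ∈ s, δ j * φ (j * h)) :=
  ⟨{ toFun := fun φ => ∑ j ∈ s, δ j * (φ : ℝ → ℝ) (j * h)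
     map_add' := fun φ ψ => by simp [mul_add, Finset.sum_add_distrib]
     map_smul' := fun c φ => by simp [Finset.mul_sum, mul_left_comm] }, fun _ => rfl⟩

theorem linearOnSpace_euler {h : ℝ} (hh : 0 < h) {N : ℕ} (α : ℝ) {v w : ℝ → ℝ}
    (hv : v ∈ galerkinSpace h (N * h)) (hw : w ∈ galerkinSpace h (N * h)) :
    LinearOnSpace h N (fun φ => α * (∫ x, (v x - w x) * φ x) + ∫ x, deriv v x * deriv φ x) :=
  ⟨eulerForm hh N α ⟨v, hv⟩ - (eulerForm hh N α ⟨w, hw⟩ - eulerForm hh N 0 ⟨w, hw⟩), fun φ => by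
    have hv' := (mem_galerkinSpace_iff hh).1 hv
    have hw' := (mem_galerkinSpace_iff hh).1 hw
    have hφ := (mem_galerkinSpace_iff hh).1 φ.2
    simp only [LinearMap.sub_apply, eulerForm_apply, sub_mul]
    rw [integral_sub (hv'.integrable_mul hφ) (hw'.integrable_mul hφ)]
    ring⟩

/-! ### The noise as a right-hand side, and the fully discrete scheme -/

theorem mem_cell_iff (n : ℕ) (k : ℤ) (x : ℝ) :
    x ∈ Ico ((k : ℝ) / 2 ^ n) ((k + 1) / 2 ^ n) ↔ ⌊(2 : ℝ) ^ n * x⌋ = k := by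
  rw [Int.floor_eq_iff, mem_Ico, div_le_iff₀ (by positivity), lt_div_iff₀ (by positivity), mul_comm]

theorem noiseField_eq (n : ℕ) (a : ℤ → ℤ → ℝ) (s x : ℝ) :
    noiseField n a s x = if ⌊(2 : ℝ) ^ n * s⌋ ∈ Ico (0 : ℤ) (2 ^ n) ∧
      ⌊(2 : ℝ) ^ n * x⌋ ∈ Ico (-2 ^ (2 * n) : ℤ) (2 ^ (2 * n))
        then a ⌊(2 : ℝ) ^ n * s⌋ ⌊(2 : ℝ) ^ n * x⌋ else 0 := by
  unfold noiseField
  simp only [indicator, mem_cell_iff, Pi.one_apply, mul_ite, mul_one, mul_zero,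
    Finset.sum_ite_eq, Finset.mem_Ico]
  by_cases hx : -2 ^ (2 * n) ≤ ⌊(2 : ℝ) ^ n * x⌋ ∧ ⌊(2 : ℝ) ^ n * x⌋ < 2 ^ (2 * n)
  · simp only [hx, and_self, if_true, Finset.sum_ite_eq, Finset.mem_Ico, mem_Ico, and_true]
  · simp only [mem_Ico, hx, and_false, if_false, Finset.sum_const_zero]

theorem integral_noiseField_mul (n : ℕ) (a : ℤ → ℤ → ℝ) (s : ℝ) {φ : ℝ → ℝ} (hφ : Integrable φ) :
    ∫ x, noiseField n a s x * φ x
      = ∑ k ∈ Finset.Ico (0 : ℤ) (2 ^ n), ∑ l ∈ Finset.Ico (-2 ^ (2 * n) : ℤ) (2 ^ (2 * n)),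
        (Ico ((k : ℝ) / 2 ^ n) ((k + 1) / 2 ^ n)).indicator 1 s
          * (a k l * ∫ x in Ico ((l : ℝ) / 2 ^ n) ((l + 1) / 2 ^ n), φ x) := by
  simp_rw [noiseField, Finset.sum_mul]
  have e : ∀ (x : ℝ) (k l : ℤ),
      a k l * (Ico ((k : ℝ) / 2 ^ n) ((k + 1) / 2 ^ n)).indicator 1 s
        * (Ico ((l : ℝ) / 2 ^ n) ((l + 1) / 2 ^ n)).indicator 1 x * φ x
      = (Ico ((k : ℝ) / 2 ^ n) ((k + 1) / 2 ^ n)).indicator 1 s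
        * (a k l * (Ico ((l : ℝ) / 2 ^ n) ((l + 1) / 2 ^ n)).indicator φ x) := by
    intro x k l
    by_cases h : x ∈ Ico ((l : ℝ) / 2 ^ n) ((l + 1) / 2 ^ n)
    · simp only [indicator_of_mem h, Pi.one_apply]; ring
    · simp only [indicator_of_notMem h]; ring
  simp_rw [e]
  have hi : ∀ k l : ℤ, Integrable (fun x => (Ico ((k : ℝ) / 2 ^ n) ((k + 1) / 2 ^ n)).indicator 1 s
        * (a k l * (Ico ((l : ℝ) / 2 ^ n) ((l + 1) / 2 ^ n)).indicator φ x)) := fun k l =>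
    ((hφ.indicator measurableSet_Ico).const_mul _).const_mul _
  rw [integral_finsetSum _ fun k _ => integrable_finsetSum _ fun l _ => hi k l]
  refine Finset.sum_congr rfl fun k _ => ?_
  rw [integral_finsetSum _ fun l _ => hi k l]
  refine Finset.sum_congr rfl fun l _ => ?_
  rw [integral_const_mul, integral_const_mul, integral_indicator measurableSet_Ico]

/-- The right-hand side of the Galerkin scheme. -/
def noiseRhs (n : ℕ) (a : ℤ → ℤ → ℝ) (m i : ℕ) (φ : ℝ → ℝ) : ℝ :=
  2 ^ m * ∫ s in ((i : ℕ) / 2 ^ m : ℝ)..(((i : ℕ) + 1) / 2 ^ m : ℝ),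
    ∫ x, noiseField n a s x * φ x

theorem intervalIntegrable_noise (n : ℕ) (a : ℤ → ℤ → ℝ) {φ : ℝ → ℝ} (hφ : Integrable φ) (α β : ℝ) :
    IntervalIntegrable (fun s => ∫ x, noiseField n a s x * φ x) volume α β := by
  simp_rw [integral_noiseField_mul n a _ hφ]
  have h1 : ∀ c d q : ℝ, IntervalIntegrable (fun s => (Ico c d).indicator (1 : ℝ → ℝ) s * q)
      volume α β := by
    intro c d q
    apply IntervalIntegrable.mul_const
    refine (intervalIntegrable_const (c := (1 : ℝ))).mono_fun
      (measurable_one.indicator measurableSet_Ico).aestronglyMeasurable.restrict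
      (Eventually.of_forall fun s => ?_)
    by_cases h : s ∈ Ico c d <;> simp [h]
  have h2 := IntervalIntegrable.sum (Finset.Ico (0 : ℤ) (2 ^ n)) (f := fun k s =>
      ∑ l ∈ Finset.Ico (-2 ^ (2 * n) : ℤ) (2 ^ (2 * n)),
        (Ico ((k : ℝ) / 2 ^ n) ((k + 1) / 2 ^ n)).indicator (1 : ℝ → ℝ) s
          * (a k l * ∫ x in Ico ((l : ℝ) / 2 ^ n) ((l + 1) / 2 ^ n), φ x))
      (μ := volume) (a := α) (b := β) (fun k _ => by
        have := IntervalIntegrable.sum (Finset.Ico (-2 ^ (2 * n) : ℤ) (2 ^ (2 * n)))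
          (f := fun l s => (Ico ((k : ℝ) / 2 ^ n) ((k + 1) / 2 ^ n)).indicator (1 : ℝ → ℝ) s
          * (a k l * ∫ x in Ico ((l : ℝ) / 2 ^ n) ((l + 1) / 2 ^ n), φ x))
          (μ := volume) (a := α) (b := β) (fun l _ => h1 _ _ _)
        simpa only [Finset.sum_fn] using this)
  simpa only [Finset.sum_fn] using h2

theorem integrable_noiseField_mul (n : ℕ) (a : ℤ → ℤ → ℝ) (s : ℝ) {φ : ℝ → ℝ} (hφ : Integrable φ) :
    Integrable fun x => noiseField n a s x * φ x := by
  simp_rw [noiseField, Finset.sum_mul]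
  refine integrable_finsetSum _ fun k _ => integrable_finsetSum _ fun l _ => ?_
  have := (hφ.indicator (measurableSet_Ico (a := (l : ℝ) / 2 ^ n) (b := (l + 1) / 2 ^ n))).const_mul
    (a k l * (Ico ((k : ℝ) / 2 ^ n) ((k + 1) / 2 ^ n)).indicator 1 s)
  refine this.congr (Eventually.of_forall fun x => ?_)
  by_cases h : x ∈ Ico ((l : ℝ) / 2 ^ n) ((l + 1) / 2 ^ n) <;> simp [h]

theorem linearOnSpace_noiseRhs {h : ℝ} (hh : 0 < h) (N n : ℕ) (a : ℤ → ℤ → ℝ) (m i : ℕ) :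
    LinearOnSpace h N (noiseRhs n a m i) := by
  refine ⟨{ toFun := fun φ => noiseRhs n a m i φ, map_add' := fun φ ψ => ?_,
            map_smul' := fun c φ => ?_ }, fun _ => rfl⟩
  · have hφ := ((mem_galerkinSpace_iff hh).1 φ.2).integrable
    have hψ := ((mem_galerkinSpace_iff hh).1 ψ.2).integrable
    unfold noiseRhs
    rw [← mul_add, ← intervalIntegral.integral_add (intervalIntegrable_noise n a hφ _ _)
      (intervalIntegrable_noise n a hψ _ _)]
    congr 2 with s
    rw [← integral_add (integrable_noiseField_mul n a s hφ) (integrable_noiseField_mul n a s hψ)]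
    simp [mul_add]
  · unfold noiseRhs
    simp only [Submodule.coe_smul, Pi.smul_apply, smul_eq_mul, RingHom.id_apply, mul_left_comm _ c,
      integral_const_mul, intervalIntegral.integral_const_mul]

theorem isGalerkinApprox_iff_isEvolution {h : ℝ} (N m n : ℕ) (a : ℤ → ℤ → ℝ)
    (v : Fin (2 ^ m + 1) → ℝ → ℝ) :
    IsGalerkinApprox h (N * h) m (heatConv (noiseField n a)) v ↔
      IsEvolution h N (2 ^ m) (2 ^ m) (noiseRhs n a m) v :=
  isGalerkinApprox_iff h (N * h) m n a v

/-- The mesh of the scheme. -/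
def schemeN (n : ℕ) : ℕ := 2 ^ (3 * n + 1)

/-- The right-hand side of the fully discrete scheme. -/
def schemeRhs (n : ℕ) (q : ℤ → ℤ → ℝ) (i : ℕ) (φ : ℝ → ℝ) : ℝ :=
  ∑ j ∈ Finset.Icc (-(schemeN n : ℤ) + 1) (schemeN n - 1),
    schemeNoise n q i j * φ (j * (1 / 2 ^ (2 * n)))

/-- The difference equation of the scheme, with vanishing values at the boundary. -/
theorem isScheme_iff {n : ℕ} (q : ℤ → ℤ → ℝ) (v : Fin (2 ^ (4 * n) + 1) → ℝ → ℝ) :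
    IsScheme n q v ↔ v 0 = 0 ∧ (∀ i, IsPL (1 / 2 ^ (2 * n)) (schemeN n * (1 / 2 ^ (2 * n))) (v i)) ∧
      ∀ i : Fin (2 ^ (4 * n)), ∀ j ∈ Finset.Icc (-(schemeN n : ℤ) + 1) (schemeN n - 1),
        4 * v i.succ (j * (1 / 2 ^ (2 * n)))
            - 5 / 4 * (v i.succ ((j + 1) * (1 / 2 ^ (2 * n))) + v i.succ ((j - 1) * (1 / 2 ^ (2 * n))))
          = v i.castSucc (j * (1 / 2 ^ (2 * n)))
            + 1 / 4 * (v i.castSucc ((j - 1) * (1 / 2 ^ (2 * n)))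
              + v i.castSucc ((j + 1) * (1 / 2 ^ (2 * n))))
            + 3 / 2 ^ (2 * n + 1) * schemeNoise n q i j := by
  have hh : (0 : ℝ) < 1 / 2 ^ (2 * n) := by positivity
  set h : ℝ := 1 / 2 ^ (2 * n) with hh_def
  have hN : (2 : ℤ) ^ (3 * n + 1) = (schemeN n : ℤ) := by simp [schemeN]
  -- There must be more than one interior node: otherwise the two boundary equations of the scheme
  -- would concern the same node and refer to coefficients outside the domain.
  have hN2 : 2 ≤ (schemeN n : ℤ) := by
    rw [← hN]; exact_mod_cast (show 2 ≤ 2 ^ (3 * n + 1) from by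
      calc 2 = 2 ^ 1 := rfl
        _ ≤ 2 ^ (3 * n + 1) := Nat.pow_le_pow_right (by norm_num) (by lia))
  set N := schemeN n
  have hcast : ∀ j : ℤ, ((j : ℝ) + 1) * h = ((j + 1 : ℤ) : ℝ) * h := fun j => by push_cast; ring
  have hcast' : ∀ j : ℤ, ((j : ℝ) - 1) * h = ((j - 1 : ℤ) : ℝ) * h := fun j => by push_cast; ring
  unfold IsScheme
  simp only [hN]
  constructor
  · rintro ⟨c, hc0, hc, hv⟩
    have hv' : ∀ i, v i = nodalSum h N (c i) := by
      intro i; ext x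
      rw [hv i x]; simp [nodalSum, h]
    have hpl : ∀ i, IsPL h (N * h) (v i) := fun i => by rw [hv' i]; exact isPL_nodalSum hh N _
    have hnode : ∀ i, ∀ k ∈ Finset.Icc (-(N : ℤ) + 1) (N - 1), v i (k * h) = c i k := by
      intro i k hk; rw [hv' i, nodalSum_node hh _ hk]
    have hzN : ∀ i, v i (((N : ℤ) : ℝ) * h) = 0 := fun i => (hpl i).zero _ (by
      rw [abs_of_nonneg (by positivity)]; simp)
    have hzN' : ∀ i, v i (((-(N : ℤ) : ℤ) : ℝ) * h) = 0 := fun i => (hpl i).zero _ (by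
      push_cast; rw [neg_mul, abs_neg, abs_of_nonneg (by positivity)])
    refine ⟨?_, hpl, ?_⟩
    · rw [hv' 0]; ext x; simp [nodalSum, hc0]
    · intro i j hj
      obtain ⟨e1, e2, e3⟩ := hc i
      obtain ⟨hj1, hj2⟩ := Finset.mem_Icc.1 hj
      rw [hcast, hcast']
      rcases eq_or_lt_of_le hj1 with hl | hl
      · have hjm : j - 1 = -(N : ℤ) := by lia
        rw [hjm, hzN', hzN', hnode _ _ hj, hnode _ _ hj, ← hl]
        rcases eq_or_lt_of_le hj2 with hr | hr
        · exfalso; lia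
        · rw [show -(N : ℤ) + 1 + 1 = -N + 2 by ring,
            hnode _ (-(N : ℤ) + 2) (Finset.mem_Icc.2 ⟨by lia, by lia⟩),
            hnode _ (-(N : ℤ) + 2) (Finset.mem_Icc.2 ⟨by lia, by lia⟩)]
          linarith [e1]
      · rcases eq_or_lt_of_le hj2 with hr | hr
        · have hjm : j + 1 = (N : ℤ) := by lia
          rw [hjm, hzN, hzN, hnode _ _ hj, hnode _ _ hj, hr,
            show (N : ℤ) - 1 - 1 = N - 2 by ring,
            hnode _ ((N : ℤ) - 2) (Finset.mem_Icc.2 ⟨by lia, by lia⟩),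
            hnode _ ((N : ℤ) - 2) (Finset.mem_Icc.2 ⟨by lia, by lia⟩)]
          linarith [e3]
        · rw [hnode _ _ hj, hnode _ _ hj,
            hnode _ (j + 1) (Finset.mem_Icc.2 ⟨by lia, by lia⟩),
            hnode _ (j + 1) (Finset.mem_Icc.2 ⟨by lia, by lia⟩),
            hnode _ (j - 1) (Finset.mem_Icc.2 ⟨by lia, by lia⟩),
            hnode _ (j - 1) (Finset.mem_Icc.2 ⟨by lia, by lia⟩)]
          exact e2 j ⟨by lia, by lia⟩
  · rintro ⟨h0, hpl, heq⟩
    have hzN : ∀ i, v i (((N : ℤ) : ℝ) * h) = 0 := fun i => (hpl i).zero _ (by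
      rw [abs_of_nonneg (by positivity)]; simp)
    have hzN' : ∀ i, v i (((-(N : ℤ) : ℤ) : ℝ) * h) = 0 := fun i => (hpl i).zero _ (by
      push_cast; rw [neg_mul, abs_neg, abs_of_nonneg (by positivity)])
    refine ⟨fun i j => v i (j * h), fun j => by simp [h0], fun i => ⟨?_, ?_, ?_⟩, fun i x => ?_⟩
    · have e := heq i (-(N : ℤ) + 1) (Finset.mem_Icc.2 ⟨by lia, by lia⟩)
      rw [hcast, hcast', show -(N : ℤ) + 1 - 1 = -N by ring, hzN', hzN',
        show -(N : ℤ) + 1 + 1 = -N + 2 by ring] at e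
      linarith [e]
    · intro j hj
      have e := heq i j (Finset.mem_Icc.2 ⟨by linarith [hj.1], by linarith [hj.2]⟩)
      rw [hcast, hcast'] at e
      exact e
    · have e := heq i ((N : ℤ) - 1) (Finset.mem_Icc.2 ⟨by lia, by lia⟩)
      rw [hcast, hcast', show (N : ℤ) - 1 + 1 = N by ring, hzN, hzN,
        show (N : ℤ) - 1 - 1 = N - 2 by ring] at e
      linarith [e]
    · conv_lhs => rw [(hpl i).eq_nodalSum hh]
      simp [nodalSum, h]

/-- The time step is h² with h = 2^{-2n}, so mass and stiffness carry the same power of h. Mass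
weights (1, 4, 1)/6 and stiffness weights (-1, 2, -1) add up to (2/3)(-5/4, 4, -5/4), and the old
values keep (2/3)(1/4, 1, 1/4). Division by 2/(3h) gives the coefficients of the recursion and the
factor 3h/2 in front of the noise. -/
theorem isScheme_iff_isEvolution {n : ℕ} (q : ℤ → ℤ → ℝ) (v : Fin (2 ^ (4 * n) + 1) → ℝ → ℝ) :
    IsScheme n q v ↔
      IsEvolution (1 / 2 ^ (2 * n)) (schemeN n) (2 ^ (4 * n)) (2 ^ (4 * n)) (schemeRhs n q) v := by
  have hh : (0 : ℝ) < 1 / 2 ^ (2 * n) := by positivity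
  rw [isScheme_iff]
  unfold IsEvolution
  simp only [mem_galerkinSpace_iff hh]
  refine and_congr_right fun _ => and_congr_right fun hpl => forall_congr' fun i => ?_
  have hlin := linearOnSpace_euler hh (N := schemeN n) (2 ^ (4 * n))
    ((mem_galerkinSpace_iff hh).2 (hpl i.succ)) ((mem_galerkinSpace_iff hh).2 (hpl i.castSucc))
  have hlin' : LinearOnSpace (1 / 2 ^ (2 * n)) (schemeN n) (schemeRhs n q i) :=
    linearOnSpace_nodal _ _
  have key : ∀ j ∈ Finset.Icc (-(schemeN n : ℤ) + 1) (schemeN n - 1),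
      (2 ^ (4 * n) * (∫ x, (v i.succ x - v i.castSucc x) * hat (1 / 2 ^ (2 * n)) j x)
        + ∫ x, deriv (v i.succ) x * deriv (hat (1 / 2 ^ (2 * n)) j) x
          = schemeRhs n q i (hat (1 / 2 ^ (2 * n)) j)) ↔
      4 * v i.succ (j * (1 / 2 ^ (2 * n)))
            - 5 / 4 * (v i.succ ((j + 1) * (1 / 2 ^ (2 * n))) + v i.succ ((j - 1) * (1 / 2 ^ (2 * n))))
          = v i.castSucc (j * (1 / 2 ^ (2 * n)))
            + 1 / 4 * (v i.castSucc ((j - 1) * (1 / 2 ^ (2 * n)))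
              + v i.castSucc ((j + 1) * (1 / 2 ^ (2 * n))))
            + 3 / 2 ^ (2 * n + 1) * schemeNoise n q i j := by
    intro j hj
    have e1 : schemeRhs n q i (hat (1 / 2 ^ (2 * n)) j) = schemeNoise n q i j := by
      unfold schemeRhs
      simp only [hat_node hh]
      rw [Finset.sum_eq_single j]
      · simp
      · intro b _ hb; simp [hb]
      · exact fun h => absurd hj h
    have hpj := isPL_hat_of_mem hh hj
    rw [e1, (hpl i.succ).integral_deriv_mul_deriv_hat hh]
    simp only [sub_mul _ _ (hat _ _ _)]
    rw [integral_sub ((hpl i.succ).integrable_mul hpj) ((hpl i.castSucc).integrable_mul hpj),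
      (hpl i.succ).integral_mul_hat hh, (hpl i.castSucc).integral_mul_hat hh]
    have hp : (2 : ℝ) ^ (4 * n) = (2 ^ (2 * n)) ^ 2 := by rw [← pow_mul]; congr 1; ring
    rw [hp, pow_succ (2 : ℝ) (2 * n)]
    have hX : (0 : ℝ) < 2 ^ (2 * n) := by positivity
    set X : ℝ := 2 ^ (2 * n)
    generalize v i.succ (j * (1 / X)) = a1
    generalize v i.succ ((j + 1) * (1 / X)) = a2
    generalize v i.succ ((j - 1) * (1 / X)) = a3
    generalize v i.castSucc (j * (1 / X)) = b1
    generalize v i.castSucc ((j + 1) * (1 / X)) = b2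
    generalize v i.castSucc ((j - 1) * (1 / X)) = b3
    generalize schemeNoise n q i j = d
    have expand : X ^ 2 * (1 / X / 6 * (a3 + 4 * a1 + a2) - 1 / X / 6 * (b3 + 4 * b1 + b2))
        + (2 * a1 - a3 - a2) / (1 / X) - d
        = (2 * X / 3) * (4 * a1 - 5 / 4 * (a2 + a3) - (b1 + 1 / 4 * (b3 + b2) + 3 / (X * 2) * d)) := by
      field_simp
      ring
    rw [← sub_eq_zero, expand, mul_eq_zero, or_iff_right (by positivity), sub_eq_zero]
  constructor
  · intro hs φ hφ
    exact eq_on_galerkinSpace hh hlin hlin' (fun j hj => (key j hj).2 (hs j hj)) φ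
      ((mem_galerkinSpace_iff hh).2 hφ)
  · intro hs j hj
    exact (key j hj).1 (hs _ (isPL_hat_of_mem hh hj))

/-! ### The calibrated Galerkin approximation is the scheme -/

/-- Dyadic meshes are nested: the index of the coarse cell is constant on every cell of the finer
mesh. -/
theorem floor_refine {n p : ℕ} (hnp : n ≤ p) (j : ℤ) {x : ℝ}
    (hx : x ∈ Ico ((j : ℝ) / 2 ^ p) ((j + 1) / 2 ^ p)) :
    ⌊(2 : ℝ) ^ n * x⌋ = ⌊(2 : ℝ) ^ n * (j / 2 ^ p)⌋ := by
  obtain ⟨q, rfl⟩ := Nat.exists_eq_add_of_le hnp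
  rw [Int.floor_eq_iff]
  have hn : (0 : ℝ) < 2 ^ n := by positivity
  have hq : (0 : ℝ) < 2 ^ q := by positivity
  set e := ⌊(2 : ℝ) ^ n * (j / 2 ^ (n + q))⌋
  have h1 : (e : ℝ) ≤ 2 ^ n * (j / 2 ^ (n + q)) := Int.floor_le _
  have h2 : (2 : ℝ) ^ n * (j / 2 ^ (n + q)) < e + 1 := Int.lt_floor_add_one _
  refine ⟨h1.trans (by gcongr; exact hx.1), ?_⟩
  have e1 : ∀ y : ℝ, (2 : ℝ) ^ n * (y / 2 ^ (n + q)) = y / 2 ^ q := fun y => by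
    rw [pow_add]; field_simp
  rw [e1, div_lt_iff₀ hq] at h2
  have h3 : j + 1 ≤ (e + 1) * 2 ^ q := by
    have : j < (e + 1) * 2 ^ q := by exact_mod_cast h2
    lia
  have h3' : (j : ℝ) + 1 ≤ (e + 1) * 2 ^ q := by exact_mod_cast h3
  calc (2 : ℝ) ^ n * x < 2 ^ n * ((j + 1) / 2 ^ (n + q)) := by gcongr; exact hx.2
    _ = (j + 1) / 2 ^ q := e1 _
    _ ≤ e + 1 := by rwa [div_le_iff₀ hq]

theorem integrable_noiseField (n : ℕ) (a : ℤ → ℤ → ℝ) (s : ℝ) : Integrable (noiseField n a s) := by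
  unfold noiseField
  refine integrable_finsetSum _ fun k _ => integrable_finsetSum _ fun l _ => ?_
  refine Integrable.const_mul ?_ _
  rw [integrable_indicator_iff measurableSet_Ico]
  exact integrableOn_const (by simp) (by simp)

theorem noiseField_eq_gridIncr (n : ℕ) (b : ℝ → ℝ → ℝ) (s x : ℝ) :
    noiseField n (fun k l => 2 ^ (2 * n) * rectIncr n b k l) s x
      = 2 ^ (2 * n) * gridIncr n b ⌊(2 : ℝ) ^ n * s⌋ ⌊(2 : ℝ) ^ n * x⌋ := by
  rw [noiseField_eq, gridIncr]
  split_ifs <;> simp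

/-- The noise is constant on each mesh element, and half a hat has integral h/2 = 2^{-2n}/2, so each
of the two elements at the node contributes half an increment. Both lie in the same coarse cell
unless the node is on a coarse grid line, which is the case distinction in `schemeNoise`. -/
theorem integral_noiseField_mul_hat (n : ℕ) (b : ℝ → ℝ → ℝ) (i : ℕ) (j : ℤ) {s : ℝ}
    (hs : s ∈ Ico ((i : ℝ) / 2 ^ (4 * n)) ((i + 1) / 2 ^ (4 * n))) :
    ∫ x, noiseField n (fun k l => 2 ^ (2 * n) * rectIncr n b k l) s x * hat (1 / 2 ^ (2 * n)) j x
      = schemeNoise n (gridIncr n b) i j := by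
  have hh : (0 : ℝ) < 1 / 2 ^ (2 * n) := by positivity
  have hfs : ⌊(2 : ℝ) ^ n * s⌋ = ⌊(2 : ℝ) ^ n * ((i : ℝ) / 2 ^ (4 * n))⌋ := by
    have := floor_refine (n := n) (p := 4 * n) (by lia) (i : ℤ) (x := s) (by simpa using hs)
    simpa using this
  rw [integral_mul_hat hh j fun α β => (integrable_noiseField n _ s).intervalIntegrable]
  simp_rw [noiseField_eq_gridIncr, hfs]
  set i' := ⌊(2 : ℝ) ^ n * ((i : ℝ) / 2 ^ (4 * n))⌋ with hi'
  set h : ℝ := 1 / 2 ^ (2 * n) with hh_def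
  set g := gridIncr n b
  have hcell : ∀ (k : ℤ) (x : ℝ), x ∈ Ico (k * h) ((k + 1) * h) →
      ⌊(2 : ℝ) ^ n * x⌋ = ⌊(2 : ℝ) ^ n * ((k : ℝ) / 2 ^ (2 * n))⌋ := by
    intro k x hx
    refine floor_refine (by lia) k ?_
    rw [hh_def, mul_one_div, mul_one_div] at hx
    exact hx
  have hid : ∀ (k : ℤ) (f : ℝ → ℝ), ∫ x in (k * h)..((k + 1) * h),
        2 ^ (2 * n) * g i' ⌊(2 : ℝ) ^ n * x⌋ * f x
      = 2 ^ (2 * n) * g i' ⌊(2 : ℝ) ^ n * ((k : ℝ) / 2 ^ (2 * n))⌋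
        * ∫ x in (k * h)..((k + 1) * h), f x := by
    intro k f
    rw [← intervalIntegral.integral_const_mul]
    refine intervalIntegral.integral_congr_ae ?_
    have hne : ∀ᵐ x : ℝ, x ≠ (k + 1) * h := by
      simp [ae_iff, measure_singleton]
    filter_upwards [hne] with x hx hx'
    rw [uIoc_of_le (by nlinarith)] at hx'
    rw [hcell k x ⟨hx'.1.le, lt_of_le_of_ne hx'.2 hx⟩]
  have i1 : ∫ x in (((j - 1 : ℤ) : ℝ) * h)..((((j - 1 : ℤ) : ℝ) + 1) * h), ((x - (j - 1) * h) / h)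
      = h / 2 := by
    have := integral_affine_mul 1 0 ((j - 1) * h) h hh
    push_cast
    rw [show ((j : ℝ) - 1 + 1) * h = (j - 1) * h + h by ring]
    simpa [div_eq_mul_inv] using this
  have i2 : ∫ x in ((j : ℝ) * h)..((j + 1) * h), (((j + 1) * h - x) / h) = h / 2 := by
    have := intervalIntegral.integral_comp_sub_left (a := (j : ℝ) * h) (b := (j + 1) * h)
      (fun x => x / h) ((j + 1) * h)
    rw [this, show ((j : ℝ) + 1) * h - (j + 1) * h = 0 by ring,
      show ((j : ℝ) + 1) * h - j * h = h by ring]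
    rw [intervalIntegral.integral_div, integral_id]
    field_simp
    ring
  have e1 := hid (j - 1) fun x => (x - (j - 1) * h) / h
  rw [i1] at e1
  have e2 := hid j fun x => ((j + 1) * h - x) / h
  rw [i2] at e2
  have ecast : (((j - 1 : ℤ) : ℝ) + 1) * h = j * h := by push_cast; ring
  have ecast' : ((j - 1 : ℤ) : ℝ) * h = (j - 1) * h := by push_cast; ring
  rw [ecast, ecast'] at e1
  rw [e1, e2]
  have hX : (2 : ℝ) ^ (2 * n) * (h / 2) = 1 / 2 := by
    rw [hh_def]; field_simp
  have hXn : (0 : ℝ) < 2 ^ n := by positivity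
  have hpow : (2 : ℝ) ^ (2 * n) = 2 ^ n * 2 ^ n := by rw [← pow_add]; congr 1; ring
  have hdiv : ∀ y : ℝ, (2 : ℝ) ^ n * (y / 2 ^ (2 * n)) = y / 2 ^ n := fun y => by
    rw [hpow]; field_simp
  unfold schemeNoise
  simp only [← hi']
  set j' := ⌊(2 : ℝ) ^ n * ((j : ℝ) / 2 ^ (2 * n))⌋ with hj'
  have hj1 : (j' : ℝ) ≤ j / 2 ^ n := by rw [← hdiv]; exact Int.floor_le _
  have hj2 : (j : ℝ) / 2 ^ n < j' + 1 := by rw [← hdiv]; exact Int.lt_floor_add_one _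
  rw [le_div_iff₀ hXn] at hj1
  rw [div_lt_iff₀ hXn] at hj2
  have hj1' : j' * 2 ^ n ≤ j := by exact_mod_cast hj1
  have hj2' : j < (j' + 1) * 2 ^ n := by exact_mod_cast hj2
  have hcond : (j' : ℝ) / 2 ^ n < (j : ℝ) / 2 ^ (2 * n) ↔ j' * 2 ^ n < j := by
    rw [hpow, div_lt_div_iff₀ hXn (by positivity), ← mul_assoc, mul_lt_mul_iff_left₀ hXn]
    exact_mod_cast Iff.rfl
  rw [if_congr hcond rfl rfl]
  split_ifs with hc
  · have : ⌊(2 : ℝ) ^ n * (((j - 1 : ℤ) : ℝ) / 2 ^ (2 * n))⌋ = j' := by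
      rw [hdiv, Int.floor_eq_iff, le_div_iff₀ hXn, div_lt_iff₀ hXn]
      constructor
      · exact_mod_cast (by lia : j' * 2 ^ n ≤ j - 1)
      · exact_mod_cast (by lia : j - 1 < (j' + 1) * 2 ^ n)
    rw [this]
    linear_combination 2 * g i' j' * hX
  · have : ⌊(2 : ℝ) ^ n * (((j - 1 : ℤ) : ℝ) / 2 ^ (2 * n))⌋ = j' - 1 := by
      rw [hdiv, Int.floor_eq_iff, le_div_iff₀ hXn, div_lt_iff₀ hXn]
      have hp : (1 : ℤ) ≤ 2 ^ n := one_le_pow₀ (by norm_num)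
      have hje : j = j' * 2 ^ n := le_antisymm (not_lt.1 hc) hj1'
      constructor
      · exact_mod_cast (by rw [hje]; nlinarith : (j' - 1) * 2 ^ n ≤ j - 1)
      · exact_mod_cast (by rw [hje]; nlinarith : j - 1 < (j' - 1 + 1) * 2 ^ n)
    rw [this]
    linear_combination (g i' (j' - 1) + g i' j') * hX

theorem noiseRhs_hat (n : ℕ) (b : ℝ → ℝ → ℝ) (i : ℕ) (j : ℤ) :
    noiseRhs n (fun k l => 2 ^ (2 * n) * rectIncr n b k l) (4 * n) i (hat (1 / 2 ^ (2 * n)) j)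
      = schemeNoise n (gridIncr n b) i j := by
  unfold noiseRhs
  have : ∫ s in ((i : ℕ) / 2 ^ (4 * n) : ℝ)..(((i : ℕ) + 1) / 2 ^ (4 * n) : ℝ),
      ∫ x, noiseField n (fun k l => 2 ^ (2 * n) * rectIncr n b k l) s x * hat (1 / 2 ^ (2 * n)) j x
      = ∫ _ in ((i : ℕ) / 2 ^ (4 * n) : ℝ)..(((i : ℕ) + 1) / 2 ^ (4 * n) : ℝ),
        schemeNoise n (gridIncr n b) i j := by
    refine intervalIntegral.integral_congr_ae ?_
    have hne : ∀ᵐ x : ℝ, x ≠ ((i : ℕ) + 1) / 2 ^ (4 * n) := by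
      simp [ae_iff, measure_singleton]
    filter_upwards [hne] with s hs hs'
    rw [uIoc_of_le (by gcongr; linarith)] at hs'
    exact integral_noiseField_mul_hat n b i j ⟨hs'.1.le, lt_of_le_of_ne hs'.2 hs⟩
  rw [this, intervalIntegral.integral_const, smul_eq_mul]
  field_simp
  ring

theorem schemeN_mul (n : ℕ) : (schemeN n : ℝ) * (1 / 2 ^ (2 * n)) = 2 ^ (n + 1) := by
  unfold schemeN
  push_cast
  rw [mul_one_div, div_eq_iff (by positivity), ← pow_add]
  congr 1; ring

theorem schemeRhs_hat (n : ℕ) (q : ℤ → ℤ → ℝ) (i : ℕ) {j : ℤ}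
    (hj : j ∈ Finset.Icc (-(schemeN n : ℤ) + 1) (schemeN n - 1)) :
    schemeRhs n q i (hat (1 / 2 ^ (2 * n)) j) = schemeNoise n q i j := by
  unfold schemeRhs
  simp only [hat_node (show (0 : ℝ) < 1 / 2 ^ (2 * n) by positivity)]
  rw [Finset.sum_eq_single j]
  · simp
  · intro b _ hb; simp [hb]
  · exact fun h => absurd hj h

/-- With mesh sizes `2^{-4n}` and `2^{-2n}` on `[-2^{n+1}, 2^{n+1}]`, the Galerkin approximation is
the fully discrete scheme. -/
theorem isGalerkinApprox_iff_isScheme (n : ℕ) (b : ℝ → ℝ → ℝ) (v : Fin (2 ^ (4 * n) + 1) → ℝ → ℝ) :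
    IsGalerkinApprox (1 / 2 ^ (2 * n)) (2 ^ (n + 1)) (4 * n) (heatConv (discreteNoise n b)) v ↔
      IsScheme n (gridIncr n b) v := by
  have hh : (0 : ℝ) < 1 / 2 ^ (2 * n) := by positivity
  rw [isScheme_iff_isEvolution, ← schemeN_mul]
  refine (isGalerkinApprox_iff_isEvolution (schemeN n) (4 * n) n
    (fun k l => 2 ^ (2 * n) * rectIncr n b k l) v).trans ?_
  refine IsEvolution.congr (fun i _ φ hφ => ?_) v
  refine eq_on_galerkinSpace hh (linearOnSpace_noiseRhs hh _ _ _ _ _) (linearOnSpace_nodal _ _)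
    (fun j hj => ?_) φ hφ
  rw [noiseRhs_hat]
  exact (schemeRhs_hat n _ i hj).symm

theorem existsUnique_isScheme (n : ℕ) (q : ℤ → ℤ → ℝ) : ∃! v, IsScheme n q v := by
  have hh : (0 : ℝ) < 1 / 2 ^ (2 * n) := by positivity
  obtain ⟨G, hG⟩ := exists_unique_evolution hh (schemeN n) (2 ^ (4 * n))
    (α := 2 ^ (4 * n)) (by positivity) (b := schemeRhs n q) fun i => linearOnSpace_nodal _ _
  refine ⟨G, (isScheme_iff_isEvolution q G).2 ((hG G).2 rfl), fun v hv => ?_⟩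
  exact (hG v).1 ((isScheme_iff_isEvolution q v).1 hv)

/-! ### The `L²` norm on a bounded interval -/

/-- Measurable functions that are bounded on `[-L, L]`. -/
structure BddMeas (L : ℝ) (f : ℝ → ℝ) : Prop where
  meas : Measurable f
  bdd : ∃ C, ∀ x ∈ Icc (-L) L, |f x| ≤ C

/-- The `L²` norm on `[-L, L]`. -/
def l2 (L : ℝ) (f : ℝ → ℝ) : ℝ := √(∫ x in -L..L, f x ^ 2)

theorem l2_nonneg (L : ℝ) (f : ℝ → ℝ) : 0 ≤ l2 L f := Real.sqrt_nonneg _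

namespace BddMeas

variable {L : ℝ} {f g : ℝ → ℝ}

theorem of_continuous (hf : Continuous f) : BddMeas L f := by
  refine ⟨hf.measurable, ?_⟩
  obtain ⟨C, hC⟩ := isCompact_Icc.exists_bound_of_continuousOn (s := Icc (-L) L) hf.continuousOn
  exact ⟨C, fun x hx => hC x hx⟩

theorem add (hf : BddMeas L f) (hg : BddMeas L g) : BddMeas L fun x => f x + g x := by
  obtain ⟨C, hC⟩ := hf.bdd
  obtain ⟨D, hD⟩ := hg.bdd
  exact ⟨hf.meas.add hg.meas, C + D, fun x hx =>
    (abs_add_le _ _).trans (add_le_add (hC x hx) (hD x hx))⟩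

theorem sub (hf : BddMeas L f) (hg : BddMeas L g) : BddMeas L fun x => f x - g x := by
  obtain ⟨C, hC⟩ := hf.bdd
  obtain ⟨D, hD⟩ := hg.bdd
  exact ⟨hf.meas.sub hg.meas, C + D, fun x hx =>
    (abs_sub _ _).trans (add_le_add (hC x hx) (hD x hx))⟩

theorem mul (hf : BddMeas L f) (hg : BddMeas L g) : BddMeas L fun x => f x * g x := by
  obtain ⟨C, hC⟩ := hf.bdd
  obtain ⟨D, hD⟩ := hg.bdd
  refine ⟨hf.meas.mul hg.meas, C * D, fun x hx => ?_⟩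
  rw [abs_mul]
  exact mul_le_mul (hC x hx) (hD x hx) (abs_nonneg _) ((abs_nonneg _).trans (hC x hx))

theorem sq (hf : BddMeas L f) : BddMeas L fun x => f x ^ 2 := by
  simpa only [pow_two] using hf.mul hf

theorem intervalIntegrable (hf : BddMeas L f) {α β : ℝ} (hα : α ∈ Icc (-L) L)
    (hβ : β ∈ Icc (-L) L) : IntervalIntegrable f volume α β := by
  obtain ⟨C, hC⟩ := hf.bdd
  refine (intervalIntegrable_const (c := C)).mono_fun hf.meas.aestronglyMeasurable.restrict ?_
  refine (ae_restrict_iff' measurableSet_uIoc).2 (Eventually.of_forall fun x hx => ?_)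
  have hx' : x ∈ Icc (-L) L :=
    (uIcc_subset_Icc hα hβ) (uIoc_subset_uIcc hx)
  exact (hC x hx').trans (le_abs_self _)

theorem intervalIntegrable' (hL : 0 ≤ L) (hf : BddMeas L f) :
    IntervalIntegrable f volume (-L) L :=
  hf.intervalIntegrable ⟨le_rfl, by linarith⟩ ⟨by linarith, le_rfl⟩

end BddMeas

theorem l2_sq {L : ℝ} (hL : 0 ≤ L) (f : ℝ → ℝ) : l2 L f ^ 2 = ∫ x in -L..L, f x ^ 2 :=
  Real.sq_sqrt (intervalIntegral.integral_nonneg (by linarith) fun x _ => sq_nonneg _)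

/-- Cauchy–Schwarz, from the discriminant of the nonnegative quadratic t ↦ ∫ (tf + g)². -/
theorem abs_integral_mul_le_l2 {L : ℝ} (hL : 0 ≤ L) {f g : ℝ → ℝ} (hf : BddMeas L f)
    (hg : BddMeas L g) : |∫ x in -L..L, f x * g x| ≤ l2 L f * l2 L g := by
  set A := ∫ x in -L..L, f x ^ 2 with hA
  set B := ∫ x in -L..L, f x * g x
  set D := ∫ x in -L..L, g x ^ 2 with hD
  have h : ∀ t : ℝ, 0 ≤ A * (t * t) + (2 * B) * t + D := by
    intro t
    have h1 : 0 ≤ ∫ x in -L..L, (t * f x + g x) ^ 2 :=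
      intervalIntegral.integral_nonneg (by linarith) fun x _ => sq_nonneg _
    have h2 : ∫ x in -L..L, (t * f x + g x) ^ 2 = A * (t * t) + (2 * B) * t + D := by
      have e : ∀ x, (t * f x + g x) ^ 2 = (t * t) * f x ^ 2 + (2 * t) * (f x * g x) + g x ^ 2 :=
        fun x => by ring
      simp_rw [e]
      rw [intervalIntegral.integral_add, intervalIntegral.integral_add,
        intervalIntegral.integral_const_mul, intervalIntegral.integral_const_mul]
      · ring
      · exact (hf.sq.intervalIntegrable' hL).const_mul _
      · exact ((hf.mul hg).intervalIntegrable' hL).const_mul _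
      · exact ((hf.sq.intervalIntegrable' hL).const_mul _).add
          (((hf.mul hg).intervalIntegrable' hL).const_mul _)
      · exact hg.sq.intervalIntegrable' hL
    linarith
  have hd := discrim_le_zero h
  rw [discrim] at hd
  have : B ^ 2 ≤ (l2 L f * l2 L g) ^ 2 := by
    rw [mul_pow, l2_sq hL, l2_sq hL, ← hA, ← hD]; nlinarith
  exact abs_le_of_sq_le_sq this (mul_nonneg (l2_nonneg _ _) (l2_nonneg _ _))

theorem l2_add_le {L : ℝ} (hL : 0 ≤ L) {f g : ℝ → ℝ} (hf : BddMeas L f) (hg : BddMeas L g) :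
    l2 L (fun x => f x + g x) ≤ l2 L f + l2 L g := by
  have hcs := (le_abs_self _).trans (abs_integral_mul_le_l2 hL hf hg)
  refine abs_le_of_sq_le_sq' ?_ (add_nonneg (l2_nonneg _ _) (l2_nonneg _ _)) |>.2
  rw [l2_sq hL, add_sq, l2_sq hL, l2_sq hL]
  have e : ∀ x, (f x + g x) ^ 2 = f x ^ 2 + 2 * (f x * g x) + g x ^ 2 := fun x => by ring
  simp_rw [e]
  rw [intervalIntegral.integral_add, intervalIntegral.integral_add,
    intervalIntegral.integral_const_mul]
  · linarith
  · exact hf.sq.intervalIntegrable' hL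
  · exact ((hf.mul hg).intervalIntegrable' hL).const_mul _
  · exact (hf.sq.intervalIntegrable' hL).add (((hf.mul hg).intervalIntegrable' hL).const_mul _)
  · exact hg.sq.intervalIntegrable' hL

theorem l2_neg (L : ℝ) (f : ℝ → ℝ) : l2 L (fun x => -f x) = l2 L f := by
  simp [l2]

theorem l2_sub_le {L : ℝ} (hL : 0 ≤ L) {f g : ℝ → ℝ} (hf : BddMeas L f) (hg : BddMeas L g) :
    l2 L (fun x => f x - g x) ≤ l2 L f + l2 L g := by
  have hg' : BddMeas L fun x => -g x := ⟨hg.meas.neg, by simpa using hg.bdd⟩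
  have := l2_add_le hL hf hg'
  rw [l2_neg] at this
  simpa [sub_eq_add_neg] using this

theorem l2_sum_le {ι : Type*} {L : ℝ} (hL : 0 ≤ L) (s : Finset ι) {f : ι → ℝ → ℝ}
    (hf : ∀ i ∈ s, BddMeas L (f i)) :
    BddMeas L (fun x => ∑ i ∈ s, f i x) ∧ l2 L (fun x => ∑ i ∈ s, f i x) ≤ ∑ i ∈ s, l2 L (f i) := by
  classical
  induction s using Finset.induction_on with
  | empty => exact ⟨BddMeas.of_continuous (by simpa using continuous_const), by simp [l2]⟩
  | insert a s ha ih =>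
    obtain ⟨h1, h2⟩ := ih fun i hi => hf i (Finset.mem_insert_of_mem hi)
    have h3 := hf a (Finset.mem_insert_self _ _)
    simp_rw [Finset.sum_insert ha]
    exact ⟨h3.add h1, (l2_add_le hL h3 h1).trans (by linarith)⟩

theorem l2_le_of_abs_le {L B : ℝ} (hL : 0 ≤ L) (hB : 0 ≤ B) {f : ℝ → ℝ} (hf : BddMeas L f)
    (h : ∀ x ∈ Icc (-L) L, |f x| ≤ B) : l2 L f ≤ √(2 * L) * B := by
  refine Real.sqrt_le_iff.2 ⟨by positivity, ?_⟩
  rw [mul_pow, Real.sq_sqrt (by positivity)]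
  calc ∫ x in -L..L, f x ^ 2 ≤ ∫ _ in -L..L, B ^ 2 := by
        refine intervalIntegral.integral_mono_on (by linarith) (hf.sq.intervalIntegrable' hL)
          intervalIntegrable_const fun x hx => ?_
        rw [← sq_abs]
        exact pow_le_pow_left₀ (abs_nonneg _) (h x hx) 2
    _ = 2 * L * B ^ 2 := by rw [intervalIntegral.integral_const, smul_eq_mul]; ring

theorem l2_le_of_lintegral {L B : ℝ} (hL : 0 ≤ L) (hB : 0 ≤ B) {f : ℝ → ℝ}
    (hf : Measurable f) (h : ∫⁻ x, ‖f x‖ₑ ^ 2 ≤ ENNReal.ofReal (B ^ 2)) : l2 L f ≤ B := by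
  refine Real.sqrt_le_iff.2 ⟨hB, ?_⟩
  rw [intervalIntegral.integral_of_le (by linarith),
    integral_eq_lintegral_of_nonneg_ae (Eventually.of_forall fun x => sq_nonneg _)
      (hf.pow_const 2).aestronglyMeasurable]
  refine ENNReal.toReal_le_of_le_ofReal (sq_nonneg _) (le_trans ?_ h)
  refine (setLIntegral_le_lintegral _ _).trans_eq ?_
  congr 1 with x
  rw [← ofReal_norm, ← ENNReal.ofReal_pow (norm_nonneg _), Real.norm_eq_abs, sq_abs]

theorem eLpNorm_indicator_eq_l2 {L : ℝ} (hL : 0 ≤ L) {f : ℝ → ℝ} (hf : BddMeas L f) :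
    eLpNorm ((Ioc (-L) L).indicator f) 2 volume = ENNReal.ofReal (l2 L f) := by
  rw [eLpNorm_indicator_eq_eLpNorm_restrict measurableSet_Ioc,
    eLpNorm_eq_lintegral_rpow_enorm_toReal (by simp) (by simp)]
  unfold l2
  rw [Real.sqrt_eq_rpow, ← ENNReal.ofReal_rpow_of_nonneg
    (intervalIntegral.integral_nonneg (by linarith) fun x _ => sq_nonneg _) (by norm_num),
    intervalIntegral.integral_of_le (by linarith),
    ofReal_integral_eq_lintegral_ofReal ?_ (Eventually.of_forall fun x => sq_nonneg _)]
  · simp only [ENNReal.toReal_ofNat]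
    congr 2 with x
    rw [← ofReal_norm, ENNReal.ofReal_rpow_of_nonneg (norm_nonneg _) (by norm_num),
      Real.norm_eq_abs]
    norm_num
  · have := hf.sq.intervalIntegrable' hL
    rwa [intervalIntegrable_iff_integrableOn_Ioc_of_le (by linarith)] at this

/-! ### The Ritz projection -/

/-- A function with a continuous derivative, which has itself a bounded derivative outside a
countable set. -/
structure HasSecondDeriv (u ux Z : ℝ → ℝ) : Prop where
  deriv : ∀ x, HasDerivAt u (ux x) x
  cont : Continuous ux
  deriv2 : ∃ s : Set ℝ, s.Countable ∧ ∀ x ∉ s, HasDerivAt ux (Z x) x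
  meas : Measurable Z
  bdd : ∃ C, ∀ x, |Z x| ≤ C

namespace HasSecondDeriv

variable {u ux Z : ℝ → ℝ}

theorem continuous (hu : HasSecondDeriv u ux Z) : Continuous u :=
  continuous_iff_continuousAt.2 fun x => (hu.deriv x).continuousAt

theorem bddMeas (hu : HasSecondDeriv u ux Z) (L : ℝ) : BddMeas L Z :=
  ⟨hu.meas, hu.bdd.imp fun _ h x _ => h x⟩

theorem intervalIntegrable (hu : HasSecondDeriv u ux Z) (α β : ℝ) :
    IntervalIntegrable Z volume α β := by
  obtain ⟨C, hC⟩ := hu.bdd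
  exact (intervalIntegrable_const (c := C)).mono_fun hu.meas.aestronglyMeasurable.restrict
    (Eventually.of_forall fun x => (hC x).trans (le_abs_self _))

theorem sub {v vx Y : ℝ → ℝ} (hu : HasSecondDeriv u ux Z) (hv : HasSecondDeriv v vx Y) :
    HasSecondDeriv (fun x => u x - v x) (fun x => ux x - vx x) (fun x => Z x - Y x) := by
  obtain ⟨s, hs, h1⟩ := hu.deriv2
  obtain ⟨s', hs', h2⟩ := hv.deriv2
  obtain ⟨C, hC⟩ := hu.bdd
  obtain ⟨D, hD⟩ := hv.bdd
  exact ⟨fun x => (hu.deriv x).sub (hv.deriv x), hu.cont.sub hv.cont,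
    ⟨s ∪ s', hs.union hs', fun x hx => (h1 x fun h => hx (Or.inl h)).sub
      (h2 x fun h => hx (Or.inr h))⟩, hu.meas.sub hv.meas,
    ⟨C + D, fun x => (abs_sub _ _).trans (add_le_add (hC x) (hD x))⟩⟩

/-- Testing the second derivative with a hat function gives the second difference. -/
theorem integral_mul_hat (hu : HasSecondDeriv u ux Z) {h : ℝ} (hh : 0 < h) (j : ℤ) :
    ∫ x, Z x * hat h j x = (u ((j + 1) * h) - 2 * u (j * h) + u ((j - 1) * h)) / h := by
  rw [FracHeat.integral_mul_hat hh j hu.intervalIntegrable]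
  obtain ⟨s, hs, h2⟩ := hu.deriv2
  have hc := hu.continuous
  have hcx := hu.cont
  have e1 : ∫ x in ((j - 1) * h)..(j * h), Z x * ((x - (j - 1) * h) / h)
      = ux (j * h) - (u (j * h) - u ((j - 1) * h)) / h := by
    have := integral_eq_of_hasDerivAt_off_countable (a := (j - 1) * h) (b := j * h)
      (fun x => ux x * ((x - (j - 1) * h) / h) - u x / h)
      (fun x => Z x * ((x - (j - 1) * h) / h)) hs (by fun_prop)
      (fun x hx => by
        have := ((h2 x hx.2).mul (((hasDerivAt_id x).sub_const ((j - 1) * h)).div_const h)).sub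
          ((hu.deriv x).div_const h)
        exact this.congr_deriv (by simp only [id]; ring))
      ((hu.intervalIntegrable _ _).mul_continuousOn (by fun_prop))
    rw [this]
    field_simp
    ring
  have e2 : ∫ x in (j * h)..((j + 1) * h), Z x * (((j + 1) * h - x) / h)
      = -ux (j * h) + (u ((j + 1) * h) - u (j * h)) / h := by
    have := integral_eq_of_hasDerivAt_off_countable (a := j * h) (b := (j + 1) * h)
      (fun x => ux x * (((j + 1) * h - x) / h) + u x / h)
      (fun x => Z x * (((j + 1) * h - x) / h)) hs (by fun_prop)
      (fun x hx => by
        have := ((h2 x hx.2).mul (((hasDerivAt_id x).const_sub ((j + 1) * h)).div_const h)).add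
          ((hu.deriv x).div_const h)
        exact this.congr_deriv (by simp only [id]; ring))
      ((hu.intervalIntegrable _ _).mul_continuousOn (by fun_prop))
    rw [this]
    field_simp
    ring
  rw [e1, e2]
  ring

end HasSecondDeriv

/-- The affine function with the values of `u` at `±L`. -/
def affineInterp (L : ℝ) (u : ℝ → ℝ) (x : ℝ) : ℝ :=
  (u L + u (-L)) / 2 + (u L - u (-L)) * (x / (2 * L))

theorem abs_affineInterp_le {L : ℝ} (hL : 0 < L) (u : ℝ → ℝ) {x : ℝ} (hx : x ∈ Icc (-L) L) :
    |affineInterp L u x| ≤ |u L| + |u (-L)| := by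
  have h1 : |x / (2 * L)| ≤ 1 / 2 := by
    rw [abs_div, abs_of_pos (by positivity : 0 < 2 * L), div_le_div_iff₀ (by positivity) (by norm_num)]
    linarith [abs_le.2 hx]
  unfold affineInterp
  have h2 := abs_le.1 h1
  have e : (u L + u (-L)) / 2 + (u L - u (-L)) * (x / (2 * L))
    = u L * (1 / 2 + x / (2 * L)) + u (-L) * (1 / 2 - x / (2 * L)) := by ring
  rw [e]
  refine (abs_add_le _ _).trans (add_le_add ?_ ?_) <;> rw [abs_mul]
  · exact mul_le_of_le_one_right (abs_nonneg _) (abs_le.2 ⟨by linarith, by linarith⟩)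
  · exact mul_le_of_le_one_right (abs_nonneg _) (abs_le.2 ⟨by linarith, by linarith⟩)

theorem affineInterp_sub (L : ℝ) (u v : ℝ → ℝ) (x : ℝ) :
    affineInterp L (fun x => u x - v x) x = affineInterp L u x - affineInterp L v x := by
  unfold affineInterp; ring

theorem continuous_affineInterp (L : ℝ) (u : ℝ → ℝ) : Continuous (affineInterp L u) := by
  unfold affineInterp; fun_prop

/-- The Ritz projection: the nodal interpolation of `u` minus its boundary values. -/
def ritz (h : ℝ) (N : ℕ) (u : ℝ → ℝ) : ℝ → ℝ :=
  nodalSum h N fun j => u (j * h) - affineInterp (N * h) u (j * h)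

theorem isPL_ritz {h : ℝ} (hh : 0 < h) (N : ℕ) (u : ℝ → ℝ) : IsPL h (N * h) (ritz h N u) :=
  isPL_nodalSum hh N _

theorem ritz_sub (h : ℝ) (N : ℕ) (u v : ℝ → ℝ) (x : ℝ) :
    ritz h N (fun x => u x - v x) x = ritz h N u x - ritz h N v x := by
  unfold ritz nodalSum
  simp only [Finset.sum_apply, Pi.smul_apply, smul_eq_mul, affineInterp_sub]
  rw [← Finset.sum_sub_distrib]
  exact Finset.sum_congr rfl fun j _ => by ring

/-- At the two end nodes both sides vanish, because the affine function matches u there. Including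
them allows second differences at the nodes next to the boundary. -/
theorem ritz_node {h : ℝ} (hh : 0 < h) {N : ℕ} (hN : 0 < N) (u : ℝ → ℝ) {k : ℤ}
    (hk : k ∈ Finset.Icc (-(N : ℤ)) N) :
    ritz h N u (k * h) = u (k * h) - affineInterp (N * h) u (k * h) := by
  obtain ⟨h1, h2⟩ := Finset.mem_Icc.1 hk
  have hL : (0 : ℝ) < N * h := by positivity
  by_cases hm : k ∈ Finset.Icc (-(N : ℤ) + 1) (N - 1)
  · exact nodalSum_node hh _ hm
  · rw [(isPL_ritz hh N u).zero _ (not_lt.1 fun hc => hm ((abs_node_lt_iff hh N k).1 hc))]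
    have : k = N ∨ k = -N := by rw [Finset.mem_Icc] at hm; lia
    rcases this with rfl | rfl
    · simp only [affineInterp, Int.cast_natCast]; field_simp; ring
    · simp only [affineInterp, Int.cast_neg, Int.cast_natCast, neg_mul]; field_simp; ring

/-- In one dimension nodal interpolation is the Ritz projection: tested with a hat function, both
sides are the second difference of u at the node, and the affine part has none. -/
theorem integral_deriv_ritz {h : ℝ} (hh : 0 < h) {N : ℕ} (hN : 0 < N) {u ux Z : ℝ → ℝ}
    (hu : HasSecondDeriv u ux Z) {φ : ℝ → ℝ} (hφ : IsPL h (N * h) φ) :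
    ∫ x, deriv (ritz h N u) x * deriv φ x = -∫ x, Z x * φ x := by
  have hR := isPL_ritz hh N u
  have hlin : LinearOnSpace h N fun φ => ∫ x, deriv (ritz h N u) x * deriv φ x := by
    simpa using linearOnSpace_euler hh 0 ((mem_galerkinSpace_iff hh).2 hR)
      ((mem_galerkinSpace_iff hh).2 hR)
  obtain ⟨C, hC⟩ := hu.bdd
  have hi : ∀ φ, IsPL h (N * h) φ → Integrable fun x => Z x * φ x := fun φ hφ =>
    hφ.integrable.bdd_mul hu.meas.aestronglyMeasurable (Eventually.of_forall hC)
  have hlin' : LinearOnSpace h N fun φ => -∫ x, Z x * φ x :=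
    ⟨{ toFun := fun φ => -∫ x, Z x * (φ : ℝ → ℝ) x
       map_add' := fun φ ψ => by
        have h1 := hi _ ((mem_galerkinSpace_iff hh).1 φ.2)
        have h2 := hi _ ((mem_galerkinSpace_iff hh).1 ψ.2)
        rw [← neg_add, ← integral_add h1 h2]
        simp [mul_add]
       map_smul' := fun c φ => by
        simp only [Submodule.coe_smul, Pi.smul_apply, smul_eq_mul, RingHom.id_apply,
          mul_left_comm _ c, integral_const_mul, mul_neg] }, fun _ => rfl⟩
  refine eq_on_galerkinSpace hh hlin hlin' (fun j hj => ?_) φ ((mem_galerkinSpace_iff hh).2 hφ)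
  obtain ⟨h1, h2⟩ := Finset.mem_Icc.1 hj
  rw [hR.integral_deriv_mul_deriv_hat hh, hu.integral_mul_hat hh]
  have n0 := ritz_node hh hN u (k := j) (Finset.mem_Icc.2 ⟨by lia, by lia⟩)
  have n1 := ritz_node hh hN u (k := j + 1) (Finset.mem_Icc.2 ⟨by lia, by lia⟩)
  have n2 := ritz_node hh hN u (k := j - 1) (Finset.mem_Icc.2 ⟨by lia, by lia⟩)
  push_cast at n1 n2
  rw [n0, n1, n2]
  unfold affineInterp
  field_simp
  ring

/-! ### The interpolation error -/

theorem sq_integral_abs_le {f : ℝ → ℝ} {a h : ℝ} (hh : 0 < h)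
    (hf : IntervalIntegrable f volume a (a + h))
    (hf2 : IntervalIntegrable (fun x => f x ^ 2) volume a (a + h)) :
    (∫ x in a..(a + h), |f x|) ^ 2 ≤ h * ∫ x in a..(a + h), f x ^ 2 := by
  set I := ∫ x in a..(a + h), |f x| with hI
  have h1 : 0 ≤ ∫ x in a..(a + h), (|f x| - I / h) ^ 2 :=
    intervalIntegral.integral_nonneg (by linarith) fun x _ => sq_nonneg _
  have e : ∀ x, (|f x| - I / h) ^ 2 = f x ^ 2 - (2 * I / h) * |f x| + (I / h) ^ 2 := fun x => by
    rw [← sq_abs (f x)]; ring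
  simp_rw [e] at h1
  rw [intervalIntegral.integral_add (hf2.sub (hf.abs.const_mul _)) intervalIntegrable_const,
    intervalIntegral.integral_sub hf2 (hf.abs.const_mul _), intervalIntegral.integral_const_mul,
    intervalIntegral.integral_const, ← hI, smul_eq_mul] at h1
  have : h * ((∫ x in a..(a + h), f x ^ 2) - 2 * I / h * I + (a + h - a) * (I / h) ^ 2)
      = h * (∫ x in a..(a + h), f x ^ 2) - I ^ 2 := by field_simp; ring
  nlinarith [mul_nonneg hh.le h1]

/-- By the mean value theorem the derivative of u equals the slope of the chord at some point of the
element. It stays within ∫|Z| of this slope, and integration from the left node, where the error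
vanishes, adds the factor h. -/
theorem HasSecondDeriv.abs_sub_interp_le {u ux Z : ℝ → ℝ} (hu : HasSecondDeriv u ux Z) {a h : ℝ}
    (hh : 0 < h) {x : ℝ} (hx : x ∈ Icc a (a + h)) :
    |u x - (u a + (u (a + h) - u a) * ((x - a) / h))| ≤ h * ∫ y in a..(a + h), |Z y| := by
  obtain ⟨s, hs, h2⟩ := hu.deriv2
  have hZi : IntervalIntegrable Z volume a (a + h) := hu.intervalIntegrable _ _
  obtain ⟨ξ, hξ, hξe⟩ := exists_hasDerivAt_eq_slope u ux (by linarith : a < a + h)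
    hu.continuous.continuousOn fun y _ => hu.deriv y
  rw [show a + h - a = h by ring] at hξe
  set I := ∫ y in a..(a + h), |Z y| with hI
  have hg : ∀ y ∈ Icc a (a + h), |ux y - (u (a + h) - u a) / h| ≤ I := by
    intro y hy
    rw [← hξe]
    have e := integral_eq_of_hasDerivAt_off_countable (a := ξ) (b := y) ux Z hs
      hu.cont.continuousOn (fun x hx => h2 x hx.2) (hu.intervalIntegrable _ _)
    rw [← e]
    have hn := intervalIntegral.norm_integral_le_integral_norm_uIoc (f := Z) (a := ξ) (b := y)
      (μ := volume)
    simp only [Real.norm_eq_abs] at hn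
    refine hn.trans ?_
    rw [hI, intervalIntegral.integral_of_le (by linarith)]
    refine setIntegral_mono_set ?_ (Eventually.of_forall fun _ => abs_nonneg _) ?_
    · exact (intervalIntegrable_iff_integrableOn_Ioc_of_le (by linarith)).1 hZi.abs
    · refine LE.le.eventuallyLE ?_
      intro z hz
      rw [mem_uIoc] at hz
      rcases hz with hz | hz
      · exact ⟨hξ.1.trans hz.1, hz.2.trans hy.2⟩
      · exact ⟨lt_of_le_of_lt hy.1 hz.1, hz.2.trans hξ.2.le⟩
  have hI0 : 0 ≤ I := intervalIntegral.integral_nonneg (by linarith) fun _ _ => abs_nonneg _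
  have hd : ∀ y ∈ Icc a (a + h), HasDerivWithinAt
      (fun x => u x - (u a + (u (a + h) - u a) * ((x - a) / h)))
      (ux y - (u (a + h) - u a) / h) (Icc a (a + h)) y := by
    intro y _
    have := (hu.deriv y).sub (((((hasDerivAt_id y).sub_const a).div_const h).const_mul
      (u (a + h) - u a)).const_add (u a))
    exact (this.congr_deriv (by ring)).hasDerivWithinAt
  have := norm_image_sub_le_of_norm_deriv_le_segment' hd (C := I)
    (fun y hy => hg y ⟨hy.1, hy.2.le⟩) x hx
  simp only [sub_self, zero_div, mul_zero, add_zero, sub_zero, Real.norm_eq_abs] at this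
  refine this.trans ?_
  rw [mul_comm]
  exact mul_le_mul_of_nonneg_right (by linarith [hx.2]) hI0

/-- On each element the squared error is at most h³ ∫ Z² pointwise, hence h⁴ ∫ Z² after integration
over length h; the elements then add up. -/
theorem l2_interp_le {h : ℝ} (hh : 0 < h) {N : ℕ} (hN : 0 < N) {u ux Z : ℝ → ℝ}
    (hu : HasSecondDeriv u ux Z) :
    l2 (N * h) (fun x => u x - affineInterp (N * h) u x - ritz h N u x)
      ≤ h ^ 2 * l2 (N * h) Z := by
  have hL : (0 : ℝ) ≤ N * h := by positivity
  have hR := isPL_ritz hh N u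
  set e : ℝ → ℝ := fun x => u x - affineInterp (N * h) u x - ritz h N u x with he
  have hec : Continuous e := (hu.continuous.sub (continuous_affineInterp _ _)).sub hR.continuous
  have hZ2 : ∀ α β, IntervalIntegrable (fun x => Z x ^ 2) volume α β := by
    obtain ⟨C, hC⟩ := hu.bdd
    intro α β
    refine (intervalIntegrable_const (c := C ^ 2)).mono_fun
      (hu.meas.pow_const 2).aestronglyMeasurable.restrict (Eventually.of_forall fun x => ?_)
    simp only [Real.norm_eq_abs]
    rw [abs_of_nonneg (sq_nonneg _), abs_of_nonneg (sq_nonneg _), ← sq_abs]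
    exact pow_le_pow_left₀ (abs_nonneg _) (hC x) 2
  have helem : ∀ k ∈ Finset.Ico (-(N : ℤ)) N,
      ∫ x in (k * h)..(k * h + h), e x ^ 2 ≤ h ^ 4 * ∫ x in (k * h)..(k * h + h), Z x ^ 2 := by
    intro k hk
    obtain ⟨hk1, hk2⟩ := Finset.mem_Ico.1 hk
    have n0 := ritz_node hh hN u (k := k) (Finset.mem_Icc.2 ⟨by lia, by lia⟩)
    have n1 := ritz_node hh hN u (k := k + 1) (Finset.mem_Icc.2 ⟨by lia, by lia⟩)
    push_cast at n1
    have hpt : ∀ x ∈ Icc (k * h : ℝ) (k * h + h),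
        e x ^ 2 ≤ h ^ 3 * ∫ x in (k * h)..(k * h + h), Z x ^ 2 := by
      intro x hx
      have ex : e x = u x - (u (k * h) + (u (k * h + h) - u (k * h)) * ((x - k * h) / h)) := by
        have ek : (k * h + h : ℝ) = (k + 1) * h := by ring
        rw [he, ek]
        simp only
        rw [hR.affine k x (by rwa [← ek]), n0, n1]
        unfold affineInterp
        field_simp
        ring
      have h1 := hu.abs_sub_interp_le hh hx
      rw [← ex] at h1
      have h2 := sq_integral_abs_le hh (hu.intervalIntegrable (k * h) (k * h + h)) (hZ2 _ _)
      calc e x ^ 2 = |e x| ^ 2 := (sq_abs _).symm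
        _ ≤ (h * ∫ y in (k * h)..(k * h + h), |Z y|) ^ 2 :=
          pow_le_pow_left₀ (abs_nonneg _) h1 2
        _ = h ^ 2 * (∫ y in (k * h)..(k * h + h), |Z y|) ^ 2 := by ring
        _ ≤ h ^ 2 * (h * ∫ x in (k * h)..(k * h + h), Z x ^ 2) := by gcongr
        _ = _ := by ring
    calc ∫ x in (k * h)..(k * h + h), e x ^ 2
        ≤ ∫ _ in (k * h)..(k * h + h), h ^ 3 * ∫ x in (k * h)..(k * h + h), Z x ^ 2 :=
          intervalIntegral.integral_mono_on (by linarith) ((hec.pow 2).intervalIntegrable _ _)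
            intervalIntegrable_const hpt
      _ = _ := by rw [intervalIntegral.integral_const, smul_eq_mul]; ring
  have hsum : ∀ f : ℝ → ℝ, (∀ α β, IntervalIntegrable f volume α β) →
      ∫ x in -(N * h)..(N * h), f x
        = ∑ i ∈ Finset.range (2 * N), ∫ x in (((i - N : ℤ) : ℝ) * h)..(((i - N : ℤ) : ℝ) * h + h), f x := by
    intro f hf
    have := intervalIntegral.sum_integral_adjacent_intervals (f := f) (μ := volume)
      (a := fun i : ℕ => ((i - N : ℤ) : ℝ) * h) (n := 2 * N) fun k _ => hf _ _
    rw [show ((((0 : ℕ) : ℤ) - N : ℤ) : ℝ) * h = -(N * h) by push_cast; ring,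
      show (((2 * N : ℕ) : ℤ) - N : ℤ) * h = N * h by push_cast; ring] at this
    rw [← this]
    refine Finset.sum_congr rfl fun i _ => ?_
    congr 1
    push_cast; ring
  refine Real.sqrt_le_iff.2 ⟨mul_nonneg (sq_nonneg _) (l2_nonneg _ _), ?_⟩
  rw [mul_pow, l2_sq hL, hsum (fun x => e x ^ 2) fun α β => (hec.pow 2).intervalIntegrable α β, hsum _ hZ2,
    Finset.mul_sum, ← pow_mul]
  refine Finset.sum_le_sum fun i hi => ?_
  have := Finset.mem_range.1 hi
  exact helem (i - N) (Finset.mem_Ico.2 ⟨by lia, by lia⟩)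

/-! ### The energy estimate -/

theorem IsPL.integral_mul_eq {h L : ℝ} (hL : 0 ≤ L) {φ : ℝ → ℝ} (hφ : IsPL h L φ) (f : ℝ → ℝ) :
    ∫ x, f x * φ x = ∫ x in -L..L, f x * φ x := by
  rw [intervalIntegral.integral_of_le (by linarith), setIntegral_eq_integral_of_forall_compl_eq_zero]
  intro x hx
  rw [hφ.zero, mul_zero]
  rw [mem_Ioc, not_and_or, not_lt, not_le] at hx
  rcases hx with hx | hx
  · rw [abs_of_nonpos (by linarith)]; linarith
  · rw [abs_of_nonneg (by linarith)]; linarith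

theorem IsPL.bddMeas {h L : ℝ} {φ : ℝ → ℝ} (hφ : IsPL h L φ) (L' : ℝ) : BddMeas L' φ :=
  BddMeas.of_continuous hφ.continuous

/-- The equation is tested with θ' and the nonnegative gradient term dropped, leaving ‖θ'‖² ≤ ⟨θ,
θ'⟩ + X. Dividing by ‖θ'‖ makes the defect enter additively, so that errors accumulate over the
steps without an amplification factor. -/
theorem energy_step {h L α X B : ℝ} (hL : 0 ≤ L) (hα : 0 < α) (hB : 0 ≤ B) {θ θ' : ℝ → ℝ}
    (hθ : IsPL h L θ) (hθ' : IsPL h L θ')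
    (heq : α * (∫ x, (θ' x - θ x) * θ' x) + ∫ x, deriv θ' x * deriv θ' x = α * X)
    (hX : |X| ≤ B * l2 L θ') : l2 L θ' ≤ l2 L θ + B := by
  have h0 : 0 ≤ ∫ x, deriv θ' x * deriv θ' x := integral_nonneg fun x => mul_self_nonneg _
  have h1 : ∫ x, (θ' x - θ x) * θ' x ≤ X := by
    by_contra hc
    push Not at hc
    nlinarith [mul_pos hα (sub_pos.2 hc)]
  rw [hθ'.integral_mul_eq hL] at h1
  have e : ∀ x, (θ' x - θ x) * θ' x = θ' x ^ 2 - θ x * θ' x := fun x => by ring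
  simp_rw [e] at h1
  rw [intervalIntegral.integral_sub ((hθ'.bddMeas L).sq.intervalIntegrable' hL)
    (((hθ.bddMeas L).mul (hθ'.bddMeas L)).intervalIntegrable' hL), ← l2_sq hL] at h1
  have h2 := (le_abs_self _).trans (abs_integral_mul_le_l2 hL (hθ.bddMeas L) (hθ'.bddMeas L))
  have h3 := (le_abs_self _).trans hX
  rcases (l2_nonneg L θ').eq_or_lt with hz | hz
  · rw [← hz]; exact add_nonneg (l2_nonneg _ _) hB
  · by_contra hc
    push Not at hc
    nlinarith

/-! ### Consistency of one time step -/

theorem abs_four_le {p q r s : ℝ} (hp : |p| ≤ 1) (hq : |q| ≤ 1) (hr : |r| ≤ 1) (hs : |s| ≤ 1) :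
    |p - q - (r - s)| ≤ 4 := by
  rw [abs_le] at *
  constructor <;> linarith [hp.1, hp.2, hq.1, hq.2, hr.1, hr.2, hs.1, hs.2]

theorem exists_bound_solXX (n : ℕ) (a : ℤ → ℤ → ℝ) (t : ℝ) :
    ∃ C, ∀ x, |cellSum n a heatStepXX t x| ≤ C := by
  refine ⟨∑ k ∈ Finset.Ico (0 : ℤ) (2 ^ n), ∑ l ∈ Finset.Ico (-2 ^ (2 * n) : ℤ) (2 ^ (2 * n)),
    |a k l| * 4, fun x => ?_⟩
  unfold cellSum
  refine (Finset.abs_sum_le_sum_abs _ _).trans (Finset.sum_le_sum fun k _ => ?_)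
  refine (Finset.abs_sum_le_sum_abs _ _).trans (Finset.sum_le_sum fun l _ => ?_)
  rw [abs_mul]
  exact mul_le_mul_of_nonneg_left (abs_four_le (abs_heatStepXX_le _ _) (abs_heatStepXX_le _ _)
    (abs_heatStepXX_le _ _) (abs_heatStepXX_le _ _)) (abs_nonneg _)

theorem measurable_solXX (n : ℕ) (a : ℤ → ℤ → ℝ) (t : ℝ) : Measurable (cellSum n a heatStepXX t) :=
  (measurable_cellSum measurable_heatStepXX n a).of_uncurry_left

theorem hasSecondDeriv_sol (n : ℕ) (a : ℤ → ℤ → ℝ) (t : ℝ) :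
    HasSecondDeriv (cellSum n a heatStep t) (cellSum n a heatStepX t) (cellSum n a heatStepXX t) :=
  ⟨hasDerivAt_sol_space n a t, continuous_solX n a t,
    ⟨gridPoints n, countable_gridPoints n, fun _ hx => hasDerivAt_solX_space n a t hx⟩,
    measurable_solXX n a t, exists_bound_solXX n a t⟩

/-- The weak formulation of the heat equation on a time interval. -/
theorem integral_noise_eq (n : ℕ) (a : ℤ → ℤ → ℝ) {t t' : ℝ} (h0 : 0 ≤ t) (htt : t ≤ t')
    (h1 : t' ≤ 1) {h L : ℝ} {φ : ℝ → ℝ} (hφ : IsPL h L φ) :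
    IntervalIntegrable (fun s => ∫ x, cellSum n a heatStepXX s x * φ x) volume t t' ∧
    ∫ s in t..t', ∫ x, noiseField n a s x * φ x
      = (∫ x, (cellSum n a heatStep t' x - cellSum n a heatStep t x) * φ x)
        - ∫ s in t..t', ∫ x, cellSum n a heatStepXX s x * φ x := by
  -- Since φ vanishes outside [-L, L], local boundedness of the kernels is enough for Fubini.
  have hInt : ∀ K : ℝ → ℝ → ℝ, KernelBdd K → (Measurable fun p : ℝ × ℝ => K p.1 p.2) →
      Integrable (fun p : ℝ × ℝ => cellSum n a K p.1 p.2 * φ p.2)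
        ((volume.restrict (Ioc t t')).prod volume) := by
    intro K hK hm
    obtain ⟨C, hC⟩ := hK.locBdd_cellSum n a L
    have hb : Integrable (fun p : ℝ × ℝ => C * |φ p.2|) ((volume.restrict (Ioc t t')).prod volume) :=
      ((hφ.integrable.abs.comp_snd (volume.restrict (Ioc t t')))).const_mul C
    refine hb.mono' (((measurable_cellSum hm n a).mul
      (hφ.continuous.measurable.comp measurable_snd)).aestronglyMeasurable) ?_
    have hae : ∀ᵐ p : ℝ × ℝ ∂((volume.restrict (Ioc t t')).prod volume), p.1 ∈ Ioc t t' := by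
      have := (ae_restrict_mem (μ := (volume : Measure ℝ)) (measurableSet_Ioc (a := t) (b := t')))
      exact Measure.quasiMeasurePreserving_fst.ae this
    filter_upwards [hae] with p hp
    rw [Real.norm_eq_abs, abs_mul]
    by_cases hx : p.2 ∈ Icc (-L) L
    · exact mul_le_mul_of_nonneg_right
        (hC p.1 ⟨h0.trans hp.1.le, hp.2.trans h1⟩ p.2 hx) (abs_nonneg _)
    · rw [hφ.zero p.2 (by
        by_contra hc; push Not at hc; exact hx (abs_le.1 hc.le))]
      simp
  have hZ := hInt _ kernelBdd_heatStepXX measurable_heatStepXX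
  have hU := hInt _ kernelBdd_heatSign measurable_heatSign
  have hZi : IntervalIntegrable (fun s => ∫ x, cellSum n a heatStepXX s x * φ x) volume t t' := by
    rw [intervalIntegrable_iff_integrableOn_Ioc_of_le htt]
    exact hZ.integral_prod_left
  have hUi : IntervalIntegrable (fun s => ∫ x, cellSum n a heatSign s x * φ x) volume t t' := by
    rw [intervalIntegrable_iff_integrableOn_Ioc_of_le htt]
    exact hU.integral_prod_left
  refine ⟨hZi, ?_⟩
  have e1 : ∫ s in t..t', ∫ x, noiseField n a s x * φ x
      = ∫ s in t..t', ((∫ x, cellSum n a heatSign s x * φ x)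
        - ∫ x, cellSum n a heatStepXX s x * φ x) := by
    rw [intervalIntegral.integral_of_le htt, intervalIntegral.integral_of_le htt]
    apply integral_congr_ae
    have hg : ∀ᵐ s ∂(volume.restrict (Ioc t t')), s ∉ gridPoints n :=
      ae_restrict_of_ae (measure_mono_null (fun _ hx => not_not.1 hx)
        ((countable_gridPoints n).measure_zero _))
    have hg' : ∀ᵐ x : ℝ, x ∉ gridPoints n :=
      measure_mono_null (fun _ hx => not_not.1 hx) ((countable_gridPoints n).measure_zero _)
    filter_upwards [hg, hZ.prod_right_ae, hU.prod_right_ae] with s hs hs1 hs2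
    rw [← integral_sub hs2 hs1]
    apply integral_congr_ae
    filter_upwards [hg'] with x hx
    rw [← sol_time_sub_solXX n a hs hx]
    ring
  rw [e1, intervalIntegral.integral_sub hUi hZi]
  congr 1
  rw [intervalIntegral.integral_of_le htt, integral_integral_swap hU]
  congr 1 with x
  rw [integral_mul_const, ← intervalIntegral.integral_of_le htt]
  congr 1
  obtain ⟨C, hC⟩ := kernelBdd_heatSign.locBdd_cellSum n a |x|
  refine integral_eq_of_hasDerivAt_off_countable _ _ (countable_gridPoints n)
    (continuous_sol_time n a x).continuousOn (fun s hs => hasDerivAt_sol_time n a hs.2 x) ?_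
  refine (intervalIntegrable_const (c := C)).mono_fun ((measurable_cellSum measurable_heatSign n a).comp
    measurable_prodMk_right).aestronglyMeasurable.restrict ?_
  refine (ae_restrict_iff' measurableSet_uIoc).2 (Eventually.of_forall fun s hs => ?_)
  rw [uIoc_of_le htt] at hs
  exact (hC s ⟨h0.trans hs.1.le, hs.2.trans h1⟩ x (abs_le.1 le_rfl)).trans (le_abs_self _)

/-- One step of the Galerkin scheme, compared with the Ritz projection of the exact solution. -/
theorem galerkin_step {h : ℝ} (hh : 0 < h) {N : ℕ} (hN : 0 < N) (n : ℕ) (a : ℤ → ℤ → ℝ)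
    {t t' D : ℝ} (h0 : 0 ≤ t) (htt : t < t') (h1 : t' ≤ 1) (hD : ∀ s ∈ Icc t t',
      l2 (N * h) (fun x => cellSum n a heatStepXX t' x - cellSum n a heatStepXX s x) ≤ D)
    {G G' : ℝ → ℝ} (hG : IsPL h (N * h) G) (hG' : IsPL h (N * h) G')
    (heq : ∀ φ, IsPL h (N * h) φ → 1 / (t' - t) * (∫ x, (G' x - G x) * φ x)
      + ∫ x, deriv G' x * deriv φ x = 1 / (t' - t) * ∫ s in t..t', ∫ x, noiseField n a s x * φ x) :
    l2 (N * h) (fun x => G' x - ritz h N (cellSum n a heatStep t') x)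
      ≤ l2 (N * h) (fun x => G x - ritz h N (cellSum n a heatStep t) x)
        + ((h ^ 2 + (t' - t)) * D + √(2 * (N * h))
          * (|cellSum n a heatStep t' (N * h) - cellSum n a heatStep t (N * h)|
            + |cellSum n a heatStep t' (-(N * h)) - cellSum n a heatStep t (-(N * h))|)) := by
  have hL : (0 : ℝ) < N * h := by positivity
  set L : ℝ := N * h with hLdef
  set u := cellSum n a heatStep t
  set u' := cellSum n a heatStep t'
  set Z := cellSum n a heatStepXX with hZdef
  have hu : HasSecondDeriv u _ (Z t) := hasSecondDeriv_sol n a t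
  have hu' : HasSecondDeriv u' _ (Z t') := hasSecondDeriv_sol n a t'
  have hR := isPL_ritz hh N u
  have hR' := isPL_ritz hh N u'
  have hdiff := hu'.sub hu
  have hD0 : 0 ≤ D := (l2_nonneg _ _).trans (hD t ⟨le_rfl, htt.le⟩)
  have hneg : ∀ v w : ℝ → ℝ, (fun x => v x - w x) = v + (-1 : ℝ) • w := fun v w => by
    ext x; simp [sub_eq_add_neg]
  have hθ : IsPL h L (fun x => G x - ritz h N u x) := by
    rw [hneg]; exact hG.add (hR.smul _)
  have hθ' : IsPL h L (fun x => G' x - ritz h N u' x) := by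
    rw [hneg]; exact hG'.add (hR'.smul _)
  set θ := fun x => G x - ritz h N u x with hθdef
  set θ' := fun x => G' x - ritz h N u' x with hθ'def
  obtain ⟨hZi, hpde⟩ := integral_noise_eq n a h0 htt.le h1 hθ'
  set w : ℝ → ℝ := fun x => u' x - u x
  set e : ℝ → ℝ := fun x => w x - affineInterp L w x - ritz h N w x with he
  have hwc : Continuous w := hu'.continuous.sub hu.continuous
  have hec : Continuous e := (hwc.sub (continuous_affineInterp _ _)).sub (isPL_ritz hh N w).continuous
  have hInt : ∀ f : ℝ → ℝ, Continuous f → Integrable fun x => f x * θ' x := fun f hf =>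
    (hf.mul hθ'.continuous).integrable_of_hasCompactSupport hθ'.hasCompactSupport.mul_left
  have hZint : ∀ s, Integrable fun x => Z s x * θ' x := by
    intro s
    obtain ⟨C, hC⟩ := (hasSecondDeriv_sol n a s).bdd
    exact hθ'.integrable.bdd_mul (hasSecondDeriv_sol n a s).meas.aestronglyMeasurable
      (Eventually.of_forall hC)
  have hk : 0 < t' - t := sub_pos.2 htt
  -- The defect has three sources: the interpolation error of the time increment w of the solution,
  -- the affine part of w that carries its boundary values, and the freezing of the second
  -- derivative at the end of the step.
  set X : ℝ := (∫ x, e x * θ' x) + (∫ x, affineInterp L w x * θ' x)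
    + ∫ s in t..t', ∫ x, (Z t' x - Z s x) * θ' x with hX
  refine energy_step (α := 1 / (t' - t)) (X := X) hL.le (by positivity) (by positivity) hθ hθ' ?_ ?_
  · have hder : ∫ x, deriv θ' x * deriv θ' x
        = (∫ x, deriv G' x * deriv θ' x) - ∫ x, deriv (ritz h N u') x * deriv θ' x := by
      have : θ' = G' + (-1 : ℝ) • ritz h N u' := hneg _ _
      calc ∫ x, deriv θ' x * deriv θ' x
          = ∫ x, deriv (G' + (-1 : ℝ) • ritz h N u') x * deriv θ' x := by rw [← this]
        _ = _ := by
          rw [hG'.integral_deriv_add hh (hR'.smul _) hθ', IsPL.integral_deriv_smul]; ring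
    have hXs : ∫ s in t..t', ∫ x, (Z t' x - Z s x) * θ' x
        = (t' - t) * (∫ x, Z t' x * θ' x) - ∫ s in t..t', ∫ x, Z s x * θ' x := by
      simp_rw [sub_mul]
      simp_rw [fun s => integral_sub (hZint t') (hZint s)]
      rw [intervalIntegral.integral_sub intervalIntegrable_const hZi, intervalIntegral.integral_const,
        smul_eq_mul]
      simp only [sub_mul]; rfl
    have hsplit : ∫ x, (θ' x - θ x) * θ' x
        = (∫ x, (G' x - G x) * θ' x) - ∫ x, (ritz h N u' x - ritz h N u x) * θ' x := by
      rw [← integral_sub (hInt (fun x => G' x - G x) (hG'.continuous.sub hG.continuous))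
        (hInt (fun x => ritz h N u' x - ritz h N u x) (hR'.continuous.sub hR.continuous))]
      congr 1 with x
      simp only [hθdef, hθ'def]; ring
    have hXe : (∫ x, e x * θ' x) + (∫ x, affineInterp L w x * θ' x)
        = (∫ x, (u' x - u x) * θ' x) - ∫ x, (ritz h N u' x - ritz h N u x) * θ' x := by
      rw [← integral_sub (hInt (fun x => u' x - u x) hwc) (hInt (fun x => ritz h N u' x - ritz h N u x) (hR'.continuous.sub hR.continuous)),
        ← integral_add (hInt _ hec) (hInt _ (continuous_affineInterp _ _))]
      congr 1 with x
      simp only [he, w, ritz_sub]; ring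
    rw [hder, integral_deriv_ritz hh hN hu' hθ', hsplit, hX, hXe, hXs]
    have := heq θ' hθ'
    rw [hpde] at this
    have hk' : 1 / (t' - t) * ((t' - t) * ∫ x, Z t' x * θ' x) = ∫ x, Z t' x * θ' x := by
      field_simp
    linear_combination this - hk'
  · have b1 : |∫ x, e x * θ' x| ≤ h ^ 2 * D * l2 L θ' := by
      rw [hθ'.integral_mul_eq hL.le]
      refine (abs_integral_mul_le_l2 hL.le (BddMeas.of_continuous hec) (hθ'.bddMeas L)).trans ?_
      refine mul_le_mul_of_nonneg_right ((l2_interp_le hh hN hdiff).trans ?_) (l2_nonneg _ _)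
      exact mul_le_mul_of_nonneg_left (hD t ⟨le_rfl, htt.le⟩) (sq_nonneg _)
    have b2 : |∫ x, affineInterp L w x * θ' x| ≤ √(2 * L) * (|w L| + |w (-L)|) * l2 L θ' := by
      rw [hθ'.integral_mul_eq hL.le]
      have hb := BddMeas.of_continuous (L := L) (continuous_affineInterp L w)
      refine (abs_integral_mul_le_l2 hL.le hb (hθ'.bddMeas L)).trans ?_
      refine mul_le_mul_of_nonneg_right ?_ (l2_nonneg _ _)
      exact l2_le_of_abs_le hL.le (by positivity) hb fun x hx => abs_affineInterp_le hL w hx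
    have b3 : |∫ s in t..t', ∫ x, (Z t' x - Z s x) * θ' x| ≤ (t' - t) * D * l2 L θ' := by
      have := intervalIntegral.norm_integral_le_of_norm_le_const (a := t) (b := t')
        (f := fun s => ∫ x, (Z t' x - Z s x) * θ' x) (C := D * l2 L θ') fun s hs => by
          rw [uIoc_of_le htt.le] at hs
          rw [hθ'.integral_mul_eq hL.le]
          refine (abs_integral_mul_le_l2 hL.le ((hu'.bddMeas L).sub
            ((hasSecondDeriv_sol n a s).bddMeas L)) (hθ'.bddMeas L)).trans ?_
          exact mul_le_mul_of_nonneg_right (hD s ⟨hs.1.le, hs.2⟩) (l2_nonneg _ _)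
      rw [Real.norm_eq_abs, abs_of_pos hk] at this
      linarith
    calc |X| ≤ |∫ x, e x * θ' x| + |∫ x, affineInterp L w x * θ' x|
          + |∫ s in t..t', ∫ x, (Z t' x - Z s x) * θ' x| := abs_add_three _ _ _
      _ ≤ _ := by
        have : (t' - t) * D * l2 L θ' + √(2 * L) * (|w L| + |w (-L)|) * l2 L θ' + h ^ 2 * D * l2 L θ'
          = ((h ^ 2 + (t' - t)) * D + √(2 * L) * (|w L| + |w (-L)|)) * l2 L θ' := by ring
        linarith

/-! ### Time increments of the second space derivative -/

/-- The exponential factor increases with time; only the normalization decreases, by the factor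
√(r/r'). -/
theorem heatKernel_ge_of_le {r r' : ℝ} (hr : 0 < r) (hrr : r ≤ r') (z : ℝ) :
    √(r / r') * heatKernel r z ≤ heatKernel r' z := by
  have hr' : 0 < r' := hr.trans_le hrr
  rw [heatKernel_of_pos hr, heatKernel_of_pos hr', ← mul_assoc]
  have e : √(r / r') * (1 / √(4 * Real.pi * r)) = 1 / √(4 * Real.pi * r') := by
    rw [Real.sqrt_div hr.le, Real.sqrt_mul (by positivity : (0 : ℝ) ≤ 4 * Real.pi) r,
      Real.sqrt_mul (by positivity : (0 : ℝ) ≤ 4 * Real.pi) r']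
    have := Real.sqrt_pos.2 hr
    have := Real.sqrt_pos.2 hr'
    field_simp
  rw [e]
  refine mul_le_mul_of_nonneg_left (Real.exp_le_exp.2 ?_) (by positivity)
  rw [neg_div, neg_div, neg_le_neg_iff]
  exact div_le_div_of_nonneg_left (sq_nonneg z) (by positivity) (by linarith)

/-- The pointwise lower bound gives |G' - G| ≤ 2(1 - √(r/r')) G + (G' - G), and the last bracket
integrates to zero because both kernels have mass one. Finally √(r/r') ≥ r/r'. -/
theorem integral_abs_heatKernel_sub_le {r r' : ℝ} (hr : 0 < r) (hrr : r ≤ r') :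
    ∫ z, |heatKernel r' z - heatKernel r z| ≤ 2 * ((r' - r) / r') := by
  have hr' : 0 < r' := hr.trans_le hrr
  have hi := integrable_heatKernel r
  have hi' := integrable_heatKernel r'
  have hsub : Integrable fun z => heatKernel r' z - heatKernel r z := hi'.sub hi
  have hq : r / r' ≤ 1 := (div_le_one hr').2 hrr
  have hs : r / r' ≤ √(r / r') := by
    refine Real.le_sqrt_of_sq_le ?_
    have : 0 ≤ r / r' := by positivity
    nlinarith
  have hs1 : √(r / r') ≤ 1 := Real.sqrt_le_one.2 hq
  calc ∫ z, |heatKernel r' z - heatKernel r z|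
      ≤ ∫ z, (2 * (1 - √(r / r')) * heatKernel r z + (heatKernel r' z - heatKernel r z)) := by
        refine integral_mono hsub.abs ((hi.const_mul _).add hsub) fun z => ?_
        have h1 := heatKernel_ge_of_le hr hrr z
        have h2 := heatKernel_nonneg r z
        beta_reduce
        rcases abs_cases (heatKernel r' z - heatKernel r z) with ⟨h, _⟩ | ⟨h, _⟩ <;> rw [h]
        · nlinarith
        · nlinarith
    _ = 2 * (1 - √(r / r')) := by
        rw [integral_add (hi.const_mul _) hsub, integral_const_mul, integral_sub hi' hi,
          integral_heatKernel hr, integral_heatKernel hr']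
        ring
    _ ≤ 2 * ((r' - r) / r') := by
        rw [sub_div, div_self hr'.ne']
        linarith

/-- The cells of the space grid. -/
def cell (n : ℕ) (l : ℤ) : Set ℝ := Ico ((l : ℝ) / 2 ^ n) ((l + 1) / 2 ^ n)

theorem measurableSet_cell (n : ℕ) (l : ℤ) : MeasurableSet (cell n l) := measurableSet_Ico

theorem pairwise_disjoint_cell (n : ℕ) (s : Set ℤ) : s.PairwiseDisjoint (cell n) := by
  intro l _ l' _ hll
  refine disjoint_left.2 fun x hx hx' => hll ?_
  rw [cell, mem_cell_iff] at hx hx'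
  exact hx.symm.trans hx'

theorem volume_cell (n : ℕ) (l : ℤ) : volume (cell n l) = ENNReal.ofReal (1 / 2 ^ n) := by
  rw [cell, Real.volume_Ico]
  congr 1
  ring

/-- A Schur-type bound for sums of functions that are almost localized in the cells. -/
theorem lintegral_sq_sum_cells_le (n : ℕ) {κ : ℝ → ℝ} (hκ : Measurable κ) {A F : ℝ} {q : ℝ≥0∞}
    (hA : (∫⁻ z, ‖κ z‖ₑ) + q ≤ ENNReal.ofReal A) (hA0 : 0 ≤ A) (hF : 0 ≤ F)
    {b : ℤ → ℝ} (hb : ∀ l, |b l| ≤ F) {w : ℤ → ℝ → ℝ}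
    (hw : ∀ l, ∀ᵐ x : ℝ, ‖w l x‖ₑ ≤ (∫⁻ y in cell n l, ‖κ (x - y)‖ₑ) + q * (cell n l).indicator 1 x) :
    ∫⁻ x, ‖∑ l ∈ Finset.Ico (-2 ^ (2 * n) : ℤ) (2 ^ (2 * n)), b l * w l x‖ₑ ^ 2
      ≤ ENNReal.ofReal ((F * A * √(2 ^ (n + 1))) ^ 2) := by
  set s := Finset.Ico (-2 ^ (2 * n) : ℤ) (2 ^ (2 * n)) with hs
  set V : ℤ → ℝ → ℝ≥0∞ := fun l x =>
    (∫⁻ y in cell n l, ‖κ (x - y)‖ₑ) + q * (cell n l).indicator 1 x with hV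
  have hmκ : Measurable fun p : ℝ × ℝ => ‖κ (p.1 - p.2)‖ₑ :=
    (hκ.comp (measurable_fst.sub measurable_snd)).enorm
  have hVm : ∀ l, Measurable (V l) := fun l =>
    (hmκ.lintegral_prod_right' (ν := volume.restrict (cell n l))).add
      ((measurable_one.indicator (measurableSet_cell n l)).const_mul q)
  -- Schur's test. At each point the sum over l is at most A because the cells are disjoint, and for
  -- each l the integral over x is at most A 2^{-n}. One factor of the square is estimated each way,
  -- and the 2^{2n+1} cells leave 2^{n+1}.
  have hsup : ∀ x, ∑ l ∈ s, V l x ≤ ENNReal.ofReal A := by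
    intro x
    refine le_trans ?_ hA
    rw [hV, Finset.sum_add_distrib, ← Finset.mul_sum,
      ← lintegral_biUnion_finset (pairwise_disjoint_cell n _) fun l _ => measurableSet_cell n l]
    refine add_le_add ((setLIntegral_le_lintegral _ _).trans_eq ?_) ?_
    · exact lintegral_sub_left_eq_self (fun z => ‖κ z‖ₑ) x
    · refine mul_le_of_le_one_right' ?_
      rw [← Finset.indicator_biUnion_apply]
      · exact indicator_le_self' (f := (1 : ℝ → ℝ≥0∞)) (by simp) x
      · intro l hl l' hl' hll
        exact pairwise_disjoint_cell n univ (mem_univ l) (mem_univ l') hll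
  have hInt : ∀ l, ∫⁻ x, V l x ≤ ENNReal.ofReal (1 / 2 ^ n) * ENNReal.ofReal A := by
    intro l
    have hswap : ∫⁻ x, ∫⁻ y in cell n l, ‖κ (x - y)‖ₑ = ∫⁻ y in cell n l, ∫⁻ x, ‖κ (x - y)‖ₑ :=
      lintegral_lintegral_swap (f := fun x y => ‖κ (x - y)‖ₑ) hmκ.aemeasurable
    have hshift : ∀ y, ∫⁻ x, ‖κ (x - y)‖ₑ = ∫⁻ z, ‖κ z‖ₑ := fun y =>
      lintegral_sub_right_eq_self (fun z => ‖κ z‖ₑ) y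
    simp only [hV]
    rw [lintegral_add_left (hmκ.lintegral_prod_right' (ν := volume.restrict (cell n l))),
      hswap, lintegral_const_mul _
        (measurable_one.indicator (measurableSet_cell n l)),
      lintegral_indicator_one (measurableSet_cell n l)]
    simp_rw [hshift]
    rw [setLIntegral_const, volume_cell, mul_comm q, mul_comm (∫⁻ z, ‖κ z‖ₑ), ← mul_add]
    gcongr
  have hbe : ∀ l, ‖b l‖ₑ ≤ ENNReal.ofReal F := fun l => by
    rw [← ofReal_norm]; exact ENNReal.ofReal_le_ofReal (hb l)
  calc ∫⁻ x, ‖∑ l ∈ s, b l * w l x‖ₑ ^ 2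
      ≤ ∫⁻ x, ENNReal.ofReal F * ENNReal.ofReal A * (ENNReal.ofReal F * ∑ l ∈ s, V l x) := by
        refine lintegral_mono_ae ?_
        have hall : ∀ᵐ x : ℝ, ∀ l, ‖w l x‖ₑ ≤ V l x := ae_all_iff.2 hw
        filter_upwards [hall] with x hx
        have h1 : ‖∑ l ∈ s, b l * w l x‖ₑ ≤ ENNReal.ofReal F * ∑ l ∈ s, V l x := by
          refine (enorm_sum_le _ _).trans ?_
          rw [Finset.mul_sum]
          refine Finset.sum_le_sum fun l _ => ?_
          rw [enorm_mul]
          exact mul_le_mul' (hbe l) (hx l)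
        rw [pow_two]
        refine mul_le_mul' (h1.trans ?_) h1
        gcongr
        exact hsup x
    _ = ENNReal.ofReal F * ENNReal.ofReal A * (ENNReal.ofReal F * ∑ l ∈ s, ∫⁻ x, V l x) := by
        rw [lintegral_const_mul _ ((Finset.measurable_fun_sum s fun l _ => hVm l).const_mul _),
          lintegral_const_mul _ (Finset.measurable_fun_sum s fun l _ => hVm l),
          lintegral_finsetSum _ fun l _ => hVm l]
    _ ≤ ENNReal.ofReal F * ENNReal.ofReal A * (ENNReal.ofReal F *
        ∑ l ∈ s, ENNReal.ofReal (1 / 2 ^ n) * ENNReal.ofReal A) := by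
        gcongr with l _
        exact hInt l
    _ = ENNReal.ofReal ((F * A * √(2 ^ (n + 1))) ^ 2) := by
        have hcard : (s.card : ℝ≥0∞) = ENNReal.ofReal (2 ^ (2 * n + 1)) := by
          have : s.card = 2 ^ (2 * n + 1) := by
            rw [hs, Int.card_Ico]
            have : (2 : ℤ) ^ (2 * n) - -2 ^ (2 * n) = ((2 ^ (2 * n + 1) : ℕ) : ℤ) := by
              push_cast; ring
            rw [this, Int.toNat_natCast]
          rw [this, ← ENNReal.ofReal_natCast]
          push_cast; rfl
        rw [Finset.sum_const, nsmul_eq_mul, hcard]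
        rw [← ENNReal.ofReal_mul (by positivity), ← ENNReal.ofReal_mul (by positivity),
          ← ENNReal.ofReal_mul (by positivity), ← ENNReal.ofReal_mul (by positivity),
          ← ENNReal.ofReal_mul (by positivity)]
        congr 1
        rw [mul_pow, Real.sq_sqrt (by positivity)]
        have : (2 : ℝ) ^ (2 * n + 1) * (1 / 2 ^ n) = 2 ^ (n + 1) := by
          rw [mul_one_div, div_eq_iff (by positivity), ← pow_add]; congr 1; ring
        linear_combination (F * A) ^ 2 * this

/-- The contribution of one time slab to the second space derivative. -/
def slabXX (n : ℕ) (b : ℤ → ℝ) (r x : ℝ) : ℝ :=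
  ∑ l ∈ Finset.Ico (-2 ^ (2 * n) : ℤ) (2 ^ (2 * n)),
    b l * (heatStepXX r (x - l / 2 ^ n) - heatStepXX r (x - (l + 1) / 2 ^ n))

theorem cellSum_heatStepXX (n : ℕ) (a : ℤ → ℤ → ℝ) (t x : ℝ) :
    cellSum n a heatStepXX t x = ∑ k ∈ Finset.Ico (0 : ℤ) (2 ^ n),
      (slabXX n (a k) (t - k / 2 ^ n) x - slabXX n (a k) (t - (k + 1) / 2 ^ n) x) := by
  unfold cellSum slabXX
  refine Finset.sum_congr rfl fun k _ => ?_
  rw [← Finset.sum_sub_distrib]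
  exact Finset.sum_congr rfl fun l _ => by ring

theorem measurable_heatStepXX_space (r c : ℝ) : Measurable fun x => heatStepXX r (x - c) :=
  measurable_heatStepXX.comp (measurable_const.prodMk (measurable_id.sub_const c))

theorem bddMeas_slabXX (n : ℕ) (b : ℤ → ℝ) (r L : ℝ) : BddMeas L (slabXX n b r) := by
  refine ⟨?_, ∑ l ∈ Finset.Ico (-2 ^ (2 * n) : ℤ) (2 ^ (2 * n)), |b l| * 2, fun x _ => ?_⟩
  · exact Finset.measurable_fun_sum _ fun l _ =>
      ((measurable_heatStepXX_space _ _).sub (measurable_heatStepXX_space _ _)).const_mul _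
  · unfold slabXX
    refine (Finset.abs_sum_le_sum_abs _ _).trans (Finset.sum_le_sum fun l _ => ?_)
    rw [abs_mul]
    refine mul_le_mul_of_nonneg_left ((abs_sub _ _).trans ?_) (abs_nonneg _)
    linarith [abs_heatStepXX_le r (x - l / 2 ^ n), abs_heatStepXX_le r (x - (l + 1) / 2 ^ n)]

/-- The factor that bounds the increments over a time step of length at most `δ`. -/
def incrFactor (δ r : ℝ) : ℝ := if 0 < r then 2 * min 1 (δ / r) else 0

theorem incrFactor_nonneg {δ : ℝ} (hδ : 0 ≤ δ) (r : ℝ) : 0 ≤ incrFactor δ r := by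
  unfold incrFactor; split_ifs <;> positivity

theorem incrFactor_le_two {δ : ℝ} (r : ℝ) : incrFactor δ r ≤ 2 := by
  unfold incrFactor; split_ifs
  · linarith [min_le_left 1 (δ / r)]
  · norm_num

/-- If both times are positive, a cell contributes the difference of two heat kernels integrated
over it, which is small in L¹. If r ≤ 0 < r', it contributes one heat kernel integral minus the
indicator of the cell, of total mass 2; this is consistent with `incrFactor` since then r' ≤ r' - r
≤ δ. If neither is positive, nothing is left. -/
theorem l2_slabXX_sub_le (n : ℕ) {b : ℤ → ℝ} {F : ℝ} (hF : 0 ≤ F) (hb : ∀ l, |b l| ≤ F) {r r' δ L : ℝ}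
    (hL : 0 ≤ L) (hrr : r ≤ r') (hδ : r' - r ≤ δ) :
    l2 L (fun x => slabXX n b r' x - slabXX n b r x) ≤ F * incrFactor δ r' * √(2 ^ (n + 1)) := by
  have hδ0 : 0 ≤ δ := by linarith
  have hA0 := incrFactor_nonneg hδ0 r'
  refine l2_le_of_lintegral hL (by positivity)
    ((bddMeas_slabXX n b r' L).sub (bddMeas_slabXX n b r L)).meas ?_
  set w : ℤ → ℝ → ℝ := fun l x =>
    (heatStepXX r' (x - l / 2 ^ n) - heatStepXX r' (x - (l + 1) / 2 ^ n))
      - (heatStepXX r (x - l / 2 ^ n) - heatStepXX r (x - (l + 1) / 2 ^ n)) with hw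
  have hsum : ∀ x, slabXX n b r' x - slabXX n b r x
      = ∑ l ∈ Finset.Ico (-2 ^ (2 * n) : ℤ) (2 ^ (2 * n)), b l * w l x := by
    intro x
    unfold slabXX
    rw [← Finset.sum_sub_distrib]
    exact Finset.sum_congr rfl fun l _ => by rw [hw]; ring
  simp_rw [hsum]
  have hmk : ∀ r, Measurable (heatKernel r) := fun r => (continuous_heatKernel r).measurable
  have hcd : ∀ l : ℤ, (l : ℝ) / 2 ^ n ≤ (l + 1) / 2 ^ n := fun l => by gcongr; linarith
  have hgrid : ∀ᵐ x : ℝ, x ∉ gridPoints n :=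
    measure_mono_null (fun _ hx => not_not.1 hx) ((countable_gridPoints n).measure_zero _)
  have hen : ∀ (κ : ℝ → ℝ) (l : ℤ) (x : ℝ),
      ‖∫ y in ((l : ℝ) / 2 ^ n)..((l + 1) / 2 ^ n), κ (x - y)‖ₑ
        ≤ ∫⁻ y in cell n l, ‖κ (x - y)‖ₑ := by
    intro κ l x
    rw [intervalIntegral.integral_of_le (hcd l), ← integral_Ico_eq_integral_Ioc]
    exact enorm_integral_le_lintegral_enorm _
  by_cases h' : 0 < r'
  swap
  · refine lintegral_sq_sum_cells_le n (κ := 0) measurable_const (q := 0) (by simp) hA0 hF hb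
      fun l => Eventually.of_forall fun x => ?_
    have : w l x = 0 := by
      simp [hw, heatStepXX, not_lt.2 (hrr.trans (not_lt.1 h')), h']
    simp [this]
  by_cases h : 0 < r
  · refine lintegral_sq_sum_cells_le n (κ := fun z => heatKernel r' z - heatKernel r z) (q := 0)
      ((hmk r').sub (hmk r)) ?_ hA0 hF hb fun l => Eventually.of_forall fun x => ?_
    · rw [add_zero]
      have hi := (integrable_heatKernel r').sub (integrable_heatKernel r)
      have e := ofReal_integral_norm_eq_lintegral_enorm hi
      simp only [Pi.sub_apply] at e
      rw [← e]
      refine ENNReal.ofReal_le_ofReal ((integral_abs_heatKernel_sub_le h hrr).trans ?_)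
      rw [incrFactor, if_pos h']
      gcongr
      refine le_min ((div_le_one h').2 (by linarith)) (by gcongr)
    · have e : w l x = ∫ y in ((l : ℝ) / 2 ^ n)..((l + 1) / 2 ^ n),
          (heatKernel r' (x - y) - heatKernel r (x - y)) := by
        have hc : ∀ r, Continuous fun y => heatKernel r (x - y) := fun r =>
          (continuous_heatKernel r).comp (continuous_const.sub continuous_id)
        rw [intervalIntegral.integral_sub ((hc r').intervalIntegrable _ _)
          ((hc r).intervalIntegrable _ _), integral_heatKernel_sub, integral_heatKernel_sub]
        simp only [hw, heatStepXX, h, h', if_true]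
        ring
      rw [e, zero_mul, add_zero]
      exact hen (fun z => heatKernel r' z - heatKernel r z) l x
  · refine lintegral_sq_sum_cells_le n (κ := heatKernel r') (q := 1)
      (hmk r') ?_ hA0 hF hb fun l => ?_
    · have e := ofReal_integral_norm_eq_lintegral_enorm (integrable_heatKernel r')
      simp only [Real.norm_eq_abs, abs_of_nonneg (heatKernel_nonneg _ _)] at e
      rw [← e, integral_heatKernel h', ← ENNReal.ofReal_one,
        ← ENNReal.ofReal_add zero_le_one zero_le_one]
      refine ENNReal.ofReal_le_ofReal ?_
      rw [incrFactor, if_pos h', min_eq_left ((one_le_div h').2 (by linarith))]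
      norm_num
    · filter_upwards [hgrid] with x hx
      have hne := sub_ne_zero_of_notMem_gridPoints hx l
      have e : w l x = (∫ y in ((l : ℝ) / 2 ^ n)..((l + 1) / 2 ^ n), heatKernel r' (x - y))
          - (cell n l).indicator 1 x := by
        rw [integral_heatKernel_sub, cell, ← sign_sub_sign (hcd l) hne.1 hne.2]
        simp only [hw, heatStepXX, h, h', if_true, if_false]
        ring
      rw [e]
      refine (enorm_sub_le).trans (add_le_add (hen _ l x) ?_)
      rw [one_mul]
      by_cases hc : x ∈ cell n l <;> simp [hc]

theorem l2_solXX_sub_le (n : ℕ) {a : ℤ → ℤ → ℝ} {F : ℝ} (hF : 0 ≤ F)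
    (ha : ∀ k ∈ Finset.Ico (0 : ℤ) (2 ^ n), ∀ l, |a k l| ≤ F)
    {s t δ L : ℝ} (hL : 0 ≤ L) (hst : s ≤ t) (hδ : t - s ≤ δ) :
    l2 L (fun x => cellSum n a heatStepXX t x - cellSum n a heatStepXX s x)
      ≤ F * √(2 ^ (n + 1)) * ∑ k ∈ Finset.Ico (0 : ℤ) (2 ^ n),
        (incrFactor δ (t - k / 2 ^ n) + incrFactor δ (t - (k + 1) / 2 ^ n)) := by
  have e : ∀ x, cellSum n a heatStepXX t x - cellSum n a heatStepXX s x
      = ∑ k ∈ Finset.Ico (0 : ℤ) (2 ^ n),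
        ((slabXX n (a k) (t - k / 2 ^ n) x - slabXX n (a k) (s - k / 2 ^ n) x)
        - (slabXX n (a k) (t - (k + 1) / 2 ^ n) x - slabXX n (a k) (s - (k + 1) / 2 ^ n) x)) := by
    intro x
    rw [cellSum_heatStepXX, cellSum_heatStepXX, ← Finset.sum_sub_distrib]
    exact Finset.sum_congr rfl fun k _ => by ring
  simp_rw [e]
  have hb : ∀ (k : ℤ) (r r' : ℝ), BddMeas L fun x => slabXX n (a k) r' x - slabXX n (a k) r x :=
    fun k r r' => (bddMeas_slabXX _ _ _ _).sub (bddMeas_slabXX _ _ _ _)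
  refine ((l2_sum_le hL _ fun k _ => (hb k _ _).sub (hb k _ _)).2).trans ?_
  rw [Finset.mul_sum]
  refine Finset.sum_le_sum fun k hk => (l2_sub_le hL (hb k _ _) (hb k _ _)).trans ?_
  have h1 := l2_slabXX_sub_le n hF (ha k hk) hL (r := s - k / 2 ^ n) (r' := t - k / 2 ^ n) (δ := δ)
    (by linarith) (by linarith)
  have h2 := l2_slabXX_sub_le n hF (ha k hk) hL (r := s - (k + 1) / 2 ^ n)
    (r' := t - (k + 1) / 2 ^ n) (δ := δ) (by linarith) (by linarith)
  linarith

/-- Harmonic sum by dyadic blocks: each doubling of the range adds at most 1. -/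
theorem sum_inv_le (m : ℕ) :
    ∑ j ∈ Finset.range (2 ^ m), (if j = 0 then (1 : ℝ) else 1 / j) ≤ m + 1 := by
  induction m with
  | zero => simp
  | succ m ih =>
    rw [pow_succ, mul_two, Finset.sum_range_add]
    have : ∑ x ∈ Finset.range (2 ^ m), (if 2 ^ m + x = 0 then (1 : ℝ) else 1 / ((2 ^ m + x : ℕ) : ℝ))
        ≤ ∑ _ ∈ Finset.range (2 ^ m), 1 / (2 ^ m : ℝ) := by
      refine Finset.sum_le_sum fun x _ => ?_
      rw [if_neg (by positivity)]
      push_cast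
      gcongr
      linarith [(Nat.cast_nonneg x : (0 : ℝ) ≤ x)]
    have h2 : ∑ _ ∈ Finset.range (2 ^ m), 1 / (2 ^ m : ℝ) = 1 := by simp
    push_cast
    push_cast at this
    linarith

/-- A singular time τ costs only a harmonic sum over the time grid. With p the integer part of 2^m
τ, terms before p vanish, the term p is at most 2, and the term p + j is at most 2/j. -/
theorem sum_incrFactor_le (m : ℕ) {τ : ℝ} (hτ : 0 ≤ τ) :
    ∑ i ∈ Finset.range (2 ^ m), incrFactor (1 / 2 ^ m) (((i : ℝ) + 1) / 2 ^ m - τ) ≤ 2 * (m + 1) := by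
  set M : ℝ := 2 ^ m with hM
  have hM0 : 0 < M := by positivity
  set p := ⌊M * τ⌋₊ with hp
  have hp1 : (p : ℝ) ≤ M * τ := Nat.floor_le (by positivity)
  have hp2 : M * τ < p + 1 := Nat.lt_floor_add_one _
  have hterm : ∀ i : ℕ, incrFactor (1 / M) (((i : ℝ) + 1) / M - τ)
      ≤ if i < p then 0 else 2 * (if i - p = 0 then (1 : ℝ) else 1 / ((i - p : ℕ) : ℝ)) := by
    intro i
    split_ifs with h1 h2
    · have : (i : ℝ) + 1 ≤ p := by exact_mod_cast h1
      rw [incrFactor, if_neg]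
      rw [not_lt, sub_nonpos, div_le_iff₀ hM0]
      linarith
    · linarith [incrFactor_le_two (δ := 1 / M) (((i : ℝ) + 1) / M - τ)]
    · have h3 : p ≤ i := not_lt.1 h1
      have h4 : 0 < i - p := Nat.pos_of_ne_zero h2
      have h5 : (((i - p : ℕ) : ℝ)) = i - p := by push_cast [h3]; ring
      have h6 : (0 : ℝ) < i - p := by rw [← h5]; exact_mod_cast h4
      have h7 : ((i : ℝ) - p) / M ≤ ((i : ℝ) + 1) / M - τ := by
        rw [div_le_iff₀ hM0, sub_mul, div_mul_cancel₀ _ hM0.ne']; linarith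
      have h8 : 0 < ((i : ℝ) - p) / M := by positivity
      rw [incrFactor, if_pos (h8.trans_le h7), h5]
      gcongr
      refine (min_le_right _ _).trans ?_
      calc 1 / M / (((i : ℝ) + 1) / M - τ) ≤ 1 / M / (((i : ℝ) - p) / M) := by gcongr
        _ = 1 / ((i : ℝ) - p) := by field_simp
  refine (Finset.sum_le_sum fun i _ => hterm i).trans ?_
  have hnn : ∀ j : ℕ, (0 : ℝ) ≤ if j = 0 then (1 : ℝ) else 1 / j := fun j => by
    split_ifs <;> positivity
  calc ∑ i ∈ Finset.range (2 ^ m),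
        (if i < p then 0 else 2 * (if i - p = 0 then (1 : ℝ) else 1 / ((i - p : ℕ) : ℝ)))
      ≤ ∑ i ∈ Finset.range (p + 2 ^ m),
        (if i < p then 0 else 2 * (if i - p = 0 then (1 : ℝ) else 1 / ((i - p : ℕ) : ℝ))) := by
        -- After the range is enlarged by p, the p vanishing terms are followed by a full harmonic
        -- sum of length 2^m, even when p exceeds 2^m.
        refine Finset.sum_le_sum_of_subset_of_nonneg (Finset.range_mono (by lia)) fun i _ _ => ?_
        split_ifs
        · exact le_rfl
        · norm_num
        · positivity
    _ = 2 * ∑ j ∈ Finset.range (2 ^ m), (if j = 0 then (1 : ℝ) else 1 / j) := by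
        rw [Finset.sum_range_add, Finset.sum_eq_zero fun i hi => if_pos (Finset.mem_range.1 hi),
          zero_add, Finset.mul_sum]
        refine Finset.sum_congr rfl fun j _ => ?_
        rw [if_neg (by lia), Nat.add_sub_cancel_left]
    _ ≤ 2 * (m + 1) := by linarith [sum_inv_le m]

/-! ### Time variation of the solution away from the noise -/

/-- The inequality w/a ≤ e^{w/a}, raised to the power a. -/
theorem rpow_mul_exp_neg_le {a w : ℝ} (ha : 0 < a) (hw : 0 < w) :
    Real.exp (-w) ≤ a ^ a * w ^ (-a) := by
  have h1 : w / a ≤ Real.exp (w / a) := by linarith [Real.add_one_le_exp (w / a)]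
  have h2 : (w / a) ^ a ≤ Real.exp w := by
    refine (Real.rpow_le_rpow (by positivity) h1 ha.le).trans_eq ?_
    rw [← Real.exp_mul, div_mul_cancel₀ _ ha.ne']
  rw [Real.div_rpow hw.le ha.le, div_le_iff₀ (by positivity)] at h2
  rw [Real.exp_neg, Real.rpow_neg hw.le, inv_le_iff_one_le_mul₀ (Real.exp_pos _)]
  have hwa : 0 < w ^ a := by positivity
  rw [mul_assoc, mul_comm, mul_assoc, ← div_eq_inv_mul, one_le_div hwa]
  linarith

/-- The constant in the polynomial bound of the heat kernel. -/
def tailConst (β : ℝ) : ℝ := (2 * (1 + β)) ^ ((1 + β) / 2)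

theorem tailConst_nonneg {β : ℝ} (hβ : 0 < β) : 0 ≤ tailConst β := by unfold tailConst; positivity

/-- The exponential is traded for the power a = (1+β)/2 of 4r/z², chosen so that |z|^{-1-β} appears.
The remaining r^a absorbs the singular factor r^{-1/2} because a ≥ 1/2 and r ≤ 1, so the bound is
uniform in time. -/
theorem heatKernel_le_rpow {β r z : ℝ} (hβ : 0 < β) (hr : r ≤ 1) (hz : z ≠ 0) :
    heatKernel r z ≤ tailConst β * |z| ^ (-1 - β) := by
  have hz' : 0 < |z| := abs_pos.2 hz
  by_cases h : 0 < r
  swap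
  · rw [heatKernel_of_nonpos (not_lt.1 h)]
    exact mul_nonneg (tailConst_nonneg hβ) (by positivity)
  set a := (1 + β) / 2 with ha
  have ha0 : 0 < a := by positivity
  rw [heatKernel_of_pos h, neg_div]
  have h1 := rpow_mul_exp_neg_le ha0 (show 0 < z ^ 2 / (4 * r) by positivity)
  have e1 : (z ^ 2 / (4 * r)) ^ (-a) = (4 : ℝ) ^ a * r ^ a * |z| ^ (-1 - β) := by
    rw [Real.div_rpow (by positivity) (by positivity), Real.rpow_neg (by positivity : 0 ≤ 4 * r),
      div_inv_eq_mul, Real.mul_rpow (by norm_num) h.le, ← sq_abs, ← Real.rpow_natCast |z| 2,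
      ← Real.rpow_mul hz'.le]
    rw [show ((2 : ℕ) : ℝ) * -a = -1 - β by rw [ha]; push_cast; ring]
    ring
  have h2 : 1 / √(4 * Real.pi * r) * r ^ a ≤ 1 := by
    have h3 : r ^ a ≤ √r := by
      rw [Real.sqrt_eq_rpow]
      exact Real.rpow_le_rpow_of_exponent_ge h hr (by rw [ha]; linarith)
    have h4 : √r ≤ √(4 * Real.pi * r) := by
      refine Real.sqrt_le_sqrt ?_
      nlinarith [Real.pi_gt_three]
    rw [one_div_mul_eq_div, div_le_one (by positivity)]
    exact h3.trans h4
  have e2 : tailConst β = a ^ a * 4 ^ a := by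
    rw [tailConst, ← ha, ← Real.mul_rpow ha0.le (by norm_num)]
    congr 1; rw [ha]; ring
  calc 1 / √(4 * Real.pi * r) * Real.exp (-(z ^ 2 / (4 * r)))
      ≤ 1 / √(4 * Real.pi * r) * (a ^ a * ((4 : ℝ) ^ a * r ^ a * |z| ^ (-1 - β))) := by
        rw [← e1]; gcongr
    _ = (1 / √(4 * Real.pi * r) * r ^ a) * (tailConst β * |z| ^ (-1 - β)) := by rw [e2]; ring
    _ ≤ 1 * (tailConst β * |z| ^ (-1 - β)) := by
        refine mul_le_mul_of_nonneg_right h2 (mul_nonneg (tailConst_nonneg hβ) (by positivity))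
    _ = _ := one_mul _

/-- The time derivative has the sign of z²/(4r²) - 1/(2r), so at distance |z| the kernel peaks at
time z²/2. -/
theorem heatKernel_time_monotoneOn {z : ℝ} :
    MonotoneOn (fun r => heatKernel r z) (Iic (z ^ 2 / 2)) := by
  have h1 : MonotoneOn (fun r => heatKernel r z) (Ioc 0 (z ^ 2 / 2)) := by
    refine monotoneOn_of_deriv_nonneg (convex_Ioc _ _)
      (fun r hr => (hasDerivAt_heatKernel_time hr.1 z).continuousAt.continuousWithinAt)
      (fun r hr => ?_) fun r hr => ?_
    · rw [interior_Ioc] at hr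
      exact (hasDerivAt_heatKernel_time hr.1 z).differentiableAt.differentiableWithinAt
    · rw [interior_Ioc] at hr
      rw [(hasDerivAt_heatKernel_time hr.1 z).deriv]
      refine mul_nonneg ?_ (heatKernel_nonneg _ _)
      rw [sub_nonneg, div_le_div_iff₀ (by linarith [hr.1]) (by have := hr.1; positivity)]
      nlinarith [hr.1, hr.2]
  intro r hr r' hr' hrr
  by_cases h : 0 < r
  · exact h1 ⟨h, hr⟩ ⟨h.trans_le hrr, hr'⟩ hrr
  · simp only [heatKernel_of_nonpos (not_lt.1 h)]
    exact heatKernel_nonneg _ _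

theorem heatKernel_time_antitoneOn {z : ℝ} (hz : z ≠ 0) :
    AntitoneOn (fun r => heatKernel r z) (Ici (z ^ 2 / 2)) := by
  have hp : ∀ r ∈ Ici (z ^ 2 / 2), 0 < r := fun r hr =>
    lt_of_lt_of_le (by positivity) (mem_Ici.1 hr)
  refine antitoneOn_of_deriv_nonpos (convex_Ici _)
    (fun r hr => (hasDerivAt_heatKernel_time (hp r hr) z).continuousAt.continuousWithinAt)
    (fun r hr => ?_) fun r hr => ?_
  · exact (hasDerivAt_heatKernel_time (hp r (interior_subset hr)) z).differentiableAt.differentiableWithinAt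
  · have h0 := hp r (interior_subset hr)
    have h1 : z ^ 2 / 2 ≤ r := interior_subset hr
    rw [(hasDerivAt_heatKernel_time h0 z).deriv]
    refine mul_nonpos_of_nonpos_of_nonneg ?_ (heatKernel_nonneg _ _)
    rw [sub_nonpos, div_le_div_iff₀ (by positivity) (by positivity)]
    nlinarith

/-- The variation of a nonnegative unimodal function is at most twice its maximum. -/
theorem sum_abs_sub_le_of_unimodal {g : ℝ → ℝ} {p b B : ℝ} (hmono : MonotoneOn g (Iic p))
    (hanti : AntitoneOn g (Icc p b)) (hpb : p ≤ b) (hg : ∀ r, 0 ≤ g r) (hB : g p ≤ B) {t : ℕ → ℝ}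
    (ht : Monotone t) {M : ℕ} (htb : ∀ i ≤ M, t i ≤ b) :
    ∑ i ∈ Finset.range M, |g (t (i + 1)) - g (t i)| ≤ 2 * B := by
  -- Reflecting g after its peak yields an increasing function whose increments dominate those of g
  -- in absolute value, including a step that jumps over the peak. The sum then telescopes.
  set V : ℝ → ℝ := fun r => if r ≤ p then g r else 2 * g p - g r with hV
  have hstep : ∀ r r', r ≤ r' → r' ≤ b → |g r' - g r| ≤ V r' - V r := by
    intro r r' hrr hb
    simp only [hV]
    split_ifs with h1 h2 h2
    · rw [abs_of_nonneg (sub_nonneg.2 (hmono h2 h1 hrr))]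
    · exact absurd (hrr.trans h1) h2
    · have a1 := hmono h2 (mem_Iic.2 le_rfl) h2
      have a2 := hanti ⟨le_rfl, hpb⟩ ⟨(not_le.1 h1).le, hb⟩ (not_le.1 h1).le
      rw [abs_le]; constructor <;> linarith
    · have a1 := hanti ⟨(not_le.1 h2).le, hrr.trans hb⟩ ⟨(not_le.1 h1).le, hb⟩ hrr
      rw [abs_of_nonpos (by linarith)]; linarith
  calc ∑ i ∈ Finset.range M, |g (t (i + 1)) - g (t i)|
      ≤ ∑ i ∈ Finset.range M, (V (t (i + 1)) - V (t i)) :=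
        Finset.sum_le_sum fun i hi => hstep _ _ (ht (Nat.le_succ i))
          (htb (i + 1) (Finset.mem_range.1 hi))
    _ = V (t M) - V (t 0) := Finset.sum_range_sub (fun i => V (t i)) M
    _ ≤ 2 * B := by
        have hp0 := hg p
        have v1 : V (t M) ≤ 2 * g p := by
          simp only [hV]; split_ifs with h
          · have := hmono h (mem_Iic.2 le_rfl) h; linarith
          · linarith [hg (t M)]
        have v2 : 0 ≤ V (t 0) := by
          simp only [hV]; split_ifs with h
          · exact hg _
          · have := hanti ⟨le_rfl, hpb⟩ ⟨(not_le.1 h).le, htb 0 (Nat.zero_le _)⟩ (not_le.1 h).le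
            linarith
        linarith

/-- The peak is capped at time 1: when z²/2 > 1 the kernel is increasing on the whole time range and
the decreasing part degenerates to a point. -/
theorem sum_abs_heatKernel_sub_le {β z : ℝ} (hβ : 0 < β) (hz : z ≠ 0) {t : ℕ → ℝ}
    (ht : Monotone t) {M : ℕ} (htb : ∀ i ≤ M, t i ≤ 1) :
    ∑ i ∈ Finset.range M, |heatKernel (t (i + 1)) z - heatKernel (t i) z|
      ≤ 2 * (tailConst β * |z| ^ (-1 - β)) := by
  refine sum_abs_sub_le_of_unimodal (g := fun r => heatKernel r z) (p := min (z ^ 2 / 2) 1) (b := 1)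
    (heatKernel_time_monotoneOn.mono (Iic_subset_Iic.2 (min_le_left _ _))) ?_ (min_le_right _ _)
    (fun r => heatKernel_nonneg _ _) (heatKernel_le_rpow hβ (min_le_right _ _) hz) ht htb
  rcases le_total (z ^ 2 / 2) 1 with h | h
  · rw [min_eq_left h]
    exact (heatKernel_time_antitoneOn hz).mono Icc_subset_Ici_self
  · rw [min_eq_right h, Icc_self]
    exact antitoneOn_singleton _

/-- The power tail `|z|^{-1-β}` on `|z| ≥ d`. -/
def powerTail (β d z : ℝ) : ℝ := (Ici d).indicator (fun y => y ^ (-1 - β)) |z|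

theorem powerTail_nonneg {d : ℝ} (hd : 0 < d) (β z : ℝ) : 0 ≤ powerTail β d z :=
  indicator_nonneg (fun _ hy => Real.rpow_nonneg (hd.le.trans hy) _) _

theorem integrable_powerTail {β d : ℝ} (hβ : 0 < β) (hd : 0 < d) : Integrable (powerTail β d) ∧
    ∫ z, powerTail β d z = 2 * (d ^ (-β) / β) := by
  set f : ℝ → ℝ := (Ici d).indicator (fun y => y ^ (-1 - β)) with hf
  have hon : IntegrableOn (fun y : ℝ => y ^ (-1 - β)) (Ioi d) :=
    integrableOn_Ioi_rpow_of_lt (by linarith) hd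
  have hfi : Integrable f := by
    rw [hf, integrable_indicator_iff measurableSet_Ici, integrableOn_Ici_iff_integrableOn_Ioi]
    exact hon
  refine ⟨?_, ?_⟩
  · refine (hfi.add hfi.comp_neg).congr (Eventually.of_forall fun z => ?_)
    have hneg : ∀ y < 0, f y = 0 := fun y hy =>
      indicator_of_notMem (fun h => by linarith [mem_Ici.1 h]) _
    have h0 : f 0 = 0 := indicator_of_notMem (fun h => by linarith [mem_Ici.1 h]) _
    change f z + f (-z) = f |z|
    rcases lt_trichotomy z 0 with h | rfl | h
    · rw [hneg z h, abs_of_neg h, zero_add]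
    · simp [h0]
    · rw [hneg (-z) (by linarith), abs_of_pos h, add_zero]
  · have := integral_comp_abs (f := f)
    unfold powerTail
    rw [this]
    congr 1
    rw [hf, setIntegral_indicator measurableSet_Ici,
      inter_eq_right.2 (Ici_subset_Ioi.2 hd), integral_Ici_eq_integral_Ioi,
      integral_Ioi_rpow_of_lt (by linarith) hd, show -1 - β + 1 = -β by ring]
    field_simp

/-- The heat flow of the indicator of a cell, as a function of time. -/
def cellFlow (n : ℕ) (l : ℤ) (x r : ℝ) : ℝ :=
  heatSign r (x - l / 2 ^ n) - heatSign r (x - (l + 1) / 2 ^ n)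

theorem cell_le (n : ℕ) (l : ℤ) : (l : ℝ) / 2 ^ n ≤ (l + 1) / 2 ^ n := by gcongr; linarith

theorem cellFlow_eq (n : ℕ) (l : ℤ) (x r : ℝ) :
    cellFlow n l x r = ∫ y in cell n l, heatKernel r (x - y) := by
  rw [cellFlow, ← integral_heatKernel_sub, intervalIntegral.integral_of_le (cell_le n l),
    ← integral_Ico_eq_integral_Ioc, cell]

theorem sub_mem_tail {n : ℕ} {l : ℤ} (hl : l ∈ Finset.Ico (-2 ^ (2 * n) : ℤ) (2 ^ (2 * n))) {d x y : ℝ}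
    (hx : 2 ^ n + d ≤ |x|) (hy : y ∈ cell n l) : d ≤ |x - y| := by
  obtain ⟨h1, h2⟩ := Finset.mem_Ico.1 hl
  have h1' : -(2 : ℝ) ^ n ≤ y := by
    refine le_trans ?_ hy.1
    rw [le_div_iff₀ (by positivity), neg_mul, ← pow_add, ← two_mul]
    exact_mod_cast h1
  have h2' : y ≤ 2 ^ n := by
    refine hy.2.le.trans ?_
    rw [div_le_iff₀ (by positivity), ← pow_add, ← two_mul]
    exact_mod_cast h2
  have h3 := abs_le.2 ⟨h1', h2'⟩
  have h4 := abs_sub_abs_le_abs_sub x y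
  linarith

/-- The variation of an integral is at most the integral of the variations, and every point of the
cell is at distance at least d from x. -/
theorem sum_abs_cellFlow_sub_le {β d : ℝ} (hβ : 0 < β) (hd : 0 < d) {n : ℕ} {l : ℤ}
    (hl : l ∈ Finset.Ico (-2 ^ (2 * n) : ℤ) (2 ^ (2 * n))) {x : ℝ} (hx : 2 ^ n + d ≤ |x|) {t : ℕ → ℝ}
    (ht : Monotone t) {M : ℕ} (htb : ∀ i ≤ M, t i ≤ 1) :
    ∑ i ∈ Finset.range M, |cellFlow n l x (t (i + 1)) - cellFlow n l x (t i)|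
      ≤ ∫ y in cell n l, 2 * (tailConst β * powerTail β d (x - y)) := by
  have hi : ∀ r, IntegrableOn (fun y => heatKernel r (x - y)) (cell n l) := fun r =>
    ((integrable_heatKernel r).comp_sub_left x).integrableOn
  calc ∑ i ∈ Finset.range M, |cellFlow n l x (t (i + 1)) - cellFlow n l x (t i)|
      ≤ ∑ i ∈ Finset.range M,
        ∫ y in cell n l, |heatKernel (t (i + 1)) (x - y) - heatKernel (t i) (x - y)| := by
        refine Finset.sum_le_sum fun i _ => ?_
        rw [cellFlow_eq, cellFlow_eq, ← integral_sub (hi _) (hi _)]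
        exact abs_integral_le_integral_abs
    _ = ∫ y in cell n l, ∑ i ∈ Finset.range M,
        |heatKernel (t (i + 1)) (x - y) - heatKernel (t i) (x - y)| :=
        (integral_finsetSum _ fun i _ => ((hi _).sub (hi _)).abs).symm
    _ ≤ _ := by
        refine setIntegral_mono_on (integrable_finsetSum _ fun i _ => ((hi _).sub (hi _)).abs)
          ((((integrable_powerTail hβ hd).1.comp_sub_left x).const_mul _).const_mul _).integrableOn
          (measurableSet_cell n l) fun y hy => ?_
        have hdy := sub_mem_tail hl hx hy
        have hne : x - y ≠ 0 := abs_pos.1 (hd.trans_le hdy)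
        rw [powerTail, indicator_of_mem (mem_Ici.2 hdy)]
        exact sum_abs_heatKernel_sub_le hβ hne ht htb

theorem measurable_cellFlow (n : ℕ) (l : ℤ) (x : ℝ) : Measurable (cellFlow n l x) :=
  (measurable_heatSign.comp (measurable_id.prodMk measurable_const)).sub
    (measurable_heatSign.comp (measurable_id.prodMk measurable_const))

theorem abs_cellFlow_le (n : ℕ) (l : ℤ) (x r : ℝ) : |cellFlow n l x r| ≤ 1 := by
  refine (abs_sub _ _).trans ?_
  linarith [abs_heatSign_le r (x - l / 2 ^ n), abs_heatSign_le r (x - (l + 1) / 2 ^ n)]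

theorem intervalIntegrable_cellFlow (n : ℕ) (l : ℤ) (x t α γ : ℝ) :
    IntervalIntegrable (fun s => cellFlow n l x (t - s)) volume α γ := by
  refine (intervalIntegrable_const (c := (1 : ℝ))).mono_fun
    ((measurable_cellFlow n l x).comp (measurable_const.sub measurable_id)).aestronglyMeasurable.restrict
    (Eventually.of_forall fun s => ?_)
  simpa using abs_cellFlow_le n l x (t - s)

theorem cellSum_heatStep (n : ℕ) (a : ℤ → ℤ → ℝ) (t x : ℝ) :
    cellSum n a heatStep t x = ∑ k ∈ Finset.Ico (0 : ℤ) (2 ^ n),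
      ∑ l ∈ Finset.Ico (-2 ^ (2 * n) : ℤ) (2 ^ (2 * n)),
        a k l * ∫ s in ((k : ℝ) / 2 ^ n)..((k + 1) / 2 ^ n), cellFlow n l x (t - s) := by
  have hii : ∀ z α β, IntervalIntegrable (fun s => heatSign (t - s) z) volume α β := by
    intro z α β
    refine (intervalIntegrable_const (c := (1 : ℝ))).mono_fun
      (measurable_heatSign.comp ((measurable_const.sub measurable_id).prodMk
        measurable_const)).aestronglyMeasurable.restrict (Eventually.of_forall fun s => ?_)
    simpa using (abs_heatSign_le (t - s) z).trans (by norm_num)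
  unfold cellSum cellFlow
  refine Finset.sum_congr rfl fun k _ => Finset.sum_congr rfl fun l _ => ?_
  rw [intervalIntegral.integral_sub (hii _ _ _) (hii _ _ _), integral_heatSign_sub,
    integral_heatSign_sub]

/-- The total variation in time of the solution at a distance at least `d` from the noise. -/
theorem sum_abs_sol_sub_le {β d : ℝ} (hβ : 0 < β) (hd : 0 < d) {n : ℕ} {a : ℤ → ℤ → ℝ} {F : ℝ}
    (ha : ∀ k ∈ Finset.Ico (0 : ℤ) (2 ^ n), ∀ l, |a k l| ≤ F) (hF : 0 ≤ F)
    {x : ℝ} (hx : 2 ^ n + d ≤ |x|) {t : ℕ → ℝ} (ht : Monotone t) {M : ℕ} (htb : ∀ i ≤ M, t i ≤ 1) :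
    ∑ i ∈ Finset.range M, |cellSum n a heatStep (t (i + 1)) x - cellSum n a heatStep (t i) x|
      ≤ F * (4 * tailConst β / β * d ^ (-β)) := by
  set Q : ℤ → ℤ → ℝ → ℝ := fun k l t =>
    ∫ s in ((k : ℝ) / 2 ^ n)..((k + 1) / 2 ^ n), cellFlow n l x (t - s) with hQ
  set J : ℤ → ℝ := fun l => ∫ y in cell n l, 2 * (tailConst β * powerTail β d (x - y)) with hJ
  have hlen : ∀ k : ℤ, ((k : ℝ) + 1) / 2 ^ n - k / 2 ^ n = 1 / 2 ^ n := fun k => by ring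
  -- The bound on the flow is uniform under time shifts, so a slab contributes its length 2^{-n}.
  -- The 2^n slabs then cancel this factor, and the disjoint space cells combine into one integral
  -- of the power tail over the line.
  have hQsum : ∀ k ∈ Finset.Ico (0 : ℤ) (2 ^ n),
      ∀ l ∈ Finset.Ico (-2 ^ (2 * n) : ℤ) (2 ^ (2 * n)),
      ∑ i ∈ Finset.range M, |Q k l (t (i + 1)) - Q k l (t i)| ≤ 1 / 2 ^ n * J l := by
    intro k hk l hl
    have hk0 : (0 : ℝ) ≤ k := by exact_mod_cast (Finset.mem_Ico.1 hk).1
    have hInt : ∀ i, IntervalIntegrable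
        (fun s => cellFlow n l x (t (i + 1) - s) - cellFlow n l x (t i - s)) volume
        ((k : ℝ) / 2 ^ n) ((k + 1) / 2 ^ n) := fun i =>
      (intervalIntegrable_cellFlow n l x _ _ _).sub (intervalIntegrable_cellFlow n l x _ _ _)
    calc ∑ i ∈ Finset.range M, |Q k l (t (i + 1)) - Q k l (t i)|
        ≤ ∑ i ∈ Finset.range M, ∫ s in ((k : ℝ) / 2 ^ n)..((k + 1) / 2 ^ n),
            |cellFlow n l x (t (i + 1) - s) - cellFlow n l x (t i - s)| := by
          refine Finset.sum_le_sum fun i _ => ?_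
          simp only [hQ]
          rw [← intervalIntegral.integral_sub (intervalIntegrable_cellFlow n l x _ _ _)
            (intervalIntegrable_cellFlow n l x _ _ _)]
          exact intervalIntegral.abs_integral_le_integral_abs (cell_le n k)
      _ = ∫ s in ((k : ℝ) / 2 ^ n)..((k + 1) / 2 ^ n), ∑ i ∈ Finset.range M,
            |cellFlow n l x (t (i + 1) - s) - cellFlow n l x (t i - s)| :=
          (intervalIntegral.integral_finsetSum fun i _ => (hInt i).abs).symm
      _ ≤ ∫ _ in ((k : ℝ) / 2 ^ n)..((k + 1) / 2 ^ n), J l := by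
          refine intervalIntegral.integral_mono_on (cell_le n k) ?_ intervalIntegrable_const
            fun s hs => ?_
          · have := IntervalIntegrable.sum (Finset.range M) (f := fun i s =>
              |cellFlow n l x (t (i + 1) - s) - cellFlow n l x (t i - s)|) fun i _ => (hInt i).abs
            simpa only [Finset.sum_fn] using this
          · have hs0 : 0 ≤ s := le_trans (by positivity) hs.1
            exact sum_abs_cellFlow_sub_le hβ hd hl hx (t := fun i => t i - s)
              (fun i j hij => sub_le_sub_right (ht hij) s) fun i hi => by linarith [htb i hi]
      _ = 1 / 2 ^ n * J l := by
          rw [intervalIntegral.integral_const, smul_eq_mul, hlen]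
  have hJsum : ∑ l ∈ Finset.Ico (-2 ^ (2 * n) : ℤ) (2 ^ (2 * n)), J l
      ≤ 4 * tailConst β / β * d ^ (-β) := by
    have hInt : Integrable fun y => 2 * (tailConst β * powerTail β d (x - y)) :=
      (((integrable_powerTail hβ hd).1.comp_sub_left x).const_mul _).const_mul _
    rw [hJ, ← integral_biUnion_finset _ (fun l _ => measurableSet_cell n l)
      (pairwise_disjoint_cell n _) fun l _ => hInt.integrableOn]
    refine (setIntegral_le_integral hInt (Eventually.of_forall fun y => ?_)).trans_eq ?_
    · exact mul_nonneg zero_le_two (mul_nonneg (tailConst_nonneg hβ) (powerTail_nonneg hd _ _))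
    · rw [integral_const_mul, integral_const_mul, integral_sub_left_eq_self (powerTail β d),
        (integrable_powerTail hβ hd).2]
      ring
  calc ∑ i ∈ Finset.range M, |cellSum n a heatStep (t (i + 1)) x - cellSum n a heatStep (t i) x|
      ≤ ∑ i ∈ Finset.range M, ∑ k ∈ Finset.Ico (0 : ℤ) (2 ^ n),
        ∑ l ∈ Finset.Ico (-2 ^ (2 * n) : ℤ) (2 ^ (2 * n)),
          F * |Q k l (t (i + 1)) - Q k l (t i)| := by
        refine Finset.sum_le_sum fun i _ => ?_
        rw [cellSum_heatStep, cellSum_heatStep, ← Finset.sum_sub_distrib]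
        refine (Finset.abs_sum_le_sum_abs _ _).trans (Finset.sum_le_sum fun k hk => ?_)
        rw [← Finset.sum_sub_distrib]
        refine (Finset.abs_sum_le_sum_abs _ _).trans (Finset.sum_le_sum fun l _ => ?_)
        rw [← mul_sub, abs_mul]
        exact mul_le_mul_of_nonneg_right (ha k hk l) (abs_nonneg _)
    _ = ∑ k ∈ Finset.Ico (0 : ℤ) (2 ^ n), ∑ l ∈ Finset.Ico (-2 ^ (2 * n) : ℤ) (2 ^ (2 * n)),
          F * ∑ i ∈ Finset.range M, |Q k l (t (i + 1)) - Q k l (t i)| := by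
        rw [Finset.sum_comm]
        refine Finset.sum_congr rfl fun k _ => ?_
        rw [Finset.sum_comm]
        exact Finset.sum_congr rfl fun l _ => (Finset.mul_sum _ _ _).symm
    _ ≤ ∑ k ∈ Finset.Ico (0 : ℤ) (2 ^ n), ∑ l ∈ Finset.Ico (-2 ^ (2 * n) : ℤ) (2 ^ (2 * n)),
          F * (1 / 2 ^ n * J l) := by
        gcongr with k hk l hl
        exact hQsum k hk l hl
    _ = F * ∑ l ∈ Finset.Ico (-2 ^ (2 * n) : ℤ) (2 ^ (2 * n)), J l := by
        rw [Finset.sum_const, ← Finset.mul_sum, ← Finset.mul_sum, nsmul_eq_mul, Int.card_Ico]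
        have : (((2 : ℤ) ^ n - 0).toNat : ℝ) = 2 ^ n := by
          rw [sub_zero, show (2 : ℤ) ^ n = ((2 ^ n : ℕ) : ℤ) by push_cast; rfl, Int.toNat_natCast]
          push_cast; rfl
        rw [this]
        field_simp
    _ ≤ _ := by gcongr

/-! ### The error of the Galerkin approximation for a given noise -/

theorem cellSum_of_nonpos {K : ℝ → ℝ → ℝ} (hK : ∀ r ≤ 0, ∀ z, K r z = 0) (n : ℕ) (a : ℤ → ℤ → ℝ)
    {t : ℝ} (ht : t ≤ 0) (x : ℝ) : cellSum n a K t x = 0 := by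
  unfold cellSum
  refine Finset.sum_eq_zero fun k hk => Finset.sum_eq_zero fun l _ => ?_
  have hk0 : (0 : ℝ) ≤ k := by exact_mod_cast (Finset.mem_Ico.1 hk).1
  have h1 : t - k / 2 ^ n ≤ 0 := by
    have : 0 ≤ (k : ℝ) / 2 ^ n := by positivity
    linarith
  have h2 : t - (k + 1) / 2 ^ n ≤ 0 := by
    have : 0 ≤ ((k : ℝ) + 1) / 2 ^ n := by positivity
    linarith
  simp [hK _ h1, hK _ h2]

theorem sol_zero (n : ℕ) (a : ℤ → ℤ → ℝ) (x : ℝ) : cellSum n a heatStep 0 x = 0 :=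
  cellSum_of_nonpos (fun r hr z => by simp [heatStep, not_lt.2 hr]) n a le_rfl x

theorem solXX_zero (n : ℕ) (a : ℤ → ℤ → ℝ) (x : ℝ) : cellSum n a heatStepXX 0 x = 0 :=
  cellSum_of_nonpos (fun r hr z => by simp [heatStepXX, not_lt.2 hr]) n a le_rfl x

theorem card_time_cells (n : ℕ) : ((Finset.Ico (0 : ℤ) (2 ^ n)).card : ℝ) = 2 ^ n := by
  rw [Int.card_Ico, sub_zero, show (2 : ℤ) ^ n = ((2 ^ n : ℕ) : ℤ) by push_cast; rfl,
    Int.toNat_natCast]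
  push_cast; rfl

/-- The increment bound started at time 0, where the solution vanishes, with every `incrFactor`
bounded by 2. -/
theorem l2_solXX_le (n : ℕ) {a : ℤ → ℤ → ℝ} {F : ℝ} (hF : 0 ≤ F)
    (ha : ∀ k ∈ Finset.Ico (0 : ℤ) (2 ^ n), ∀ l, |a k l| ≤ F) {t L : ℝ} (hL : 0 ≤ L) (ht : 0 ≤ t) :
    l2 L (cellSum n a heatStepXX t) ≤ 4 * F * √(2 ^ (n + 1)) * 2 ^ n := by
  have h := l2_solXX_sub_le n hF ha hL ht (δ := t) (by linarith)
  simp only [solXX_zero, sub_zero] at h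
  refine h.trans ?_
  have : ∑ k ∈ Finset.Ico (0 : ℤ) (2 ^ n),
      (incrFactor t (t - k / 2 ^ n) + incrFactor t (t - (k + 1) / 2 ^ n)) ≤ 2 ^ n * 4 := by
    refine (Finset.sum_le_card_nsmul _ _ 4 fun k _ => ?_).trans_eq ?_
    · linarith [incrFactor_le_two (δ := t) (t - k / 2 ^ n),
        incrFactor_le_two (δ := t) (t - (k + 1) / 2 ^ n)]
    · rw [nsmul_eq_mul, card_time_cells]
  calc F * √(2 ^ (n + 1)) * _ ≤ F * √(2 ^ (n + 1)) * (2 ^ n * 4) := by gcongr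
    _ = _ := by ring

/-- Total variation along the two times 0 and t is already the pointwise value, since the solution
starts from zero. -/
theorem abs_sol_le {β d : ℝ} (hβ : 0 < β) (hd : 0 < d) {n : ℕ} {a : ℤ → ℤ → ℝ} {F : ℝ}
    (ha : ∀ k ∈ Finset.Ico (0 : ℤ) (2 ^ n), ∀ l, |a k l| ≤ F) (hF : 0 ≤ F)
    {x : ℝ} (hx : 2 ^ n + d ≤ |x|) {t : ℝ} (ht : 0 ≤ t) (ht1 : t ≤ 1) :
    |cellSum n a heatStep t x| ≤ F * (4 * tailConst β / β * d ^ (-β)) := by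
  have := sum_abs_sol_sub_le hβ hd ha hF hx (t := fun i => if i = 0 then 0 else t) (M := 1)
    (fun i j hij => by
      by_cases hj : j = 0
      · have : i = 0 := by lia
        simp [hj, this]
      · simp only [hj, if_false]; split_ifs <;> linarith)
    (fun i _ => by split_ifs <;> linarith)
  simpa [sol_zero] using this

/-- Sum of the defects over all steps. The beginning and the end of each of the 2^n slabs cost a
harmonic sum of size 2(m+1), and the boundary increments at ±L add up to total variations instead of
2^m times a supremum. -/
theorem l2_sub_ritz_le {h : ℝ} (hh : 0 < h) {N m n : ℕ} (hN : 0 < N) {a : ℤ → ℤ → ℝ} {F : ℝ}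
    (hF : 0 ≤ F) (ha : ∀ k ∈ Finset.Ico (0 : ℤ) (2 ^ n), ∀ l, |a k l| ≤ F) {β d : ℝ} (hβ : 0 < β)
    (hd : 0 < d) (hLd : 2 ^ n + d ≤ N * h) {v : Fin (2 ^ m + 1) → ℝ → ℝ}
    (hv : IsEvolution h N (2 ^ m) (2 ^ m) (noiseRhs n a m) v) (i : Fin (2 ^ m + 1)) :
    l2 (N * h) (fun x => v i x - ritz h N (cellSum n a heatStep ((i : ℕ) / 2 ^ m)) x)
      ≤ (h ^ 2 + 1 / 2 ^ m) * (4 * F * √(2 ^ (n + 1)) * 2 ^ n * (m + 1))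
        + √(2 * (N * h)) * (2 * (F * (4 * tailConst β / β * d ^ (-β)))) := by
  obtain ⟨hv0, hvm, hve⟩ := hv
  have hL : (0 : ℝ) < N * h := by positivity
  set L : ℝ := N * h with hLdef
  set t : ℕ → ℝ := fun i => (i : ℝ) / 2 ^ m with ht
  have htmono : Monotone t := fun i j hij => by
    simp only [ht]; gcongr
  have ht1 : ∀ i ≤ 2 ^ m, t i ≤ 1 := fun i hi => by
    simp only [ht]; rw [div_le_one (by positivity)]; exact_mod_cast hi
  have ht0 : ∀ i, 0 ≤ t i := fun i => by simp only [ht]; positivity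
  set u := cellSum n a heatStep
  set D : ℕ → ℝ := fun i => F * √(2 ^ (n + 1)) * ∑ k ∈ Finset.Ico (0 : ℤ) (2 ^ n),
    (incrFactor (1 / 2 ^ m) (t (i + 1) - k / 2 ^ n)
      + incrFactor (1 / 2 ^ m) (t (i + 1) - (k + 1) / 2 ^ n)) with hD
  have hstep : ∀ i, t (i + 1) - t i = 1 / 2 ^ m := fun i => by simp only [ht]; push_cast; ring
  have hind : ∀ (i : ℕ) (hi : i < 2 ^ m + 1), l2 L (fun x => v ⟨i, hi⟩ x - ritz h N (u (t i)) x)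
      ≤ ∑ j ∈ Finset.range i, ((h ^ 2 + 1 / 2 ^ m) * D j
        + √(2 * L) * (|u (t (j + 1)) L - u (t j) L| + |u (t (j + 1)) (-L) - u (t j) (-L)|)) := by
    intro i
    induction i with
    | zero =>
      intro hi
      have h1 : v ⟨0, hi⟩ = 0 := hv0
      have h2 : ∀ x, ritz h N (u (t 0)) x = 0 := by
        intro x
        have : ∀ y, u (t 0) y = 0 := fun y => by simp [ht, u, sol_zero]
        simp [ritz, nodalSum, affineInterp, this]
      rw [h1]
      simp [h2, l2]
    | succ i ih =>
      intro hi
      have hi' : i < 2 ^ m := Nat.lt_of_succ_lt_succ hi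
      rw [Finset.sum_range_succ]
      refine (galerkin_step hh hN n a (ht0 i) (t' := t (i + 1)) (D := D i) ?_ (ht1 _ hi') ?_
        ((mem_galerkinSpace_iff hh).1 (hvm ⟨i, hi'.trans (Nat.lt_succ_self _)⟩))
        ((mem_galerkinSpace_iff hh).1 (hvm ⟨i + 1, hi⟩)) ?_).trans ?_
      · have := hstep i
        have : (0 : ℝ) < 1 / 2 ^ m := by positivity
        linarith
      · intro s hs
        exact l2_solXX_sub_le n hF ha hL.le hs.2 (by linarith [hs.1, hstep i])
      · intro φ hφ
        have := hve ⟨i, hi'⟩ φ ((mem_galerkinSpace_iff hh).2 hφ)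
        rw [hstep, one_div_one_div]
        simpa [noiseRhs, ht] using this
      · rw [hstep]
        exact add_le_add_left (ih _) _
  have hi := hind i i.2
  refine hi.trans ?_
  have hsub : ∀ f : ℕ → ℝ, (∀ j, 0 ≤ f j) →
      ∑ j ∈ Finset.range i, f j ≤ ∑ j ∈ Finset.range (2 ^ m), f j := fun f hf =>
    Finset.sum_le_sum_of_subset_of_nonneg (Finset.range_mono (Nat.lt_succ_iff.1 i.2)) fun j _ _ => hf j
  have hδ : (0 : ℝ) ≤ 1 / 2 ^ m := by positivity
  have hDn : ∀ j, 0 ≤ D j := fun j => mul_nonneg (by positivity)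
    (Finset.sum_nonneg fun k _ => add_nonneg (incrFactor_nonneg hδ _) (incrFactor_nonneg hδ _))
  refine (hsub _ fun j => add_nonneg (mul_nonneg (by positivity) (hDn j)) (by positivity)).trans ?_
  rw [Finset.sum_add_distrib, ← Finset.mul_sum (f := D),
    ← Finset.mul_sum (a := √(2 * L)), Finset.sum_add_distrib]
  have hsumD : ∑ j ∈ Finset.range (2 ^ m), D j ≤ 4 * F * √(2 ^ (n + 1)) * 2 ^ n * (m + 1) := by
    simp only [hD]
    rw [← Finset.mul_sum, Finset.sum_comm]
    have : ∑ k ∈ Finset.Ico (0 : ℤ) (2 ^ n), ∑ j ∈ Finset.range (2 ^ m),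
        (incrFactor (1 / 2 ^ m) (t (j + 1) - k / 2 ^ n)
          + incrFactor (1 / 2 ^ m) (t (j + 1) - (k + 1) / 2 ^ n)) ≤ 2 ^ n * (4 * (m + 1)) := by
      refine (Finset.sum_le_card_nsmul _ _ (4 * ((m : ℝ) + 1)) fun k hk => ?_).trans_eq ?_
      · have hk0 : (0 : ℝ) ≤ k := by exact_mod_cast (Finset.mem_Ico.1 hk).1
        rw [Finset.sum_add_distrib]
        have s1 := sum_incrFactor_le m (τ := (k : ℝ) / 2 ^ n) (by positivity)
        have s2 := sum_incrFactor_le m (τ := ((k : ℝ) + 1) / 2 ^ n) (by positivity)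
        simp only [ht]
        push_cast
        linarith
      · rw [nsmul_eq_mul, card_time_cells]
    calc F * √(2 ^ (n + 1)) * _ ≤ F * √(2 ^ (n + 1)) * (2 ^ n * (4 * (m + 1))) := by gcongr
      _ = _ := by ring
  have hb1 := sum_abs_sol_sub_le hβ hd ha hF (x := L) (by rwa [abs_of_pos hL]) htmono (M := 2 ^ m) ht1
  have hb2 := sum_abs_sol_sub_le hβ hd ha hF (x := -L) (by rwa [abs_neg, abs_of_pos hL]) htmono
    (M := 2 ^ m) ht1
  refine add_le_add (mul_le_mul_of_nonneg_left hsumD (by positivity))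
    (mul_le_mul_of_nonneg_left ?_ (Real.sqrt_nonneg _))
  linarith

theorem sqrt_pow_mul (n : ℕ) : √(2 ^ (n + 1)) * 2 ^ n ≤ 2 * (2 : ℝ) ^ (n * (3 / 2) : ℝ) := by
  have e : (2 : ℝ) ^ (n * (3 / 2) : ℝ) = √(2 ^ n) * 2 ^ n := by
    rw [Real.sqrt_eq_rpow, ← Real.rpow_natCast 2 n, ← Real.rpow_mul (by norm_num),
      ← Real.rpow_add (by norm_num)]
    congr 1; ring
  rw [e, pow_succ, Real.sqrt_mul (by positivity)]
  have : √2 ≤ 2 := by rw [Real.sqrt_le_left (by norm_num)]; norm_num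
  calc √(2 ^ n) * √2 * 2 ^ n ≤ √(2 ^ n) * 2 * 2 ^ n := by gcongr
    _ = _ := by ring

/-- The error of the Galerkin approximation, in terms of a uniform bound on the noise. -/
theorem eLpNorm_galerkin_error_le {ρ : ℝ → ℝ} (hρm : Measurable ρ) (hρ : ∀ x, |ρ x| ≤ 1)
    {Q : ℝ} (hQ0 : 0 ≤ Q) (hQ : eLpNorm ρ 2 volume ≤ ENNReal.ofReal Q)
    {h : ℝ} (hh : 0 < h) {N m n : ℕ} {a : ℤ → ℤ → ℝ} {F : ℝ}
    (hF : 0 ≤ F) (ha : ∀ k ∈ Finset.Ico (0 : ℤ) (2 ^ n), ∀ l, |a k l| ≤ F) {β : ℝ} (hβ : 0 < β)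
    (hLn : 2 ^ n < N * h) {v : Fin (2 ^ m + 1) → ℝ → ℝ}
    (hv : IsEvolution h N (2 ^ m) (2 ^ m) (noiseRhs n a m) v) (i : Fin (2 ^ m + 1)) :
    eLpNorm (fun x => ρ x * (cellSum n a heatStep ((i : ℕ) / 2 ^ m) x - v i x)) 2 volume
      ≤ ENNReal.ofReal (F * (16 * (2 : ℝ) ^ (n * (3 / 2) : ℝ) * (h ^ 2 + 1 / 2 ^ m) * (m + 1)
        + (8 + Q) * (4 * tailConst β / β) * √(N * h) * (N * h - 2 ^ n) ^ (-β))) := by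
  have h2n : (1 : ℝ) ≤ 2 ^ n := one_le_pow₀ (by norm_num)
  have hL : (0 : ℝ) < N * h := by linarith
  have hN : 0 < N := by
    rcases Nat.eq_zero_or_pos N with h0 | h0
    · simp [h0] at hL
    · exact h0
  have hθ := l2_sub_ritz_le hh hN hF ha hβ (sub_pos.2 hLn) (by linarith) hv i
  have hpl : ∀ i, IsPL h (N * h) (v i) := fun i => (mem_galerkinSpace_iff hh).1 (hv.2.1 i)
  set L : ℝ := N * h with hLdef
  set d : ℝ := L - 2 ^ n with hd
  have hd0 : 0 < d := sub_pos.2 hLn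
  set t : ℝ := (i : ℕ) / 2 ^ m with ht
  have ht0 : 0 ≤ t := by positivity
  have ht1 : t ≤ 1 := by
    rw [ht, div_le_one (by positivity)]; exact_mod_cast Nat.lt_succ_iff.1 i.2
  set u := cellSum n a heatStep t with hu
  have hsec := hasSecondDeriv_sol n a t
  set K := 4 * tailConst β / β with hK
  have hK0 : 0 ≤ K := by have := tailConst_nonneg hβ; positivity
  set B := F * (K * d ^ (-β)) with hB
  have hB0 : 0 ≤ B := by positivity
  have hbd : ∀ x, L ≤ |x| → |u x| ≤ B := fun x hx =>
    abs_sol_le hβ hd0 ha hF (by rw [hd]; linarith) ht0 ht1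
  have hRc := (isPL_ritz hh N u).continuous
  have hlc := continuous_affineInterp L u
  have hvc := (hpl i).continuous
  have huc : Continuous u := hsec.continuous
  have hl2 : l2 L (fun x => u x - v i x)
      ≤ h ^ 2 * (4 * F * √(2 ^ (n + 1)) * 2 ^ n) + √(2 * L) * (2 * B)
        + ((h ^ 2 + 1 / 2 ^ m) * (4 * F * √(2 ^ (n + 1)) * 2 ^ n * (m + 1)) + √(2 * L) * (2 * B)) := by
    -- The error is the interpolation error of u, plus the affine function carrying its boundary
    -- values, minus the discrepancy between the approximation and the Ritz projection.
    have e : (fun x => u x - v i x) = fun x => ((u x - affineInterp L u x - ritz h N u x)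
        + affineInterp L u x) - (v i x - ritz h N u x) := by ext x; ring
    rw [e]
    have c1 : BddMeas L fun x => u x - affineInterp L u x - ritz h N u x :=
      BddMeas.of_continuous ((huc.sub hlc).sub hRc)
    have c2 : BddMeas L (affineInterp L u) := BddMeas.of_continuous hlc
    have c3 : BddMeas L fun x => v i x - ritz h N u x := BddMeas.of_continuous (hvc.sub hRc)
    refine (l2_sub_le hL.le (c1.add c2) c3).trans (add_le_add ((l2_add_le hL.le c1 c2).trans
      (add_le_add ?_ ?_)) hθ)
    · exact (l2_interp_le hh hN hsec).trans
        (mul_le_mul_of_nonneg_left (l2_solXX_le n hF ha hL.le ht0) (sq_nonneg _))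
    · refine l2_le_of_abs_le hL.le (by positivity) c2 fun x hx => ?_
      refine (abs_affineInterp_le hL u hx).trans ?_
      have b1 := hbd L (le_abs_self _)
      have b2 := hbd (-L) (by rw [abs_neg]; exact le_abs_self _)
      linarith
  have hfc : Continuous fun x => u x - v i x := huc.sub hvc
  -- Nothing forces the support of ρ into [-L, L]. Outside, the approximation vanishes and the
  -- solution is at most B, so this part is paid for by the L² norm of ρ.
  have hmain : eLpNorm (fun x => ρ x * (u x - v i x)) 2 volume
      ≤ eLpNorm ((Ioc (-L) L).indicator fun x => u x - v i x) 2 volume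
        + eLpNorm (fun x => B * ρ x) 2 volume := by
    have hm1 : Measurable ((Ioc (-L) L).indicator fun x => u x - v i x) :=
      hfc.measurable.indicator measurableSet_Ioc
    have hm2 : Measurable fun x => B * ρ x := hρm.const_mul B
    calc eLpNorm (fun x => ρ x * (u x - v i x)) 2 volume
        ≤ eLpNorm ((fun x => ‖(Ioc (-L) L).indicator (fun x => u x - v i x) x‖)
          + fun x => ‖B * ρ x‖) 2 volume := by
          refine eLpNorm_mono_real fun x => ?_
          rw [Pi.add_apply, norm_mul, Real.norm_eq_abs (ρ x)]
          by_cases hx : x ∈ Ioc (-L) L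
          · rw [indicator_of_mem hx]
            have := mul_le_of_le_one_left (norm_nonneg (u x - v i x)) (hρ x)
            linarith [norm_nonneg (B * ρ x)]
          · rw [indicator_of_notMem hx, norm_zero, zero_add, norm_mul, Real.norm_eq_abs (ρ x),
              Real.norm_of_nonneg hB0, mul_comm]
            have hx' : L ≤ |x| := by
              rw [mem_Ioc, not_and_or, not_lt, not_le] at hx
              rcases hx with hx | hx
              · rw [abs_of_nonpos (by linarith)]; linarith
              · rw [abs_of_nonneg (by linarith)]; linarith
            rw [(hpl i).zero x hx', sub_zero]
            exact mul_le_mul_of_nonneg_right (hbd x hx') (abs_nonneg _)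
      _ ≤ _ := by
          refine (eLpNorm_add_le hm1.norm.aestronglyMeasurable hm2.norm.aestronglyMeasurable
            (by norm_num)).trans_eq ?_
          rw [eLpNorm_norm, eLpNorm_norm]
  refine hmain.trans ?_
  rw [eLpNorm_indicator_eq_l2 hL.le (BddMeas.of_continuous hfc)]
  have hρB : eLpNorm (fun x => B * ρ x) 2 volume ≤ ENNReal.ofReal (B * Q) := by
    have := eLpNorm_const_smul_le (c := B) (f := ρ) (p := 2) (μ := volume)
    rw [ENNReal.ofReal_mul hB0]
    refine this.trans (mul_le_mul' ?_ hQ)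
    rw [Real.enorm_eq_ofReal hB0]
  refine (add_le_add_right hρB _).trans ?_
  rw [← ENNReal.ofReal_add (l2_nonneg _ _) (by positivity)]
  refine ENNReal.ofReal_le_ofReal ?_
  have hsq := sqrt_pow_mul n
  have hL1 : 1 ≤ √L := by rw [Real.one_le_sqrt]; linarith
  have hs2 : √(2 * L) ≤ 2 * √L := by
    rw [Real.sqrt_mul (by norm_num)]
    have : √2 ≤ 2 := by rw [Real.sqrt_le_left (by norm_num)]; norm_num
    gcongr
  set P := (2 : ℝ) ^ (n * (3 / 2) : ℝ)
  have hP : 0 ≤ P := by positivity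
  have hδ : (0 : ℝ) ≤ 1 / 2 ^ m := by positivity
  set δ : ℝ := 1 / 2 ^ m
  have hm0 : (0 : ℝ) ≤ m := Nat.cast_nonneg m
  have e1 : h ^ 2 * (4 * F * √(2 ^ (n + 1)) * 2 ^ n)
      + (h ^ 2 + δ) * (4 * F * √(2 ^ (n + 1)) * 2 ^ n * (m + 1))
      ≤ F * (16 * P * (h ^ 2 + δ) * (m + 1)) := by
    calc _ = 4 * F * (√(2 ^ (n + 1)) * 2 ^ n) * (h ^ 2 + (h ^ 2 + δ) * (m + 1)) := by ring
      _ ≤ 4 * F * (2 * P) * (2 * ((h ^ 2 + δ) * (m + 1))) := by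
        refine mul_le_mul (by gcongr) ?_ (by positivity) (by positivity)
        nlinarith [mul_nonneg (add_nonneg (sq_nonneg h) hδ) hm0]
      _ = _ := by ring
  have e2 : √(2 * L) * (2 * B) + √(2 * L) * (2 * B) + B * Q ≤ F * ((8 + Q) * K * √L * d ^ (-β)) := by
    calc √(2 * L) * (2 * B) + √(2 * L) * (2 * B) + B * Q
        ≤ 2 * √L * (2 * B) + 2 * √L * (2 * B) + B * Q * √L := by
          refine add_le_add (by gcongr) ?_
          exact le_mul_of_one_le_right (by positivity) hL1
      _ = _ := by rw [hB]; ring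
  linarith

/-! ### Comparison of the two versions of the scheme -/

/-- The discrete minimum principle for an implicit step. -/
theorem nonneg_of_implicit_step {N : ℕ} {z : ℤ → ℝ} (hl : 0 ≤ z (-N)) (hr : 0 ≤ z N)
    (hz : ∀ j ∈ Finset.Icc (-(N : ℤ) + 1) (N - 1), 0 ≤ 4 * z j - 5 / 4 * (z (j + 1) + z (j - 1)))
    {j : ℤ} (hj : j ∈ Finset.Icc (-(N : ℤ)) N) : 0 ≤ z j := by
  obtain ⟨p, hp, hmin⟩ := Finset.exists_min_image (Finset.Icc (-(N : ℤ)) N) z ⟨j, hj⟩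
  refine le_trans ?_ (hmin j hj)
  obtain ⟨h1, h2⟩ := Finset.mem_Icc.1 hp
  rcases eq_or_lt_of_le h1 with h | h
  · rwa [← h]
  rcases eq_or_lt_of_le h2 with h' | h'
  · rwa [h']
  have a1 := hmin (p + 1) (Finset.mem_Icc.2 ⟨by lia, by lia⟩)
  have a2 := hmin (p - 1) (Finset.mem_Icc.2 ⟨by lia, by lia⟩)
  have a3 := hz p (Finset.mem_Icc.2 ⟨by lia, by lia⟩)
  linarith

theorem cosh_add_cosh (x h : ℝ) :
    Real.cosh (x + h) + Real.cosh (x - h) = 2 * Real.cosh x * Real.cosh h := by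
  rw [Real.cosh_add, Real.cosh_sub]; ring

/-- The barrier `(1 + 4h²)ⁱ cosh x` absorbs a source of size `h² cosh x`. -/
theorem barrier_step {h x c : ℝ} (hh : 0 < h) (hh4 : h ≤ 1 / 4) (hc : 0 ≤ c) :
    c * Real.cosh x + 1 / 4 * (c * Real.cosh (x - h) + c * Real.cosh (x + h)) + c * h ^ 2 * Real.cosh x
      ≤ 4 * (c * (1 + 4 * h ^ 2) * Real.cosh x)
        - 5 / 4 * (c * (1 + 4 * h ^ 2) * Real.cosh (x + h) + c * (1 + 4 * h ^ 2) * Real.cosh (x - h)) := by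
  have h1 : Real.cosh h ≤ 1 + h ^ 2 := by
    have e1 := Real.cosh_le_exp_half_sq h
    have e2 : Real.exp (h ^ 2 / 2) ≤ 1 + h ^ 2 := by
      have := Real.abs_exp_sub_one_le (x := h ^ 2 / 2) (by rw [abs_of_nonneg (by positivity)]; nlinarith)
      rw [abs_of_nonneg (by positivity : 0 ≤ h ^ 2 / 2)] at this
      linarith [le_abs_self (Real.exp (h ^ 2 / 2) - 1)]
    exact e1.trans e2
  have hs := cosh_add_cosh x h
  have hx := Real.cosh_pos x
  have e : 4 * (c * (1 + 4 * h ^ 2) * Real.cosh x)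
        - 5 / 4 * (c * (1 + 4 * h ^ 2) * Real.cosh (x + h) + c * (1 + 4 * h ^ 2) * Real.cosh (x - h))
        - (c * Real.cosh x + 1 / 4 * (c * Real.cosh (x - h) + c * Real.cosh (x + h))
          + c * h ^ 2 * Real.cosh x)
      = c * Real.cosh x * (4 * (1 + 4 * h ^ 2) - 5 / 2 * (1 + 4 * h ^ 2) * Real.cosh h - 1
          - 1 / 2 * Real.cosh h - h ^ 2) := by
    linear_combination (-(5 / 4) * c * (1 + 4 * h ^ 2) - 1 / 4 * c) * hs
  -- With y = h² and cosh h ≤ 1 + y, what remains is at least 2y - 10y², which is nonnegative for y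
  -- ≤ 1/16.
  have hq : 0 ≤ 4 * (1 + 4 * h ^ 2) - 5 / 2 * (1 + 4 * h ^ 2) * Real.cosh h - 1
          - 1 / 2 * Real.cosh h - h ^ 2 := by
    have hp : 0 ≤ h ^ 2 := sq_nonneg h
    have hp2 : h ^ 2 ≤ 1 / 16 := by nlinarith
    set y := h ^ 2
    nlinarith [mul_nonneg (by linarith : 0 ≤ 1 + 4 * y) (sub_nonneg.2 h1),
      mul_nonneg hp (sub_nonneg.2 hp2)]
  have := mul_nonneg (mul_nonneg hc hx.le) hq
  linarith

/-- The barrier plus or minus the solution satisfies the implicit step with nonnegative right-hand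
side and nonnegative boundary values, so the minimum principle applies at every time level. The
parameter T only normalizes the size of the admissible sources. -/
theorem abs_le_barrier {h A T : ℝ} (hh : 0 < h) (hh4 : h ≤ 1 / 4) (hA : 0 ≤ A) {N M : ℕ}
    {e : ℕ → ℤ → ℝ} {δ : ℕ → ℤ → ℝ} (h0 : ∀ j, e 0 j = 0) (hl : ∀ i ≤ M, e i (-N) = 0)
    (hr : ∀ i ≤ M, e i N = 0)
    (hstep : ∀ i < M, ∀ j ∈ Finset.Icc (-(N : ℤ) + 1) (N - 1),
      4 * e (i + 1) j - 5 / 4 * (e (i + 1) (j + 1) + e (i + 1) (j - 1))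
        = e i j + 1 / 4 * (e i (j - 1) + e i (j + 1)) + δ i j)
    (hδ : ∀ i < M, ∀ j ∈ Finset.Icc (-(N : ℤ) + 1) (N - 1),
      |δ i j| ≤ A / Real.cosh T * h ^ 2 * Real.cosh (j * h)) {i : ℕ} (hi : i ≤ M) {j : ℤ}
    (hj : j ∈ Finset.Icc (-(N : ℤ)) N) :
    |e i j| ≤ A / Real.cosh T * (1 + 4 * h ^ 2) ^ i * Real.cosh (j * h) := by
  have hT := Real.cosh_pos T
  set c := A / Real.cosh T with hc
  have hc0 : 0 ≤ c := by positivity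
  induction i generalizing j with
  | zero =>
    rw [h0, abs_zero]
    have := Real.cosh_pos (j * h)
    positivity
  | succ i ih =>
    have hlam : (1 : ℝ) ≤ (1 + 4 * h ^ 2) ^ i := one_le_pow₀ (by nlinarith [sq_nonneg h])
    -- The sign σ treats the upper and the lower bound together.
    have key : ∀ σ : ℝ, |σ| = 1 →
        0 ≤ c * (1 + 4 * h ^ 2) ^ (i + 1) * Real.cosh (j * h) + σ * e (i + 1) j := by
      intro σ hσ
      have hbar0 : ∀ k : ℤ, 0 ≤ c * (1 + 4 * h ^ 2) ^ (i + 1) * Real.cosh (k * h) := fun k => by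
        have := Real.cosh_pos (k * h)
        positivity
      refine nonneg_of_implicit_step (N := N)
        (z := fun k => c * (1 + 4 * h ^ 2) ^ (i + 1) * Real.cosh (k * h) + σ * e (i + 1) k)
        ?_ ?_ (fun k hk => ?_) hj
      · rw [hl _ hi, mul_zero, add_zero]; exact hbar0 _
      · rw [hr _ hi, mul_zero, add_zero]; exact hbar0 _
      · obtain ⟨k1, k2⟩ := Finset.mem_Icc.1 hk
        have hbs := barrier_step (x := k * h) (c := c * (1 + 4 * h ^ 2) ^ i) hh hh4 (by positivity)
        have hst := hstep i (Nat.lt_of_succ_le hi) k hk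
        have hde := hδ i (Nat.lt_of_succ_le hi) k hk
        have i0 := ih (Nat.le_of_succ_le hi) (j := k) (Finset.mem_Icc.2 ⟨by lia, by lia⟩)
        have i1 := ih (Nat.le_of_succ_le hi) (j := k - 1) (Finset.mem_Icc.2 ⟨by lia, by lia⟩)
        have i2 := ih (Nat.le_of_succ_le hi) (j := k + 1) (Finset.mem_Icc.2 ⟨by lia, by lia⟩)
        have x1 : ((k - 1 : ℤ) : ℝ) * h = k * h - h := by push_cast; ring
        have x2 : ((k + 1 : ℤ) : ℝ) * h = k * h + h := by push_cast; ring
        rw [x1] at i1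
        rw [x2] at i2
        rw [x1, x2, pow_succ]
        have hs : ∀ y B : ℝ, |y| ≤ B → -B ≤ σ * y := fun y B hy => by
          have : |σ * y| ≤ B := by rw [abs_mul, hσ, one_mul]; exact hy
          exact (abs_le.1 this).1
        have j0 := hs _ _ i0
        have j1 := hs _ _ i1
        have j2 := hs _ _ i2
        have j3 := hs _ _ hde
        have hgrow : c * h ^ 2 * Real.cosh (k * h)
            ≤ c * (1 + 4 * h ^ 2) ^ i * h ^ 2 * Real.cosh (k * h) := by
          have := Real.cosh_pos (k * h)
          have hcc : c ≤ c * (1 + 4 * h ^ 2) ^ i := le_mul_of_one_le_right hc0 hlam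
          gcongr
        have hst' := congrArg (σ * ·) hst
        beta_reduce at hst'
        nlinarith
    have k1 := key 1 (by norm_num)
    have k2 := key (-1) (by norm_num)
    rw [abs_le]; constructor <;> linarith

/-- On an element the value is a convex combination of the values at its two ends, which lie within
h of the point. -/
theorem IsPL.abs_le_of_nodes {h L : ℝ} (hh : 0 < h) {w : ℝ → ℝ} (hw : IsPL h L w) {R B : ℝ}
    (hB : ∀ k : ℤ, |(k : ℝ) * h| ≤ R + h → |w (k * h)| ≤ B) {x : ℝ} (hx : |x| ≤ R) : |w x| ≤ B := by
  obtain ⟨k, hk⟩ := exists_mem_element hh x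
  obtain ⟨x1, x2⟩ := abs_le.1 hx
  rw [hw.affine k x ⟨hk.1, hk.2.le⟩]
  have b1 := hB k (by rw [abs_le]; constructor <;> linarith [hk.1, hk.2])
  have b2 := hB (k + 1) (by
    push_cast
    rw [abs_le]; constructor <;> linarith [hk.1, hk.2])
  push_cast at b2
  have s0 : 0 ≤ (x - k * h) / h := div_nonneg (by linarith [hk.1]) hh.le
  have s1 : (x - k * h) / h ≤ 1 := by rw [div_le_one hh]; linarith [hk.2]
  set s := (x - k * h) / h
  rw [abs_le] at *
  constructor <;> nlinarith [b1.1, b1.2, b2.1, b2.2]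

theorem floor_time_mem {n i : ℕ} (hi : i < 2 ^ (4 * n)) :
    ⌊(2 : ℝ) ^ n * ((i : ℝ) / 2 ^ (4 * n))⌋ ∈ Finset.Ico (0 : ℤ) (2 ^ n) := by
  rw [Finset.mem_Ico]
  constructor
  · exact Int.floor_nonneg.2 (by positivity)
  · rw [Int.floor_lt]
    push_cast
    refine mul_lt_of_lt_one_right (by positivity) ?_
    rw [div_lt_one (by positivity)]
    exact_mod_cast hi

/-- The noise terms of both versions of the scheme agree inside `(-2ⁿ, 2ⁿ)` and are bounded. -/
theorem abs_schemeNoise_sub_le {n : ℕ} {b : ℝ → ℝ → ℝ} {F : ℝ}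
    (hb : ∀ k ∈ Finset.Ico (0 : ℤ) (2 ^ n), ∀ l ∈ Finset.Ico (-2 ^ (2 * n + 1) : ℤ) (2 ^ (2 * n + 1)),
      |rectIncr n b k l| ≤ F) {i : ℕ} (hi : i < 2 ^ (4 * n)) {j : ℤ}
    (hj : j ∈ Finset.Icc (-(schemeN n : ℤ) + 1) (schemeN n - 1)) :
    |schemeNoise n (rectIncr n b) i j - schemeNoise n (gridIncr n b) i j|
      ≤ if 2 ^ n ≤ |(j : ℝ) * (1 / 2 ^ (2 * n))| then F else 0 := by
  have hi' := floor_time_mem hi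
  unfold schemeNoise
  set i' := ⌊(2 : ℝ) ^ n * ((i : ℝ) / 2 ^ (4 * n))⌋
  have hXn : (0 : ℝ) < 2 ^ n := by positivity
  have hpow : (2 : ℝ) ^ (2 * n) = 2 ^ n * 2 ^ n := by rw [← pow_add]; congr 1; ring
  have hpowZ : (2 : ℤ) ^ (2 * n) = 2 ^ n * 2 ^ n := by rw [← pow_add]; congr 1; ring
  have hpowZ1 : (2 : ℤ) ^ (2 * n + 1) = 2 * (2 ^ n * 2 ^ n) := by rw [pow_succ, hpowZ]; ring
  have hN : (schemeN n : ℤ) = 2 * (2 ^ n * 2 ^ n) * 2 ^ n := by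
    unfold schemeN; push_cast; rw [← hpowZ1, ← pow_add]; congr 1; ring
  have hdiv : (2 : ℝ) ^ n * ((j : ℝ) / 2 ^ (2 * n)) = j / 2 ^ n := by rw [hpow]; field_simp
  set j' := ⌊(2 : ℝ) ^ n * ((j : ℝ) / 2 ^ (2 * n))⌋ with hj'
  have hj1 : (j' : ℝ) ≤ j / 2 ^ n := by rw [← hdiv]; exact Int.floor_le _
  have hj2 : (j : ℝ) / 2 ^ n < j' + 1 := by rw [← hdiv]; exact Int.lt_floor_add_one _
  rw [le_div_iff₀ hXn] at hj1
  rw [div_lt_iff₀ hXn] at hj2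
  have hj1' : j' * 2 ^ n ≤ j := by exact_mod_cast hj1
  have hj2' : j < (j' + 1) * 2 ^ n := by exact_mod_cast hj2
  have hcond : (j' : ℝ) / 2 ^ n < (j : ℝ) / 2 ^ (2 * n) ↔ j' * 2 ^ n < j := by
    rw [hpow, div_lt_div_iff₀ hXn (by positivity), ← mul_assoc, mul_lt_mul_iff_left₀ hXn]
    exact_mod_cast Iff.rfl
  simp only [hcond]
  obtain ⟨m1, m2⟩ := Finset.mem_Icc.1 hj
  rw [hN] at m1 m2
  set X : ℤ := 2 ^ n with hX
  have hX0 : 0 < X := by positivity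
  -- Interior nodes of [-2^{n+1}, 2^{n+1}] only meet coarse cells inside this interval, and there
  -- the increments are bounded by hypothesis.
  have c1 : -(2 * (X * X)) ≤ j' := by
    by_contra hc; push Not at hc
    nlinarith [mul_le_mul_of_nonneg_right (Int.add_one_le_iff.2 hc) hX0.le]
  have c2 : j' < 2 * (X * X) := by
    by_contra hc; push Not at hc
    nlinarith [mul_le_mul_of_nonneg_right hc hX0.le]
  have hdel : ∀ l : ℤ, -(2 * (X * X)) ≤ l → l < 2 * (X * X) →
      |rectIncr n b i' l - gridIncr n b i' l| ≤ F ∧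
      (-(X * X) ≤ l → l < X * X → rectIncr n b i' l - gridIncr n b i' l = 0) := by
    intro l l1 l2
    have hr := hb i' hi' l (by rw [hpowZ1]; exact Finset.mem_Ico.2 ⟨l1, l2⟩)
    have hi2 : i' ∈ Ico (0 : ℤ) (2 ^ n) := by simpa using hi'
    unfold gridIncr
    rw [hpowZ]
    constructor
    · split_ifs
      · rw [sub_self, abs_zero]; exact (abs_nonneg _).trans hr
      · rwa [sub_zero]
    · intro l3 l4
      rw [if_pos ⟨hi2, l3, l4⟩, sub_self]
  have hins : ¬ (2 ^ n ≤ |(j : ℝ) * (1 / 2 ^ (2 * n))|) → -(X * X * X) < j ∧ j < X * X * X := by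
    intro hc
    push Not at hc
    rw [mul_one_div, abs_div, abs_of_pos (by positivity : (0 : ℝ) < 2 ^ (2 * n)),
      div_lt_iff₀ (by positivity), hpow, abs_lt] at hc
    have e : (2 : ℝ) ^ n * (2 ^ n * 2 ^ n) = ((X * X * X : ℤ) : ℝ) := by
      rw [hX]; push_cast; ring
    rw [e] at hc
    exact ⟨by exact_mod_cast hc.1, by exact_mod_cast hc.2⟩
  by_cases hlt : j' * X < j
  · simp only [hlt, if_true]
    obtain ⟨d1, d2⟩ := hdel j' c1 c2
    split_ifs with hc
    · exact d1
    · obtain ⟨q1, q2⟩ := hins hc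
      rw [d2, abs_zero]
      · by_contra hcon; push Not at hcon
        nlinarith [mul_le_mul_of_nonneg_right (Int.add_one_le_iff.2 hcon) hX0.le]
      · by_contra hcon; push Not at hcon
        nlinarith [mul_le_mul_of_nonneg_right hcon hX0.le]
  · simp only [hlt, if_false]
    have hje : j = j' * X := le_antisymm (not_lt.1 hlt) hj1'
    have c3 : -(2 * (X * X)) ≤ j' - 1 := by
      by_contra hc; push Not at hc
      have : j' ≤ -(2 * (X * X)) := by lia
      nlinarith [mul_le_mul_of_nonneg_right this hX0.le]
    obtain ⟨d1, d2⟩ := hdel j' c1 c2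
    obtain ⟨d3, d4⟩ := hdel (j' - 1) c3 (by lia)
    split_ifs with hc
    · rw [abs_le] at *
      constructor <;> linarith [d1.1, d1.2, d3.1, d3.2]
    · obtain ⟨q1, q2⟩ := hins hc
      have r1 : -(X * X) < j' := by
        by_contra hcon; push Not at hcon
        nlinarith [mul_le_mul_of_nonneg_right hcon hX0.le]
      have r2 : j' < X * X := by
        by_contra hcon; push Not at hcon
        nlinarith [mul_le_mul_of_nonneg_right hcon hX0.le]
      have z1 := d2 r1.le r2
      have z2 := d4 (by lia) (by lia)
      rw [show ∀ p q r s : ℝ, 1 / 2 * p + 1 / 2 * q - (1 / 2 * r + 1 / 2 * s)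
        = 1 / 2 * (p - r) + 1 / 2 * (q - s) from fun p q r s => by ring, z1, z2]
      simp

/-- Away from the boundary of the computational domain, the two versions of the scheme are close. -/
theorem abs_scheme_sub_le {n : ℕ} (hn : 1 ≤ n) {b : ℝ → ℝ → ℝ} {F : ℝ} (hF : 0 ≤ F)
    (hb : ∀ k ∈ Finset.Ico (0 : ℤ) (2 ^ n), ∀ l ∈ Finset.Ico (-2 ^ (2 * n + 1) : ℤ) (2 ^ (2 * n + 1)),
      |rectIncr n b k l| ≤ F) {v w : Fin (2 ^ (4 * n) + 1) → ℝ → ℝ}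
    (hv : IsScheme n (rectIncr n b) v) (hw : IsScheme n (gridIncr n b) w) {R x : ℝ} (hx : |x| ≤ R)
    (i : Fin (2 ^ (4 * n) + 1)) :
    |v i x - w i x| ≤ 3 / 2 * F * 2 ^ (2 * n) / Real.cosh (2 ^ n) * Real.exp 4 * Real.cosh (R + 1) := by
  obtain ⟨hv0, hvp, hve⟩ := (isScheme_iff _ v).1 hv
  obtain ⟨hw0, hwp, hwe⟩ := (isScheme_iff _ w).1 hw
  have hh : (0 : ℝ) < 1 / 2 ^ (2 * n) := by positivity
  have hX : (4 : ℝ) ≤ 2 ^ (2 * n) := by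
    calc (4 : ℝ) = 2 ^ 2 := by norm_num
      _ ≤ 2 ^ (2 * n) := pow_le_pow_right₀ (by norm_num) (by lia)
  have hh4 : (1 : ℝ) / 2 ^ (2 * n) ≤ 1 / 4 := one_div_le_one_div_of_le (by norm_num) hX
  have hhX : (2 : ℝ) ^ (2 * n) * (1 / 2 ^ (2 * n)) = 1 := by field_simp
  have h3 : (3 : ℝ) / 2 ^ (2 * n + 1) = 3 / 2 * (1 / 2 ^ (2 * n)) := by
    rw [pow_succ]; field_simp
  have hM : (((2 ^ (4 * n) : ℕ) : ℝ)) * (1 / 2 ^ (2 * n)) ^ 2 = 1 := by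
    push_cast
    rw [show (2 : ℝ) ^ (4 * n) = (2 ^ (2 * n)) ^ 2 by rw [← pow_mul]; congr 1; ring]
    field_simp
  set h : ℝ := 1 / 2 ^ (2 * n) with hhdef
  set N := schemeN n
  have hneg : ∀ p q : ℝ → ℝ, (fun x => p x - q x) = p + (-1 : ℝ) • q := fun p q => by
    ext x; simp [sub_eq_add_neg]
  have hd : ∀ i, IsPL h (N * h) (fun x => v i x - w i x) := fun i => by
    rw [hneg]; exact (hvp i).add ((hwp i).smul _)
  set e : ℕ → ℤ → ℝ := fun i j =>
    if hi : i < 2 ^ (4 * n) + 1 then v ⟨i, hi⟩ (j * h) - w ⟨i, hi⟩ (j * h) else 0 with he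
  have heq : ∀ (i : ℕ) (hi : i < 2 ^ (4 * n) + 1) (j : ℤ),
      e i j = v ⟨i, hi⟩ (j * h) - w ⟨i, hi⟩ (j * h) := fun i hi j => by simp only [he, hi, dite_true]
  set A : ℝ := 3 / 2 * F * 2 ^ (2 * n) with hA
  have hA0 : 0 ≤ A := by positivity
  -- The choice T = 2^n: sources vanish where |x| < 2^n, and elsewhere cosh x ≥ cosh 2^n. So a
  -- source of size (3/2)hF is at most A h² cosh x / cosh 2^n with A = (3/2)F/h.
  have hbar : ∀ i₀ ≤ 2 ^ (4 * n), ∀ j₀ ∈ Finset.Icc (-(N : ℤ)) N,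
      |e i₀ j₀| ≤ A / Real.cosh (2 ^ n) * (1 + 4 * h ^ 2) ^ i₀ * Real.cosh (j₀ * h) :=
    fun i₀ hi₀ j₀ hj₀ => abs_le_barrier (T := 2 ^ n) hh hh4 hA0 (N := N) (M := 2 ^ (4 * n)) (e := e)
    (δ := fun i j => 3 / 2 * h * (schemeNoise n (rectIncr n b) i j - schemeNoise n (gridIncr n b) i j))
    (fun j => by
      rw [heq 0 (Nat.succ_pos _)]
      have z1 : v ⟨0, Nat.succ_pos _⟩ = 0 := hv0
      have z2 : w ⟨0, Nat.succ_pos _⟩ = 0 := hw0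
      rw [z1, z2]; simp)
    (fun i hi => by
      rw [heq i (Nat.lt_succ_of_le hi)]
      refine (hd _).zero _ ?_
      push_cast
      rw [neg_mul, abs_neg]; exact le_abs_self _)
    (fun i hi => by
      rw [heq i (Nat.lt_succ_of_le hi)]
      refine (hd _).zero _ ?_
      push_cast
      exact le_abs_self _)
    (fun i hi j hj => by
      have e1 := hve ⟨i, hi⟩ j hj
      have e2 := hwe ⟨i, hi⟩ j hj
      rw [h3] at e1 e2
      rw [heq (i + 1) (Nat.succ_lt_succ hi), heq (i + 1) (Nat.succ_lt_succ hi),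
        heq (i + 1) (Nat.succ_lt_succ hi), heq i (Nat.lt_succ_of_lt hi), heq i (Nat.lt_succ_of_lt hi),
        heq i (Nat.lt_succ_of_lt hi)]
      push_cast
      simp only [Fin.succ_mk, Fin.castSucc_mk] at e1 e2
      linear_combination e1 - e2)
    (fun i hi j hj => by
      have hs := abs_schemeNoise_sub_le hb hi hj
      have hcT := Real.cosh_pos ((2 : ℝ) ^ n)
      have hcx := Real.cosh_pos (j * h)
      rw [abs_mul, abs_of_pos (by positivity)]
      split_ifs at hs with hc
      · have hco : Real.cosh (2 ^ n) ≤ Real.cosh (j * h) := by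
          rw [Real.cosh_le_cosh, abs_of_pos (by positivity : (0 : ℝ) < 2 ^ n)]
          exact hc
        calc 3 / 2 * h * _ ≤ 3 / 2 * h * F := by gcongr
          _ = A * h ^ 2 * 1 := by
            rw [hA]; linear_combination (-(3 / 2) * F * h) * hhX
          _ ≤ A * h ^ 2 * (Real.cosh (j * h) / Real.cosh (2 ^ n)) := by
            gcongr
            rwa [one_le_div hcT]
          _ = _ := by ring
      · have : |schemeNoise n (rectIncr n b) i j - schemeNoise n (gridIncr n b) i j| = 0 :=
          le_antisymm hs (abs_nonneg _)
        rw [this, mul_zero]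
        positivity) hi₀ hj₀
  -- There are h^{-2} time steps, so the growth of the barrier over the unit time interval is at
  -- most e⁴.
  have hlam : ∀ i ≤ 2 ^ (4 * n), (1 + 4 * h ^ 2) ^ i ≤ Real.exp 4 := by
    intro i hi
    calc (1 + 4 * h ^ 2) ^ i ≤ Real.exp (4 * h ^ 2) ^ i := by
          gcongr
          linarith [Real.add_one_le_exp (4 * h ^ 2)]
      _ = Real.exp (i * (4 * h ^ 2)) := (Real.exp_nat_mul _ _).symm
      _ ≤ Real.exp 4 := by
          refine Real.exp_le_exp.2 ?_
          have : (i : ℝ) ≤ ((2 ^ (4 * n) : ℕ) : ℝ) := by exact_mod_cast hi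
          calc (i : ℝ) * (4 * h ^ 2) ≤ ((2 ^ (4 * n) : ℕ) : ℝ) * (4 * h ^ 2) := by gcongr
            _ = 4 * (((2 ^ (4 * n) : ℕ) : ℝ) * h ^ 2) := by ring
            _ = 4 := by rw [hM]; norm_num
  have hcT := Real.cosh_pos ((2 : ℝ) ^ n)
  have hcR := Real.cosh_pos (R + 1)
  refine (hd i).abs_le_of_nodes hh (R := R) (fun k hk => ?_) hx
  by_cases hkN : |(k : ℝ) * h| < N * h
  · have hk' := (abs_node_lt_iff hh N k).1 hkN
    obtain ⟨k1, k2⟩ := Finset.mem_Icc.1 hk'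
    have := hbar i (Nat.lt_succ_iff.1 i.2) k (Finset.mem_Icc.2 ⟨by lia, by lia⟩)
    rw [heq i i.2] at this
    refine this.trans ?_
    have hck : Real.cosh (k * h) ≤ Real.cosh (R + 1) := by
      rw [Real.cosh_le_cosh]
      refine hk.trans (le_trans ?_ (le_abs_self _))
      linarith
    have := hlam i (Nat.lt_succ_iff.1 i.2)
    have hck0 := Real.cosh_pos (k * h)
    gcongr
  · rw [(hd i).zero _ (not_lt.1 hkN), abs_zero]
    positivity

/-! ### The error estimates -/

/-- Converts the logarithmic loss m+1 into an arbitrarily small power of 2^m. -/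
theorem add_one_le_mul_two_rpow {ε : ℝ} (hε : 0 < ε) (m : ℕ) :
    (m : ℝ) + 1 ≤ (1 + 1 / (ε * Real.log 2)) * (2 : ℝ) ^ (m * ε) := by
  have hl : 0 < ε * Real.log 2 := mul_pos hε (Real.log_pos (by norm_num))
  have h1 : (m : ℝ) * (ε * Real.log 2) + 1 ≤ (2 : ℝ) ^ (m * ε) := by
    rw [Real.rpow_def_of_pos (by norm_num)]
    refine (Real.add_one_le_exp _).trans_eq ?_
    congr 1; ring
  have h2 : (m : ℝ) ≤ 1 / (ε * Real.log 2) * (2 : ℝ) ^ (m * ε) := by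
    rw [one_div_mul_eq_div, le_div_iff₀ hl]; linarith
  have h3 : (1 : ℝ) ≤ (2 : ℝ) ^ (m * ε) := Real.one_le_rpow (by norm_num) (by positivity)
  linarith

/-- Cells outside the grid do not enter the noise. With `gridIncr` the coefficients are bounded for
every l, as the error estimates require, and not merely on the grid. -/
theorem discreteNoise_eq_gridIncr (n : ℕ) (b : ℝ → ℝ → ℝ) :
    discreteNoise n b = noiseField n (fun k l => 2 ^ (2 * n) * gridIncr n b k l) := by
  ext s x
  unfold discreteNoise noiseField
  refine Finset.sum_congr rfl fun k hk => Finset.sum_congr rfl fun l hl => ?_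
  simp only [gridIncr]
  rw [if_pos ⟨Finset.mem_Ico.1 hk, Finset.mem_Ico.1 hl⟩]

theorem abs_gridIncr_le {n : ℕ} {b : ℝ → ℝ → ℝ} {F : ℝ} (hF : 0 ≤ F)
    (hb : ∀ k ∈ Finset.Ico (0 : ℤ) (2 ^ n), ∀ l ∈ Finset.Ico (-2 ^ (2 * n + 1) : ℤ) (2 ^ (2 * n + 1)),
      |rectIncr n b k l| ≤ F) (k l : ℤ) : |gridIncr n b k l| ≤ F := by
  unfold gridIncr
  split_ifs with h
  · obtain ⟨h1, h2, h3⟩ := h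
    refine hb k (Finset.mem_Ico.2 h1) l (Finset.mem_Ico.2 ?_)
    have : (0 : ℤ) < 2 ^ (2 * n) := by positivity
    rw [pow_succ]
    constructor <;> linarith
  · simpa using hF

/-- The error of the Galerkin approximation, in terms of the regularity of the increments. -/
theorem eLpNorm_galerkin_error_le_of_rectIncr {ρ : ℝ → ℝ} (hρm : Measurable ρ)
    (hρ : ∀ x, |ρ x| ≤ 1) {Q : ℝ} (hQ0 : 0 ≤ Q) (hQ : eLpNorm ρ 2 volume ≤ ENNReal.ofReal Q)
    {h : ℝ} (hh : 0 < h) {N m n : ℕ} {b : ℝ → ℝ → ℝ} {D r : ℝ} (hD : 0 ≤ D)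
    (hb : ∀ k ∈ Finset.Ico (0 : ℤ) (2 ^ n), ∀ l ∈ Finset.Ico (-2 ^ (2 * n + 1) : ℤ) (2 ^ (2 * n + 1)),
      |rectIncr n b k l| ≤ D * (2 : ℝ) ^ (-(n * r))) {β : ℝ} (hβ : 0 < β)
    (hLn : 2 ^ n < N * h) {v : Fin (2 ^ m + 1) → ℝ → ℝ}
    (hv : IsGalerkinApprox h (N * h) m (heatConv (discreteNoise n b)) v) (i : Fin (2 ^ m + 1)) :
    eLpNorm (fun x => ρ x * (heatConv (discreteNoise n b) ((i : ℕ) / 2 ^ m) x - v i x)) 2 volume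
      ≤ ENNReal.ofReal (D * (2 : ℝ) ^ (n * (2 - r))
        * (16 * (2 : ℝ) ^ (n * (3 / 2) : ℝ) * (h ^ 2 + 1 / 2 ^ m) * (m + 1)
        + (8 + Q) * (4 * tailConst β / β) * √(N * h) * (N * h - 2 ^ n) ^ (-β))) := by
  rw [discreteNoise_eq_gridIncr] at hv ⊢
  simp only [heatConv_noiseField]
  refine eLpNorm_galerkin_error_le hρm hρ hQ0 hQ hh (by positivity) (fun k _ l => ?_) hβ hLn
    ((isGalerkinApprox_iff_isEvolution N m n _ v).1 hv) i
  rw [abs_mul, abs_of_pos (by positivity)]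
  have e : D * (2 : ℝ) ^ (n * (2 - r)) = 2 ^ (2 * n) * (D * (2 : ℝ) ^ (-(n * r))) := by
    rw [← Real.rpow_natCast, mul_left_comm, ← Real.rpow_add (by norm_num)]
    congr 2; push_cast; ring
  rw [e]
  exact mul_le_mul_of_nonneg_left (abs_gridIncr_le (by positivity) hb k l) (by positivity)

theorem exists_unique_galerkinApprox {h : ℝ} (hh : 0 < h) (N m n : ℕ) (b : ℝ → ℝ → ℝ) :
    ∃ G, ∀ v, IsGalerkinApprox h (N * h) m (heatConv (discreteNoise n b)) v ↔ v = G := by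
  obtain ⟨G, hG⟩ := exists_unique_evolution hh N (2 ^ m) (α := 2 ^ m) (by positivity)
    (fun i => linearOnSpace_noiseRhs hh N n (fun k l => 2 ^ (2 * n) * rectIncr n b k l) m i)
  exact ⟨G, fun v => (isGalerkinApprox_iff_isEvolution N m n _ v).trans (hG v)⟩

/-- The calibrated mesh balances the contributions to the error. -/
theorem eLpNorm_scheme_error_le {ρ : ℝ → ℝ} (hρm : Measurable ρ)
    (hρ : ∀ x, |ρ x| ≤ 1) {Q : ℝ} (hQ0 : 0 ≤ Q) (hQ : eLpNorm ρ 2 volume ≤ ENNReal.ofReal Q)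
    {n : ℕ} {b : ℝ → ℝ → ℝ} {D r : ℝ} (hD : 0 ≤ D) (hr : 0 < r)
    (hb : ∀ k ∈ Finset.Ico (0 : ℤ) (2 ^ n), ∀ l ∈ Finset.Ico (-2 ^ (2 * n + 1) : ℤ) (2 ^ (2 * n + 1)),
      |rectIncr n b k l| ≤ D * (2 : ℝ) ^ (-(n * r))) {v : Fin (2 ^ (4 * n) + 1) → ℝ → ℝ}
    (hv : IsScheme n (gridIncr n b) v) (i : Fin (2 ^ (4 * n) + 1)) :
    eLpNorm (fun x => ρ x * (heatConv (discreteNoise n b) ((i : ℕ) / 2 ^ (4 * n)) x - v i x)) 2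
        volume
      ≤ ENNReal.ofReal (D * (128 * (1 + 1 / (r * Real.log 2))
        + 2 * ((8 + Q) * (4 * tailConst 3 / 3))) * (2 : ℝ) ^ (-(n : ℝ) / 2)) := by
  have hv' := (isGalerkinApprox_iff_isScheme n b v).2 hv
  rw [← schemeN_mul] at hv'
  have h2 : (0 : ℝ) < 2 ^ n := by positivity
  have hLn : (2 : ℝ) ^ n < schemeN n * (1 / 2 ^ (2 * n)) := by
    rw [schemeN_mul, pow_succ]; linarith
  refine (eLpNorm_galerkin_error_le_of_rectIncr hρm hρ hQ0 hQ (by positivity) hD hb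
    (by norm_num : (0 : ℝ) < 3) hLn hv' i).trans (ENNReal.ofReal_le_ofReal ?_)
  rw [schemeN_mul]
  set c := 1 + 1 / (r * Real.log 2) with hc
  have hc0 : 0 ≤ c := by
    have : 0 < r * Real.log 2 := mul_pos hr (Real.log_pos (by norm_num))
    positivity
  set K := (8 + Q) * (4 * tailConst 3 / 3)
  have hK0 : 0 ≤ K := by have := tailConst_nonneg (β := 3) (by norm_num); positivity
  set E : ℝ := (2 : ℝ) ^ (n * (2 - r)) with hE
  set q : ℝ := (2 : ℝ) ^ (-(n : ℝ) / 2) with hq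
  -- The factor m+1 with m = 4n is paid for by the decay 2^{-nr} of the increments; what is left is
  -- 2^{n(2 + 3/2 - 4)} = 2^{-n/2}. Any r > 0 suffices, whereas the general estimate with its factor
  -- 2^{mε} would be less economical.
  have hm : ((4 * n : ℕ) : ℝ) + 1 ≤ 4 * (c * (2 : ℝ) ^ (n * r)) := by
    have := add_one_le_mul_two_rpow hr n
    push_cast; linarith
  have hh2 : ((1 : ℝ) / 2 ^ (2 * n)) ^ 2 + 1 / 2 ^ (4 * n) = 2 * (2 : ℝ) ^ (-(4 * n : ℝ)) := by
    rw [Real.rpow_neg (by norm_num), show (4 * n : ℝ) = ((4 * n : ℕ) : ℝ) by push_cast; ring,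
      Real.rpow_natCast, div_pow, ← pow_mul, show 2 * n * 2 = 4 * n by ring, one_pow]
    ring
  have t1 : E * (16 * (2 : ℝ) ^ (n * (3 / 2) : ℝ) * (((1 : ℝ) / 2 ^ (2 * n)) ^ 2 + 1 / 2 ^ (4 * n))
      * (((4 * n : ℕ) : ℝ) + 1)) ≤ 128 * c * q := by
    calc _ ≤ E * (16 * (2 : ℝ) ^ (n * (3 / 2) : ℝ) * (2 * (2 : ℝ) ^ (-(4 * n : ℝ)))
          * (4 * (c * (2 : ℝ) ^ (n * r)))) := by rw [hh2]; gcongr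
      _ = 128 * c * (E * (2 : ℝ) ^ (n * (3 / 2) : ℝ) * (2 : ℝ) ^ (-(4 * n : ℝ)) * (2 : ℝ) ^ (n * r)) := by
          ring
      _ = 128 * c * q := by
          rw [hE, hq, ← Real.rpow_add (by norm_num), ← Real.rpow_add (by norm_num),
            ← Real.rpow_add (by norm_num)]
          congr 2; ring
  -- Here L - 2^n = 2^n, and β = 3 balances exactly: 2n + n/2 - 3n = -n/2.
  have t2 : E * (√((2 : ℝ) ^ (n + 1)) * ((2 : ℝ) ^ (n + 1) - 2 ^ n) ^ (-3 : ℝ)) ≤ 2 * q := by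
    have e1 : ((2 : ℝ) ^ (n + 1) - 2 ^ n) = (2 : ℝ) ^ (n : ℝ) := by
      rw [Real.rpow_natCast, pow_succ]; ring
    have e2 : √((2 : ℝ) ^ (n + 1)) ≤ 2 * (2 : ℝ) ^ (n / 2 : ℝ) := by
      rw [pow_succ, mul_comm, Real.sqrt_mul (by norm_num), Real.sqrt_eq_rpow ((2 : ℝ) ^ n),
        ← Real.rpow_natCast, ← Real.rpow_mul (by norm_num), mul_one_div]
      gcongr
      rw [Real.sqrt_le_left (by norm_num)]; norm_num
    have e3 : E ≤ (2 : ℝ) ^ (n * 2 : ℝ) := by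
      rw [hE]; gcongr
      · norm_num
      · linarith
    rw [e1, ← Real.rpow_mul (by norm_num)]
    calc _ ≤ (2 : ℝ) ^ (n * 2 : ℝ) * (2 * (2 : ℝ) ^ (n / 2 : ℝ) * (2 : ℝ) ^ ((n : ℝ) * -3)) := by
          gcongr
      _ = 2 * ((2 : ℝ) ^ (n * 2 : ℝ) * (2 : ℝ) ^ (n / 2 : ℝ) * (2 : ℝ) ^ ((n : ℝ) * -3)) := by ring
      _ = 2 * q := by
          rw [hq, ← Real.rpow_add (by norm_num), ← Real.rpow_add (by norm_num)]
          congr 2; ring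
  have t3 := mul_le_mul_of_nonneg_left t2 hK0
  have t4 := mul_le_mul_of_nonneg_left (add_le_add t1 t3) hD
  refine le_trans (le_of_eq ?_) (t4.trans (le_of_eq ?_)) <;> ring

/-- The cubic term of the exponential series in cosh(2^n) already beats 2^{2n}. -/
theorem two_pow_div_cosh_le (n : ℕ) :
    (2 : ℝ) ^ (2 * n) / Real.cosh (2 ^ n) ≤ 12 * (2 : ℝ) ^ (-(n : ℝ) / 2) := by
  have hy : (0 : ℝ) < 2 ^ n := by positivity
  have h1 := Real.pow_div_factorial_le_exp ((2 : ℝ) ^ n) hy.le 3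
  have h2 : ((2 : ℝ) ^ n) ^ 3 / 12 ≤ Real.cosh (2 ^ n) := by
    rw [Real.cosh_eq]
    have := Real.exp_pos (-(2 : ℝ) ^ n)
    norm_num [Nat.factorial] at h1
    linarith
  have h3 : ((2 : ℝ) ^ n)⁻¹ ≤ (2 : ℝ) ^ (-(n : ℝ) / 2) := by
    rw [← Real.rpow_natCast, ← Real.rpow_neg (by norm_num)]
    refine Real.rpow_le_rpow_of_exponent_le (by norm_num) ?_
    have : (0 : ℝ) ≤ n := Nat.cast_nonneg n
    linarith
  calc (2 : ℝ) ^ (2 * n) / Real.cosh (2 ^ n) ≤ 2 ^ (2 * n) / (((2 : ℝ) ^ n) ^ 3 / 12) := by gcongr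
    _ = 12 * ((2 : ℝ) ^ n)⁻¹ := by
      rw [mul_comm 2 n, pow_mul]; field_simp
    _ ≤ _ := by gcongr

/-- Localized near the support of `ρ`, the two versions of the scheme are close. -/
theorem eLpNorm_scheme_sub_le {ρ : ℝ → ℝ} {Q R : ℝ}
    (hQ : eLpNorm ρ 2 volume ≤ ENNReal.ofReal Q) (hR : ∀ x, R < |x| → ρ x = 0)
    {n : ℕ} (hn : 1 ≤ n) {b : ℝ → ℝ → ℝ} {D : ℝ} (hD : 0 ≤ D)
    (hb : ∀ k ∈ Finset.Ico (0 : ℤ) (2 ^ n), ∀ l ∈ Finset.Ico (-2 ^ (2 * n + 1) : ℤ) (2 ^ (2 * n + 1)),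
      |rectIncr n b k l| ≤ D) {v w : Fin (2 ^ (4 * n) + 1) → ℝ → ℝ}
    (hv : IsScheme n (rectIncr n b) v) (hw : IsScheme n (gridIncr n b) w)
    (i : Fin (2 ^ (4 * n) + 1)) :
    eLpNorm (fun x => ρ x * (w i x - v i x)) 2 volume
      ≤ ENNReal.ofReal (D * (18 * Real.exp 4 * Real.cosh (R + 1) * Q) * (2 : ℝ) ^ (-(n : ℝ) / 2)) := by
  set B := 3 / 2 * D * 2 ^ (2 * n) / Real.cosh (2 ^ n) * Real.exp 4 * Real.cosh (R + 1) with hB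
  have hcR := Real.cosh_pos (R + 1)
  have hcn := Real.cosh_pos ((2 : ℝ) ^ n)
  have hB0 : 0 ≤ B := by positivity
  have h1 : eLpNorm (fun x => ρ x * (w i x - v i x)) 2 volume ≤ ENNReal.ofReal B * eLpNorm ρ 2 volume := by
    refine eLpNorm_le_mul_eLpNorm_of_ae_le_mul (Eventually.of_forall fun x => ?_) 2
    rw [norm_mul, mul_comm]
    by_cases hx : |x| ≤ R
    · refine mul_le_mul_of_nonneg_right ?_ (norm_nonneg _)
      rw [Real.norm_eq_abs, abs_sub_comm]
      exact abs_scheme_sub_le hn hD hb hv hw hx i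
    · rw [hR x (not_le.1 hx)]; simp
  refine h1.trans ((mul_le_mul_right hQ _).trans ?_)
  rw [← ENNReal.ofReal_mul hB0]
  rcases le_total Q 0 with hQ0 | hQ0
  · rw [ENNReal.ofReal_of_nonpos (mul_nonpos_of_nonneg_of_nonpos hB0 hQ0)]; simp
  refine ENNReal.ofReal_le_ofReal ?_
  calc B * Q = 3 / 2 * D * Real.exp 4 * Real.cosh (R + 1) * Q * (2 ^ (2 * n) / Real.cosh (2 ^ n)) := by
        rw [hB]; ring
    _ ≤ 3 / 2 * D * Real.exp 4 * Real.cosh (R + 1) * Q * (12 * (2 : ℝ) ^ (-(n : ℝ) / 2)) := by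
        gcongr
        exact two_pow_div_cosh_le n
    _ = _ := by ring

theorem continuous_scheme {n : ℕ} {q : ℤ → ℤ → ℝ} {v : Fin (2 ^ (4 * n) + 1) → ℝ → ℝ}
    (hv : IsScheme n q v) (i : Fin (2 ^ (4 * n) + 1)) : Continuous (v i) :=
  (((isScheme_iff _ v).1 hv).2.1 i).continuous

theorem continuous_heatConv_discreteNoise (n : ℕ) (b : ℝ → ℝ → ℝ) (t : ℝ) :
    Continuous (heatConv (discreteNoise n b) t) := by
  have := (hasSecondDeriv_sol n (fun k l => 2 ^ (2 * n) * gridIncr n b k l) t).continuous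
  rw [discreteNoise_eq_gridIncr]
  exact this.congr fun x => (heatConv_noiseField n _ t x).symm

/-- The real form of the general error estimate. -/
theorem galerkin_error_rate {D s ε β Q h L : ℝ} {n m : ℕ} (hD : 0 ≤ D) (hε : 0 < ε) (hβ : 0 < β)
    (hQ0 : 0 ≤ Q) (hL : 2 ^ n < L) :
    D * (2 : ℝ) ^ (n * (2 - (s - ε)))
        * (16 * (2 : ℝ) ^ (n * (3 / 2) : ℝ) * (h ^ 2 + 1 / 2 ^ m) * (m + 1)
        + (8 + Q) * (4 * tailConst β / β) * √L * (L - 2 ^ n) ^ (-β))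
      ≤ D * (16 * (1 + 1 / (ε * Real.log 2)) + (8 + Q) * (4 * tailConst β / β))
        * ((2 : ℝ) ^ (-(m * (1 - ε))) * (2 : ℝ) ^ (n * (7 / 2 - s + ε))
          + (2 : ℝ) ^ (m * ε) * h ^ 2 * (2 : ℝ) ^ (n * (7 / 2 - s + ε))
          + L ^ (1 / 2 : ℝ) / |L - 2 ^ n| ^ β * (2 : ℝ) ^ (n * (2 - s + ε))) := by
  have hd : 0 < L - 2 ^ n := sub_pos.2 hL
  have hm := add_one_le_mul_two_rpow hε m
  set c := 1 + 1 / (ε * Real.log 2)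
  have hc0 : 0 ≤ c := by
    have : 0 < ε * Real.log 2 := mul_pos hε (Real.log_pos (by norm_num))
    positivity
  set K := (8 + Q) * (4 * tailConst β / β)
  have hK0 : 0 ≤ K := by have := tailConst_nonneg hβ; positivity
  rw [abs_of_pos hd, Real.sqrt_eq_rpow, Real.rpow_neg hd.le, div_eq_mul_inv (L ^ (1 / 2 : ℝ))]
  have e1 : (2 : ℝ) ^ (n * (7 / 2 - s + ε)) = (2 : ℝ) ^ (n * (2 - (s - ε))) * (2 : ℝ) ^ (n * (3 / 2) : ℝ) := by
    rw [← Real.rpow_add (by norm_num)]; congr 1; ring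
  have e2 : (2 : ℝ) ^ (-(m * (1 - ε))) = 1 / 2 ^ m * (2 : ℝ) ^ (m * ε) := by
    rw [one_div, ← Real.rpow_natCast, ← Real.rpow_neg (by norm_num), ← Real.rpow_add (by norm_num)]
    congr 1; ring
  have e3 : (n : ℝ) * (2 - s + ε) = n * (2 - (s - ε)) := by ring
  rw [e1, e2, e3]
  have hL0 : 0 < L := lt_trans (by positivity) hL
  set E := (2 : ℝ) ^ (n * (2 - (s - ε)))
  set T := (2 : ℝ) ^ (n * (3 / 2) : ℝ)
  set Y := (2 : ℝ) ^ (m * ε)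
  have hE : 0 < E := by positivity
  have hT : 0 < T := by positivity
  have hY : 0 < Y := by positivity
  set S := L ^ (1 / 2 : ℝ) * ((L - 2 ^ n) ^ β)⁻¹
  have hS : 0 < S := by positivity
  set g := h ^ 2 + 1 / 2 ^ m with hg
  have hg0 : 0 < g := by positivity
  calc _ = D * E * (16 * T * g * (m + 1) + K * S) := by ring
    _ ≤ D * E * (16 * T * g * (c * Y) + K * S) := by gcongr
    -- The added cross terms make the sum factor as one constant times the sum of the three error
    -- terms.
    _ ≤ D * E * (16 * T * g * (c * Y) + K * S) + D * E * (K * (T * g * Y) + 16 * c * S) :=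
      le_add_of_nonneg_right (by positivity)
    _ = _ := by rw [hg]; ring

end FracHeat

end

/-! ### Assembly of the main theorem -/

theorem mainTheorem4 {Ω : Type*} [MeasurableSpace Ω] (P : Measure Ω) [IsProbabilityMeasure P]
    (W : Lp ℝ 2 (volume : Measure FracHeat.Plane) → Ω → ℝ) (hW : FracHeat.IsWhiteNoise P W)
    (H₀ H₁ : ℝ) (hH₀ : H₀ ∈ Ioo (0 : ℝ) 1) (hH₁ : H₁ ∈ Ioo (0 : ℝ) 1)
    (ρ : ℝ → ℝ) (hρ : ContDiff ℝ (⊤ : ℕ∞) ρ) (hρc : HasCompactSupport ρ)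
    (hρ01 : ∀ x, ρ x ∈ Icc (0 : ℝ) 1) :
    -- the general estimate
    (∀ β > (0 : ℝ), ∀ ε ∈ Ioo (0 : ℝ) 1, ∃ C : Ω → ℝ, Measurable C ∧
      ∀ κ > (0 : ℝ), ∀ᵐ ω ∂P, ∀ n ≥ (1 : ℕ), ∀ m ≥ (1 : ℕ), ∀ h > (0 : ℝ), ∀ L > (2 : ℝ) ^ n,
        (∃ N : ℕ, L = N * h) →
        ∃ G : Fin (2 ^ m + 1) → ℝ → ℝ,
          (∀ v, FracHeat.IsGalerkinApprox h L m (FracHeat.psiTilde W H₀ H₁ κ n ω) v ↔ v = G) ∧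
          ∀ i : Fin (2 ^ m + 1),
            eLpNorm (fun x => ρ x *
                (FracHeat.psiTilde W H₀ H₁ κ n ω ((i : ℕ) / 2 ^ m) x - G i x)) 2 volume
              ≤ ENNReal.ofReal (C ω *
                ((2 : ℝ) ^ (-(m * (1 - ε))) * (2 : ℝ) ^ (n * (7 / 2 - H₀ - H₁ + ε))
                  + (2 : ℝ) ^ (m * ε) * h ^ 2 * (2 : ℝ) ^ (n * (7 / 2 - H₀ - H₁ + ε))
                  + L ^ (1 / 2 : ℝ) / |L - 2 ^ n| ^ β * (2 : ℝ) ^ (n * (2 - H₀ - H₁ + ε))))) ∧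
    -- both versions of the scheme are well defined
    (∀ κ > (0 : ℝ), ∀ n ≥ (1 : ℕ), ∀ ω,
      (∃! v, FracHeat.IsScheme n
        (FracHeat.gridIncr n (FracHeat.smoothSheet W H₀ H₁ κ n ω)) v) ∧
      (∃! v, FracHeat.IsScheme n
        (FracHeat.rectIncr n (FracHeat.smoothSheet W H₀ H₁ κ n ω)) v)) ∧
    -- the calibrated Galerkin approximation is the scheme
    (∀ κ > (0 : ℝ), ∀ n ≥ (1 : ℕ), ∀ ω, ∀ v,
      FracHeat.IsGalerkinApprox (1 / 2 ^ (2 * n)) (2 ^ (n + 1)) (4 * n)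
          (FracHeat.psiTilde W H₀ H₁ κ n ω) v ↔
        FracHeat.IsScheme n (FracHeat.gridIncr n (FracHeat.smoothSheet W H₀ H₁ κ n ω)) v) ∧
    -- the error of the scheme
    (∃ C : Ω → ℝ, Measurable C ∧
      ∀ κ > (0 : ℝ), ∀ᵐ ω ∂P, ∀ n ≥ (1 : ℕ), ∀ v,
        (FracHeat.IsScheme n (FracHeat.gridIncr n (FracHeat.smoothSheet W H₀ H₁ κ n ω)) v ∨
          FracHeat.IsScheme n (FracHeat.rectIncr n (FracHeat.smoothSheet W H₀ H₁ κ n ω)) v) →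
        ∀ i : Fin (2 ^ (4 * n) + 1),
          eLpNorm (fun x => ρ x *
              (FracHeat.psiTilde W H₀ H₁ κ n ω ((i : ℕ) / 2 ^ (4 * n)) x - v i x)) 2 volume
            ≤ ENNReal.ofReal (C ω * (2 : ℝ) ^ (-(n : ℝ) / 2))) := by
  have hm : Measurable ρ := hρ.continuous.measurable
  have h1 : ∀ x, |ρ x| ≤ 1 := fun x => by rw [abs_of_nonneg (hρ01 x).1]; exact (hρ01 x).2
  obtain ⟨Q, hQ0, hQ⟩ : ∃ Q : ℝ, 0 ≤ Q ∧ eLpNorm ρ 2 volume ≤ ENNReal.ofReal Q := by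
    have hp : MemLp ρ 2 volume := hρ.continuous.memLp_of_hasCompactSupport hρc
    exact ⟨_, ENNReal.toReal_nonneg, (ENNReal.ofReal_toReal hp.2.ne).ge⟩
  refine ⟨fun β hβ ε hε => ?_, fun κ _ n _ ω => ⟨FracHeat.existsUnique_isScheme _ _,
    FracHeat.existsUnique_isScheme _ _⟩,
    fun κ _ n _ ω v => FracHeat.isGalerkinApprox_iff_isScheme n _ v, ?_⟩
  · obtain ⟨C, hCm, hC0, hC⟩ := hW.exists_rectIncr_bound hH₀ hH₁ hε.1
    refine ⟨fun ω => C ω * (16 * (1 + 1 / (ε * Real.log 2))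
      + (8 + Q) * (4 * FracHeat.tailConst β / β)), hCm.mul_const _, fun κ _ => ?_⟩
    filter_upwards [hC κ] with ω hω
    rintro n - m - h hh L hL ⟨N, rfl⟩
    obtain ⟨G, hG⟩ := FracHeat.exists_unique_galerkinApprox hh N m n
      (FracHeat.smoothSheet W H₀ H₁ κ n ω)
    refine ⟨G, hG, fun i => ?_⟩
    refine (FracHeat.eLpNorm_galerkin_error_le_of_rectIncr hm h1 hQ0 hQ hh (hC0 ω) (hω n) hβ hL
      ((hG G).2 rfl) i).trans (ENNReal.ofReal_le_ofReal ?_)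
    have := FracHeat.galerkin_error_rate (s := H₀ + H₁) (h := h) (m := m) (hC0 ω) hε.1 hβ hQ0 hL
    rwa [← sub_sub, ← sub_sub] at this
  · obtain ⟨R, hR⟩ := hρc.isCompact.isBounded.subset_closedBall (0 : ℝ)
    have hR0 : ∀ x, R < |x| → ρ x = 0 := fun x hx => by
      by_contra hne
      have := hR (subset_tsupport ρ hne)
      rw [mem_closedBall_zero_iff, Real.norm_eq_abs] at this
      linarith
    -- Giving away half of the regularity leaves the decay exponent r = (H₀+H₁)/2 > 0, enough to
    -- absorb the logarithm for the calibrated scheme.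
    have hs : 0 < (H₀ + H₁) / 2 := by linarith [hH₀.1, hH₁.1]
    obtain ⟨C, hCm, hC0, hC⟩ := hW.exists_rectIncr_bound hH₀ hH₁ hs
    have hr : 0 < H₀ + H₁ - (H₀ + H₁) / 2 := by linarith
    set r := H₀ + H₁ - (H₀ + H₁) / 2
    set c₁ := 128 * (1 + 1 / (r * Real.log 2)) + 2 * ((8 + Q) * (4 * FracHeat.tailConst 3 / 3))
      with hc₁
    set c₂ := 18 * Real.exp 4 * Real.cosh (R + 1) * Q with hc₂
    have hc₁0 : 0 ≤ c₁ := by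
      have := FracHeat.tailConst_nonneg (β := 3) (by norm_num)
      have : 0 < r * Real.log 2 := mul_pos hr (Real.log_pos (by norm_num))
      positivity
    have hc₂0 : 0 ≤ c₂ := by have := Real.cosh_pos (R + 1); positivity
    refine ⟨fun ω => C ω * (c₁ + c₂), hCm.mul_const _, fun κ _ => ?_⟩
    filter_upwards [hC κ] with ω hω
    intro n hn v hv i
    have hb := hω n
    have hCω := hC0 ω
    obtain ⟨w, hw, -⟩ := FracHeat.existsUnique_isScheme n
      (FracHeat.gridIncr n (FracHeat.smoothSheet W H₀ H₁ κ n ω))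
    have herr := fun z (hz : FracHeat.IsScheme n (FracHeat.gridIncr n
      (FracHeat.smoothSheet W H₀ H₁ κ n ω)) z) =>
        FracHeat.eLpNorm_scheme_error_le hm h1 hQ0 hQ hCω hr hb hz i
    rcases hv with hv | hv
    · refine (herr v hv).trans (ENNReal.ofReal_le_ofReal ?_)
      exact mul_le_mul_of_nonneg_right (mul_le_mul_of_nonneg_left (le_add_of_nonneg_right hc₂0) hCω)
        (by positivity)
    -- For untruncated increments the decay in n is discarded: the comparison of the two schemes is
    -- so small that mere boundedness suffices.
    · have hb' := fun k hk l hl => (hb k hk l hl).trans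
        (mul_le_of_le_one_right hCω (Real.rpow_le_one_of_one_le_of_nonpos (by norm_num)
          (neg_nonpos.2 (by positivity))))
      have hdiff := FracHeat.eLpNorm_scheme_sub_le hQ hR0 hn hCω hb' hv hw i
      have hwc := FracHeat.continuous_scheme hw i
      have hvc := FracHeat.continuous_scheme hv i
      have huc := FracHeat.continuous_heatConv_discreteNoise n
        (FracHeat.smoothSheet W H₀ H₁ κ n ω) ((i : ℕ) / 2 ^ (4 * n))
      calc _ = eLpNorm ((fun x => ρ x * (FracHeat.psiTilde W H₀ H₁ κ n ω
              ((i : ℕ) / 2 ^ (4 * n)) x - w i x)) + fun x => ρ x * (w i x - v i x)) 2 volume := by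
            congr 1; ext x; simp only [Pi.add_apply]; ring
        _ ≤ _ := eLpNorm_add_le (hρ.continuous.mul (huc.sub hwc)).aestronglyMeasurable
            (hρ.continuous.mul (hwc.sub hvc)).aestronglyMeasurable (by norm_num)
        _ ≤ _ := add_le_add (herr w hw) hdiff
        _ = _ := by
            rw [← ENNReal.ofReal_add (by positivity) (by positivity)]
            congr 1; ring
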